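/- Let $n\ge 1$, $\omega>0$, $\lambda\in\mathbb R$, and $\sigma>0$, with $\sigma<\frac{2}{n-2}$ if $n\ge 3$. Let $\Sigma=\{f\in L^2(\mathbb R^n;\mathbb C):\ \nabla f\in L^2,\ xf\in L^2\}$, normed by $\|f\|_{L^2}+\|\nabla f\|_{L^2}+\|xf\|_{L^2}$, let $u_0\in\Sigma$, and let $I\subset\mathbb R$ be an open interval containing $0$. Put $V_\pm(x)=\pm\omega^2\frac{|x|^2}{2}$ and let $$u_\pm\in C(I;\Sigma)\cap L^q_{\rm loc}(I;W^{1,2\sigma+2}(\mathbb R^n)),\qquad q=\frac{4\sigma+4}{n\sigma},$$ be a solution, in the sense of distributions, of $$i\partial_t u_\pm+\tfrac12\Delta u_\pm=V_\pm u_\pm+\lambda|u_\pm|^{2\sigma}u_\pm\ \text{ on } I\times\mathbb R^n,\qquad u_\pm|_{t=0}=u_0 .$$ Define the operators $$J_+(t)=-\omega\sin(\omega t)\,x+i\cos(\omega t)\nabla,\qquad H_+(t)=\cos(\omega t)\,x+i\frac{\sin(\omega t)}{\omega}\nabla,$$ $$J_-(t)=\omega\sinh(\omega t)\,x+i\cosh(\omega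 t)\nabla,\qquad H_-(t)=\cosh(\omega t)\,x+i\frac{\sinh(\omega t)}{\omega}\nabla,$$ and, for $t\in I$, $$E_+^1(t)=\tfrac12\|J_+(t)u_+(t)\|_{L^2}^2+\tfrac{\lambda}{\sigma+1}\cos^2(\omega t)\|u_+(t)\|_{L^{2\sigma+2}}^{2\sigma+2},$$ $$E_+^2(t)=\tfrac{\omega^2}{2}\|H_+(t)u_+(t)\|_{L^2}^2+\tfrac{\lambda}{\sigma+1}\sin^2(\omega t)\|u_+(t)\|_{L^{2\sigma+2}}^{2\sigma+2},$$ $$E_-^1(t)=\tfrac12\|J_-(t)u_-(t)\|_{L^2}^2+\tfrac{\lambda}{\sigma+1}\cosh^2(\omega t)\|u_-(t)\|_{L^{2\sigma+2}}^{2\sigma+2},$$ $$E_-^2(t)=-\tfrac{\omega^2}{2}\|H_-(t)u_-(t)\|_{L^2}^2-\tfrac{\lambda}{\sigma+1}\sinh^2(\omega t)\|u_-(t)\|_{L^{2\sigma+2}}^{2\sigma+2}.$$ Let also $E_V(f)=\tfrac12\|\nabla f\|_{L^2}^2+\tfrac{\lambda}{\sigma+1}\|f\|_{L^{2\sigma+2}}^{2\sigma+2}+\int_{\mathbb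 R^n}V(x)|f(x)|^2\,dx$. Then, for every $t\in I$, all the norms above are finite, $$E_\pm^1(t)+E_\pm^2(t)=E_{V_\pm}(u_\pm(t))=E_{V_\pm}(u_0),$$ $E_\pm^1$ is differentiable at $t$, and $$\frac{dE_+^1}{dt}(t)=\frac{\omega\lambda}{2\sigma+2}(n\sigma-2)\sin(2\omega t)\,\|u_+(t)\|_{L^{2\sigma+2}}^{2\sigma+2},$$ $$\frac{dE_-^1}{dt}(t)=\frac{\omega\lambda}{2\sigma+2}(2-n\sigma)\sinh(2\omega t)\,\|u_-(t)\|_{L^{2\sigma+2}}^{2\sigma+2}.$$ -/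

import Mathlib

open MeasureTheory Filter Topology
open scoped ENNReal

namespace HarmonicNLS

noncomputable section

/-- The space `ℝⁿ` with its Euclidean norm. -/
abbrev Space (n : ℕ) : Type := EuclideanSpace ℝ (Fin n)

/-- `g = ∂ⱼ f` in the sense of distributions on `ℝⁿ`. -/
structure HasWeakPartial {n : ℕ} (j : Fin n) (f g : Space n → ℂ) : Prop where
  locallyIntegrable : LocallyIntegrable f volume
  locallyIntegrable_partial : LocallyIntegrable g volume
  integral_eq : ∀ φ : Space n → ℝ, ContDiff ℝ (⊤ : ℕ∞) φ → HasCompactSupport φ →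
    ∫ x, fderiv ℝ φ x (EuclideanSpace.single j 1) • f x = -∫ x, φ x • g x

/-- `f` has a locally integrable weak gradient. -/
def HasWeakGrad {n : ℕ} (f : Space n → ℂ) : Prop :=
  ∀ j : Fin n, ∃ g : Space n → ℂ, HasWeakPartial j f g

open Classical in
/-- The weak partial derivative `∂ⱼ f` (a representative of it; it is unique almost everywhere),
and `0` if there is none. -/
def weakPartial {n : ℕ} (j : Fin n) (f : Space n → ℂ) : Space n → ℂ :=
  if h : ∃ g : Space n → ℂ, HasWeakPartial j f g then h.choose else 0

/-- The weak gradient `∇ f`, with values in `ℂⁿ`. -/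
def weakGrad {n : ℕ} (f : Space n → ℂ) (x : Space n) : EuclideanSpace ℂ (Fin n) :=
  WithLp.toLp 2 fun j => weakPartial j f x

/-- `‖f‖_{L²} + ‖∇ f‖_{L²} + ‖x f‖_{L²}`, for `f` with a weak gradient. -/
def sigmaENorm {n : ℕ} (f : Space n → ℂ) : ℝ≥0∞ :=
  eLpNorm f 2 volume + eLpNorm (weakGrad f) 2 volume + eLpNorm (fun x => ‖x‖ • f x) 2 volume

/-- `f` belongs to the space `Σ` of the `f ∈ L²` with `∇ f ∈ L²` and `x f ∈ L²`. -/
structure MemSigma {n : ℕ} (f : Space n → ℂ) : Prop where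
  aestronglyMeasurable : AEStronglyMeasurable f volume
  hasWeakGrad : HasWeakGrad f
  sigmaENorm_lt_top : sigmaENorm f < ∞

/-- The norm of `W^{1,r}(ℝⁿ)`, for `f` with a weak gradient. -/
def sobolevENorm {n : ℕ} (r : ℝ) (f : Space n → ℂ) : ℝ≥0∞ :=
  eLpNorm f (ENNReal.ofReal r) volume + eLpNorm (weakGrad f) (ENNReal.ofReal r) volume

/-- `u ∈ C(I; Σ) ∩ L^q_loc(I; W^{1,2σ+2})`, with `q = (4σ+4)/(nσ)`, solves
`i ∂ₜ u + ½ Δ u = V u + lam |u|^{2σ} u` on `I × ℝⁿ` with `u(0) = u₀`. The equation is understood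
in the sense of distributions in `x`, for every `t ∈ I`. -/
structure IsSolution {n : ℕ} (σ lam : ℝ) (V : Space n → ℝ) (I : Set ℝ)
    (u₀ : Space n → ℂ) (u : ℝ → Space n → ℂ) : Prop where
  memSigma : ∀ t ∈ I, MemSigma (u t)
  continuous_sigma : ∀ t ∈ I, Tendsto (fun s => sigmaENorm (u s - u t)) (𝓝[I] t) (𝓝 0)
  strichartz : ∀ a b : ℝ, Set.Icc a b ⊆ I →
    ∫⁻ t in Set.Icc a b, sobolevENorm (2 * σ + 2) (u t) ^ ((4 * σ + 4) / (n * σ)) < ∞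
  initial : u 0 =ᵐ[volume] u₀
  equation : ∀ φ : Space n → ℝ, ContDiff ℝ (⊤ : ℕ∞) φ → HasCompactSupport φ → ∀ t ∈ I, ∃ d : ℂ,
    HasDerivWithinAt (fun s => ∫ x, φ x • u s x) d I t ∧
    Complex.I * d + (1 / 2) * ∫ x, Laplacian.laplacian φ x • u t x =
      ∫ x, φ x • ((V x : ℂ) * u t x + ((lam * ‖u t x‖ ^ (2 * σ) : ℝ) : ℂ) * u t x)

/-- `‖f‖_{L^{2σ+2}}^{2σ+2}`. -/
def potentialTerm {n : ℕ} (σ : ℝ) (f : Space n → ℂ) : ℝ :=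
  lpNorm f (ENNReal.ofReal (2 * σ + 2)) volume ^ (2 * σ + 2)

/-- The energy
`E_V(f) = ½ ‖∇ f‖²_{L²} + lam/(σ+1) ‖f‖_{L^{2σ+2}}^{2σ+2} + ∫ V |f|²`. -/
def energy {n : ℕ} (σ lam : ℝ) (V : Space n → ℝ) (f : Space n → ℂ) : ℝ :=
  1 / 2 * lpNorm (weakGrad f) 2 volume ^ 2 + lam / (σ + 1) * potentialTerm σ f
    + ∫ x, V x * ‖f x‖ ^ 2

/-- The confining potential `V₊(x) = ω² |x|² / 2`. -/
def Vplus {n : ℕ} (ω : ℝ) (x : Space n) : ℝ := ω ^ 2 * ‖x‖ ^ 2 / 2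

/-- The repulsive potential `V₋(x) = - ω² |x|² / 2`. -/
def Vminus {n : ℕ} (ω : ℝ) (x : Space n) : ℝ := -(ω ^ 2 * ‖x‖ ^ 2 / 2)

/-- The vector-valued function `a x f + i b ∇ f`. -/
def firstOrder {n : ℕ} (a b : ℝ) (f : Space n → ℂ) (x : Space n) : EuclideanSpace ℂ (Fin n) :=
  WithLp.toLp 2 fun j => (a : ℂ) * ((x j : ℝ) : ℂ) * f x + Complex.I * (b : ℂ) * weakPartial j f x

/-- `J₊(t) = - ω sin(ωt) x + i cos(ωt) ∇`. -/
def Jplus {n : ℕ} (ω t : ℝ) (f : Space n → ℂ) : Space n → EuclideanSpace ℂ (Fin n) :=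
  firstOrder (-(ω * Real.sin (ω * t))) (Real.cos (ω * t)) f

/-- `H₊(t) = cos(ωt) x + i (sin(ωt)/ω) ∇`. -/
def Hplus {n : ℕ} (ω t : ℝ) (f : Space n → ℂ) : Space n → EuclideanSpace ℂ (Fin n) :=
  firstOrder (Real.cos (ω * t)) (Real.sin (ω * t) / ω) f

/-- `J₋(t) = ω sinh(ωt) x + i cosh(ωt) ∇`. -/
def Jminus {n : ℕ} (ω t : ℝ) (f : Space n → ℂ) : Space n → EuclideanSpace ℂ (Fin n) :=
  firstOrder (ω * Real.sinh (ω * t)) (Real.cosh (ω * t)) f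

/-- `H₋(t) = cosh(ωt) x + i (sinh(ωt)/ω) ∇`. -/
def Hminus {n : ℕ} (ω t : ℝ) (f : Space n → ℂ) : Space n → EuclideanSpace ℂ (Fin n) :=
  firstOrder (Real.cosh (ω * t)) (Real.sinh (ω * t) / ω) f

/-- `E₊¹(t)`. -/
def E1plus {n : ℕ} (σ lam ω : ℝ) (u : ℝ → Space n → ℂ) (t : ℝ) : ℝ :=
  1 / 2 * lpNorm (Jplus ω t (u t)) 2 volume ^ 2
    + lam / (σ + 1) * Real.cos (ω * t) ^ 2 * potentialTerm σ (u t)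

/-- `E₊²(t)`. -/
def E2plus {n : ℕ} (σ lam ω : ℝ) (u : ℝ → Space n → ℂ) (t : ℝ) : ℝ :=
  ω ^ 2 / 2 * lpNorm (Hplus ω t (u t)) 2 volume ^ 2
    + lam / (σ + 1) * Real.sin (ω * t) ^ 2 * potentialTerm σ (u t)

/-- `E₋¹(t)`. -/
def E1minus {n : ℕ} (σ lam ω : ℝ) (u : ℝ → Space n → ℂ) (t : ℝ) : ℝ :=
  1 / 2 * lpNorm (Jminus ω t (u t)) 2 volume ^ 2
    + lam / (σ + 1) * Real.cosh (ω * t) ^ 2 * potentialTerm σ (u t)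

/-- `E₋²(t)`. -/
def E2minus {n : ℕ} (σ lam ω : ℝ) (u : ℝ → Space n → ℂ) (t : ℝ) : ℝ :=
  -ω ^ 2 / 2 * lpNorm (Hminus ω t (u t)) 2 volume ^ 2
    - lam / (σ + 1) * Real.sinh (ω * t) ^ 2 * potentialTerm σ (u t)

end

end HarmonicNLS

/-!
Both equations have a potential `V x = -κ |x|² / 2`, with `κ = -ω²` (confining) or `κ = ω²`
(repulsive), and the two cases are treated at once. Formally, the quantities
`X = ‖x u‖²`, `Y = ½ ‖∇u‖² + lam/(σ+1) F` and `μ = Im ∫ conj u (x · ∇u)`, with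
`F = ‖u‖^{2σ+2}` in `L^{2σ+2}`, satisfy
`X' = 2 μ`, `Y' = κ μ`, `μ' = ‖∇u‖² + κ X + lam n σ/(σ+1) F`.
The energy is `Y - κ/2 X`, hence constant. Moreover
`½ ‖α x u + i β ∇u‖² + lam/(σ+1) β² F = ½ α² X - α β μ + β² Y`, and if the coefficients move along the
classical flow, `β' = α` and `α' = κ β`, its derivative reduces to `lam/(σ+1) (2 - n σ) α β F`; for
`α = -ω sin ωt`, `β = cos ωt` or `α = ω sinh ωt`, `β = cosh ωt` these are the assertions about `E¹`
(`IsSolution.hasDerivAt_pseudoEnergy`, `IsSolution.energy_eq`). That `E¹ + E²` is the energy is algebra.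

The work lies in the justification, since `u` has only one derivative in `L²` and the equation
holds in the sense of distributions.

* Below the critical exponent `Σ` embeds into `L^{2σ+2}` (`exists_sigmaEmbeds`); this is obtained by
  a bootstrap comparing a function with its averages over balls (`SobolevBound.step`). Test functions
  are dense in `Σ` (`MemSigma.exists_contDiff`). So the equation can be tested with elements of `Σ`,
  even time-dependent ones (`IsSolution.tendsto_ip_slope`), and `‖u s - u t‖² = o(|s - t|)`
  (`IsSolution.tendsto_lpNorm_sq_div`).

* The evolution of `½ ‖Dⱼ u‖²`, for `Dⱼ = α xⱼ + i β ∂ⱼ`, is derived from that of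
  `½ ‖exp (i r Dⱼ) u - u‖²`, which involves only admissible test functions because the unitary group
  `exp (i r Dⱼ)`, a translation with a phase, preserves `Σ`. Division by `r²` and `r → 0` gives
  `IsSolution.shiftGenerator_sub_eq_integral`, in integrated form. The nonlinearity contributes
  `β² ∫ ∂ⱼ(|u|^{2σ}) Im (conj u ∂ⱼu)`, the `crossTerm`, which makes sense for almost every time only:
  here `u ∈ L^q W^{1,2σ+2}` with `q ≥ 2` is used
  (`IsSolution.integrableOn_lpNorm_weakPartial_sq`).

* The evolution of `F` is derived from that of the integrals of smoother functions `regPot σ ε` of `u`,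
  and it consists of the same cross terms (`IsSolution.potentialTerm_sub_eq_integral`).

The cross terms cancel in the sum (`IsSolution.sub_eq_integral`), and the remaining rates are
continuous in time, so that the integrated identities can be differentiated at every time.
-/

namespace HarmonicNLS

/-! ### Calculus of weak partial derivatives -/

/-- The `j`-th vector of the standard basis of `ℝⁿ`. -/
noncomputable abbrev unitVec {n : ℕ} (j : Fin n) : Space n := EuclideanSpace.single j 1

section WeakPartial

variable {n : ℕ} {j : Fin n} {f g f' g' : Space n → ℂ}

theorem integrable_test_smul {φ : Space n → ℝ} (hφ : Continuous φ) (hc : HasCompactSupport φ)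
    (hf : LocallyIntegrable f volume) : Integrable (fun x => φ x • f x) volume :=
  hf.integrable_smul_left_of_hasCompactSupport hφ hc

theorem contDiff_fderiv_apply {φ : Space n → ℝ} (hφ : ContDiff ℝ (⊤ : ℕ∞) φ) (v : Space n) :
    ContDiff ℝ (⊤ : ℕ∞) fun x => fderiv ℝ φ x v :=
  (hφ.fderiv_right (m := (⊤ : ℕ∞)) le_rfl).clm_apply contDiff_const

theorem hasCompactSupport_fderiv_apply {φ : Space n → ℝ} (hc : HasCompactSupport φ) (v : Space n) :
    HasCompactSupport fun x => fderiv ℝ φ x v :=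
  hc.fderiv_apply (𝕜 := ℝ) v

theorem HasWeakPartial.unique (h : HasWeakPartial j f g) (h' : HasWeakPartial j f g') :
    g =ᵐ[volume] g' := by
  refine ae_eq_of_integral_contDiff_smul_eq h.locallyIntegrable_partial
    h'.locallyIntegrable_partial fun φ hφ hc => ?_
  have h1 := h.integral_eq φ hφ hc
  rw [h'.integral_eq φ hφ hc] at h1
  exact (neg_injective h1).symm

theorem HasWeakPartial.congr (h : HasWeakPartial j f g) (hf : f =ᵐ[volume] f')
    (hg : g =ᵐ[volume] g') : HasWeakPartial j f' g' where
  locallyIntegrable := h.locallyIntegrable.congr hf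
  locallyIntegrable_partial := h.locallyIntegrable_partial.congr hg
  integral_eq φ hφ hc := by
    rw [integral_congr_ae (g := fun x => fderiv ℝ φ x (EuclideanSpace.single j 1) • f x),
      h.integral_eq φ hφ hc, neg_inj]
    · exact integral_congr_ae (hg.mono fun x hx => by simp only [hx])
    · exact hf.mono fun x hx => by simp only [hx]

theorem HasWeakPartial.add (h : HasWeakPartial j f g) (h' : HasWeakPartial j f' g') :
    HasWeakPartial j (f + f') (g + g') where
  locallyIntegrable := h.locallyIntegrable.add h'.locallyIntegrable
  locallyIntegrable_partial := h.locallyIntegrable_partial.add h'.locallyIntegrable_partial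
  integral_eq φ hφ hc := by
    have hd := (contDiff_fderiv_apply hφ (unitVec j)).continuous
    have hdc := hasCompactSupport_fderiv_apply hc (unitVec j)
    simp only [Pi.add_apply, smul_add]
    rw [integral_add (integrable_test_smul hd hdc h.locallyIntegrable)
      (integrable_test_smul hd hdc h'.locallyIntegrable),
      integral_add (integrable_test_smul hφ.continuous hc h.locallyIntegrable_partial)
      (integrable_test_smul hφ.continuous hc h'.locallyIntegrable_partial),
      h.integral_eq φ hφ hc, h'.integral_eq φ hφ hc, neg_add]

theorem HasWeakPartial.const_smul (h : HasWeakPartial j f g) (c : ℂ) :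
    HasWeakPartial j (c • f) (c • g) where
  locallyIntegrable := h.locallyIntegrable.smul c
  locallyIntegrable_partial := h.locallyIntegrable_partial.smul c
  integral_eq φ hφ hc := by
    simp only [Pi.smul_apply, smul_comm _ c, integral_smul, h.integral_eq φ hφ hc, smul_neg]

theorem HasWeakPartial.sub (h : HasWeakPartial j f g) (h' : HasWeakPartial j f' g') :
    HasWeakPartial j (f - f') (g - g') := by
  have := h.add (h'.const_smul (-1))
  rwa [neg_one_smul, neg_one_smul, ← sub_eq_add_neg, ← sub_eq_add_neg] at this

theorem HasWeakGrad.hasWeakPartial (h : HasWeakGrad f) (j : Fin n) :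
    HasWeakPartial j f (weakPartial j f) := by
  have hj := h j
  rw [weakPartial, dif_pos hj]
  exact hj.choose_spec

theorem HasWeakPartial.weakPartial_ae_eq (h : HasWeakPartial j f g) :
    weakPartial j f =ᵐ[volume] g := by
  have hj : ∃ g, HasWeakPartial j f g := ⟨g, h⟩
  rw [weakPartial, dif_pos hj]
  exact hj.choose_spec.unique h

/-- The product rule with a smooth real factor. -/
theorem HasWeakPartial.smooth_smul (h : HasWeakPartial j f g) {m : Space n → ℝ}
    (hm : ContDiff ℝ (⊤ : ℕ∞) m) :
    HasWeakPartial j (fun x => m x • f x)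
      (fun x => fderiv ℝ m x (unitVec j) • f x + m x • g x) where
  locallyIntegrable := h.locallyIntegrable.continuous_smul hm.continuous
  locallyIntegrable_partial :=
    (h.locallyIntegrable.continuous_smul (contDiff_fderiv_apply hm _).continuous).add
      (h.locallyIntegrable_partial.continuous_smul hm.continuous)
  integral_eq φ hφ hc := by
    have hmφ := h.integral_eq (fun x => m x * φ x) (hm.mul hφ) hc.mul_left
    have hdφ := (contDiff_fderiv_apply hφ (unitVec j)).continuous
    have hdm := (contDiff_fderiv_apply hm (unitVec j)).continuous
    have hdc := hasCompactSupport_fderiv_apply hc (unitVec j)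
    have e : ∀ x, fderiv ℝ (fun x => m x * φ x) x (EuclideanSpace.single j 1) • f x
        = (fderiv ℝ φ x (unitVec j) * m x) • f x + (φ x * fderiv ℝ m x (unitVec j)) • f x := by
      intro x
      have := (hm.differentiable (by simp) x).hasFDerivAt.mul
        (hφ.differentiable (by simp) x).hasFDerivAt
      have e' : fderiv ℝ (fun x => m x * φ x) x = _ := this.fderiv
      rw [e']
      simp only [add_apply, smul_apply, smul_eq_mul,
        ← add_smul]
      congr 1; ring
    have i1 : Integrable (fun x => (fderiv ℝ φ x (unitVec j) * m x) • f x) volume :=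
      integrable_test_smul (hdφ.mul hm.continuous) hdc.mul_right h.locallyIntegrable
    have i2 : Integrable (fun x => (φ x * fderiv ℝ m x (unitVec j)) • f x) volume :=
      integrable_test_smul (hφ.continuous.mul hdm) hc.mul_right h.locallyIntegrable
    have i3 : Integrable (fun x => (φ x * m x) • g x) volume :=
      integrable_test_smul (hφ.continuous.mul hm.continuous) hc.mul_right
        h.locallyIntegrable_partial
    simp only [e] at hmφ
    rw [integral_add i1 i2] at hmφ
    simp only [smul_add, smul_smul]
    rw [integral_add i2 i3, neg_add]
    simp only [mul_comm (m _) (φ _)] at hmφ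
    rw [← hmφ]
    abel

theorem _root_.MeasureTheory.LocallyIntegrable.comp_sub_right' {E : Type*} [NormedAddCommGroup E]
    {f : Space n → E} (hf : LocallyIntegrable f volume) (v : Space n) :
    LocallyIntegrable (fun x => f (x - v)) volume := by
  rw [locallyIntegrable_iff] at hf ⊢
  intro K hK
  have hK' : IsCompact ((fun x => x - v) '' K) := hK.image (by fun_prop)
  have := (measurePreserving_sub_right (volume : Measure (Space n)) v).integrableOn_comp_preimage
    (Homeomorph.subRight v).measurableEmbedding (f := f) (s := (fun x => x - v) '' K)
  rw [Set.preimage_image_eq _ sub_left_injective] at this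
  exact this.2 (hf _ hK')

theorem HasWeakPartial.comp_sub_right (h : HasWeakPartial j f g) (v : Space n) :
    HasWeakPartial j (fun x => f (x - v)) (fun x => g (x - v)) where
  locallyIntegrable := h.locallyIntegrable.comp_sub_right' v
  locallyIntegrable_partial := h.locallyIntegrable_partial.comp_sub_right' v
  integral_eq φ hφ hc := by
    have h1 := h.integral_eq (fun x => φ (x + v)) (hφ.comp (contDiff_id.add contDiff_const))
      (hc.comp_homeomorph (Homeomorph.addRight v))
    rw [← integral_sub_right_eq_self _ v, ← integral_sub_right_eq_self (fun x => φ (x + v) • g x) v]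
      at h1
    simpa only [fderiv_comp_add_right, sub_add_cancel] using h1

/-- The classical partial derivative of a `C¹` function is its weak one. -/
theorem hasWeakPartial_of_contDiff {f : Space n → ℂ} (hf : ContDiff ℝ 1 f) (j : Fin n) :
    HasWeakPartial j f (fun x => fderiv ℝ f x (unitVec j)) where
  locallyIntegrable := hf.continuous.locallyIntegrable
  locallyIntegrable_partial :=
    ((hf.continuous_fderiv (by simp)).clm_apply continuous_const).locallyIntegrable
  integral_eq φ hφ hc := by
    have hd := (contDiff_fderiv_apply hφ (unitVec j)).continuous
    have hdc := hasCompactSupport_fderiv_apply hc (unitVec j)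
    have hf' : Continuous fun x => fderiv ℝ f x (unitVec j) :=
      (hf.continuous_fderiv (by simp)).clm_apply continuous_const
    have key := integral_bilinear_hasFDerivAt_right_eq_neg_left_of_integrable
      (μ := (volume : Measure (Space n))) (f := φ) (f' := fderiv ℝ φ) (g := f) (g' := fderiv ℝ f)
      (v := unitVec j) (B := ContinuousLinearMap.lsmul ℝ ℝ)
      (integrable_test_smul hd hdc hf.continuous.locallyIntegrable)
      (integrable_test_smul hφ.continuous hc hf'.locallyIntegrable)
      (integrable_test_smul hφ.continuous hc hf.continuous.locallyIntegrable)
      (fun x _ => (hφ.differentiable (by simp) x).hasFDerivAt)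
      (fun x _ => (hf.differentiable (by simp) x).hasFDerivAt)
    simp only [ContinuousLinearMap.lsmul_apply] at key
    rw [key, neg_neg]

end WeakPartial

/-! ### Averages of translates -/

section Average

variable {n : ℕ} {Ω : Type*} [MeasurableSpace Ω] {ν : Measure Ω}

theorem quasiMeasurePreserving_sub_translate [SFinite ν] {T : Ω → Space n} (hT : Measurable T) :
    Measure.QuasiMeasurePreserving (fun z : Space n × Ω => z.1 - T z.2)
      ((volume : Measure (Space n)).prod ν) volume := by
  have hm : Measurable fun z : Space n × Ω => z.1 - T z.2 := by fun_prop
  refine ⟨hm, Measure.AbsolutelyContinuous.mk fun s hs h0 => ?_⟩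
  rw [Measure.map_apply hm hs, Measure.prod_apply_symm (hm hs)]
  have : ∀ y, volume ((fun x => (x, y)) ⁻¹' ((fun z : Space n × Ω => z.1 - T z.2) ⁻¹' s)) = 0 := by
    intro y
    rw [← Set.preimage_comp]
    exact ((measurePreserving_sub_right (volume : Measure (Space n)) (T y)).measure_preimage
      hs.nullMeasurableSet).trans h0
  simp [this]

theorem aestronglyMeasurable_translate [SFinite ν] {E : Type*} [TopologicalSpace E]
    {f : Space n → E}
    (hf : AEStronglyMeasurable f volume) {T : Ω → Space n} (hT : Measurable T) :
    AEStronglyMeasurable (fun z : Space n × Ω => f (z.1 - T z.2)) (volume.prod ν) :=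
  hf.comp_quasiMeasurePreserving (quasiMeasurePreserving_sub_translate hT)

theorem integrable_translate [IsFiniteMeasure ν] {E : Type*} [NormedAddCommGroup E]
    {f : Space n → E}
    (hf : Integrable f volume) {T : Ω → Space n} (hT : Measurable T) :
    Integrable (fun z : Space n × Ω => f (z.1 - T z.2)) (volume.prod ν) := by
  have hm := aestronglyMeasurable_translate (ν := ν) hf.1 hT
  refine ⟨hm, ?_⟩
  rw [hasFiniteIntegral_iff_enorm, lintegral_prod_symm _ hm.enorm]
  simp only [lintegral_sub_right_eq_self (fun x => ‖f x‖ₑ)]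
  rw [lintegral_const]
  exact ENNReal.mul_lt_top hf.2 (measure_lt_top _ _)

/-- Minkowski's inequality for an average over a probability measure. -/
theorem eLpNorm_integral_le_of_forall [IsProbabilityMeasure ν] {X E : Type*} [MeasurableSpace X]
    {μ : Measure X} [SFinite μ]
    [NormedAddCommGroup E] [NormedSpace ℝ E] {h : X → Ω → E}
    (hm : AEStronglyMeasurable (Function.uncurry h) (μ.prod ν)) {p : ℝ≥0∞} (hp1 : 1 ≤ p)
    (hp : p ≠ ∞) {C : ℝ≥0∞} (hC : ∀ᵐ y ∂ν, eLpNorm (fun x => h x y) p μ ≤ C) :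
    eLpNorm (fun x => ∫ y, h x y ∂ν) p μ ≤ C := by
  have hp0 : p ≠ 0 := (one_pos.trans_le hp1).ne'
  have hpr : 0 < p.toReal := ENNReal.toReal_pos hp0 hp
  rw [eLpNorm_eq_lintegral_rpow_enorm_toReal hp0 hp, one_div, ENNReal.rpow_inv_le_iff hpr]
  calc ∫⁻ x, ‖∫ y, h x y ∂ν‖ₑ ^ p.toReal ∂μ
      ≤ ∫⁻ x, ∫⁻ y, ‖h x y‖ₑ ^ p.toReal ∂ν ∂μ := by
        refine lintegral_mono_ae ?_
        filter_upwards [hm.prodMk_left] with x hx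
        have h1 : ‖∫ y, h x y ∂ν‖ₑ ≤ eLpNorm (h x) p ν := by
          refine (enorm_integral_le_lintegral_enorm _).trans ?_
          rw [← eLpNorm_one_eq_lintegral_enorm]
          exact eLpNorm_le_eLpNorm_of_exponent_le hp1 hx
        rw [eLpNorm_eq_lintegral_rpow_enorm_toReal hp0 hp, one_div,
          ENNReal.le_rpow_inv_iff hpr] at h1
        exact h1
    _ = ∫⁻ y, ∫⁻ x, ‖h x y‖ₑ ^ p.toReal ∂μ ∂ν :=
        lintegral_lintegral_swap (hm.enorm.pow_const _)
    _ ≤ ∫⁻ y, C ^ p.toReal ∂ν := by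
        refine lintegral_mono_ae (hC.mono fun y hy => ?_)
        rw [eLpNorm_eq_lintegral_rpow_enorm_toReal hp0 hp, one_div,
          ENNReal.rpow_inv_le_iff hpr] at hy
        exact hy
    _ = C ^ p.toReal := by simp

/-- Translations are continuous in `Lᵖ`, `p < ∞`. -/
theorem tendsto_eLpNorm_translate_sub {E : Type*} [NormedAddCommGroup E] {f : Space n → E}
    {p : ℝ≥0∞} (hp1 : 1 ≤ p) (hp : p ≠ ∞) (hf : MemLp f p volume) :
    Tendsto (fun v => eLpNorm (fun x => f (x - v) - f x) p volume) (𝓝 0) (𝓝 0) := by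
  have : Fact (1 ≤ p) := ⟨hp1⟩
  let T : Space n → C(Space n, Space n) := fun v => ⟨fun x => x - v, by fun_prop⟩
  have hT : Continuous T :=
    (ContinuousMap.curry ⟨fun z : Space n × Space n => z.2 - z.1, by fun_prop⟩).continuous
  have hmp : ∀ v, MeasurePreserving (T v) volume volume := fun v =>
    measurePreserving_sub_right volume v
  have key := Filter.Tendsto.compMeasurePreservingLp (μ := (volume : Measure (Space n)))
    (f := fun _ => hf.toLp f) (f₀ := hf.toLp f) (l := 𝓝 (0 : Space n)) tendsto_const_nhds
    (hT.tendsto 0) hmp (hmp 0) hp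
  have h0 : (Lp.compMeasurePreserving (T 0) (hmp 0)) (hf.toLp f) = hf.toLp f := by
    rw [Lp.toLp_compMeasurePreserving]
    congr 1
    funext x
    simp [T]
  rw [h0, Lp.tendsto_Lp_iff_tendsto_eLpNorm'] at key
  refine key.congr fun v => eLpNorm_congr_ae ?_
  rw [Lp.toLp_compMeasurePreserving]
  filter_upwards [(hf.comp_measurePreserving (hmp v)).coeFn_toLp, hf.coeFn_toLp] with x h1 h2
  simp only [Pi.sub_apply, h1, h2]
  rfl

end Average
/-! ### Averages of locally integrable functions -/

section AverageLocal

variable {n : ℕ} {Ω : Type*} [MeasurableSpace Ω] {ν : Measure Ω}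
  {E : Type*} [NormedAddCommGroup E] {g : Space n → E} {T : Ω → Space n} {R : ℝ}

theorem ae_indicator_translate_eq (hR : ∀ᵐ y ∂ν, ‖T y‖ ≤ R) (a : ℝ) : ∀ᵐ y ∂ν,
    ∀ x ∈ Metric.closedBall (0 : Space n) a,
      (Metric.closedBall (0 : Space n) (a + R)).indicator g (x - T y) = g (x - T y) := by
  filter_upwards [hR] with y hy x hx
  refine Set.indicator_of_mem ?_ _
  rw [mem_closedBall_zero_iff] at hx ⊢
  exact (norm_sub_le _ _).trans (add_le_add hx hy)

variable [IsFiniteMeasure ν]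

theorem integrable_indicator_translate (hg : LocallyIntegrable g volume) (hT : Measurable T)
    (a : ℝ) : Integrable (fun z : Space n × Ω =>
      (Metric.closedBall (0 : Space n) a).indicator g (z.1 - T z.2)) (volume.prod ν) :=
  integrable_translate ((hg.integrableOn_isCompact (isCompact_closedBall _ _)).integrable_indicator
    Metric.isClosed_closedBall.measurableSet) hT

variable [NormedSpace ℝ E]

theorem locallyIntegrable_average (hg : LocallyIntegrable g volume) (hT : Measurable T)
    (hR : ∀ᵐ y ∂ν, ‖T y‖ ≤ R) : LocallyIntegrable (fun x => ∫ y, g (x - T y) ∂ν) volume := by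
  rw [locallyIntegrable_iff]
  intro K hK
  obtain ⟨a, ha⟩ := hK.isBounded.subset_closedBall 0
  have h1 := (integrable_indicator_translate (ν := ν) hg hT (a + R)).integral_prod_left
  refine (h1.integrableOn (s := K)).congr_fun_ae ?_
  refine (ae_restrict_mem hK.measurableSet).mono fun x hx => ?_
  exact integral_congr_ae ((ae_indicator_translate_eq hR a).mono fun y hy => hy x (ha hx))

/-- Fubini for the average of the translates of a locally integrable function: where `φ` does not
vanish, only the values of `g` in a fixed ball matter. -/
theorem integral_smul_average {φ : Space n → ℝ} (hφ : Continuous φ) (hc : HasCompactSupport φ)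
    (hg : LocallyIntegrable g volume) (hT : Measurable T) (hR : ∀ᵐ y ∂ν, ‖T y‖ ≤ R) :
    ∫ x, φ x • (∫ y, g (x - T y) ∂ν) = ∫ y, (∫ x, φ x • g (x - T y)) ∂ν := by
  obtain ⟨a, ha⟩ := hc.isCompact.isBounded.subset_closedBall 0
  obtain ⟨M, hM⟩ := hφ.bounded_above_of_compact_support hc
  have h1 := (integrable_indicator_translate (ν := ν) hg hT (a + R)).bdd_smul
    M (hφ.measurable.comp measurable_fst).aestronglyMeasurable (Eventually.of_forall fun z => hM z.1)
  have h2 := integral_integral_swap (f := fun x y => φ x •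
    (Metric.closedBall (0 : Space n) (a + R)).indicator g (x - T y)) h1
  have e : ∀ᵐ y ∂ν, ∀ x,
      φ x • (Metric.closedBall (0 : Space n) (a + R)).indicator g (x - T y)
        = φ x • g (x - T y) := by
    filter_upwards [ae_indicator_translate_eq (g := g) hR a] with y hy x
    by_cases hx : φ x = 0
    · simp [hx]
    · rw [hy x (ha (subset_tsupport _ hx))]
  simp only [← integral_smul]
  convert h2 using 1
  · refine integral_congr_ae (Eventually.of_forall fun x => ?_)
    exact integral_congr_ae (e.mono fun y hy => (hy x).symm)
  · exact integral_congr_ae (e.mono fun y hy => by simp only [hy])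

theorem integral_average_smul [CompleteSpace E] {φ : Space n → ℝ} (hφ : Continuous φ) (hc : HasCompactSupport φ)
    (hg : LocallyIntegrable g volume) (hT : Measurable T) (hR : ∀ᵐ y ∂ν, ‖T y‖ ≤ R) :
    ∫ x, (∫ y, φ (x + T y) ∂ν) • g x = ∫ y, (∫ x, φ (x + T y) • g x) ∂ν := by
  obtain ⟨a, ha⟩ := hc.isCompact.isBounded.subset_closedBall 0
  obtain ⟨M, hM⟩ := hφ.bounded_above_of_compact_support hc
  have h0 : Integrable ((Metric.closedBall (0 : Space n) (a + R)).indicator g) volume :=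
    (hg.integrableOn_isCompact (isCompact_closedBall _ _)).integrable_indicator
      Metric.isClosed_closedBall.measurableSet
  have h1 := (h0.comp_fst ν).bdd_smul (𝕜 := ℝ)
    (φ := fun z : Space n × Ω => φ (z.1 + T z.2)) M
    (by
      have : Measurable fun z : Space n × Ω => z.1 + T z.2 := by fun_prop
      exact (hφ.measurable.comp this).aestronglyMeasurable)
    (Eventually.of_forall fun z => hM _)
  have h2 := integral_integral_swap (f := fun x y => φ (x + T y) •
    (Metric.closedBall (0 : Space n) (a + R)).indicator g x) h1
  have e : ∀ᵐ y ∂ν, ∀ x, φ (x + T y) •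
      (Metric.closedBall (0 : Space n) (a + R)).indicator g x = φ (x + T y) • g x := by
    filter_upwards [hR] with y hy x
    by_cases hx : φ (x + T y) = 0
    · simp [hx]
    · rw [Set.indicator_of_mem]
      have h3 : ‖x + T y‖ ≤ a := by
        have h4 := ha (subset_tsupport _ hx)
        rwa [mem_closedBall_zero_iff] at h4
      rw [mem_closedBall_zero_iff]
      calc ‖x‖ = ‖(x + T y) - T y‖ := by rw [add_sub_cancel_right]
        _ ≤ _ := (norm_sub_le _ _).trans (add_le_add h3 hy)
  convert h2 using 1
  · refine integral_congr_ae (Eventually.of_forall fun x => ?_)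
    dsimp only
    rw [← integral_smul_const]
    exact integral_congr_ae (e.mono fun y hy => (hy x).symm)
  · exact integral_congr_ae (e.mono fun y hy => by simp only [hy])

end AverageLocal

/-! ### Difference quotients -/

section DifferenceQuotient

variable {n : ℕ} {j : Fin n} {f g : Space n → ℂ}

/-- The fundamental theorem of calculus along the lines parallel to the `j`-th axis. -/
theorem HasWeakPartial.translate_sub_ae (h : HasWeakPartial j f g) (r : ℝ) :
    ∀ᵐ x, f (x - r • unitVec j) - f x
      = -(r • ∫ s in Set.Ioc (0 : ℝ) 1, g (x - (s * r) • unitVec j)) := by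
  have hT : Measurable fun s : ℝ => (s * r) • unitVec j := by fun_prop
  have hR : ∀ᵐ s ∂(volume.restrict (Set.Ioc (0 : ℝ) 1)), ‖(s * r) • unitVec j‖ ≤ |r| := by
    refine (ae_restrict_mem measurableSet_Ioc).mono fun s hs => ?_
    rw [norm_smul, PiLp.norm_single, norm_one, mul_one, Real.norm_eq_abs, abs_mul,
      abs_of_pos hs.1]
    exact mul_le_of_le_one_left (abs_nonneg _) hs.2
  refine ae_eq_of_integral_contDiff_smul_eq
    ((h.locallyIntegrable.comp_sub_right' _).sub h.locallyIntegrable)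
    ((locallyIntegrable_average h.locallyIntegrable_partial hT hR).smul r).neg fun φ hφ hc => ?_
  have i1 := integrable_test_smul hφ.continuous hc
    (h.locallyIntegrable.comp_sub_right' (r • unitVec j))
  have i2 := integrable_test_smul hφ.continuous hc h.locallyIntegrable
  have i3 : Integrable (fun x => φ (x + r • unitVec j) • f x) volume :=
    integrable_test_smul (hφ.continuous.comp (continuous_id.add continuous_const))
    (hc.comp_homeomorph (Homeomorph.addRight (r • unitVec j))) h.locallyIntegrable
  have hd := (contDiff_fderiv_apply hφ (unitVec j)).continuous
  have hdc := hasCompactSupport_fderiv_apply hc (unitVec j)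
  have ftc : ∀ x, φ (x + r • unitVec j) - φ x
      = r * ∫ s in Set.Ioc (0 : ℝ) 1, fderiv ℝ φ (x + (s * r) • unitVec j) (unitVec j) := by
    intro x
    have hder : ∀ s : ℝ, HasDerivAt (fun s : ℝ => φ (x + (s * r) • unitVec j))
        (r * fderiv ℝ φ (x + (s * r) • unitVec j) (unitVec j)) s := by
      intro s
      have h1 : HasDerivAt (fun s : ℝ => x + (s * r) • unitVec j) (r • unitVec j) s := by
        have := (((hasDerivAt_id s).mul_const r).smul_const (unitVec j)).const_add x
        simpa using this
      have h2 := (hφ.differentiable (by simp) (x + (s * r) • unitVec j)).hasFDerivAt.comp_hasDerivAt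
        s h1
      exact h2.congr_deriv (by simp)
    have hcont : Continuous fun s : ℝ =>
        r * fderiv ℝ φ (x + (s * r) • unitVec j) (unitVec j) :=
      continuous_const.mul (hd.comp (by fun_prop))
    have := intervalIntegral.integral_eq_sub_of_hasDerivAt (a := 0) (b := 1)
      (fun s _ => hder s) (hcont.intervalIntegrable 0 1)
    rw [intervalIntegral.integral_of_le zero_le_one, integral_const_mul] at this
    rw [this]; simp
  have e1 : ∫ x, φ x • (f (x - r • unitVec j) - f x)
      = ∫ x, (φ (x + r • unitVec j) - φ x) • f x := by
    simp only [smul_sub, sub_smul]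
    rw [integral_sub i1 i2, integral_sub i3 i2,
      ← integral_add_right_eq_self (fun x => φ x • f (x - r • unitVec j)) (r • unitVec j)]
    simp
  have e2 : ∀ s : ℝ, ∫ x, fderiv ℝ φ (x + (s * r) • unitVec j) (unitVec j) • f x
      = -∫ x, φ x • g (x - (s * r) • unitVec j) := by
    intro s
    rw [← (h.comp_sub_right ((s * r) • unitVec j)).integral_eq φ hφ hc,
      ← integral_sub_right_eq_self _ ((s * r) • unitVec j)]
    simp only [sub_add_cancel]
  have e3 : ∀ x, (φ (x + r • unitVec j) - φ x) • f x
      = r • ((∫ s in Set.Ioc (0 : ℝ) 1, fderiv ℝ φ (x + (s * r) • unitVec j) (unitVec j)) • f x) :=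
    fun x => by rw [ftc, mul_smul]
  rw [e1]
  simp only [e3]
  rw [integral_smul, integral_average_smul hd hdc h.locallyIntegrable hT hR]
  simp only [e2, smul_neg, integral_neg, smul_comm (φ _) r]
  rw [integral_smul, integral_smul_average hφ.continuous hc h.locallyIntegrable_partial hT hR]

variable {p : ℝ≥0∞}

instance : IsProbabilityMeasure ((volume : Measure ℝ).restrict (Set.Ioc 0 1)) := ⟨by simp⟩

theorem eLpNorm_translate {E : Type*} [NormedAddCommGroup E] {f : Space n → E}
    (hf : AEStronglyMeasurable f volume) (v : Space n) (p : ℝ≥0∞) :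
    eLpNorm (fun x => f (x - v)) p volume = eLpNorm f p volume :=
  eLpNorm_comp_measurePreserving hf (measurePreserving_sub_right volume v)

theorem _root_.MeasureTheory.MemLp.translate {E : Type*} [NormedAddCommGroup E] {f : Space n → E}
    (hf : MemLp f p volume) (v : Space n) : MemLp (fun x => f (x - v)) p volume :=
  hf.comp_measurePreserving (measurePreserving_sub_right volume v)

theorem HasWeakPartial.eLpNorm_translate_sub_le (h : HasWeakPartial j f g) (hp1 : 1 ≤ p)
    (hp : p ≠ ∞) (r : ℝ) :
    eLpNorm (fun x => f (x - r • unitVec j) - f x) p volume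
      ≤ ENNReal.ofReal |r| * eLpNorm g p volume := by
  have hgm := h.locallyIntegrable_partial.aestronglyMeasurable
  have hT : Measurable fun s : ℝ => (s * r) • unitVec j := by fun_prop
  rw [eLpNorm_congr_ae (h.translate_sub_ae r)]
  have h1 := eLpNorm_integral_le_of_forall (ν := (volume : Measure ℝ).restrict (Set.Ioc 0 1))
    (h := fun x s => g (x - (s * r) • unitVec j)) (aestronglyMeasurable_translate hgm hT)
    hp1 hp (Eventually.of_forall fun s => (eLpNorm_translate hgm _ p).le)
  have h2 := eLpNorm_const_smul r
    (fun x => ∫ s in Set.Ioc (0 : ℝ) 1, g (x - (s * r) • unitVec j)) p volume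
  calc _ = eLpNorm (r • fun x => ∫ s in Set.Ioc (0 : ℝ) 1, g (x - (s * r) • unitVec j)) p volume :=
        eLpNorm_neg _ _ _
    _ ≤ _ := by
        rw [h2, Real.enorm_eq_ofReal_abs]
        gcongr

/-- Difference quotients converge to the weak partial derivative in `Lᵖ`. -/
theorem HasWeakPartial.tendsto_differenceQuotient (h : HasWeakPartial j f g) (hp1 : 1 ≤ p)
    (hp : p ≠ ∞) (hg : MemLp g p volume) :
    Tendsto (fun r : ℝ => eLpNorm (fun x => r⁻¹ • (f (x - r • unitVec j) - f x) + g x) p volume)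
      (𝓝[≠] 0) (𝓝 0) := by
  have hgm := hg.1
  rw [ENNReal.tendsto_nhds_zero]
  intro ε hε
  have h0 := tendsto_eLpNorm_translate_sub hp1 hp hg
  rw [ENNReal.tendsto_nhds_zero] at h0
  obtain ⟨δ, hδ, hb⟩ := Metric.eventually_nhds_iff.1 (h0 ε hε)
  have hball : ∀ᶠ r : ℝ in 𝓝[≠] 0, |r| < δ := by
    refine nhdsWithin_le_nhds ?_
    have := Metric.ball_mem_nhds (0 : ℝ) hδ
    filter_upwards [this] with r hr
    simpa using hr
  filter_upwards [hball, self_mem_nhdsWithin] with r hr hr0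
  have hr0 : r ≠ 0 := hr0
  have hT : Measurable fun s : ℝ => (s * r) • unitVec j := by fun_prop
  have hR : ∀ᵐ s ∂(volume.restrict (Set.Ioc (0 : ℝ) 1)), ‖(s * r) • unitVec j‖ ≤ |r| := by
    refine (ae_restrict_mem measurableSet_Ioc).mono fun s hs => ?_
    rw [norm_smul, PiLp.norm_single, norm_one, mul_one, Real.norm_eq_abs, abs_mul,
      abs_of_pos hs.1]
    exact mul_le_of_le_one_left (abs_nonneg _) hs.2
  have h1 := eLpNorm_integral_le_of_forall (ν := (volume : Measure ℝ).restrict (Set.Ioc 0 1))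
    (μ := (volume : Measure (Space n)))
    (h := fun x s => g (x - (s * r) • unitVec j) - g x)
    ((aestronglyMeasurable_translate hgm hT).sub hgm.comp_fst)
    hp1 hp (C := ε) (hR.mono fun s hs => hb (by rw [dist_zero_right]; exact hs.trans_lt hr))
  refine le_trans (le_of_eq ?_) h1
  have hint : ∀ᵐ x : Space n, Integrable (fun s => g (x - (s * r) • unitVec j))
      (volume.restrict (Set.Ioc (0 : ℝ) 1)) := by
    have hloc : ∀ k : ℕ, ∀ᵐ x : Space n, Integrable (fun s =>
      (Metric.closedBall (0 : Space n) (k + |r|)).indicator g (x - (s * r) • unitVec j))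
      (volume.restrict (Set.Ioc (0 : ℝ) 1)) := fun k =>
      (integrable_indicator_translate h.locallyIntegrable_partial hT _).prod_right_ae
    rw [← ae_all_iff] at hloc
    filter_upwards [hloc] with x hx
    obtain ⟨k, hk⟩ := exists_nat_ge ‖x‖
    refine (hx k).congr ?_
    filter_upwards [ae_indicator_translate_eq (g := g) hR k] with s hs
    exact hs x (by simpa using hk)
  rw [← eLpNorm_neg]
  refine eLpNorm_congr_ae ?_
  filter_upwards [h.translate_sub_ae r, hint] with x hx hix
  rw [Pi.neg_apply, hx, integral_sub hix (integrable_const _), smul_neg, smul_smul,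
    inv_mul_cancel₀ hr0]
  simp only [one_smul, integral_const, probReal_univ]
  abel

end DifferenceQuotient
/-! ### Passing to the limit under the integral sign -/

section Convergence

variable {α : Type*} [MeasurableSpace α] {μ : Measure α}

/-- A generalised dominated convergence theorem, in which the dominating functions converge
almost everywhere and in mean. -/
theorem tendsto_integral_of_tendsto_dominating {F G : ℕ → α → ℝ} {F₀ G₀ : α → ℝ}
    (hFm : ∀ k, AEStronglyMeasurable (F k) μ) (hG : ∀ k, Integrable (G k) μ)
    (hG₀ : Integrable G₀ μ) (hFG : ∀ k, ∀ᵐ x ∂μ, |F k x| ≤ G k x)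
    (hF : ∀ᵐ x ∂μ, Tendsto (fun k => F k x) atTop (𝓝 (F₀ x)))
    (hGt : ∀ᵐ x ∂μ, Tendsto (fun k => G k x) atTop (𝓝 (G₀ x)))
    (hGi : Tendsto (fun k => ∫ x, G k x ∂μ) atTop (𝓝 (∫ x, G₀ x ∂μ))) :
    Tendsto (fun k => ∫ x, F k x ∂μ) atTop (𝓝 (∫ x, F₀ x ∂μ)) := by
  have hpos : ∀ᵐ x ∂μ, 0 ≤ G₀ x ∧ |F₀ x| ≤ G₀ x := by
    filter_upwards [hF, hGt, ae_all_iff.2 hFG] with x h1 h2 h3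
    have h4 : |F₀ x| ≤ G₀ x := le_of_tendsto_of_tendsto' h1.abs h2 h3
    exact ⟨(abs_nonneg _).trans h4, h4⟩
  -- `F k` is truncated at the height `G₀`, and the error is controlled by `(G k - G₀)⁺`.
  set m : ℕ → α → ℝ := fun k x => max (-G₀ x) (min (F k x) (G₀ x)) with hm
  have hm_meas : ∀ k, AEStronglyMeasurable (m k) μ := fun k =>
    hG₀.1.neg.sup ((hFm k).inf hG₀.1)
  have hm_bd : ∀ k, ∀ᵐ x ∂μ, ‖m k x‖ ≤ G₀ x := fun k => hpos.mono fun x hx => by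
    rw [Real.norm_eq_abs, abs_le]
    exact ⟨le_max_left _ _, max_le (by linarith [hx.1]) (min_le_right _ _)⟩
  have hm_lim : Tendsto (fun k => ∫ x, m k x ∂μ) atTop (𝓝 (∫ x, F₀ x ∂μ)) := by
    refine tendsto_integral_of_dominated_convergence G₀ hm_meas hG₀ hm_bd ?_
    filter_upwards [hF, hpos] with x h1 h2
    have h3 : max (-G₀ x) (min (F₀ x) (G₀ x)) = F₀ x := by
      rw [min_eq_left (le_trans (le_abs_self _) h2.2), max_eq_right (neg_le_of_abs_le h2.2)]
    have := (tendsto_const_nhds (x := -G₀ x)).max (h1.min (tendsto_const_nhds (x := G₀ x)))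
    rwa [h3] at this
  have hneg : Tendsto (fun k => ∫ x, max (G₀ x - G k x) 0 ∂μ) atTop (𝓝 0) := by
    have := tendsto_integral_of_dominated_convergence (μ := μ)
      (F := fun k x => max (G₀ x - G k x) 0) (f := fun _ => (0 : ℝ)) G₀
      (fun k => (hG₀.1.sub (hG k).1).sup aestronglyMeasurable_const) hG₀
      (fun k => by
        filter_upwards [hpos, hFG k] with x h1 h2
        rw [Real.norm_eq_abs, abs_of_nonneg (le_max_right _ _)]
        exact max_le (by linarith [(abs_nonneg _).trans h2]) h1.1)
      (by
        filter_upwards [hGt] with x h1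
        have := ((tendsto_const_nhds (x := G₀ x)).sub h1).max (tendsto_const_nhds (x := (0 : ℝ)))
        simpa using this)
    simpa using this
  have herr : Tendsto (fun k => ∫ x, max (G₀ x - G k x) 0 ∂μ
      + ((∫ x, G k x ∂μ) - ∫ x, G₀ x ∂μ)) atTop (𝓝 0) := by
    simpa using hneg.add (hGi.sub_const (∫ x, G₀ x ∂μ))
  have hFi : ∀ k, Integrable (F k) μ := fun k => (hG k).mono' (hFm k) (hFG k)
  have hmi : ∀ k, Integrable (m k) μ := fun k => hG₀.mono' (hm_meas k) (hm_bd k)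
  have hdiff : Tendsto (fun k => (∫ x, F k x ∂μ) - ∫ x, m k x ∂μ) atTop (𝓝 0) := by
    refine squeeze_zero_norm (fun k => ?_) herr
    have hi1 : Integrable (fun x => max (G₀ x - G k x) 0) μ := (hG₀.sub (hG k)).sup
      (integrable_zero _ _ _)
    have e := integral_add hi1 ((hG k).sub hG₀)
    simp only [Pi.sub_apply] at e
    rw [← integral_sub (hFi k) (hmi k), ← integral_sub (hG k) hG₀, ← e]
    refine norm_integral_le_of_norm_le (hi1.add ((hG k).sub hG₀)) ?_
    filter_upwards [hFG k, hpos] with x h1 h2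
    have h3 := abs_le.1 h1
    simp only [hm, Real.norm_eq_abs]
    rw [abs_le]
    constructor <;>
    rcases max_cases (G₀ x - G k x) 0 with h4 | h4 <;>
    rcases max_cases (-G₀ x) (min (F k x) (G₀ x)) with h5 | h5 <;>
    rcases min_cases (F k x) (G₀ x) with h6 | h6 <;> linarith
  simpa using hdiff.add hm_lim

theorem tendsto_integral_of_tendsto_dominating_norm {E : Type*} [NormedAddCommGroup E]
    [NormedSpace ℝ E] {F : ℕ → α → E} {G : ℕ → α → ℝ} {F₀ : α → E} {G₀ : α → ℝ}
    (hFm : ∀ k, AEStronglyMeasurable (F k) μ) (hF₀m : AEStronglyMeasurable F₀ μ)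
    (hG : ∀ k, Integrable (G k) μ)
    (hG₀ : Integrable G₀ μ) (hFG : ∀ k, ∀ᵐ x ∂μ, ‖F k x‖ ≤ G k x)
    (hF : ∀ᵐ x ∂μ, Tendsto (fun k => F k x) atTop (𝓝 (F₀ x)))
    (hGt : ∀ᵐ x ∂μ, Tendsto (fun k => G k x) atTop (𝓝 (G₀ x)))
    (hGi : Tendsto (fun k => ∫ x, G k x ∂μ) atTop (𝓝 (∫ x, G₀ x ∂μ))) :
    Integrable F₀ μ ∧ Tendsto (fun k => ∫ x, F k x ∂μ) atTop (𝓝 (∫ x, F₀ x ∂μ)) := by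
  have hbd : ∀ᵐ x ∂μ, ‖F₀ x‖ ≤ G₀ x := by
    filter_upwards [hF, hGt, ae_all_iff.2 hFG] with x h1 h2 h3
    exact le_of_tendsto_of_tendsto' h1.norm h2 h3
  have hF₀ : Integrable F₀ μ := hG₀.mono' hF₀m hbd
  have hFi : ∀ k, Integrable (F k) μ := fun k => (hG k).mono' (hFm k) (hFG k)
  refine ⟨hF₀, ?_⟩
  have key := tendsto_integral_of_tendsto_dominating (μ := μ) (F := fun k x => ‖F k x - F₀ x‖)
    (F₀ := fun _ => (0 : ℝ)) (G := fun k x => G k x + G₀ x) (G₀ := fun x => G₀ x + G₀ x)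
    (fun k => ((hFm k).sub hF₀m).norm) (fun k => (hG k).add hG₀) (hG₀.add hG₀)
    (fun k => by
      filter_upwards [hFG k, hbd] with x h1 h2
      rw [abs_norm]
      exact (norm_sub_le _ _).trans (add_le_add h1 h2))
    (hF.mono fun x h1 => by simpa using (h1.sub_const (F₀ x)).norm)
    (hGt.mono fun x h1 => h1.add_const _)
    (by
      simp only [fun k => integral_add (hG k) hG₀, integral_add hG₀ hG₀]
      exact hGi.add_const _)
  rw [tendsto_iff_norm_sub_tendsto_zero]
  refine squeeze_zero (fun _ => norm_nonneg _) (fun k => ?_) (by simpa using key)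
  rw [← integral_sub (hFi k) hF₀]
  exact norm_integral_le_integral_norm _

theorem exists_subseq_tendsto_ae_of_tendsto_eLpNorm {E : Type*} [NormedAddCommGroup E]
    {f : ℕ → α → E} {f₀ : α → E} {p : ℝ≥0∞} (hp : p ≠ 0)
    (hf : ∀ k, AEStronglyMeasurable (f k) μ) (hf₀ : AEStronglyMeasurable f₀ μ)
    (h : Tendsto (fun k => eLpNorm (f k - f₀) p μ) atTop (𝓝 0)) :
    ∃ ns : ℕ → ℕ, StrictMono ns ∧
      ∀ᵐ x ∂μ, Tendsto (fun i => f (ns i) x) atTop (𝓝 (f₀ x)) :=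
  (tendstoInMeasure_of_tendsto_eLpNorm hp hf hf₀ h).exists_seq_tendsto_ae

theorem tendsto_lpNorm_of_tendsto_eLpNorm {E ι : Type*} [NormedAddCommGroup E] {l : Filter ι}
    {f : ι → α → E} {f₀ : α → E} {p : ℝ≥0∞} (hp : 1 ≤ p)
    (hf : ∀ k, MemLp (f k) p μ) (hf₀ : MemLp f₀ p μ)
    (h : Tendsto (fun k => eLpNorm (f k - f₀) p μ) l (𝓝 0)) :
    Tendsto (fun k => lpNorm (f k) p μ) l (𝓝 (lpNorm f₀ p μ)) := by
  have h' : Tendsto (fun k => lpNorm (f k - f₀) p μ) l (𝓝 0) := by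
    have := (ENNReal.tendsto_toReal ENNReal.zero_ne_top).comp h
    refine this.congr fun k => toReal_eLpNorm ((hf k).sub hf₀).1
  rw [tendsto_iff_norm_sub_tendsto_zero]
  refine squeeze_zero (fun _ => norm_nonneg _) (fun k => ?_) h'
  rw [Real.norm_eq_abs, abs_le]
  have h1 := lpNorm_le_lpNorm_add_lpNorm_sub' hf₀ hp (f := f k)
  have h2 := lpNorm_le_lpNorm_add_lpNorm_sub (hf k) hp (f := f₀)
  constructor <;> linarith

theorem integral_norm_rpow_eq {E : Type*} [NormedAddCommGroup E] {f : α → E} {p : ℝ} (hp : 0 < p)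
    (hf : AEStronglyMeasurable f μ) :
    ∫ x, ‖f x‖ ^ p ∂μ = lpNorm f (ENNReal.ofReal p) μ ^ p := by
  rw [lpNorm_eq_integral_norm_rpow_toReal (by simpa using hp) (by simp) hf,
    ENNReal.toReal_ofReal hp.le, ← Real.rpow_mul (by positivity), inv_mul_cancel₀ hp.ne',
    Real.rpow_one]

theorem integrable_norm_rpow_ofReal {E : Type*} [NormedAddCommGroup E] {f : α → E} {p : ℝ}
    (hp : 0 < p) (hf : MemLp f (ENNReal.ofReal p) μ) : Integrable (fun x => ‖f x‖ ^ p) μ := by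
  have := hf.integrable_norm_rpow (by simpa using hp) (by simp)
  rwa [ENNReal.toReal_ofReal hp.le] at this

theorem tendsto_integral_norm_rpow {E ι : Type*} [NormedAddCommGroup E] {l : Filter ι}
    {f : ι → α → E} {f₀ : α → E} {p : ℝ} (hp : 1 ≤ p)
    (hf : ∀ k, MemLp (f k) (ENNReal.ofReal p) μ) (hf₀ : MemLp f₀ (ENNReal.ofReal p) μ)
    (h : Tendsto (fun k => eLpNorm (f k - f₀) (ENNReal.ofReal p) μ) l (𝓝 0)) :
    Tendsto (fun k => ∫ x, ‖f k x‖ ^ p ∂μ) l (𝓝 (∫ x, ‖f₀ x‖ ^ p ∂μ)) := by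
  have hp0 : 0 < p := by linarith
  rw [integral_norm_rpow_eq hp0 hf₀.1]
  simp only [fun k => integral_norm_rpow_eq hp0 (hf k).1]
  exact (tendsto_lpNorm_of_tendsto_eLpNorm (by simpa using hp) hf hf₀ h).rpow_const
    (Or.inr hp0.le)

end Convergence

/-! ### The chain rule for weak derivatives -/

section ChainRule

variable {n : ℕ} {j : Fin n} {f g : Space n → ℂ}

/-- A weak limit of difference quotients is a weak partial derivative. -/
theorem hasWeakPartial_of_tendsto_differenceQuotient (hf : LocallyIntegrable f volume)
    (hg : LocallyIntegrable g volume) {r : ℕ → ℝ} (hr : Tendsto r atTop (𝓝[≠] 0))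
    (h : ∀ φ : Space n → ℝ, ContDiff ℝ (⊤ : ℕ∞) φ → HasCompactSupport φ →
      Tendsto (fun k => ∫ x, φ x • ((r k)⁻¹ • (f (x - r k • unitVec j) - f x))) atTop
        (𝓝 (-∫ x, φ x • g x))) : HasWeakPartial j f g where
  locallyIntegrable := hf
  locallyIntegrable_partial := hg
  integral_eq φ hφ hc := by
    refine tendsto_nhds_unique ?_ (h φ hφ hc)
    have hr1 : ∀ᶠ k in atTop, |r k| ≤ 1 ∧ r k ≠ 0 := by
      have h1 : ∀ᶠ s : ℝ in 𝓝[≠] 0, |s| ≤ 1 ∧ s ≠ 0 := by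
        refine Filter.Eventually.and (nhdsWithin_le_nhds ?_) self_mem_nhdsWithin
        filter_upwards [Metric.closedBall_mem_nhds (0 : ℝ) one_pos] with s hs
        simpa using hs
      exact hr.eventually h1
    have e1 : ∀ s : ℝ, ∫ x, φ x • (s⁻¹ • (f (x - s • unitVec j) - f x))
        = ∫ x, (s⁻¹ * (φ (x + s • unitVec j) - φ x)) • f x := by
      intro s
      have i1 := integrable_test_smul hφ.continuous hc (hf.comp_sub_right' (s • unitVec j))
      have i2 := integrable_test_smul hφ.continuous hc hf
      have i3 : Integrable (fun x => φ (x + s • unitVec j) • f x) volume :=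
        integrable_test_smul (hφ.continuous.comp (continuous_id.add continuous_const))
          (hc.comp_homeomorph (Homeomorph.addRight (s • unitVec j))) hf
      simp only [smul_comm (φ _) s⁻¹, mul_smul]
      rw [integral_smul, integral_smul]
      congr 1
      simp only [smul_sub, sub_smul]
      rw [integral_sub i1 i2, integral_sub i3 i2,
        ← integral_add_right_eq_self (fun x => φ x • f (x - s • unitVec j)) (s • unitVec j)]
      simp
    simp only [e1]
    obtain ⟨L, hL⟩ := (hφ.of_le (m := 1) (by simp)).lipschitzWith_of_hasCompactSupport hc
      (by simp)
    obtain ⟨a, ha⟩ := hc.isCompact.isBounded.subset_closedBall 0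
    have hdom : Integrable (fun x => L * (Metric.closedBall (0 : Space n) (a + 1)).indicator
        (fun x => ‖f x‖) x) volume :=
      (IntegrableOn.integrable_indicator (hf.integrableOn_isCompact (isCompact_closedBall _ _)).norm
        Metric.isClosed_closedBall.measurableSet).const_mul _
    refine tendsto_integral_filter_of_dominated_convergence _ ?_ ?_ hdom ?_
    · refine Eventually.of_forall fun k => ?_
      have h1 : Continuous fun x => (r k)⁻¹ * (φ (x + r k • unitVec j) - φ x) := by
        have := hφ.continuous
        fun_prop
      exact h1.aestronglyMeasurable.smul hf.aestronglyMeasurable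
    · filter_upwards [hr1] with k hk
      refine Eventually.of_forall fun x => ?_
      by_cases hx : x ∈ Metric.closedBall (0 : Space n) (a + 1)
      · rw [Set.indicator_of_mem hx, norm_smul]
        refine mul_le_mul_of_nonneg_right ?_ (norm_nonneg _)
        have h1 := hL.dist_le_mul (x + r k • unitVec j) x
        rw [dist_eq_norm, dist_eq_norm, add_sub_cancel_left, norm_smul, PiLp.norm_single,
          norm_one, mul_one] at h1
        rw [norm_mul, norm_inv, inv_mul_le_iff₀ (norm_pos_iff.2 hk.2)]
        linarith
      · have hz : ∀ y : Space n, a < ‖y‖ → φ y = 0 := fun y hy => by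
          by_contra h0
          have := ha (subset_tsupport _ h0)
          rw [mem_closedBall_zero_iff] at this
          linarith
        have hx' : a + 1 < ‖x‖ := by simpa using hx
        rw [hz x (by linarith), hz (x + r k • unitVec j) ?_]
        · simp [hx]
        · have h1 : ‖x‖ ≤ ‖x + r k • unitVec j‖ + ‖r k • unitVec j‖ := norm_le_add_norm_add _ _
          rw [norm_smul, PiLp.norm_single, norm_one, mul_one, Real.norm_eq_abs] at h1
          linarith [hk.1]
    · refine Eventually.of_forall fun x => ?_
      refine Tendsto.smul_const ?_ _
      have h1 : HasDerivAt (fun s : ℝ => φ (x + s • unitVec j))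
          (fderiv ℝ φ x (unitVec j)) 0 := by
        have h2 : HasDerivAt (fun s : ℝ => x + s • unitVec j) (unitVec j) 0 := by
          have := ((hasDerivAt_id (0 : ℝ)).smul_const (unitVec j)).const_add x
          simpa using this
        have h3 : HasFDerivAt φ (fderiv ℝ φ x) (x + (0 : ℝ) • unitVec j) := by
          simpa using (hφ.differentiable (by simp) x).hasFDerivAt
        exact h3.comp_hasDerivAt 0 h2
      have h4 := (hasDerivAt_iff_tendsto_slope.1 h1).comp hr
      refine h4.congr fun k => ?_
      simp [slope_def_field, div_eq_inv_mul]

/-- The chain rule for a Lipschitz, everywhere differentiable outer function: along a sequence the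
difference quotients of `Ψ ∘ f` converge almost everywhere, and those of `f` dominate them. -/
theorem HasWeakPartial.comp_lipschitz (h : HasWeakPartial j f g) (hf : MemLp f 2 volume)
    (hg : MemLp g 2 volume) {Ψ : ℂ → ℂ} {Ψ' : ℂ → ℂ →L[ℝ] ℂ} {L : NNReal}
    (hΨ : ∀ z, HasFDerivAt Ψ (Ψ' z) z) (hL : LipschitzWith L Ψ) (h0 : Ψ 0 = 0) :
    HasWeakPartial j (fun x => Ψ (f x)) (fun x => Ψ' (f x) (g x)) := by
  have hr : Tendsto (fun k : ℕ => ((k : ℝ) + 1)⁻¹) atTop (𝓝[≠] 0) := by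
    refine tendsto_nhdsWithin_iff.2 ⟨?_, Eventually.of_forall fun k => ?_⟩
    · simpa using tendsto_one_div_add_atTop_nhds_zero_nat (𝕜 := ℝ)
    · have : (0 : ℝ) < (k : ℝ) + 1 := by positivity
      simp [this.ne']
  set d : ℕ → Space n → ℂ := fun k x =>
    (((k : ℝ) + 1)⁻¹)⁻¹ • (f (x - ((k : ℝ) + 1)⁻¹ • unitVec j) - f x) with hd
  have hdm : ∀ k, MemLp (d k) 2 volume := fun k =>
    ((hf.translate (((k : ℝ) + 1)⁻¹ • unitVec j)).sub hf).const_smul ((((k : ℝ) + 1)⁻¹)⁻¹)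
  have hdlim : Tendsto (fun k => eLpNorm (d k - (-g)) 2 volume) atTop (𝓝 0) := by
    refine ((h.tendsto_differenceQuotient (by simp) (by simp) hg).comp hr).congr fun k => ?_
    simp only [hd, Function.comp, sub_neg_eq_add]
    rfl
  obtain ⟨ns, hns, hae⟩ := exists_subseq_tendsto_ae_of_tendsto_eLpNorm (by simp)
    (fun k => (hdm k).1) hg.1.neg hdlim
  have hns' := hns.tendsto_atTop
  have hΨm : Continuous Ψ := hL.continuous
  have hgrow : ∀ z w, ‖Ψ z - Ψ w‖ ≤ L * ‖z - w‖ := fun z w => by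
    simpa [dist_eq_norm] using hL.dist_le_mul z w
  have hΨf : MemLp (fun x => Ψ (f x)) 2 volume :=
    hf.of_le_mul (c := L) (hΨm.comp_aestronglyMeasurable hf.1)
      (Eventually.of_forall fun x => by simpa [h0] using hgrow (f x) 0)
  set q : ℕ → Space n → ℂ := fun k x => (((k : ℝ) + 1)⁻¹)⁻¹ •
    (Ψ (f (x - ((k : ℝ) + 1)⁻¹ • unitVec j)) - Ψ (f x)) with hq
  have hqm : ∀ k, MemLp (q k) 2 volume := fun k =>
    ((hΨf.translate (((k : ℝ) + 1)⁻¹ • unitVec j)).sub hΨf).const_smul ((((k : ℝ) + 1)⁻¹)⁻¹)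
  have hqd : ∀ k x, ‖q k x‖ ≤ L * ‖d k x‖ := fun k x => by
    simp only [hq, hd, norm_smul]
    calc _ ≤ ‖(((k : ℝ) + 1)⁻¹)⁻¹‖ * (L * ‖f (x - ((k : ℝ) + 1)⁻¹ • unitVec j) - f x‖) := by
          gcongr; exact hgrow _ _
      _ = _ := by ring
  have hqlim : ∀ᵐ x, Tendsto (fun i => q (ns i) x) atTop (𝓝 (-Ψ' (f x) (g x))) := by
    filter_upwards [hae] with x hx
    have hr0 : Tendsto (fun i => ((((ns i : ℕ) : ℝ) + 1)⁻¹)) atTop (𝓝 0) :=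
      (hr.mono_right nhdsWithin_le_nhds).comp hns'
    have := (hasFDerivWithinAt_univ.2 (hΨ (f x))).lim (l := atTop)
      (c := fun i => ((((ns i : ℕ) : ℝ) + 1)⁻¹)⁻¹)
      (d := fun i => f (x - (((ns i : ℕ) : ℝ) + 1)⁻¹ • unitVec j) - f x) (v := -g x)
      (by
        have h1 := hr0.smul hx
        rw [zero_smul] at h1
        refine h1.congr fun i => ?_
        have : ((ns i : ℕ) : ℝ) + 1 ≠ 0 := by positivity
        simp only [hd]
        rw [smul_inv_smul₀ (inv_ne_zero this)])
      (Eventually.of_forall fun _ => Set.mem_univ _) hx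
    simp only [add_sub_cancel, map_neg] at this
    exact this
  have hmeas : AEStronglyMeasurable (fun x => Ψ' (f x) (g x)) volume := by
    have := aestronglyMeasurable_of_tendsto_ae atTop (fun i => (hqm (ns i)).1) hqlim
    refine this.neg.congr (Eventually.of_forall fun x => ?_)
    simp
  have hbound : ∀ᵐ x, ‖Ψ' (f x) (g x)‖ ≤ L * ‖g x‖ := Eventually.of_forall fun x =>
    (Ψ' (f x)).le_of_opNorm_le ((hΨ (f x)).le_of_lipschitz hL) _
  have hΨg : MemLp (fun x => Ψ' (f x) (g x)) 2 volume := hg.of_le_mul hmeas hbound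
  refine hasWeakPartial_of_tendsto_differenceQuotient (hΨf.locallyIntegrable (by simp))
    (hΨg.locallyIntegrable (by simp)) (hr.comp hns') fun φ hφ hc => ?_
  have hφ2 : MemLp φ 2 volume := hφ.continuous.memLp_of_hasCompactSupport hc
  have i1 := hφ2.integrable_norm_rpow (by simp) (by simp)
  have i2 : ∀ {w : Space n → ℂ}, MemLp w 2 volume → Integrable (fun x => ‖w x‖ ^ (2 : ℝ)) volume :=
    fun hw => integrable_norm_rpow_ofReal two_pos (by simpa using hw)
  have hGi := tendsto_integral_norm_rpow (p := 2) one_le_two (f := d) (f₀ := -g) (l := atTop)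
    (by simpa using hdm) (by simpa using hg.neg) (by simpa using hdlim)
  have key := tendsto_integral_of_tendsto_dominating_norm (μ := (volume : Measure (Space n)))
    (F := fun i x => φ x • q (ns i) x) (F₀ := fun x => φ x • -Ψ' (f x) (g x))
    (G := fun i x => L * (‖φ x‖ ^ (2 : ℝ) + ‖d (ns i) x‖ ^ (2 : ℝ)))
    (G₀ := fun x => L * (‖φ x‖ ^ (2 : ℝ) + ‖(-g) x‖ ^ (2 : ℝ)))
    (fun i => hφ.continuous.aestronglyMeasurable.smul (hqm _).1)
    (hφ.continuous.aestronglyMeasurable.smul hmeas.neg)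
    (fun i => ((by simpa using i1 : Integrable _ volume).add (i2 (hdm _))).const_mul _)
    (((by simpa using i1 : Integrable _ volume).add (i2 hg.neg)).const_mul _)
    (fun i => Eventually.of_forall fun x => by
      rw [norm_smul, Real.rpow_two, Real.rpow_two]
      have h1 := hqd (ns i) x
      have h2 : ‖φ x‖ * ‖q (ns i) x‖ ≤ ‖φ x‖ * (L * ‖d (ns i) x‖) := by gcongr
      have h3 : ‖φ x‖ * ‖d (ns i) x‖ ≤ ‖φ x‖ ^ 2 + ‖d (ns i) x‖ ^ 2 := by
        nlinarith [sq_nonneg (‖φ x‖ - ‖d (ns i) x‖), sq_nonneg ‖φ x‖, sq_nonneg ‖d (ns i) x‖]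
      have h4 := mul_le_mul_of_nonneg_left h3 L.coe_nonneg
      linarith)
    (hqlim.mono fun x hx => hx.const_smul _)
    (hae.mono fun x hx => ((hx.norm.rpow_const (Or.inr two_pos.le)).const_add _).const_mul _)
    (by
      simp only [integral_const_mul]
      have e : ∀ w : Space n → ℂ, MemLp w 2 volume →
          ∫ x, (‖φ x‖ ^ (2 : ℝ) + ‖w x‖ ^ (2 : ℝ))
            = (∫ x, ‖φ x‖ ^ (2 : ℝ)) + ∫ x, ‖w x‖ ^ (2 : ℝ) := fun w hw =>
        integral_add (by simpa using i1) (i2 hw)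
      rw [e _ hg.neg]
      simp only [fun i => e _ (hdm (ns i))]
      exact ((hGi.comp hns').const_add _).const_mul _)
  have h2 := key.2
  simp only [smul_neg, integral_neg] at h2
  exact h2

end ChainRule
/-! ### The Sobolev embedding -/

section Sobolev

variable {n : ℕ} {f : Space n → ℂ}

/-- The norm of `H¹(ℝⁿ)`, for `f` with a weak gradient. -/
noncomputable def hOneENorm (f : Space n → ℂ) : ℝ≥0∞ :=
  eLpNorm f 2 volume + ∑ j, eLpNorm (weakPartial j f) 2 volume

/-- Translation by `y` is carried out one coordinate after the other. -/
theorem HasWeakGrad.eLpNorm_translate_sub_le (hg : HasWeakGrad f) (y : Space n) :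
    eLpNorm (fun x => f (x - y) - f x) 2 volume ≤ ENNReal.ofReal ‖y‖ * hOneENorm f := by
  have key : ∀ s : Finset (Fin n),
      AEStronglyMeasurable f volume →
      eLpNorm (fun x => f (x - ∑ j ∈ s, y j • unitVec j) - f x) 2 volume
        ≤ ∑ j ∈ s, ENNReal.ofReal |y j| * eLpNorm (weakPartial j f) 2 volume := by
    intro s hm
    induction s using Finset.induction_on with
    | empty => simp
    | insert j s hj ih =>
      rw [Finset.sum_insert hj, Finset.sum_insert hj]
      have e : (fun x => f (x - (y j • unitVec j + ∑ i ∈ s, y i • unitVec i)) - f x)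
          = (fun x => (fun z => f (z - y j • unitVec j) - f z) (x - ∑ i ∈ s, y i • unitVec i))
            + fun x => f (x - ∑ i ∈ s, y i • unitVec i) - f x := by
        funext x
        simp only [Pi.add_apply, sub_add_sub_cancel]
        congr 2
        abel
      have hm1 : ∀ v, AEStronglyMeasurable (fun x => f (x - v)) volume := fun v =>
        hm.comp_measurePreserving (measurePreserving_sub_right volume v)
      have hm2 : AEStronglyMeasurable (fun z => f (z - y j • unitVec j) - f z) volume :=
        (hm1 _).sub hm
      rw [e]
      refine (eLpNorm_add_le (hm2.comp_measurePreserving (measurePreserving_sub_right volume _))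
        ((hm1 _).sub hm) (by simp)).trans (add_le_add ?_ ih)
      rw [eLpNorm_comp_measurePreserving hm2 (measurePreserving_sub_right volume _)]
      exact (hg.hasWeakPartial j).eLpNorm_translate_sub_le (by simp) (by simp) _
  by_cases hn : Nonempty (Fin n)
  · obtain ⟨j0⟩ := hn
    have h1 := key Finset.univ (hg.hasWeakPartial j0).locallyIntegrable.aestronglyMeasurable
    have hy : ∑ j, y j • unitVec j = y := by
      ext i
      simp [Finset.sum_apply, Pi.single_apply]
    rw [hy] at h1
    refine h1.trans ?_
    rw [hOneENorm, mul_add, Finset.mul_sum]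
    refine le_add_of_nonneg_of_le zero_le (Finset.sum_le_sum fun j _ => ?_)
    gcongr
    exact PiLp.norm_apply_le y j
  · have hy : y = 0 := by
      ext i
      exact (hn ⟨i⟩).elim
    simp [hy]

/-- The average of `f` over the ball of radius `ε` about `x`. -/
noncomputable def ballAverage (ε : ℝ) (f : Space n → ℂ) (x : Space n) : ℂ :=
  ∫ y, f (x - y) ∂(ProbabilityTheory.cond volume (Metric.ball 0 ε))

theorem isProbabilityMeasure_cond_ball {ε : ℝ} (hε : 0 < ε) :
    IsProbabilityMeasure (ProbabilityTheory.cond (volume : Measure (Space n)) (Metric.ball 0 ε)) :=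
  ProbabilityTheory.cond_isProbabilityMeasure_of_finite
    (Metric.measure_ball_pos _ _ hε).ne' measure_ball_lt_top.ne

theorem eLpNorm_ballAverage_sub_le (hg : HasWeakGrad f) (hf : MemLp f 2 volume) {ε : ℝ}
    (hε : 0 < ε) :
    eLpNorm (fun x => ballAverage ε f x - f x) 2 volume ≤ ENNReal.ofReal ε * hOneENorm f := by
  have := isProbabilityMeasure_cond_ball (n := n) hε
  set ν := ProbabilityTheory.cond (volume : Measure (Space n)) (Metric.ball 0 ε) with hν
  have hac : ν ≪ volume := ProbabilityTheory.cond_absolutelyContinuous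
  have hball : ∀ᵐ y ∂ν, ‖y‖ ≤ ε := by
    have := ProbabilityTheory.ae_cond_mem (μ := (volume : Measure (Space n)))
      (s := Metric.ball 0 ε) Metric.isOpen_ball.measurableSet
    filter_upwards [this] with y hy
    exact (mem_ball_zero_iff.1 hy).le
  have h1 := eLpNorm_integral_le_of_forall (ν := ν) (μ := (volume : Measure (Space n)))
    (h := fun x y => f (x - y) - f x) (p := 2) (C := ENNReal.ofReal ε * hOneENorm f)
    ((aestronglyMeasurable_translate hf.1 measurable_id).sub hf.1.comp_fst)
    (by simp) (by simp) (hball.mono fun y hy => (hg.eLpNorm_translate_sub_le y).trans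
      (by gcongr))
  refine le_trans (le_of_eq (eLpNorm_congr_ae ?_)) h1
  have hloc : LocallyIntegrable f volume := hf.locallyIntegrable (by simp)
  refine Eventually.of_forall fun x => ?_
  have hi : Integrable (fun y => f (x - y)) ν := by
    have h2 : IntegrableOn (fun y => f (x - y)) (Metric.ball 0 ε) volume := by
      have h3 : IntegrableOn f ((fun y => x - y) '' Metric.closedBall 0 ε) volume :=
        hloc.integrableOn_isCompact ((isCompact_closedBall 0 ε).image (by fun_prop))
      have h4 := (Measure.measurePreserving_sub_left (volume : Measure (Space n)) x).integrableOn_comp_preimage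
        (Homeomorph.subLeft x).measurableEmbedding (f := f)
        (s := (fun y => x - y) '' Metric.closedBall 0 ε)
      rw [Set.preimage_image_eq _ sub_right_injective] at h4
      exact (h4.2 h3).mono_set Metric.ball_subset_closedBall
    exact h2.smul_measure (ENNReal.inv_ne_top.2 (Metric.measure_ball_pos _ _ hε).ne')
  simp only [ballAverage, ← hν]
  rw [integral_sub hi (integrable_const _)]
  simp

theorem enorm_ballAverage_rpow_le (hf : AEStronglyMeasurable f volume) {ε q : ℝ} (hε : 0 < ε)
    (hq : 1 ≤ q) (x : Space n) :
    ‖ballAverage ε f x‖ₑ ^ q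
      ≤ (volume (Metric.ball (0 : Space n) ε))⁻¹ * ∫⁻ z, ‖f z‖ₑ ^ q := by
  have := isProbabilityMeasure_cond_ball (n := n) hε
  set ν := ProbabilityTheory.cond (volume : Measure (Space n)) (Metric.ball 0 ε) with hν
  have hac : ν ≪ volume := ProbabilityTheory.cond_absolutelyContinuous
  have hm : AEStronglyMeasurable (fun y => f (x - y)) volume :=
    hf.comp_measurePreserving (Measure.measurePreserving_sub_left volume x)
  have hq0 : 0 < q := by linarith
  have h1 : ‖ballAverage ε f x‖ₑ ≤ eLpNorm (fun y => f (x - y)) (ENNReal.ofReal q) ν := by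
    refine (enorm_integral_le_lintegral_enorm _).trans ?_
    rw [← eLpNorm_one_eq_lintegral_enorm]
    exact eLpNorm_le_eLpNorm_of_exponent_le (by simpa using hq) (hm.mono_ac hac)
  rw [eLpNorm_eq_lintegral_rpow_enorm_toReal (by simpa using hq0) (by simp), one_div,
    ENNReal.le_rpow_inv_iff (by rw [ENNReal.toReal_ofReal hq0.le]; exact hq0),
    ENNReal.toReal_ofReal hq0.le] at h1
  refine h1.trans ?_
  rw [hν, ProbabilityTheory.cond, lintegral_smul_measure, smul_eq_mul]
  refine mul_le_mul' le_rfl ?_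
  refine (setLIntegral_le_lintegral _ _).trans (le_of_eq ?_)
  exact lintegral_sub_left_eq_self (fun z => ‖f z‖ₑ ^ q) x

/-- Boundedness in `L^q` of the unit ball of `H¹(ℝⁿ)`. -/
def SobolevBound (n : ℕ) (q : ℝ) : Prop :=
  ∃ C : ℝ≥0∞, C ≠ ∞ ∧ ∀ f : Space n → ℂ, MemLp f 2 volume → HasWeakGrad f → hOneENorm f ≤ 1 →
    ∫⁻ x, ‖f x‖ₑ ^ q ≤ C

theorem lintegral_enorm_sq_le_one (h : hOneENorm f ≤ 1) : ∫⁻ x, ‖f x‖ₑ ^ (2 : ℝ) ≤ 1 := by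
  have h1 : eLpNorm f 2 volume ≤ 1 := le_trans (self_le_add_right _ _) h
  rw [eLpNorm_eq_lintegral_rpow_enorm_toReal (by simp) (by simp), one_div,
    ENNReal.rpow_inv_le_iff (by simp)] at h1
  simpa using h1

theorem sobolevBound_two : SobolevBound n 2 :=
  ⟨1, by simp, fun _ _ _ h => lintegral_enorm_sq_le_one h⟩

/-- `|f|^r ≤ |f|² + |f|^q` for `2 ≤ r ≤ q`. -/
theorem SobolevBound.mono {q r : ℝ} (h : SobolevBound n q) (hr : 2 ≤ r) (hrq : r ≤ q) :
    SobolevBound n r := by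
  obtain ⟨C, hC, hb⟩ := h
  refine ⟨1 + C, by simp [hC], fun f hf hg h1 => ?_⟩
  calc ∫⁻ x, ‖f x‖ₑ ^ r ≤ ∫⁻ x, (‖f x‖ₑ ^ (2 : ℝ) + ‖f x‖ₑ ^ q) := by
        refine lintegral_mono fun x => ?_
        rcases le_total ‖f x‖ₑ 1 with h | h
        · exact le_add_of_le_of_nonneg (ENNReal.rpow_le_rpow_of_exponent_ge h hr) zero_le
        · exact le_add_of_nonneg_of_le zero_le (ENNReal.rpow_le_rpow_of_exponent_le h hrq)
    _ = (∫⁻ x, ‖f x‖ₑ ^ (2 : ℝ)) + ∫⁻ x, ‖f x‖ₑ ^ q :=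
        lintegral_add_left' (hf.1.enorm.pow_const _) _
    _ ≤ 1 + C := add_le_add (lintegral_enorm_sq_le_one h1) (hb f hf hg h1)

/-- One step of the bootstrap: a bound in `L^q` improves to a bound in `L^r` for `r < 2 + 2q/n`.
Where `|f|` is about `2ᵏ`, `f` is compared with its average over a ball whose radius is chosen
so that this average is at most `2^(k-1)`. -/
theorem SobolevBound.step (hn : 1 ≤ n) {q r : ℝ} (h : SobolevBound n q) (hq : 2 ≤ q) (hr : 2 ≤ r)
    (hrq : r < 2 + 2 * q / n) : SobolevBound n r := by
  obtain ⟨C, hC, hb⟩ := h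
  have hn0 : (0 : ℝ) < n := by exact_mod_cast hn
  have hq0 : 0 < q := by linarith
  set v : ℝ := (volume (Metric.ball (0 : Space n) 1)).toReal with hv
  have hvpos : 0 < v := ENNReal.toReal_pos (Metric.measure_ball_pos _ _ one_pos).ne'
    measure_ball_lt_top.ne
  -- The radius `a * 2^(-kq/n)` makes the volume of the ball equal to `2^q (C+1) / 2^(kq)`.
  set D : ℝ := 2 ^ q * (C.toReal + 1) / v with hD
  have hDpos : 0 < D := by positivity
  set a : ℝ := D ^ ((n : ℝ)⁻¹) with ha
  have hapos : 0 < a := by positivity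
  set ρ : ℝ := (2 : ℝ) ^ (-(q / n)) with hρ
  have hρpos : 0 < ρ := by positivity
  have hvol : ∀ k : ℕ, volume (Metric.ball (0 : Space n) (a * ρ ^ k))
      = ENNReal.ofReal (2 ^ q * (C.toReal + 1) / (2 ^ k : ℝ) ^ q) := by
    intro k
    have : Nonempty (Fin n) := ⟨⟨0, hn⟩⟩
    rw [Measure.addHaar_ball _ _ (by positivity), finrank_euclideanSpace_fin,
      ← ENNReal.ofReal_toReal (measure_ball_lt_top (μ := (volume : Measure (Space n)))
        (x := 0) (r := 1)).ne, ← hv, ← ENNReal.ofReal_mul (by positivity)]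
    congr 1
    have e1 : a ^ n = D := by
      rw [ha, ← Real.rpow_natCast, ← Real.rpow_mul hDpos.le, inv_mul_cancel₀ hn0.ne',
        Real.rpow_one]
    have e2 : (ρ ^ k) ^ n = ((2 ^ k : ℝ) ^ q)⁻¹ := by
      rw [← pow_mul, hρ, ← Real.rpow_natCast, ← Real.rpow_mul zero_le_two, ← Real.rpow_natCast 2 k,
        ← Real.rpow_mul zero_le_two, ← Real.rpow_neg zero_le_two]
      congr 1
      push_cast
      field_simp
    rw [mul_pow, e1, e2, hD]
    field_simp
  set c : ℝ := 4 * 2 ^ (r - 2) * a ^ 2 with hc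
  set θ : ℝ := 2 ^ (r - 2) * ρ ^ 2 with hθ
  have hθ1 : θ < 1 := by
    rw [hθ, hρ, ← Real.rpow_natCast, ← Real.rpow_mul zero_le_two, ← Real.rpow_add two_pos]
    apply Real.rpow_lt_one_of_one_lt_of_neg one_lt_two
    push_cast
    have : 2 * q / n = q / n * 2 := by ring
    linarith
  have hθ0 : 0 < θ := by positivity
  have hsum : ∑' k : ℕ, ENNReal.ofReal (c * θ ^ k) ≠ ∞ := by
    rw [← ENNReal.ofReal_tsum_of_nonneg (fun k => by positivity)
      ((summable_geometric_of_lt_one hθ0.le hθ1).mul_left c)]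
    exact ENNReal.ofReal_ne_top
  refine ⟨1 + ∑' k : ℕ, ENNReal.ofReal (c * θ ^ k), by simp [hsum], fun f hf hg h1 => ?_⟩
  have hεpos : ∀ k : ℕ, 0 < a * ρ ^ k := fun k => by positivity
  have hA : ∀ (k : ℕ) x, ‖ballAverage (a * ρ ^ k) f x‖ ≤ 2 ^ k / 2 := by
    intro k x
    have h2 := enorm_ballAverage_rpow_le hf.1 (hεpos k) (by linarith : 1 ≤ q) x
    have h3 : ‖ballAverage (a * ρ ^ k) f x‖ₑ ^ q ≤ ENNReal.ofReal ((2 ^ k / 2) ^ q) := by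
      refine h2.trans ?_
      rw [hvol, ← ENNReal.ofReal_inv_of_pos (by positivity)]
      refine (mul_le_mul' le_rfl (hb f hf hg h1)).trans ?_
      rw [← ENNReal.ofReal_toReal hC, ← ENNReal.ofReal_mul (by positivity),
        ENNReal.toReal_ofReal ENNReal.toReal_nonneg]
      apply ENNReal.ofReal_le_ofReal
      rw [Real.div_rpow (by positivity) (by positivity), inv_div, div_mul_eq_mul_div]
      rw [div_le_div_iff₀ (by positivity) (by positivity)]
      have : 0 ≤ C.toReal := ENNReal.toReal_nonneg
      have h5 : 0 ≤ ((2 ^ k : ℝ) ^ q) * 2 ^ q := by positivity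
      nlinarith
    rw [← ofReal_norm, ENNReal.ofReal_rpow_of_nonneg (norm_nonneg _) hq0.le,
      ENNReal.ofReal_le_ofReal_iff (by positivity)] at h3
    exact (Real.rpow_le_rpow_iff (norm_nonneg _) (by positivity) hq0).1 h3
  have hmA : ∀ k : ℕ, AEStronglyMeasurable (fun x => ballAverage (a * ρ ^ k) f x - f x) volume := by
    intro k
    have := isProbabilityMeasure_cond_ball (n := n) (hεpos k)
    exact (AEStronglyMeasurable.integral_prod_right'
      (aestronglyMeasurable_translate hf.1 measurable_id)).sub hf.1
  have hpt : ∀ x, ‖f x‖ₑ ^ r ≤ ‖f x‖ₑ ^ (2 : ℝ) + ∑' k : ℕ,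
      ENNReal.ofReal (4 * 2 ^ (r - 2) * (2 ^ (r - 2)) ^ k)
        * ‖ballAverage (a * ρ ^ k) f x - f x‖ₑ ^ (2 : ℝ) := by
    intro x
    rcases le_total ‖f x‖ 1 with h2 | h2
    · refine le_add_of_le_of_nonneg (ENNReal.rpow_le_rpow_of_exponent_ge ?_ hr) zero_le
      rw [← ofReal_norm]
      exact ENNReal.ofReal_le_one.2 h2
    · obtain ⟨k, hk1, hk2⟩ := exists_nat_pow_near h2 one_lt_two
      refine le_add_of_nonneg_of_le zero_le (le_trans ?_ (ENNReal.le_tsum k))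
      rw [← ofReal_norm, ← ofReal_norm,
        ENNReal.ofReal_rpow_of_nonneg (norm_nonneg _) (by linarith),
        ENNReal.ofReal_rpow_of_nonneg (norm_nonneg _) (by norm_num),
        ← ENNReal.ofReal_mul (by positivity)]
      apply ENNReal.ofReal_le_ofReal
      have h3 : ‖f x‖ ≤ 2 * ‖ballAverage (a * ρ ^ k) f x - f x‖ := by
        have h4 : ‖f x‖ ≤ ‖ballAverage (a * ρ ^ k) f x - f x‖ + ‖ballAverage (a * ρ ^ k) f x‖ := by
          rw [norm_sub_rev]
          simpa using norm_add_le (f x - ballAverage (a * ρ ^ k) f x) (ballAverage (a * ρ ^ k) f x)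
        linarith [hA k x]
      have h5 : ‖f x‖ ^ (r - 2) ≤ 2 ^ (r - 2) * (2 ^ (r - 2)) ^ k := by
        calc ‖f x‖ ^ (r - 2) ≤ (2 ^ (k + 1) : ℝ) ^ (r - 2) :=
              Real.rpow_le_rpow (norm_nonneg _) hk2.le (by linarith)
          _ = _ := by
              rw [pow_succ', Real.mul_rpow zero_le_two (by positivity), ← Real.rpow_natCast,
                ← Real.rpow_mul zero_le_two, mul_comm (k : ℝ), Real.rpow_mul zero_le_two,
                Real.rpow_natCast]
      have h6 : ‖f x‖ ^ r = ‖f x‖ ^ 2 * ‖f x‖ ^ (r - 2) := by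
        rw [← Real.rpow_natCast, ← Real.rpow_add (by linarith)]
        congr 1
        push_cast
        ring
      rw [h6, Real.rpow_two]
      calc ‖f x‖ ^ 2 * ‖f x‖ ^ (r - 2)
          ≤ (2 * ‖ballAverage (a * ρ ^ k) f x - f x‖) ^ 2
            * (2 ^ (r - 2) * (2 ^ (r - 2)) ^ k) := by gcongr
        _ = _ := by ring
  calc ∫⁻ x, ‖f x‖ₑ ^ r ≤ ∫⁻ x, (‖f x‖ₑ ^ (2 : ℝ) + ∑' k : ℕ,
      ENNReal.ofReal (4 * 2 ^ (r - 2) * (2 ^ (r - 2)) ^ k)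
        * ‖ballAverage (a * ρ ^ k) f x - f x‖ₑ ^ (2 : ℝ)) := lintegral_mono hpt
    _ = (∫⁻ x, ‖f x‖ₑ ^ (2 : ℝ)) + ∑' k : ℕ,
        ENNReal.ofReal (4 * 2 ^ (r - 2) * (2 ^ (r - 2)) ^ k)
        * ∫⁻ x, ‖ballAverage (a * ρ ^ k) f x - f x‖ₑ ^ (2 : ℝ) := by
      rw [lintegral_add_left' (hf.1.enorm.pow_const _), lintegral_tsum]
      · congr 2
        funext k
        exact lintegral_const_mul' _ _ ENNReal.ofReal_ne_top
      · exact fun k => ((hmA k).enorm.pow_const _).const_mul _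
    _ ≤ _ := by
      refine add_le_add (lintegral_enorm_sq_le_one h1) (ENNReal.tsum_le_tsum fun k => ?_)
      have h2 := (eLpNorm_ballAverage_sub_le hg hf (hεpos k)).trans
        (mul_le_of_le_one_right zero_le h1)
      rw [eLpNorm_eq_lintegral_rpow_enorm_toReal (by simp) (by simp), one_div,
        ENNReal.rpow_inv_le_iff (by simp), ENNReal.toReal_ofNat] at h2
      refine (mul_le_mul' le_rfl h2).trans (le_of_eq ?_)
      rw [ENNReal.ofReal_rpow_of_nonneg (hεpos k).le (by norm_num),
        ← ENNReal.ofReal_mul (by positivity), hc, hθ, Real.rpow_two]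
      congr 1
      ring

/-- `H¹(ℝⁿ)` embeds into `L^r` for all `r` below the critical exponent: the bootstrap cannot
stop before it, because `q < 2 + 2q/n` there. -/
theorem sobolevBound (hn : 1 ≤ n) {r : ℝ} (hr : 2 ≤ r)
    (hrn : 3 ≤ n → r * (n - 2) < 2 * n) : SobolevBound n r := by
  by_contra hno
  have hn0 : (0 : ℝ) < n := by exact_mod_cast hn
  set Q : Set ℝ := {q | 2 ≤ q ∧ SobolevBound n q} with hQ
  have hne : Q.Nonempty := ⟨2, le_rfl, sobolevBound_two⟩
  have hub : ∀ q ∈ Q, q ≤ r := fun q hq => by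
    by_contra h
    exact hno (hq.2.mono hr (not_le.1 h).le)
  have hbdd : BddAbove Q := ⟨r, hub⟩
  -- At the supremum `s` of the attainable exponents a further step would lead beyond `s`.
  set s := sSup Q with hs
  have hs2 : 2 ≤ s := le_csSup hbdd ⟨le_rfl, sobolevBound_two⟩
  have hsr : s ≤ r := csSup_le hne hub
  have hlt : n * (s - 2) / 2 < s := by
    rcases le_or_gt 3 n with h3 | h3
    · have h4 := hrn h3
      have h5 : (3 : ℝ) ≤ n := by exact_mod_cast h3
      nlinarith
    · have h5 : (n : ℝ) ≤ 2 := by exact_mod_cast (by omega : n ≤ 2)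
      nlinarith
  obtain ⟨q, hq, hql⟩ := exists_lt_of_lt_csSup hne hlt
  have h6 : s < 2 + 2 * q / n := by
    have : s - 2 < 2 * q / n := by
      rw [lt_div_iff₀ hn0]
      linarith
    linarith
  obtain ⟨t, ht1, ht2⟩ := exists_between h6
  have := le_csSup hbdd (show t ∈ Q from ⟨by linarith, hq.2.step hn hq.1 (by linarith) ht2⟩)
  linarith

/-- The Sobolev inequality `‖f‖_{L^r} ≤ C ‖f‖_{H¹}` in the subcritical range. -/
theorem exists_eLpNorm_le_hOneENorm (hn : 1 ≤ n) {r : ℝ} (hr : 2 ≤ r)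
    (hrn : 3 ≤ n → r * (n - 2) < 2 * n) :
    ∃ C : ℝ, 0 < C ∧ ∀ f : Space n → ℂ, MemLp f 2 volume → HasWeakGrad f →
      eLpNorm f (ENNReal.ofReal r) volume ≤ ENNReal.ofReal C * hOneENorm f := by
  obtain ⟨C, hC, hb⟩ := sobolevBound hn hr hrn
  have hr0 : 0 < r := by linarith
  refine ⟨(C.toReal + 1) ^ r⁻¹, by positivity, fun f hf hg => ?_⟩
  -- The bound on the unit ball extends by homogeneity, except where the norm is zero.
  rcases eq_or_ne (hOneENorm f) 0 with h0 | h0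
  · have h1 : eLpNorm f 2 volume = 0 := by
      rw [hOneENorm, add_eq_zero] at h0
      exact h0.1
    rw [eLpNorm_eq_zero_iff hf.1 (by simp)] at h1
    rw [eLpNorm_congr_ae h1]
    simp
  rcases eq_or_ne (hOneENorm f) ∞ with hT | hT
  · rw [hT, ENNReal.mul_top (by simp; positivity)]
    exact le_top
  set N : ℝ := (hOneENorm f).toReal with hN
  have hNpos : 0 < N := ENNReal.toReal_pos h0 hT
  have hNe : hOneENorm f = ENNReal.ofReal N := (ENNReal.ofReal_toReal hT).symm
  set c : ℂ := ((N⁻¹ : ℝ) : ℂ) with hc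
  have hce : ‖c‖ₑ = ENNReal.ofReal N⁻¹ := by
    rw [← ofReal_norm, hc, Complex.norm_real, Real.norm_eq_abs,
      abs_of_pos (by positivity)]
  have hone : hOneENorm (c • f) ≤ 1 := by
    have h1 : hOneENorm (c • f) = ‖c‖ₑ * hOneENorm f := by
      rw [hOneENorm, hOneENorm, eLpNorm_const_smul, mul_add, Finset.mul_sum]
      congr 1
      refine Finset.sum_congr rfl fun j _ => ?_
      rw [eLpNorm_congr_ae ((hg.hasWeakPartial j).const_smul c).weakPartial_ae_eq,
        eLpNorm_const_smul]
    rw [h1, hce, hNe, ← ENNReal.ofReal_mul (by positivity), inv_mul_cancel₀ hNpos.ne']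
    simp
  have h2 := hb (c • f) (hf.const_smul c)
    (fun j => ⟨_, (hg.hasWeakPartial j).const_smul c⟩) hone
  have h3 : eLpNorm (c • f) (ENNReal.ofReal r) volume ≤ ENNReal.ofReal ((C.toReal + 1) ^ r⁻¹) := by
    rw [eLpNorm_eq_lintegral_rpow_enorm_toReal (by simpa using hr0) (by simp),
      ENNReal.toReal_ofReal hr0.le, one_div, ← ENNReal.ofReal_rpow_of_nonneg (by positivity)
      (by positivity)]
    refine ENNReal.rpow_le_rpow (h2.trans ?_) (by positivity)
    rw [← ENNReal.ofReal_toReal hC]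
    exact ENNReal.ofReal_le_ofReal (by simp [ENNReal.toReal_ofReal])
  rw [eLpNorm_const_smul, hce] at h3
  calc eLpNorm f (ENNReal.ofReal r) volume
      = ENNReal.ofReal N * (ENNReal.ofReal N⁻¹ * eLpNorm f (ENNReal.ofReal r) volume) := by
        rw [← mul_assoc, ← ENNReal.ofReal_mul hNpos.le, mul_inv_cancel₀ hNpos.ne',
          ENNReal.ofReal_one, one_mul]
    _ ≤ ENNReal.ofReal N * ENNReal.ofReal ((C.toReal + 1) ^ r⁻¹) := by gcongr
    _ = _ := by rw [hNe, mul_comm]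

end Sobolev
/-! ### The space `Σ` -/

section Sigma

variable {n : ℕ} {f g : Space n → ℂ}

theorem eLpNorm_weakPartial_le (f : Space n → ℂ) (j : Fin n) (p : ℝ≥0∞) :
    eLpNorm (weakPartial j f) p volume ≤ eLpNorm (weakGrad f) p volume :=
  eLpNorm_mono fun x => PiLp.norm_apply_le (weakGrad f x) j

theorem aestronglyMeasurable_weakGrad (hf : HasWeakGrad f) :
    AEStronglyMeasurable (weakGrad f) volume := by
  have h : AEMeasurable (fun x => fun j => weakPartial j f x) volume :=
    aemeasurable_pi_lambda _ fun j =>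
      (hf.hasWeakPartial j).locallyIntegrable_partial.aestronglyMeasurable.aemeasurable
  exact ((PiLp.continuous_toLp 2 _).measurable.comp_aemeasurable h).aestronglyMeasurable

theorem norm_le_sum_norm_apply {𝕜 : Type*} [RCLike 𝕜] (v : EuclideanSpace 𝕜 (Fin n)) :
    ‖v‖ ≤ ∑ j, ‖v j‖ := by
  rw [EuclideanSpace.norm_eq]
  refine Real.sqrt_le_iff.2 ⟨Finset.sum_nonneg fun _ _ => norm_nonneg _, ?_⟩
  exact Finset.sum_sq_le_sq_sum_of_nonneg fun _ _ => norm_nonneg _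

theorem eLpNorm_weakGrad_le (hf : HasWeakGrad f) {p : ℝ≥0∞} (hp : 1 ≤ p) :
    eLpNorm (weakGrad f) p volume ≤ ∑ j, eLpNorm (weakPartial j f) p volume := by
  have hm : ∀ j, AEStronglyMeasurable (fun x => ‖weakPartial j f x‖) volume := fun j =>
    (hf.hasWeakPartial j).locallyIntegrable_partial.aestronglyMeasurable.norm
  calc eLpNorm (weakGrad f) p volume
      ≤ eLpNorm (∑ j, fun x => ‖weakPartial j f x‖) p volume := by
        refine eLpNorm_mono_real fun x => ?_
        rw [Finset.sum_apply]
        exact norm_le_sum_norm_apply (weakGrad f x)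
    _ ≤ ∑ j, eLpNorm (fun x => ‖weakPartial j f x‖) p volume :=
        eLpNorm_sum_le (fun j _ => hm j) hp
    _ = _ := by simp only [eLpNorm_norm]

theorem weakGrad_ae_eq {G : Fin n → Space n → ℂ} (h : ∀ j, HasWeakPartial j f (G j)) :
    weakGrad f =ᵐ[volume] fun x => WithLp.toLp 2 fun j => G j x := by
  have := ae_all_iff.2 fun j => (h j).weakPartial_ae_eq
  filter_upwards [this] with x hx
  simp only [weakGrad, hx]

theorem HasWeakGrad.sub (hf : HasWeakGrad f) (hg : HasWeakGrad g) : HasWeakGrad (f - g) :=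
  fun j => ⟨_, (hf.hasWeakPartial j).sub (hg.hasWeakPartial j)⟩

theorem weakPartial_sub_ae (hf : HasWeakGrad f) (hg : HasWeakGrad g) (j : Fin n) :
    weakPartial j (f - g) =ᵐ[volume] weakPartial j f - weakPartial j g :=
  ((hf.hasWeakPartial j).sub (hg.hasWeakPartial j)).weakPartial_ae_eq

theorem aestronglyMeasurable_norm_smul (hf : AEStronglyMeasurable f volume) :
    AEStronglyMeasurable (fun x => ‖x‖ • f x) volume :=
  continuous_norm.aestronglyMeasurable.smul hf

namespace MemSigma

variable (hf : MemSigma f)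

include hf

theorem memLp : MemLp f 2 volume :=
  ⟨hf.1, lt_of_le_of_lt (le_trans (self_le_add_right _ _) (self_le_add_right _ _)) hf.3⟩

theorem memLp_weakGrad : MemLp (weakGrad f) 2 volume :=
  ⟨aestronglyMeasurable_weakGrad hf.2,
    lt_of_le_of_lt (le_trans (self_le_add_left _ _) (self_le_add_right _ _)) hf.3⟩

theorem memLp_weakPartial (j : Fin n) : MemLp (weakPartial j f) 2 volume :=
  ⟨(hf.2.hasWeakPartial j).locallyIntegrable_partial.aestronglyMeasurable,
    lt_of_le_of_lt (eLpNorm_weakPartial_le f j 2) hf.memLp_weakGrad.2⟩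

theorem memLp_norm_smul : MemLp (fun x => ‖x‖ • f x) 2 volume :=
  ⟨aestronglyMeasurable_norm_smul hf.1, lt_of_le_of_lt (self_le_add_left _ _) hf.3⟩

theorem memLp_coord (j : Fin n) : MemLp (fun x => ((x j : ℝ) : ℂ) * f x) 2 volume := by
  refine hf.memLp_norm_smul.of_le ?_ (Eventually.of_forall fun x => ?_)
  · exact (Continuous.aestronglyMeasurable (by fun_prop)).mul hf.1
  · rw [norm_mul, norm_smul, Complex.norm_real, norm_norm]
    gcongr
    exact PiLp.norm_apply_le x j

end MemSigma

theorem memSigma_of_memLp (h2 : MemLp f 2 volume) (hg : HasWeakGrad f)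
    (h3 : ∀ j, MemLp (weakPartial j f) 2 volume) (h4 : MemLp (fun x => ‖x‖ • f x) 2 volume) :
    MemSigma f := by
  refine ⟨h2.1, hg, ?_⟩
  rw [sigmaENorm]
  refine ENNReal.add_lt_top.2 ⟨ENNReal.add_lt_top.2 ⟨h2.2, ?_⟩, h4.2⟩
  exact (eLpNorm_weakGrad_le hg (by simp)).trans_lt (ENNReal.sum_lt_top.2 fun j _ => (h3 j).2)

theorem memSigma_of_hasWeakPartial {G : Fin n → Space n → ℂ} (h2 : MemLp f 2 volume)
    (hG : ∀ j, HasWeakPartial j f (G j))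
    (h3 : ∀ j, MemLp (G j) 2 volume) (h4 : MemLp (fun x => ‖x‖ • f x) 2 volume) :
    MemSigma f :=
  memSigma_of_memLp h2 (fun j => ⟨_, hG j⟩)
    (fun j => (h3 j).ae_eq (hG j).weakPartial_ae_eq.symm) h4

theorem MemSigma.add (hf : MemSigma f) (hg : MemSigma g) : MemSigma (f + g) :=
  memSigma_of_hasWeakPartial (hf.memLp.add hg.memLp)
    (fun j => (hf.2.hasWeakPartial j).add (hg.2.hasWeakPartial j))
    (fun j => (hf.memLp_weakPartial j).add (hg.memLp_weakPartial j))
    ((hf.memLp_norm_smul.add hg.memLp_norm_smul).ae_eq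
      (Eventually.of_forall fun _ => (smul_add _ _ _).symm))

theorem MemSigma.const_smul (hf : MemSigma f) (c : ℂ) : MemSigma (c • f) :=
  memSigma_of_hasWeakPartial (hf.memLp.const_smul c)
    (fun j => (hf.2.hasWeakPartial j).const_smul c)
    (fun j => (hf.memLp_weakPartial j).const_smul c)
    (by
      have := hf.memLp_norm_smul.const_smul c
      exact this.ae_eq (Eventually.of_forall fun x => smul_comm c _ _))

theorem MemSigma.sub (hf : MemSigma f) (hg : MemSigma g) : MemSigma (f - g) := by
  have := hf.add (hg.const_smul (-1))
  rwa [neg_one_smul, ← sub_eq_add_neg] at this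

theorem sigmaENorm_add_le (hf : MemSigma f) (hg : MemSigma g) :
    sigmaENorm (f + g) ≤ sigmaENorm f + sigmaENorm g := by
  have h1 : weakGrad (f + g) =ᵐ[volume] weakGrad f + weakGrad g := by
    refine (weakGrad_ae_eq fun j =>
      (hf.2.hasWeakPartial j).add (hg.2.hasWeakPartial j)).trans
      (Eventually.of_forall fun x => ?_)
    ext j
    simp [weakGrad]
  have h2 : (fun x : Space n => ‖x‖ • (f + g) x) = (fun x => ‖x‖ • f x) + fun x => ‖x‖ • g x := by
    funext x
    simp only [Pi.add_apply, smul_add]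
  simp only [sigmaENorm]
  rw [eLpNorm_congr_ae h1, h2]
  calc _ ≤ (eLpNorm f 2 volume + eLpNorm g 2 volume)
        + (eLpNorm (weakGrad f) 2 volume + eLpNorm (weakGrad g) 2 volume)
        + (eLpNorm (fun x => ‖x‖ • f x) 2 volume + eLpNorm (fun x => ‖x‖ • g x) 2 volume) := by
        refine add_le_add (add_le_add ?_ ?_) ?_
        · exact eLpNorm_add_le hf.1 hg.1 (by simp)
        · exact eLpNorm_add_le hf.memLp_weakGrad.1 hg.memLp_weakGrad.1 (by simp)
        · exact eLpNorm_add_le hf.memLp_norm_smul.1 hg.memLp_norm_smul.1 (by simp)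
    _ = _ := by ring

theorem sigmaENorm_le_of_hasWeakPartial {G : Fin n → Space n → ℂ}
    (hG : ∀ j, HasWeakPartial j f (G j)) :
    sigmaENorm f ≤ eLpNorm f 2 volume + ∑ j, eLpNorm (G j) 2 volume
      + eLpNorm (fun x => ‖x‖ • f x) 2 volume := by
  rw [sigmaENorm]
  gcongr
  refine (eLpNorm_weakGrad_le (fun j => ⟨_, hG j⟩) (by simp)).trans (le_of_eq ?_)
  exact Finset.sum_congr rfl fun j _ => eLpNorm_congr_ae (hG j).weakPartial_ae_eq

/-- The `H¹` norm is summed over the coordinates, whence the factor. -/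
theorem hOneENorm_le_sigmaENorm (f : Space n → ℂ) :
    hOneENorm f ≤ (n + 1) * sigmaENorm f := by
  have h1 : eLpNorm f 2 volume ≤ sigmaENorm f :=
    le_trans (self_le_add_right _ _) (self_le_add_right _ _)
  have h2 : ∀ j, eLpNorm (weakPartial j f) 2 volume ≤ sigmaENorm f := fun j =>
    (eLpNorm_weakPartial_le f j 2).trans
      (le_trans (self_le_add_left _ _) (self_le_add_right _ _))
  rw [hOneENorm, add_mul, one_mul, add_comm]
  refine add_le_add ((Finset.sum_le_card_nsmul _ _ _ fun j _ => h2 j).trans (le_of_eq ?_)) h1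
  simp

end Sigma

/-! ### Smooth compactly supported functions are dense in `Σ` -/

section Density

variable {n : ℕ} {f : Space n → ℂ}

theorem HasWeakPartial.average {Ω : Type*} [MeasurableSpace Ω] {ν : Measure Ω} [IsFiniteMeasure ν]
    {j : Fin n} {g : Space n → ℂ} (h : HasWeakPartial j f g) {T : Ω → Space n} {R : ℝ}
    (hT : Measurable T) (hR : ∀ᵐ y ∂ν, ‖T y‖ ≤ R) :
    HasWeakPartial j (fun x => ∫ y, f (x - T y) ∂ν) (fun x => ∫ y, g (x - T y) ∂ν) where
  locallyIntegrable := locallyIntegrable_average h.locallyIntegrable hT hR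
  locallyIntegrable_partial := locallyIntegrable_average h.locallyIntegrable_partial hT hR
  integral_eq φ hφ hc := by
    rw [integral_smul_average (contDiff_fderiv_apply hφ _).continuous
      (hasCompactSupport_fderiv_apply hc _) h.locallyIntegrable hT hR,
      integral_smul_average hφ.continuous hc h.locallyIntegrable_partial hT hR, ← integral_neg]
    exact integral_congr_ae (Eventually.of_forall fun y =>
      (h.comp_sub_right (T y)).integral_eq φ hφ hc)

theorem tendsto_eLpNorm_zero_of_dominated {F : ℕ → Space n → ℂ} {G : Space n → ℝ}
    (hF : ∀ k, AEStronglyMeasurable (F k) volume) (hG : MemLp G 2 volume)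
    (hb : ∀ k x, ‖F k x‖ ≤ G x) (hl : ∀ x, Tendsto (fun k => F k x) atTop (𝓝 0)) :
    Tendsto (fun k => eLpNorm (F k) 2 volume) atTop (𝓝 0) := by
  have key : Tendsto (fun k => ∫⁻ x, ‖F k x‖ₑ ^ (2 : ℝ)) atTop (𝓝 0) := by
    have := tendsto_lintegral_of_dominated_convergence' (μ := (volume : Measure (Space n)))
      (F := fun k x => ‖F k x‖ₑ ^ (2 : ℝ)) (f := fun _ => 0) (fun x => ‖G x‖ₑ ^ (2 : ℝ))
      (fun k => (hF k).enorm.pow_const _)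
      (fun k => Eventually.of_forall fun x => by
        dsimp only
        gcongr
        rw [enorm_le_iff_norm_le]
        exact (hb k x).trans (le_abs_self _))
      (by
        have h2 := hG.2
        have := lintegral_rpow_enorm_lt_top_of_eLpNorm_lt_top (p := 2) (by simp) (by simp) h2
        simpa using this.ne)
      (Eventually.of_forall fun x => by
        have h1 := (hl x).enorm
        have h2 := (ENNReal.continuous_rpow_const (y := (2 : ℝ))).tendsto ‖(0 : ℂ)‖ₑ
        have h3 := h2.comp h1
        simp only [enorm_zero, ENNReal.zero_rpow_of_pos two_pos] at h3
        exact h3)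
    simpa using this
  have h2 := (ENNReal.continuous_rpow_const (y := ((2 : ℝ)⁻¹))).tendsto 0
  have h3 := h2.comp key
  simp only [ENNReal.zero_rpow_of_pos (by norm_num : (0 : ℝ) < 2⁻¹)] at h3
  refine h3.congr fun k => ?_
  rw [eLpNorm_eq_lintegral_rpow_enorm_toReal (by simp) (by simp)]
  simp

/-- Functions in `Σ` are approximated by their cut-offs. -/
theorem MemSigma.exists_cutoff (hf : MemSigma f) {ε : ℝ≥0∞} (hε : 0 < ε) :
    ∃ g : Space n → ℂ, MemSigma g ∧ HasCompactSupport g ∧ sigmaENorm (f - g) ≤ ε := by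
  let χ : ContDiffBump (0 : Space n) := ⟨1, 2, one_pos, one_lt_two⟩
  have hχ : ContDiff ℝ (⊤ : ℕ∞) χ := χ.contDiff
  obtain ⟨M, hM⟩ := ((hχ.continuous_fderiv (by simp))).bounded_above_of_compact_support
    (χ.hasCompactSupport.fderiv (𝕜 := ℝ))
  set s : ℕ → ℝ := fun k => ((k : ℝ) + 1)⁻¹ with hs
  have hspos : ∀ k, 0 < s k := fun k => by positivity
  have hs0 : Tendsto s atTop (𝓝 0) := by
    simpa [hs] using tendsto_one_div_add_atTop_nhds_zero_nat (𝕜 := ℝ)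
  have hs1 : ∀ k, s k ≤ 1 := fun k => inv_le_one_of_one_le₀ (by linarith [k.cast_nonneg (α := ℝ)])
  set m : ℕ → Space n → ℝ := fun k x => χ (s k • x) with hm
  have hmc : ∀ k, ContDiff ℝ (⊤ : ℕ∞) (m k) := fun k => hχ.comp (contDiff_id.const_smul (s k))
  have hm01 : ∀ k x, 0 ≤ m k x ∧ m k x ≤ 1 := fun k x => ⟨χ.nonneg, χ.le_one⟩
  have hmsupp : ∀ k, HasCompactSupport (m k) := fun k =>
    χ.hasCompactSupport.comp_homeomorph (Homeomorph.smulOfNeZero (s k) (hspos k).ne')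
  have hmlim : ∀ x, Tendsto (fun k => m k x) atTop (𝓝 1) := fun x => by
    have h1 : Tendsto (fun k => s k • x) atTop (𝓝 0) := by simpa using hs0.smul_const x
    have h2 := (χ.continuous.tendsto 0).comp h1
    rwa [χ.one_of_mem_closedBall (by simp [χ.rIn_pos.le])] at h2
  have hmder : ∀ k x j, ‖fderiv ℝ (m k) x (unitVec j)‖ ≤ s k * M := fun k x j => by
    have h0 : HasFDerivAt (fun y : Space n => s k • y) (s k • ContinuousLinearMap.id ℝ (Space n)) x :=
      (hasFDerivAt_id x).const_smul (s k)
    have h1 : HasFDerivAt (m k) ((fderiv ℝ χ (s k • x)).comp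
        (s k • ContinuousLinearMap.id ℝ (Space n))) x :=
      (hχ.differentiable (by simp) (s k • x)).hasFDerivAt.comp x h0
    rw [h1.fderiv]
    simp only [ContinuousLinearMap.comp_apply, smul_apply, ContinuousLinearMap.id_apply, map_smul,
      norm_smul, Real.norm_of_nonneg (hspos k).le]
    refine mul_le_mul_of_nonneg_left ?_ (hspos k).le
    refine ((fderiv ℝ χ (s k • x)).le_opNorm _).trans ?_
    rw [PiLp.norm_single, norm_one, mul_one]
    exact hM _
  have hM0 : 0 ≤ M := (norm_nonneg _).trans (hM 0)
  have hwp : ∀ k j, HasWeakPartial j (f - fun x => m k x • f x)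
      (weakPartial j f - fun x => fderiv ℝ (m k) x (unitVec j) • f x + m k x • weakPartial j f x) :=
    fun k j => (hf.2.hasWeakPartial j).sub ((hf.2.hasWeakPartial j).smooth_smul (hmc k))
  -- A factor tending boundedly to zero kills the norm.
  have key : ∀ (c : ℕ → Space n → ℝ) (w : Space n → ℂ) (C : ℝ), MemLp w 2 volume →
      (∀ k, Continuous (c k)) → (∀ k x, |c k x| ≤ C) →
      (∀ x, Tendsto (fun k => c k x) atTop (𝓝 0)) →
      Tendsto (fun k => eLpNorm (fun x => c k x • w x) 2 volume) atTop (𝓝 0) := by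
    intro c w C hw hc hb hl
    refine tendsto_eLpNorm_zero_of_dominated (G := fun x => C * ‖w x‖)
      (fun k => (hc k).aestronglyMeasurable.smul hw.1) (hw.norm.const_mul C) (fun k x => ?_)
      (fun x => by simpa using (hl x).smul_const (w x))
    rw [norm_smul]
    exact mul_le_mul_of_nonneg_right (hb k x) (norm_nonneg _)
  have hc1 : ∀ k, Continuous fun x => 1 - m k x := fun k =>
    continuous_const.sub (hmc k).continuous
  have hb1 : ∀ k x, |1 - m k x| ≤ 1 := fun k x => by
    rw [abs_le]; constructor <;> linarith [(hm01 k x).1, (hm01 k x).2]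
  have hl1 : ∀ x, Tendsto (fun k => 1 - m k x) atTop (𝓝 0) := fun x => by
    simpa using (hmlim x).const_sub 1
  have t1 := key (fun k x => 1 - m k x) f 1 hf.memLp hc1 hb1 hl1
  have t2 := fun j => key (fun k x => 1 - m k x) (weakPartial j f) 1 (hf.memLp_weakPartial j)
    hc1 hb1 hl1
  have t3 := fun j => key (fun k x => fderiv ℝ (m k) x (unitVec j)) f M hf.memLp
    (fun k => (contDiff_fderiv_apply (hmc k) _).continuous)
    (fun k x => (hmder k x j).trans (mul_le_of_le_one_left hM0 (hs1 k)))
    (fun x => squeeze_zero_norm (fun k => hmder k x j) (by simpa using hs0.mul_const M))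
  have t4 := key (fun k x => 1 - m k x) (fun x => ‖x‖ • f x) 1 hf.memLp_norm_smul hc1 hb1 hl1
  have tot : Tendsto (fun k => eLpNorm (fun x => (1 - m k x) • f x) 2 volume
      + ∑ j, (eLpNorm (fun x => (1 - m k x) • weakPartial j f x) 2 volume
        + eLpNorm (fun x => fderiv ℝ (m k) x (unitVec j) • f x) 2 volume)
      + eLpNorm (fun x => (1 - m k x) • ‖x‖ • f x) 2 volume) atTop (𝓝 0) := by
    simpa using (t1.add (tendsto_finsetSum Finset.univ fun j _ => (t2 j).add (t3 j))).add t4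
  obtain ⟨k, hk⟩ := ((ENNReal.tendsto_nhds_zero.1 tot) ε hε).exists
  refine ⟨fun x => m k x • f x, ?_, (hmsupp k).smul_right, le_trans ?_ hk⟩
  · have hbd : ∀ {E : Type} [NormedAddCommGroup E] [NormedSpace ℝ E] (c : Space n → ℝ)
        (w : Space n → E) (C : ℝ), MemLp w 2 volume → Continuous c → (∀ x, |c x| ≤ C) →
        MemLp (fun x => c x • w x) 2 volume := fun c w C hw hc hb =>
      hw.of_le_mul (c := C) (hc.aestronglyMeasurable.smul hw.1) (Eventually.of_forall fun x => by
        rw [norm_smul]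
        exact mul_le_mul_of_nonneg_right (hb x) (norm_nonneg _))
    have hb : ∀ x, |m k x| ≤ 1 := fun x => by
      rw [abs_of_nonneg (hm01 k x).1]; exact (hm01 k x).2
    refine memSigma_of_hasWeakPartial (hbd (m k) f 1 hf.memLp (hmc k).continuous hb)
      (fun j => (hf.2.hasWeakPartial j).smooth_smul (hmc k)) (fun j => ?_) ?_
    · exact (hbd _ f (s k * M) hf.memLp (contDiff_fderiv_apply (hmc k) _).continuous
        (fun x => hmder k x j)).add
        (hbd _ _ 1 (hf.memLp_weakPartial j) (hmc k).continuous hb)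
    · refine (hbd (m k) _ 1 hf.memLp_norm_smul (hmc k).continuous hb).ae_eq
        (Eventually.of_forall fun x => smul_comm _ _ _)
  · refine (sigmaENorm_le_of_hasWeakPartial (hwp k)).trans (add_le_add (add_le_add ?_ ?_) ?_)
    · refine (eLpNorm_congr_ae (Eventually.of_forall fun x => ?_)).le
      simp only [Pi.sub_apply, sub_smul, one_smul]
    · refine Finset.sum_le_sum fun j _ => ?_
      have e : (weakPartial j f - fun x => fderiv ℝ (m k) x (unitVec j) • f x
          + m k x • weakPartial j f x) = (fun x => (1 - m k x) • weakPartial j f x)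
          - fun x => fderiv ℝ (m k) x (unitVec j) • f x := by
        funext x
        simp only [Pi.sub_apply, sub_smul, one_smul]
        abel
      rw [e]
      exact eLpNorm_sub_le ((hc1 k).aestronglyMeasurable.smul (hf.memLp_weakPartial j).1)
        ((contDiff_fderiv_apply (hmc k) _).continuous.aestronglyMeasurable.smul hf.1) (by simp)
    · refine (eLpNorm_congr_ae (Eventually.of_forall fun x => ?_)).le
      simp only [Pi.sub_apply, sub_smul, one_smul, smul_sub]
      rw [smul_comm ‖x‖]

/-- Mollification of a compactly supported function in `Σ`. -/
theorem MemSigma.exists_mollify (hf : MemSigma f) (hc : HasCompactSupport f) {ε : ℝ≥0∞}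
    (hε : 0 < ε) :
    ∃ φ : Space n → ℂ, ContDiff ℝ (⊤ : ℕ∞) φ ∧ HasCompactSupport φ ∧ sigmaENorm (f - φ) ≤ ε := by
  obtain ⟨a, ha⟩ := hc.isCompact.isBounded.subset_closedBall 0
  have ha' : ∀ x, |a| < ‖x‖ → f x = 0 := fun x hx => by
    by_contra h0
    have := ha (subset_tsupport _ h0)
    rw [mem_closedBall_zero_iff] at this
    exact absurd hx (not_lt.2 (this.trans (le_abs_self a)))
  set A : ℝ≥0∞ := 1 + ENNReal.ofReal (|a| + 1) with hA
  have hA0 : A ≠ 0 := by simp [hA]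
  have hAT : A ≠ ∞ := by simp [hA]
  set η : ℝ≥0∞ := ε / (n + 1) with hη
  have hη0 : 0 < η := ENNReal.div_pos hε.ne' (by simp)
  have h1 := ENNReal.tendsto_nhds_zero.1
    (tendsto_eLpNorm_translate_sub (by simp) (by simp) hf.memLp) (η / A)
    (ENNReal.div_pos hη0.ne' hAT)
  have h2 := fun j => ENNReal.tendsto_nhds_zero.1
    (tendsto_eLpNorm_translate_sub (by simp) (by simp) (hf.memLp_weakPartial j)) η hη0
  obtain ⟨δ, hδ, hball⟩ := Metric.eventually_nhds_iff.1 (h1.and (eventually_all.2 h2))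
  set δ' := min δ 1 with hδ'
  have hδ'pos : 0 < δ' := lt_min hδ one_pos
  let χ : ContDiffBump (0 : Space n) := ⟨δ' / 2, δ', by positivity, by linarith⟩
  set ρ : Space n → ℝ := χ.normed volume with hρ
  have hρc : ContDiff ℝ (⊤ : ℕ∞) ρ := χ.contDiff_normed
  have hρ0 : ∀ x, 0 ≤ ρ x := χ.nonneg_normed
  have hρcs : HasCompactSupport ρ := χ.hasCompactSupport_normed
  set ν : Measure (Space n) := volume.withDensity fun y => ENNReal.ofReal (ρ y) with hν
  have hρm : Measurable fun y => ENNReal.ofReal (ρ y) := hρc.continuous.measurable.ennreal_ofReal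
  have hprob : IsProbabilityMeasure ν := by
    refine ⟨?_⟩
    rw [hν, withDensity_apply _ MeasurableSet.univ, setLIntegral_univ,
      ← ofReal_integral_eq_lintegral_ofReal (hρc.continuous.integrable_of_hasCompactSupport hρcs)
      (Eventually.of_forall hρ0), hρ, χ.integral_normed, ENNReal.ofReal_one]
  have hνball : ∀ᵐ y ∂ν, ‖y‖ < δ' := by
    rw [hν, ae_withDensity_iff hρm]
    refine Eventually.of_forall fun y hy => ?_
    have h3 : y ∈ Function.support ρ := fun h0 => hy (by simp [h0])
    rw [hρ, χ.support_normed_eq] at h3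
    simpa using h3
  have hR : ∀ᵐ y ∂ν, ‖id y‖ ≤ 1 := hνball.mono fun y hy => hy.le.trans (min_le_right _ _)
  set φ : Space n → ℂ := fun x => ∫ y, f (x - id y) ∂ν with hφ
  have hφconv : φ = convolution ρ f (ContinuousLinearMap.lsmul ℝ ℝ) volume := by
    funext x
    simp only [hφ, id]
    rw [convolution_def, hν, integral_withDensity_eq_integral_toReal_smul hρm
      (Eventually.of_forall fun _ => ENNReal.ofReal_lt_top)]
    refine integral_congr_ae (Eventually.of_forall fun y => ?_)
    simp only [ENNReal.toReal_ofReal (hρ0 y), ContinuousLinearMap.lsmul_apply]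
  have hloc : LocallyIntegrable f volume := hf.memLp.locallyIntegrable (by simp)
  have hwp : ∀ j, HasWeakPartial j φ (fun x => ∫ y, weakPartial j f (x - id y) ∂ν) := fun j =>
    (hf.2.hasWeakPartial j).average measurable_id hR
  -- Minkowski's inequality for the difference between a function and its mollification.
  have mink : ∀ (w : Space n → ℂ) (C : ℝ≥0∞), MemLp w 2 volume →
      (∀ v : Space n, ‖v‖ < δ → eLpNorm (fun x => w (x - v) - w x) 2 volume ≤ C) →
      eLpNorm (fun x => w x - ∫ y, w (x - id y) ∂ν) 2 volume ≤ C := by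
    intro w C hw hb
    have h3 := eLpNorm_integral_le_of_forall (ν := ν) (μ := (volume : Measure (Space n)))
      (h := fun x y => w (x - id y) - w x) (p := 2) (C := C)
      ((aestronglyMeasurable_translate hw.1 measurable_id).sub hw.1.comp_fst)
      (by simp) (by simp) (hνball.mono fun y hy => hb y (hy.trans_le (min_le_left _ _)))
    refine le_trans (le_of_eq ?_) h3
    rw [← eLpNorm_neg]
    refine eLpNorm_congr_ae ?_
    have hint : ∀ᵐ x : Space n, Integrable (fun y => w (x - id y)) ν := by
      have hloc : ∀ k : ℕ, ∀ᵐ x : Space n, Integrable (fun y =>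
          (Metric.closedBall (0 : Space n) (k + 1)).indicator w (x - id y)) ν := fun k =>
        (integrable_indicator_translate (hw.locallyIntegrable (by simp))
          measurable_id _).prod_right_ae
      rw [← ae_all_iff] at hloc
      filter_upwards [hloc] with x hx
      obtain ⟨k, hk⟩ := exists_nat_ge ‖x‖
      refine (hx k).congr ?_
      filter_upwards [ae_indicator_translate_eq (g := w) hR k] with y hy
      exact hy x (by simpa using hk)
    filter_upwards [hint] with x hx
    rw [Pi.neg_apply, integral_sub hx (integrable_const _)]
    simp
  have m1 : eLpNorm (f - φ) 2 volume ≤ η / A :=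
    mink f _ hf.memLp fun v hv => (hball (by simpa using hv)).1
  have m2 : ∀ j, eLpNorm (weakPartial j f - fun x => ∫ y, weakPartial j f (x - id y) ∂ν) 2 volume
      ≤ η := fun j =>
    mink _ _ (hf.memLp_weakPartial j) fun v hv => (hball (by simpa using hv)).2 j
  have m3 : eLpNorm (fun x => ‖x‖ • (f - φ) x) 2 volume
      ≤ ENNReal.ofReal (|a| + 1) * eLpNorm (f - φ) 2 volume := by
    refine eLpNorm_le_mul_eLpNorm_of_ae_le_mul (Eventually.of_forall fun x => ?_) 2
    rw [norm_smul, norm_norm]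
    rcases le_or_gt ‖x‖ (|a| + 1) with h | h
    · gcongr
    · have h4 : (f - φ) x = 0 := by
        have h5 : φ x = 0 := by
          refine integral_eq_zero_of_ae (hR.mono fun y hy => ha' _ ?_)
          have := norm_sub_norm_le x (id y)
          linarith
        rw [Pi.sub_apply, h5, ha' x (by linarith), sub_zero]
      simp [h4]
  refine ⟨φ, ?_, ?_, ?_⟩
  · rw [hφconv]
    exact hρcs.contDiff_convolution_left _ hρc hloc
  · rw [hφconv]
    exact hρcs.convolution _ hc
  · refine (sigmaENorm_le_of_hasWeakPartial
      fun j => (hf.2.hasWeakPartial j).sub (hwp j)).trans ?_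
    calc _ ≤ eLpNorm (f - φ) 2 volume + ∑ _j : Fin n, η
          + ENNReal.ofReal (|a| + 1) * eLpNorm (f - φ) 2 volume := by
          gcongr with j
          exact m2 j
      _ = A * eLpNorm (f - φ) 2 volume + n * η := by
          rw [hA, Finset.sum_const, Finset.card_univ, Fintype.card_fin, nsmul_eq_mul]
          ring
      _ ≤ A * (η / A) + n * η := by gcongr
      _ = ε := by
          rw [ENNReal.mul_div_cancel hA0 hAT, hη, ← one_add_mul, add_comm,
            ENNReal.mul_div_cancel (by simp) (by simp)]

theorem memSigma_of_contDiff {φ : Space n → ℂ} (hφ : ContDiff ℝ (⊤ : ℕ∞) φ)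
    (hc : HasCompactSupport φ) : MemSigma φ := by
  refine memSigma_of_hasWeakPartial (hφ.continuous.memLp_of_hasCompactSupport hc)
    (fun j => hasWeakPartial_of_contDiff (hφ.of_le (by simp)) j) (fun j => ?_) ?_
  · have h1 : Continuous fun x => fderiv ℝ φ x (unitVec j) :=
      (hφ.continuous_fderiv (by simp)).clm_apply (continuous_const (y := unitVec j))
    have h2 : HasCompactSupport fun x => fderiv ℝ φ x (unitVec j) :=
      hc.fderiv_apply (𝕜 := ℝ) (unitVec j)
    exact h1.memLp_of_hasCompactSupport h2
  · have h1 : Continuous fun x => ‖x‖ • φ x := continuous_norm.smul hφ.continuous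
    have h2 : HasCompactSupport fun x => ‖x‖ • φ x := by
      refine hc.mono fun x hx => ?_
      contrapose! hx
      simp [Function.notMem_support.1 hx]
    exact h1.memLp_of_hasCompactSupport h2

theorem MemSigma.exists_contDiff (hf : MemSigma f) {ε : ℝ≥0∞} (hε : 0 < ε) :
    ∃ φ : Space n → ℂ, ContDiff ℝ (⊤ : ℕ∞) φ ∧ HasCompactSupport φ ∧ sigmaENorm (f - φ) ≤ ε := by
  obtain ⟨g, hg, hgc, h1⟩ := hf.exists_cutoff (ENNReal.half_pos hε.ne')
  obtain ⟨φ, hφ, hφc, h2⟩ := hg.exists_mollify hgc (ENNReal.half_pos hε.ne')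
  refine ⟨φ, hφ, hφc, ?_⟩
  have e : f - φ = (f - g) + (g - φ) := by abel
  rw [e]
  refine (sigmaENorm_add_le (hf.sub hg) (hg.sub (memSigma_of_contDiff hφ hφc))).trans ?_
  exact (add_le_add h1 h2).trans (ENNReal.add_halves ε).le

end Density
/-! ### The `L²` pairing -/

section Pairing

open ComplexConjugate

variable {n : ℕ} {f g h : Space n → ℂ}

/-- The pairing `∫ conj f · g`. -/
noncomputable def ip (f g : Space n → ℂ) : ℂ := ∫ x, conj (f x) * g x

theorem memLp_conj {p : ℝ≥0∞} (hf : MemLp f p volume) : MemLp (fun x => conj (f x)) p volume :=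
  hf.star

theorem integrable_conj_mul_of_holder {p q : ℝ≥0∞} [p.HolderConjugate q] (hf : MemLp f p volume)
    (hg : MemLp g q volume) : Integrable (fun x => conj (f x) * g x) volume :=
  (memLp_conj hf).integrable_mul hg

theorem integrable_conj_mul (hf : MemLp f 2 volume) (hg : MemLp g 2 volume) :
    Integrable (fun x => conj (f x) * g x) volume :=
  integrable_conj_mul_of_holder hf hg

theorem norm_ip_le_of_holder {p q : ℝ≥0∞} [p.HolderConjugate q] (hf : MemLp f p volume)
    (hg : MemLp g q volume) : ‖ip f g‖ ≤ lpNorm f p volume * lpNorm g q volume := by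
  have h1 : ‖ip f g‖ₑ ≤ eLpNorm f p volume * eLpNorm g q volume := by
    refine (enorm_integral_le_lintegral_enorm _).trans ?_
    rw [← eLpNorm_one_eq_lintegral_enorm]
    have h2 := eLpNorm_smul_le_mul_eLpNorm (r := 1) hg.1 (memLp_conj hf).1 (p := p) (q := q)
    have h3 : eLpNorm (fun x => conj (f x)) p volume = eLpNorm f p volume :=
      eLpNorm_congr_norm_ae (Eventually.of_forall fun x => by simp)
    rw [h3] at h2
    exact h2
  rw [← toReal_eLpNorm hf.1, ← toReal_eLpNorm hg.1, ← ENNReal.toReal_mul, ← toReal_enorm]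
  exact ENNReal.toReal_mono (ENNReal.mul_ne_top hf.2.ne hg.2.ne) h1

theorem norm_ip_le (hf : MemLp f 2 volume) (hg : MemLp g 2 volume) :
    ‖ip f g‖ ≤ lpNorm f 2 volume * lpNorm g 2 volume :=
  norm_ip_le_of_holder hf hg

theorem conj_ip (f g : Space n → ℂ) : conj (ip f g) = ip g f := by
  rw [ip, ip, ← integral_conj]
  simp only [map_mul, RingHomCompTriple.comp_apply, RingHom.id_apply, mul_comm]

theorem ip_congr {f' g' : Space n → ℂ} (hf : f =ᵐ[volume] f') (hg : g =ᵐ[volume] g') :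
    ip f g = ip f' g' :=
  integral_congr_ae (by filter_upwards [hf, hg] with x h1 h2; rw [h1, h2])

theorem ip_sub_right_of_holder {p q : ℝ≥0∞} [p.HolderConjugate q] (hf : MemLp f p volume)
    (hg : MemLp g q volume) (hh : MemLp h q volume) : ip f (g - h) = ip f g - ip f h := by
  simp only [ip, Pi.sub_apply, mul_sub]
  exact integral_sub (integrable_conj_mul_of_holder hf hg) (integrable_conj_mul_of_holder hf hh)

theorem ip_sub_left_of_holder {p q : ℝ≥0∞} [p.HolderConjugate q] (hf : MemLp f p volume)
    (hg : MemLp g p volume) (hh : MemLp h q volume) : ip (f - g) h = ip f h - ip g h := by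
  simp only [ip, Pi.sub_apply, map_sub, sub_mul]
  exact integral_sub (integrable_conj_mul_of_holder hf hh) (integrable_conj_mul_of_holder hg hh)

theorem ip_sub_right (hf : MemLp f 2 volume) (hg : MemLp g 2 volume) (hh : MemLp h 2 volume) :
    ip f (g - h) = ip f g - ip f h := ip_sub_right_of_holder hf hg hh

theorem ip_sub_left (hf : MemLp f 2 volume) (hg : MemLp g 2 volume) (hh : MemLp h 2 volume) :
    ip (f - g) h = ip f h - ip g h := ip_sub_left_of_holder hf hg hh

theorem ip_add_left (hf : MemLp f 2 volume) (hg : MemLp g 2 volume) (hh : MemLp h 2 volume) :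
    ip (f + g) h = ip f h + ip g h := by
  simp only [ip, Pi.add_apply, map_add, add_mul]
  exact integral_add (integrable_conj_mul hf hh) (integrable_conj_mul hg hh)

theorem ip_const_mul_left (c : ℂ) : ip (fun x => c * f x) g = conj c * ip f g := by
  rw [ip, ip, ← integral_const_mul]
  congr 1; funext x; rw [map_mul]; ring

theorem ip_self (hf : MemLp f 2 volume) : ip f f = ((lpNorm f 2 volume ^ 2 : ℝ) : ℂ) := by
  have h1 : lpNorm f 2 volume ^ (2 : ℝ) = ∫ x, ‖f x‖ ^ (2 : ℝ) := by
    rw [integral_norm_rpow_eq two_pos hf.1]; simp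
  rw [Real.rpow_two] at h1
  rw [h1, ip, ← integral_complex_ofReal]
  congr 1; funext x
  rw [Complex.conj_mul', Real.rpow_two]
  push_cast; rfl

/-- The pairing is continuous for the `L²` norms. -/
theorem tendsto_ip {ι : Type*} {l : Filter ι} {F G : ι → Space n → ℂ}
    (hF : ∀ᶠ i in l, MemLp (F i) 2 volume) (hG : ∀ᶠ i in l, MemLp (G i) 2 volume)
    (hf : MemLp f 2 volume) (hg : MemLp g 2 volume)
    (h1 : Tendsto (fun i => lpNorm (F i - f) 2 volume) l (𝓝 0))
    (h2 : Tendsto (fun i => lpNorm (G i - g) 2 volume) l (𝓝 0)) :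
    Tendsto (fun i => ip (F i) (G i)) l (𝓝 (ip f g)) := by
  rw [tendsto_iff_norm_sub_tendsto_zero]
  have h3 : Tendsto (fun i => lpNorm (F i - f) 2 volume * lpNorm (G i - g) 2 volume
      + lpNorm (F i - f) 2 volume * lpNorm g 2 volume
      + lpNorm f 2 volume * lpNorm (G i - g) 2 volume) l (𝓝 0) := by
    simpa using ((h1.mul h2).add (h1.mul_const (lpNorm g 2 volume))).add
      (h2.const_mul (lpNorm f 2 volume))
  refine squeeze_zero' (Eventually.of_forall fun _ => norm_nonneg _) ?_ h3
  filter_upwards [hF, hG] with i hFi hGi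
  have e : ip (F i) (G i) - ip f g
      = ip (F i - f) (G i - g) + ip (F i - f) g + ip f (G i - g) := by
    rw [ip_sub_left hFi hf (hGi.sub hg), ip_sub_left hFi hf hg, ip_sub_right hFi hGi hg,
      ip_sub_right hf hGi hg]
    ring
  rw [e]
  refine (norm_add_le _ _).trans (add_le_add ((norm_add_le _ _).trans (add_le_add ?_ ?_)) ?_)
  · exact norm_ip_le (hFi.sub hf) (hGi.sub hg)
  · exact norm_ip_le (hFi.sub hf) hg
  · exact norm_ip_le hf (hGi.sub hg)

end Pairing

/-! ### The power nonlinearity -/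

section Nonlinearity

variable {n : ℕ} {f : Space n → ℂ} {σ : ℝ}

/-- `|z|^{2σ} z`. -/
noncomputable def powNL (σ : ℝ) (z : ℂ) : ℂ := ((‖z‖ ^ (2 * σ) : ℝ) : ℂ) * z

theorem norm_powNL (hσ : 0 < σ) (z : ℂ) : ‖powNL σ z‖ = ‖z‖ ^ (2 * σ + 1) := by
  rw [powNL, norm_mul, Complex.norm_real, Real.norm_of_nonneg (by positivity),
    Real.rpow_add_one' (norm_nonneg _) (by positivity)]

theorem continuous_powNL (hσ : 0 < σ) : Continuous (powNL σ) := by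
  unfold powNL
  have h1 : Continuous fun z : ℂ => ‖z‖ ^ (2 * σ) :=
    continuous_norm.rpow_const fun _ => Or.inr (by positivity)
  exact (Complex.continuous_ofReal.comp h1).mul continuous_id

theorem holderConjugate_pow (hσ : 0 < σ) :
    (2 * σ + 2).HolderConjugate ((2 * σ + 2) / (2 * σ + 1)) := by
  rw [Real.holderConjugate_iff]
  refine ⟨by linarith, ?_⟩
  field_simp
  ring

theorem eLpNorm_powNL (hσ : 0 < σ) (f : Space n → ℂ) :
    eLpNorm (fun x => powNL σ (f x)) (ENNReal.ofReal ((2 * σ + 2) / (2 * σ + 1))) volume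
      = eLpNorm f (ENNReal.ofReal (2 * σ + 2)) volume ^ (2 * σ + 1) := by
  have h1 := eLpNorm_norm_rpow (μ := (volume : Measure (Space n)))
    (p := ENNReal.ofReal ((2 * σ + 2) / (2 * σ + 1))) f (q := 2 * σ + 1) (by positivity)
  rw [← ENNReal.ofReal_mul (by positivity), div_mul_cancel₀ _ (by positivity)] at h1
  rw [← h1]
  refine eLpNorm_congr_norm_ae (Eventually.of_forall fun x => ?_)
  rw [norm_powNL hσ, Real.norm_of_nonneg (by positivity)]

theorem memLp_powNL (hσ : 0 < σ) (hf : MemLp f (ENNReal.ofReal (2 * σ + 2)) volume) :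
    MemLp (fun x => powNL σ (f x)) (ENNReal.ofReal ((2 * σ + 2) / (2 * σ + 1))) volume := by
  refine ⟨(continuous_powNL hσ).comp_aestronglyMeasurable hf.1, ?_⟩
  rw [eLpNorm_powNL hσ]
  exact ENNReal.rpow_lt_top_of_nonneg (by positivity) hf.2.ne

theorem lpNorm_powNL (hσ : 0 < σ) (hf : MemLp f (ENNReal.ofReal (2 * σ + 2)) volume) :
    lpNorm (fun x => powNL σ (f x)) (ENNReal.ofReal ((2 * σ + 2) / (2 * σ + 1))) volume
      = lpNorm f (ENNReal.ofReal (2 * σ + 2)) volume ^ (2 * σ + 1) := by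
  rw [← toReal_eLpNorm (memLp_powNL hσ hf).1, ← toReal_eLpNorm hf.1, eLpNorm_powNL hσ,
    ENNReal.toReal_rpow]

end Nonlinearity

/-! ### Testing the equation with functions in `Σ` -/

section WeakForm

variable {n : ℕ} {σ lam κ : ℝ} {f g ψ : Space n → ℂ}

/-- The norm of `Σ` as a real number. -/
noncomputable def sigmaNorm (f : Space n → ℂ) : ℝ := (sigmaENorm f).toReal

/-- The `j`-th coordinate times `f`. -/
noncomputable def coordMul (j : Fin n) (f : Space n → ℂ) (x : Space n) : ℂ :=
  ((x j : ℝ) : ℂ) * f x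

theorem sigmaNorm_nonneg (f : Space n → ℂ) : 0 ≤ sigmaNorm f := ENNReal.toReal_nonneg

theorem MemSigma.ofReal_sigmaNorm (hf : MemSigma f) :
    ENNReal.ofReal (sigmaNorm f) = sigmaENorm f := ENNReal.ofReal_toReal hf.3.ne

theorem MemSigma.memLp_coordMul (hf : MemSigma f) (j : Fin n) :
    MemLp (coordMul j f) 2 volume := hf.memLp_coord j

theorem lpNorm_le_of_eLpNorm_le {E : Type*} [NormedAddCommGroup E] {w : Space n → E} {p : ℝ≥0∞}
    {C : ℝ} (hw : AEStronglyMeasurable w volume) (hC : 0 ≤ C)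
    (h : eLpNorm w p volume ≤ ENNReal.ofReal C) : lpNorm w p volume ≤ C := by
  rw [← toReal_eLpNorm hw]
  exact ENNReal.toReal_le_of_le_ofReal hC h

theorem MemSigma.lpNorm_le (hf : MemSigma f) : lpNorm f 2 volume ≤ sigmaNorm f := by
  refine lpNorm_le_of_eLpNorm_le hf.1 (sigmaNorm_nonneg f) ?_
  rw [hf.ofReal_sigmaNorm]
  exact le_trans (self_le_add_right _ _) (self_le_add_right _ _)

theorem MemSigma.lpNorm_weakPartial_le (hf : MemSigma f) (j : Fin n) :
    lpNorm (weakPartial j f) 2 volume ≤ sigmaNorm f := by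
  refine lpNorm_le_of_eLpNorm_le (hf.memLp_weakPartial j).1 (sigmaNorm_nonneg f) ?_
  rw [hf.ofReal_sigmaNorm]
  exact (eLpNorm_weakPartial_le f j 2).trans
    (le_trans (self_le_add_left _ _) (self_le_add_right _ _))

theorem MemSigma.lpNorm_coordMul_le (hf : MemSigma f) (j : Fin n) :
    lpNorm (coordMul j f) 2 volume ≤ sigmaNorm f := by
  refine lpNorm_le_of_eLpNorm_le (hf.memLp_coordMul j).1 (sigmaNorm_nonneg f) ?_
  rw [hf.ofReal_sigmaNorm]
  refine le_trans (eLpNorm_mono fun x => ?_) (self_le_add_left _ _)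
  rw [coordMul, norm_mul, norm_smul, Complex.norm_real, norm_norm]
  gcongr
  exact PiLp.norm_apply_le x j

theorem sigmaNorm_add_le (hf : MemSigma f) (hg : MemSigma g) :
    sigmaNorm (f + g) ≤ sigmaNorm f + sigmaNorm g := by
  rw [sigmaNorm, sigmaNorm, sigmaNorm, ← ENNReal.toReal_add hf.3.ne hg.3.ne]
  exact ENNReal.toReal_mono (ENNReal.add_lt_top.2 ⟨hf.3, hg.3⟩).ne (sigmaENorm_add_le hf hg)

theorem sigmaENorm_neg (hf : HasWeakGrad f) : sigmaENorm (-f) = sigmaENorm f := by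
  have h : weakGrad (-f) =ᵐ[volume] -weakGrad f := by
    refine (weakGrad_ae_eq fun j => ((hf.hasWeakPartial j).const_smul (-1)).congr
      (Eventually.of_forall fun x => by simp) EventuallyEq.rfl).trans
      (Eventually.of_forall fun x => ?_)
    ext j
    simp [weakGrad]
  rw [sigmaENorm, sigmaENorm, eLpNorm_congr_ae h, eLpNorm_neg, eLpNorm_neg]
  congr 1
  rw [← eLpNorm_neg]
  congr 1; funext x; simp

/-- `C` is a bound of the embedding of `Σ` into `L^{2σ+2}`. -/
def SigmaEmbeds (n : ℕ) (σ C : ℝ) : Prop :=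
  0 < C ∧ ∀ f : Space n → ℂ, MemSigma f → MemLp f (ENNReal.ofReal (2 * σ + 2)) volume ∧
    lpNorm f (ENNReal.ofReal (2 * σ + 2)) volume ≤ C * sigmaNorm f

/-- The assumption on `σ` says that `2σ + 2` is below the critical Sobolev exponent. -/
theorem exists_sigmaEmbeds (hn : 1 ≤ n) (hσ : 0 < σ) (hσn : 3 ≤ n → σ < 2 / ((n : ℝ) - 2)) :
    ∃ C, SigmaEmbeds n σ C := by
  obtain ⟨C, hC, hb⟩ := exists_eLpNorm_le_hOneENorm hn (r := 2 * σ + 2) (by linarith) (fun h3 => by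
    have h4 := hσn h3
    have h5 : (3 : ℝ) ≤ n := by exact_mod_cast h3
    rw [lt_div_iff₀ (by linarith)] at h4
    nlinarith)
  refine ⟨C * (n + 1), by positivity, fun f hf => ?_⟩
  have h1 : eLpNorm f (ENNReal.ofReal (2 * σ + 2)) volume
      ≤ ENNReal.ofReal (C * (n + 1) * sigmaNorm f) := by
    refine (hb f hf.memLp hf.2).trans ?_
    rw [mul_assoc, ENNReal.ofReal_mul hC.le, ENNReal.ofReal_mul (by positivity),
      hf.ofReal_sigmaNorm]
    gcongr
    refine (hOneENorm_le_sigmaENorm f).trans (le_of_eq ?_)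
    rw [ENNReal.ofReal_add (by positivity) zero_le_one]
    simp
  exact ⟨⟨hf.1, h1.trans_lt ENNReal.ofReal_lt_top⟩, lpNorm_le_of_eLpNorm_le hf.1
    (mul_nonneg (by positivity) (sigmaNorm_nonneg f)) h1⟩

/-- The form `½ ⟨∇ψ, ∇f⟩ + ⟨ψ, V f⟩ + lam ⟨ψ, |f|^{2σ} f⟩` for the potential
`V x = -κ |x|² / 2`, so that the equation reads `i ∂ₜ ⟨ψ, u⟩ = nlsForm u ψ`. It is conjugate linear in
`ψ` and bounded on `Σ`. -/
noncomputable def nlsForm (σ lam κ : ℝ) (f ψ : Space n → ℂ) : ℂ :=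
  1 / 2 * ∑ j, ip (weakPartial j ψ) (weakPartial j f)
    - κ / 2 * ∑ j, ip (coordMul j ψ) (coordMul j f) + lam * ip ψ (fun x => powNL σ (f x))

theorem norm_nlsForm_le (hσ : 0 < σ) {C : ℝ} (hC : SigmaEmbeds n σ C) {M : ℝ}
    (hf : MemSigma f) (hψ : MemSigma ψ) (hM : sigmaNorm f ≤ M) :
    ‖nlsForm σ lam κ f ψ‖
      ≤ (1 / 2 * n * M + |κ| / 2 * n * M + |lam| * C * (C * M) ^ (2 * σ + 1)) * sigmaNorm ψ := by
  have hp : (ENNReal.ofReal (2 * σ + 2)).HolderConjugate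
      (ENNReal.ofReal ((2 * σ + 2) / (2 * σ + 1))) := (holderConjugate_pow hσ).ennrealOfReal
  have hM0 : 0 ≤ M := (sigmaNorm_nonneg f).trans hM
  have hψ0 := sigmaNorm_nonneg ψ
  have h1 : ‖∑ j, ip (weakPartial j ψ) (weakPartial j f)‖ ≤ n * (sigmaNorm ψ * M) := by
    refine (norm_sum_le _ _).trans ((Finset.sum_le_card_nsmul _ _ (sigmaNorm ψ * M) fun j _ =>
      ?_).trans (by simp))
    refine (norm_ip_le (hψ.memLp_weakPartial j) (hf.memLp_weakPartial j)).trans ?_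
    exact mul_le_mul (hψ.lpNorm_weakPartial_le j) ((hf.lpNorm_weakPartial_le j).trans hM)
      lpNorm_nonneg hψ0
  have h2 : ‖∑ j, ip (coordMul j ψ) (coordMul j f)‖ ≤ n * (sigmaNorm ψ * M) := by
    refine (norm_sum_le _ _).trans ((Finset.sum_le_card_nsmul _ _ (sigmaNorm ψ * M) fun j _ =>
      ?_).trans (by simp))
    refine (norm_ip_le (hψ.memLp_coordMul j) (hf.memLp_coordMul j)).trans ?_
    exact mul_le_mul (hψ.lpNorm_coordMul_le j) ((hf.lpNorm_coordMul_le j).trans hM)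
      lpNorm_nonneg hψ0
  have h3 : ‖ip ψ (fun x => powNL σ (f x))‖ ≤ C * sigmaNorm ψ * (C * M) ^ (2 * σ + 1) := by
    refine (norm_ip_le_of_holder (hC.2 ψ hψ).1 (memLp_powNL hσ (hC.2 f hf).1)).trans ?_
    rw [lpNorm_powNL hσ (hC.2 f hf).1]
    refine mul_le_mul (hC.2 ψ hψ).2 ?_ (Real.rpow_nonneg lpNorm_nonneg _)
      (mul_nonneg hC.1.le hψ0)
    refine Real.rpow_le_rpow lpNorm_nonneg ((hC.2 f hf).2.trans ?_) (by positivity)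
    exact mul_le_mul_of_nonneg_left hM hC.1.le
  rw [nlsForm]
  refine (norm_add_le _ _).trans ((add_le_add ((norm_sub_le _ _).trans
    (add_le_add (?_ : _ ≤ 1 / 2 * (n * (sigmaNorm ψ * M)))
    (?_ : _ ≤ |κ| / 2 * (n * (sigmaNorm ψ * M)))))
    (?_ : _ ≤ |lam| * (C * sigmaNorm ψ * (C * M) ^ (2 * σ + 1)))).trans (le_of_eq (by ring)))
  · rw [norm_mul]
    refine mul_le_mul (by simp) h1 (norm_nonneg _) (by norm_num)
  · rw [norm_mul]
    refine mul_le_mul (by simp) h2 (norm_nonneg _) (by positivity)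
  · rw [norm_mul, Complex.norm_real]
    exact mul_le_mul_of_nonneg_left h3 (abs_nonneg _)

theorem nlsForm_sub (hσ : 0 < σ) {C : ℝ} (hC : SigmaEmbeds n σ C)
    (hf : MemSigma f) (hψ : MemSigma ψ) (hg : MemSigma g) :
    nlsForm σ lam κ f (ψ - g) = nlsForm σ lam κ f ψ - nlsForm σ lam κ f g := by
  have hp : (ENNReal.ofReal (2 * σ + 2)).HolderConjugate
      (ENNReal.ofReal ((2 * σ + 2) / (2 * σ + 1))) := (holderConjugate_pow hσ).ennrealOfReal
  have h1 : ∀ j, ip (weakPartial j (ψ - g)) (weakPartial j f)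
      = ip (weakPartial j ψ) (weakPartial j f) - ip (weakPartial j g) (weakPartial j f) := fun j => by
    rw [ip_congr (weakPartial_sub_ae hψ.2 hg.2 j) EventuallyEq.rfl,
      ip_sub_left (hψ.memLp_weakPartial j) (hg.memLp_weakPartial j) (hf.memLp_weakPartial j)]
  have h2 : ∀ j, ip (coordMul j (ψ - g)) (coordMul j f)
      = ip (coordMul j ψ) (coordMul j f) - ip (coordMul j g) (coordMul j f) := fun j => by
    rw [← ip_sub_left (hψ.memLp_coordMul j) (hg.memLp_coordMul j) (hf.memLp_coordMul j)]
    congr 1; funext x; simp [coordMul, mul_sub]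
  rw [nlsForm, nlsForm, nlsForm, ip_sub_left_of_holder (hC.2 ψ hψ).1 (hC.2 g hg).1
    (memLp_powNL hσ (hC.2 f hf).1)]
  simp only [h1, h2, Finset.sum_sub_distrib]
  ring

end WeakForm
/-! ### The weak form of the equation -/

section SolutionTest

open ComplexConjugate

variable {n : ℕ} {σ lam κ : ℝ} {f ψ : Space n → ℂ}

/-- The potential `-κ |x|² / 2`: confining for `κ = -ω²`, repulsive for `κ = ω²`. With this sign the
classical trajectories satisfy `x'' = κ x`. -/
noncomputable def quadPot (κ : ℝ) (x : Space n) : ℝ := -(κ * ‖x‖ ^ 2 / 2)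

theorem laplacian_eq_sum {a : Space n → ℝ} (ha : ContDiff ℝ (⊤ : ℕ∞) a) (x : Space n) :
    Laplacian.laplacian a x
      = ∑ j, fderiv ℝ (fun y => fderiv ℝ a y (unitVec j)) x (unitVec j) := by
  rw [InnerProductSpace.laplacian_eq_iteratedFDeriv_orthonormalBasis a
    (EuclideanSpace.basisFun (Fin n) ℝ)]
  refine Finset.sum_congr rfl fun j _ => ?_
  rw [iteratedFDeriv_two_apply, EuclideanSpace.basisFun_apply]
  have h1 : DifferentiableAt ℝ (fderiv ℝ a) x :=
    (ha.fderiv_right (m := (⊤ : ℕ∞)) le_rfl).differentiable (by simp) x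
  have h2 := (h1.hasFDerivAt.clm_apply (hasFDerivAt_const (unitVec j) x)).fderiv
  rw [h2]
  simp

theorem nlsForm_const_smul (c : ℂ) (hψ : HasWeakGrad ψ) :
    nlsForm σ lam κ f (c • ψ) = conj c * nlsForm σ lam κ f ψ := by
  have h1 : ∀ j, ip (weakPartial j (c • ψ)) (weakPartial j f)
      = conj c * ip (weakPartial j ψ) (weakPartial j f) := fun j => by
    rw [ip_congr ((hψ.hasWeakPartial j).const_smul c).weakPartial_ae_eq EventuallyEq.rfl,
      ← ip_const_mul_left]
    rfl
  have h2 : ∀ j, ip (coordMul j (c • ψ)) (coordMul j f)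
      = conj c * ip (coordMul j ψ) (coordMul j f) := fun j => by
    rw [← ip_const_mul_left]
    congr 1; funext x; simp only [coordMul, Pi.smul_apply, smul_eq_mul]; ring
  have h3 : ip (c • ψ) (fun x => powNL σ (f x)) = conj c * ip ψ (fun x => powNL σ (f x)) := by
    rw [← ip_const_mul_left]; rfl
  simp only [nlsForm, h1, h2, h3, ← Finset.mul_sum]
  ring

/-- The weak formulation against a real test function, in terms of `nlsForm`. -/
theorem nlsForm_ofReal (hσ : 0 < σ) (hf : MemSigma f)
    (hfp : MemLp f (ENNReal.ofReal (2 * σ + 2)) volume) {a : Space n → ℝ}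
    (ha : ContDiff ℝ (⊤ : ℕ∞) a) (hc : HasCompactSupport a) :
    nlsForm σ lam κ f (fun x => (a x : ℂ))
      = -(1 / 2) * (∫ x, Laplacian.laplacian a x • f x)
        + ∫ x, a x • ((quadPot κ x : ℂ) * f x + ((lam * ‖f x‖ ^ (2 * σ) : ℝ) : ℂ) * f x) := by
  have hp : (ENNReal.ofReal (2 * σ + 2)).HolderConjugate
      (ENNReal.ofReal ((2 * σ + 2) / (2 * σ + 1))) := (holderConjugate_pow hσ).ennrealOfReal
  have hloc : LocallyIntegrable f volume := hf.memLp.locallyIntegrable (by simp)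
  have haC : ContDiff ℝ (⊤ : ℕ∞) fun x => (a x : ℂ) := Complex.ofRealCLM.contDiff.comp ha
  have hder : ∀ x j, fderiv ℝ (fun x => (a x : ℂ)) x (unitVec j)
      = ((fderiv ℝ a x (unitVec j) : ℝ) : ℂ) := fun x j => by
    have := Complex.ofRealCLM.hasFDerivAt.comp x (ha.differentiable (by simp) x).hasFDerivAt
    have e : fderiv ℝ (fun x => (a x : ℂ)) x = _ := this.fderiv
    rw [e]; simp
  have k1 : ∀ j, ip (weakPartial j fun x => (a x : ℂ)) (weakPartial j f)
      = -∫ x, fderiv ℝ (fun y => fderiv ℝ a y (unitVec j)) x (unitVec j) • f x := fun j => by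
    have h1 := (hf.2.hasWeakPartial j).integral_eq (fun y => fderiv ℝ a y (unitVec j))
      (contDiff_fderiv_apply ha _) (hasCompactSupport_fderiv_apply hc _)
    rw [h1, neg_neg, ip_congr (hasWeakPartial_of_contDiff (haC.of_le (by simp)) j).weakPartial_ae_eq
      EventuallyEq.rfl, ip]
    refine integral_congr_ae (Eventually.of_forall fun x => ?_)
    simp only [hder, Complex.conj_ofReal, Complex.real_smul]
  have k2 : ∑ j, ip (weakPartial j fun x => (a x : ℂ)) (weakPartial j f)
      = -∫ x, Laplacian.laplacian a x • f x := by
    simp only [k1, laplacian_eq_sum ha, Finset.sum_smul, Finset.sum_neg_distrib]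
    rw [integral_finsetSum]
    intro j _
    have h1 := contDiff_fderiv_apply (contDiff_fderiv_apply ha (unitVec j)) (unitVec j)
    exact integrable_test_smul h1.continuous (hasCompactSupport_fderiv_apply
      (hasCompactSupport_fderiv_apply hc _) _) hloc
  have i1 : ∀ j, Integrable (fun x => conj (coordMul j (fun x => (a x : ℂ)) x) * coordMul j f x)
      volume := fun j => by
    have h1 : Continuous fun x : Space n => x j * x j * a x := by
      have := ha.continuous
      fun_prop
    refine (integrable_test_smul h1 hc.mul_left hloc).congr (Eventually.of_forall fun x => ?_)
    simp only [coordMul, map_mul, Complex.conj_ofReal, Complex.real_smul]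
    push_cast; ring
  have k3 : -(κ / 2 : ℂ) * ∑ j, ip (coordMul j fun x => (a x : ℂ)) (coordMul j f)
      = ∫ x, a x • ((quadPot κ x : ℂ) * f x) := by
    simp only [ip]
    rw [← integral_finsetSum _ fun j _ => i1 j, ← integral_const_mul]
    refine integral_congr_ae (Eventually.of_forall fun x => ?_)
    simp only [coordMul, map_mul, Complex.conj_ofReal, Complex.real_smul, quadPot]
    rw [EuclideanSpace.norm_sq_eq]
    simp only [Real.norm_eq_abs, sq_abs]
    push_cast
    rw [show ∀ S : ℂ, (a x : ℂ) * (-((κ * S) / 2) * f x) = (-(κ / 2) * a x * f x) * S from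
      fun S => by ring, Finset.mul_sum, Finset.mul_sum]
    refine Finset.sum_congr rfl fun j _ => ?_
    ring
  have k4 : (lam : ℂ) * ip (fun x => (a x : ℂ)) (fun x => powNL σ (f x))
      = ∫ x, a x • (((lam * ‖f x‖ ^ (2 * σ) : ℝ) : ℂ) * f x) := by
    rw [ip, ← integral_const_mul]
    refine integral_congr_ae (Eventually.of_forall fun x => ?_)
    simp only [Complex.conj_ofReal, Complex.real_smul, powNL]
    push_cast; ring
  have i2 : Integrable (fun x => a x • ((quadPot κ x : ℂ) * f x)) volume := by
    have h1 : Continuous fun x : Space n => a x * quadPot κ x := by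
      have := ha.continuous
      unfold quadPot
      fun_prop
    refine (integrable_test_smul h1 hc.mul_right hloc).congr (Eventually.of_forall fun x => ?_)
    simp only [Complex.real_smul]
    push_cast; ring
  have i3 : Integrable (fun x => a x • (((lam * ‖f x‖ ^ (2 * σ) : ℝ) : ℂ) * f x)) volume := by
    have h1 : MemLp (fun x => (a x : ℂ)) (ENNReal.ofReal (2 * σ + 2)) volume :=
      haC.continuous.memLp_of_hasCompactSupport (hc.comp_left (g := Complex.ofReal) rfl)
    have h2 := (integrable_conj_mul_of_holder h1 (memLp_powNL hσ hfp)).const_mul (lam : ℂ)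
    refine h2.congr (Eventually.of_forall fun x => ?_)
    simp only [Complex.conj_ofReal, Complex.real_smul, powNL]
    push_cast; ring
  simp only [smul_add]
  rw [integral_add i2 i3, ← k3, ← k4, nlsForm, k2]
  ring

end SolutionTest

/-! ### Time regularity in the dual of `Σ` -/

section Solution

open ComplexConjugate

variable {n : ℕ} {σ lam κ : ℝ} {I : Set ℝ} {u₀ : Space n → ℂ} {u : ℝ → Space n → ℂ} {C : ℝ}

/-- The equation against a complex test function, whose real and imaginary parts are real test
functions. -/
theorem IsSolution.hasDerivAt_test (hu : IsSolution σ lam (quadPot κ) I u₀ u) (hI : IsOpen I)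
    (hσ : 0 < σ) (hC : SigmaEmbeds n σ C) {φ : Space n → ℂ} (hφ : ContDiff ℝ (⊤ : ℕ∞) φ)
    (hc : HasCompactSupport φ) {t : ℝ} (ht : t ∈ I) :
    HasDerivAt (fun s => ip φ (u s)) (-Complex.I * nlsForm σ lam κ (u t) φ) t := by
  have real_case : ∀ a : Space n → ℝ, ContDiff ℝ (⊤ : ℕ∞) a → HasCompactSupport a →
      HasDerivAt (fun s => ip (fun x => (a x : ℂ)) (u s))
        (-Complex.I * nlsForm σ lam κ (u t) (fun x => (a x : ℂ))) t := by
    intro a ha hac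
    obtain ⟨d, hd, he⟩ := hu.equation a ha hac t ht
    have h1 := nlsForm_ofReal (lam := lam) (κ := κ) hσ (hu.memSigma t ht)
      (hC.2 _ (hu.memSigma t ht)).1 ha hac
    rw [← he] at h1
    have h2 : -Complex.I * nlsForm σ lam κ (u t) (fun x => (a x : ℂ)) = d := by
      rw [h1]
      linear_combination (-d) * Complex.I_mul_I
    rw [h2]
    refine (hd.hasDerivAt (hI.mem_nhds ht)).congr_of_eventuallyEq (Eventually.of_forall fun s => ?_)
    simp only [ip, Complex.conj_ofReal, Complex.real_smul]
  have hre : ContDiff ℝ (⊤ : ℕ∞) fun x => (φ x).re := Complex.reCLM.contDiff.comp hφ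
  have him : ContDiff ℝ (⊤ : ℕ∞) fun x => (φ x).im := Complex.imCLM.contDiff.comp hφ
  have hrec : HasCompactSupport fun x => (φ x).re := hc.comp_left (g := Complex.re) rfl
  have himc : HasCompactSupport fun x => (φ x).im := hc.comp_left (g := Complex.im) rfl
  set a : Space n → ℂ := fun x => ((φ x).re : ℂ) with ha
  set b : Space n → ℂ := fun x => ((φ x).im : ℂ) with hb
  have haS : MemSigma a := memSigma_of_contDiff (Complex.ofRealCLM.contDiff.comp hre)
    (hrec.comp_left (g := Complex.ofReal) rfl)
  have hbS : MemSigma b := memSigma_of_contDiff (Complex.ofRealCLM.contDiff.comp him)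
    (himc.comp_left (g := Complex.ofReal) rfl)
  have hdec : φ = a - (-Complex.I) • b := by
    funext x
    simp only [ha, hb, Pi.sub_apply, Pi.smul_apply, smul_eq_mul, neg_mul, sub_neg_eq_add]
    rw [mul_comm, Complex.re_add_im]
  have hip : ∀ s ∈ I, ip φ (u s) = ip a (u s) - Complex.I * ip b (u s) := by
    intro s hs
    rw [hdec, ip_sub_left haS.memLp (hbS.memLp.const_smul _) (hu.memSigma s hs).memLp]
    congr 1
    rw [show (-Complex.I) • b = fun x => (-Complex.I) * b x from rfl, ip_const_mul_left]
    simp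
  have h1 := (real_case _ hre hrec).sub ((real_case _ him himc).const_mul Complex.I)
  rw [hdec, nlsForm_sub hσ hC (hu.memSigma t ht) haS (hbS.const_smul _),
    nlsForm_const_smul _ hbS.2, ← hdec]
  refine (h1.congr_of_eventuallyEq ?_).congr_deriv ?_
  · filter_upwards [hI.mem_nhds ht] with s hs
    exact hip s hs
  · simp only [map_neg, Complex.conj_I, ← ha, ← hb]
    ring

/-- A constant in the bound of `‖uₜ‖` in the dual of `Σ` where `‖u‖ ≤ M`. -/
noncomputable def formBound (n : ℕ) (σ lam κ C M : ℝ) : ℝ :=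
  1 / 2 * n * M + |κ| / 2 * n * M + |lam| * C * (C * M) ^ (2 * σ + 1)

theorem formBound_nonneg {M : ℝ} (hC : 0 < C) (hM : 0 ≤ M) : 0 ≤ formBound n σ lam κ C M := by
  unfold formBound; positivity

theorem norm_ip_le_sigmaNorm {f ψ : Space n → ℂ} (hψ : MemSigma ψ) (hf : MemLp f 2 volume) :
    ‖ip ψ f‖ ≤ sigmaNorm ψ * lpNorm f 2 volume :=
  (norm_ip_le hψ.memLp hf).trans (mul_le_mul_of_nonneg_right hψ.lpNorm_le lpNorm_nonneg)

theorem MemSigma.exists_contDiff_sigmaNorm {ψ : Space n → ℂ} (hψ : MemSigma ψ) {ε : ℝ}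
    (hε : 0 < ε) : ∃ φ : Space n → ℂ, ContDiff ℝ (⊤ : ℕ∞) φ ∧ HasCompactSupport φ ∧
      MemSigma φ ∧ sigmaNorm (ψ - φ) ≤ ε := by
  obtain ⟨φ, h1, h2, h3⟩ := hψ.exists_contDiff (ENNReal.ofReal_pos.2 hε)
  exact ⟨φ, h1, h2, memSigma_of_contDiff h1 h2, ENNReal.toReal_le_of_le_ofReal hε.le h3⟩

theorem sigmaNorm_le_add {f g : Space n → ℂ} (hf : MemSigma f) (hg : MemSigma g) :
    sigmaNorm f ≤ sigmaNorm g + sigmaNorm (f - g) := by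
  have h := sigmaNorm_add_le hg (hf.sub hg)
  rwa [add_sub_cancel] at h

/-- `u` is Lipschitz in time with values in the dual of `Σ`. For a test function this is the
mean value inequality; in general `ψ` is approximated by test functions. -/
theorem IsSolution.norm_ip_sub_le (hu : IsSolution σ lam (quadPot κ) I u₀ u) (hI : IsOpen I)
    (hσ : 0 < σ) (hC : SigmaEmbeds n σ C) {S : Set ℝ} (hS : Convex ℝ S) (hSI : S ⊆ I) {M : ℝ}
    (hM : ∀ s ∈ S, sigmaNorm (u s) ≤ M) {ψ : Space n → ℂ} (hψ : MemSigma ψ) {s t : ℝ}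
    (hs : s ∈ S) (ht : t ∈ S) :
    ‖ip ψ (u s - u t)‖ ≤ formBound n σ lam κ C M * sigmaNorm ψ * |s - t| := by
  have hM0 : 0 ≤ M := (sigmaNorm_nonneg _).trans (hM s hs)
  have hB := formBound_nonneg (n := n) (σ := σ) (lam := lam) (κ := κ) hC.1 hM0
  have hus := hu.memSigma s (hSI hs)
  have hut := hu.memSigma t (hSI ht)
  have test : ∀ φ : Space n → ℂ, ContDiff ℝ (⊤ : ℕ∞) φ → HasCompactSupport φ → MemSigma φ →
      ‖ip φ (u s - u t)‖ ≤ formBound n σ lam κ C M * sigmaNorm φ * |s - t| := by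
    intro φ hφ hc hφS
    have h1 := Convex.norm_image_sub_le_of_norm_hasDerivWithin_le (s := S) (x := t) (y := s)
      (f := fun s => ip φ (u s)) (C := formBound n σ lam κ C M * sigmaNorm φ)
      (fun r hr => (hu.hasDerivAt_test hI hσ hC hφ hc (hSI hr)).hasDerivWithinAt)
      (fun r hr => by
        rw [norm_mul, norm_neg, Complex.norm_I, one_mul]
        exact norm_nlsForm_le hσ hC (hu.memSigma r (hSI hr)) hφS (hM r hr)) hS ht hs
    rwa [ip_sub_right hφS.memLp hus.memLp hut.memLp]
  refine le_of_forall_pos_le_add fun ε hε => ?_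
  -- With `K` chosen as follows, an approximation of `ψ` up to `ε / K` costs at most `ε`.
  set K := formBound n σ lam κ C M * |s - t| + lpNorm (u s - u t) 2 volume + 1 with hK
  have hKpos : 0 < K := by
    have := lpNorm_nonneg (f := u s - u t) (p := 2) (μ := volume)
    positivity
  obtain ⟨φ, h1, h2, h3, h4⟩ := hψ.exists_contDiff_sigmaNorm (ε := ε / K) (by positivity)
  have e : ip ψ (u s - u t) = ip φ (u s - u t) + ip (ψ - φ) (u s - u t) := by
    rw [ip_sub_left hψ.memLp h3.memLp (hus.memLp.sub hut.memLp)]; ring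
  have h5 : sigmaNorm φ ≤ sigmaNorm ψ + ε / K := by
    have h6 := sigmaNorm_le_add h3 hψ
    have h7 : sigmaNorm (φ - ψ) = sigmaNorm (ψ - φ) := by
      rw [sigmaNorm, sigmaNorm, ← neg_sub, sigmaENorm_neg (hψ.2.sub h3.2)]
    linarith
  rw [e]
  calc _ ≤ formBound n σ lam κ C M * sigmaNorm φ * |s - t|
        + sigmaNorm (ψ - φ) * lpNorm (u s - u t) 2 volume :=
        (norm_add_le _ _).trans (add_le_add (test φ h1 h2 h3)
          (norm_ip_le_sigmaNorm (hψ.sub h3) (hus.memLp.sub hut.memLp)))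
    _ ≤ formBound n σ lam κ C M * (sigmaNorm ψ + ε / K) * |s - t|
        + ε / K * lpNorm (u s - u t) 2 volume := by
        gcongr
        exact lpNorm_nonneg
    _ = formBound n σ lam κ C M * sigmaNorm ψ * |s - t| + ε / K * (K - 1) := by
        rw [hK]; ring
    _ ≤ _ := by
        have : ε / K * (K - 1) ≤ ε / K * K := by gcongr; linarith
        rw [div_mul_cancel₀ _ hKpos.ne'] at this
        linarith

theorem IsSolution.tendsto_sigmaNorm_sub (hu : IsSolution σ lam (quadPot κ) I u₀ u)
    (hI : IsOpen I) {t : ℝ} (ht : t ∈ I) :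
    Tendsto (fun s => sigmaNorm (u s - u t)) (𝓝 t) (𝓝 0) := by
  have h1 := hu.continuous_sigma t ht
  rw [hI.nhdsWithin_eq ht] at h1
  exact (ENNReal.tendsto_toReal ENNReal.zero_ne_top).comp h1

theorem IsSolution.exists_local_bound (hu : IsSolution σ lam (quadPot κ) I u₀ u)
    (hI : IsOpen I) {t : ℝ} (ht : t ∈ I) :
    ∃ δ > 0, Metric.ball t δ ⊆ I ∧ ∀ s ∈ Metric.ball t δ, sigmaNorm (u s) ≤ sigmaNorm (u t) + 1 := by
  have h1 : ∀ᶠ s in 𝓝 t, s ∈ I ∧ sigmaNorm (u s - u t) < 1 :=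
    Filter.Eventually.and (hI.mem_nhds ht) ((hu.tendsto_sigmaNorm_sub hI ht).eventually (gt_mem_nhds one_pos))
  obtain ⟨δ, hδ, hb⟩ := Metric.eventually_nhds_iff_ball.1 h1
  refine ⟨δ, hδ, fun s hs => (hb s hs).1, fun s hs => ?_⟩
  have := sigmaNorm_le_add (hu.memSigma s (hb s hs).1) (hu.memSigma t ht)
  linarith [(hb s hs).2]

/-- The equation may be tested with any element of `Σ`: the error made by replacing `ψ` with a test
function is uniformly small in the difference quotients, by `IsSolution.norm_ip_sub_le`. -/
theorem IsSolution.hasDerivAt_ip (hu : IsSolution σ lam (quadPot κ) I u₀ u) (hI : IsOpen I)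
    (hσ : 0 < σ) (hC : SigmaEmbeds n σ C) {ψ : Space n → ℂ} (hψ : MemSigma ψ) {t : ℝ}
    (ht : t ∈ I) :
    HasDerivAt (fun s => ip ψ (u s)) (-Complex.I * nlsForm σ lam κ (u t) ψ) t := by
  obtain ⟨δ, hδ, hball, hM⟩ := hu.exists_local_bound hI ht
  set M := sigmaNorm (u t) + 1 with hMdef
  set B := formBound n σ lam κ C M with hB
  have hM0 : 0 ≤ M := by have := sigmaNorm_nonneg (u t); linarith
  have hB0 : 0 ≤ B := formBound_nonneg hC.1 hM0
  have hut := hu.memSigma t ht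
  rw [hasDerivAt_iff_isLittleO, Asymptotics.isLittleO_iff]
  intro c hc
  obtain ⟨φ, h1, h2, h3, h4⟩ := hψ.exists_contDiff_sigmaNorm (ε := c / (4 * (B + 1)))
    (by positivity)
  have h5 := hu.hasDerivAt_test hI hσ hC h1 h2 ht
  rw [hasDerivAt_iff_isLittleO, Asymptotics.isLittleO_iff] at h5
  filter_upwards [h5 (half_pos hc), Metric.ball_mem_nhds t hδ] with s hs1 hs2
  have hus := hu.memSigma s (hball hs2)
  have h6 := hu.norm_ip_sub_le hI hσ hC (convex_ball t δ) hball hM (hψ.sub h3) hs2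
    (Metric.mem_ball_self hδ)
  have h7 : ‖nlsForm σ lam κ (u t) (ψ - φ)‖ ≤ B * sigmaNorm (ψ - φ) :=
    norm_nlsForm_le hσ hC hut (hψ.sub h3) (by linarith)
  rw [nlsForm_sub hσ hC hut hψ h3] at h7
  rw [ip_sub_left hψ.memLp h3.memLp (hus.memLp.sub hut.memLp),
    ip_sub_right hψ.memLp hus.memLp hut.memLp, ip_sub_right h3.memLp hus.memLp hut.memLp] at h6
  have h8 : B * sigmaNorm (ψ - φ) ≤ c / 4 := by
    calc B * sigmaNorm (ψ - φ) ≤ (B + 1) * (c / (4 * (B + 1))) :=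
          mul_le_mul (by linarith) h4 (sigmaNorm_nonneg _) (by linarith)
      _ = c / 4 := by field_simp
  have e : ip ψ (u s) - ip ψ (u t) - (s - t) • (-Complex.I * nlsForm σ lam κ (u t) ψ)
      = (ip ψ (u s) - ip ψ (u t) - (ip φ (u s) - ip φ (u t)))
        + (ip φ (u s) - ip φ (u t) - (s - t) • (-Complex.I * nlsForm σ lam κ (u t) φ))
        + ((s - t : ℝ) : ℂ) * (Complex.I
          * (nlsForm σ lam κ (u t) ψ - nlsForm σ lam κ (u t) φ)) := by
    simp only [Complex.real_smul]
    ring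
  rw [e]
  have h9 : ‖((s - t : ℝ) : ℂ) * (Complex.I
      * (nlsForm σ lam κ (u t) ψ - nlsForm σ lam κ (u t) φ))‖ ≤ |s - t| * (c / 4) := by
    rw [norm_mul, norm_mul, Complex.norm_I, one_mul, Complex.norm_real, Real.norm_eq_abs]
    exact mul_le_mul_of_nonneg_left (h7.trans h8) (abs_nonneg _)
  refine (norm_add_le _ _).trans ((add_le_add ((norm_add_le _ _).trans (add_le_add
    (h6.trans (mul_le_mul_of_nonneg_right h8 (abs_nonneg _))) hs1)) h9).trans (le_of_eq ?_))
  rw [Real.norm_eq_abs]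
  ring

/-- In the weak form of the equation the test function may depend on time. -/
theorem IsSolution.tendsto_ip_slope (hu : IsSolution σ lam (quadPot κ) I u₀ u) (hI : IsOpen I)
    (hσ : 0 < σ) (hC : SigmaEmbeds n σ C) {ψ : ℝ → Space n → ℂ} (hψ : ∀ s ∈ I, MemSigma (ψ s))
    {t : ℝ} (ht : t ∈ I) (hψt : Tendsto (fun s => sigmaNorm (ψ s - ψ t)) (𝓝 t) (𝓝 0)) :
    Tendsto (fun s => ((s - t : ℝ) : ℂ)⁻¹ * ip (ψ s) (u s - u t)) (𝓝[≠] t)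
      (𝓝 (-Complex.I * nlsForm σ lam κ (u t) (ψ t))) := by
  obtain ⟨δ, hδ, hball, hM⟩ := hu.exists_local_bound hI ht
  set M := sigmaNorm (u t) + 1 with hMdef
  have h1 := hasDerivAt_iff_tendsto_slope.1 (hu.hasDerivAt_ip hI hσ hC (hψ t ht) ht)
  have h2 : Tendsto (fun s => ((s - t : ℝ) : ℂ)⁻¹ * ip (ψ s - ψ t) (u s - u t)) (𝓝[≠] t)
      (𝓝 0) := by
    have h3 : Tendsto (fun s => formBound n σ lam κ C M * sigmaNorm (ψ s - ψ t)) (𝓝[≠] t)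
        (𝓝 0) := by
      simpa using (hψt.mono_left nhdsWithin_le_nhds).const_mul (formBound n σ lam κ C M)
    refine squeeze_zero_norm' ?_ h3
    filter_upwards [self_mem_nhdsWithin, nhdsWithin_le_nhds (Metric.ball_mem_nhds t hδ)]
      with s hs hs2
    have h4 := hu.norm_ip_sub_le hI hσ hC (convex_ball t δ) hball hM
      ((hψ s (hball hs2)).sub (hψ t ht)) hs2 (Metric.mem_ball_self hδ)
    have h5 : 0 < |s - t| := abs_pos.2 (sub_ne_zero.2 hs)
    rw [norm_mul, norm_inv, Complex.norm_real, Real.norm_eq_abs, inv_mul_le_iff₀ h5]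
    linarith
  have h6 := h1.add h2
  rw [add_zero] at h6
  refine h6.congr' ?_
  filter_upwards [nhdsWithin_le_nhds (Metric.ball_mem_nhds t hδ)] with s hs
  have hus := (hu.memSigma s (hball hs)).memLp
  have hut := (hu.memSigma t ht).memLp
  rw [ip_sub_left (hψ s (hball hs)).memLp (hψ t ht).memLp (hus.sub hut), slope_def_module,
    ip_sub_right (hψ t ht).memLp hus hut, Complex.real_smul]
  push_cast
  ring

/-- `u` is better than Hölder continuous of order `1/2` in `L²`, because `‖w‖² ≤ ‖w‖_Σ ‖w‖_Σ*`. -/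
theorem IsSolution.tendsto_lpNorm_sq_div (hu : IsSolution σ lam (quadPot κ) I u₀ u) (hI : IsOpen I)
    (hσ : 0 < σ) (hC : SigmaEmbeds n σ C) {t : ℝ} (ht : t ∈ I) :
    Tendsto (fun s => lpNorm (u s - u t) 2 volume ^ 2 / |s - t|) (𝓝[≠] t) (𝓝 0) := by
  obtain ⟨δ, hδ, hball, hM⟩ := hu.exists_local_bound hI ht
  set M := sigmaNorm (u t) + 1 with hMdef
  have h3 : Tendsto (fun s => formBound n σ lam κ C M * sigmaNorm (u s - u t)) (𝓝[≠] t)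
      (𝓝 0) := by
    simpa using ((hu.tendsto_sigmaNorm_sub hI ht).mono_left nhdsWithin_le_nhds).const_mul
      (formBound n σ lam κ C M)
  refine squeeze_zero' (Eventually.of_forall fun s => by positivity) ?_ h3
  filter_upwards [self_mem_nhdsWithin, nhdsWithin_le_nhds (Metric.ball_mem_nhds t hδ)]
    with s hs hs2
  have hw := (hu.memSigma s (hball hs2)).sub (hu.memSigma t ht)
  have h4 := hu.norm_ip_sub_le hI hσ hC (convex_ball t δ) hball hM hw hs2 (Metric.mem_ball_self hδ)
  have h5 : 0 < |s - t| := abs_pos.2 (sub_ne_zero.2 hs)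
  rw [ip_self hw.memLp, Complex.norm_real, Real.norm_of_nonneg (by positivity)] at h4
  rw [div_le_iff₀ h5]
  exact h4

end Solution
/-! ### The unitary groups `exp (i r (α xⱼ + i β ∂ⱼ))` -/

section PhaseShift

open ComplexConjugate

variable {n : ℕ} {f g : Space n → ℂ} {j k : Fin n} {α β r : ℝ}

/-- The phase `r α (xⱼ - r β / 2)` of `exp (i r (α xⱼ + i β ∂ⱼ))`. -/
noncomputable def shiftPhase (j : Fin n) (α β r : ℝ) (x : Space n) : ℝ :=
  r * α * (x j - r * β / 2)

/-- The one-parameter unitary group `exp (i r Dⱼ)` generated by `Dⱼ = α xⱼ + i β ∂ⱼ`. -/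
noncomputable def phaseShift (j : Fin n) (α β r : ℝ) (f : Space n → ℂ) (x : Space n) : ℂ :=
  Complex.exp (Complex.I * (shiftPhase j α β r x : ℝ)) * f (x - (r * β) • unitVec j)

/-- `i Dⱼ f`, with `Dⱼ = α xⱼ + i β ∂ⱼ`. -/
noncomputable def shiftGenerator (j : Fin n) (α β : ℝ) (f : Space n → ℂ) (x : Space n) : ℂ :=
  Complex.I * α * coordMul j f x - β * weakPartial j f x

theorem continuous_shiftPhase : Continuous (shiftPhase j α β r) := by
  unfold shiftPhase; fun_prop

theorem contDiff_shiftPhase : ContDiff ℝ (⊤ : ℕ∞) (shiftPhase j α β r) := by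
  unfold shiftPhase
  have : ContDiff ℝ (⊤ : ℕ∞) fun x : Space n => x j :=
    (EuclideanSpace.proj (𝕜 := ℝ) j).contDiff
  exact contDiff_const.mul (this.sub contDiff_const)

theorem unitVec_apply : (unitVec j : Space n) k = if k = j then 1 else 0 := by
  simp [unitVec]

theorem hasFDerivAt_shiftPhase (x : Space n) :
    HasFDerivAt (shiftPhase j α β r) ((r * α) • EuclideanSpace.proj (𝕜 := ℝ) j) x :=
  (((EuclideanSpace.proj (𝕜 := ℝ) j).hasFDerivAt (x := x)).sub_const (r * β / 2)).const_mul (r * α)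

theorem norm_phaseShift (x : Space n) :
    ‖phaseShift j α β r f x‖ = ‖f (x - (r * β) • unitVec j)‖ := by
  rw [phaseShift, norm_mul, mul_comm Complex.I, Complex.norm_exp_ofReal_mul_I, one_mul]

theorem aestronglyMeasurable_phaseShift (hf : AEStronglyMeasurable f volume) :
    AEStronglyMeasurable (phaseShift j α β r f) volume := by
  have h1 : Continuous fun x : Space n => Complex.exp (Complex.I * (shiftPhase j α β r x : ℝ)) := by
    have := continuous_shiftPhase (j := j) (α := α) (β := β) (r := r)
    fun_prop
  exact h1.aestronglyMeasurable.mul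
    (hf.comp_measurePreserving (measurePreserving_sub_right volume _))

theorem eLpNorm_phaseShift (hf : AEStronglyMeasurable f volume) (p : ℝ≥0∞) :
    eLpNorm (phaseShift j α β r f) p volume = eLpNorm f p volume := by
  rw [← eLpNorm_translate hf ((r * β) • unitVec j)]
  exact eLpNorm_congr_norm_ae (Eventually.of_forall fun x => norm_phaseShift x)

theorem memLp_phaseShift {p : ℝ≥0∞} (hf : MemLp f p volume) :
    MemLp (phaseShift j α β r f) p volume :=
  ⟨aestronglyMeasurable_phaseShift hf.1, by rw [eLpNorm_phaseShift hf.1]; exact hf.2⟩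

theorem phaseShift_sub : phaseShift j α β r (f - g)
    = phaseShift j α β r f - phaseShift j α β r g := by
  funext x; simp only [phaseShift, Pi.sub_apply]; ring

/-- The adjoint of `exp (i r Dⱼ)` is `exp (-i r Dⱼ)`. -/
theorem ip_phaseShift_left : ip (phaseShift j α β r f) g = ip f (phaseShift j α β (-r) g) := by
  rw [ip, ip, ← integral_sub_right_eq_self (fun x => conj (f x) * phaseShift j α β (-r) g x)
    ((r * β) • unitVec j)]
  congr 1; funext x
  rw [phaseShift, phaseShift, map_mul, ← Complex.exp_conj]
  have h1 : x - (r * β) • unitVec j - (-r * β) • unitVec j = x := by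
    rw [neg_mul, neg_smul, sub_neg_eq_add, sub_add_cancel]
  have h2 : conj (Complex.I * (shiftPhase j α β r x : ℝ))
      = Complex.I * (shiftPhase j α β (-r) (x - (r * β) • unitVec j) : ℝ) := by
    simp only [map_mul, Complex.conj_I, Complex.conj_ofReal, shiftPhase, PiLp.sub_apply,
      PiLp.smul_apply, unitVec_apply, if_true, smul_eq_mul]
    push_cast; ring
  rw [h1, h2]; ring

theorem phaseShift_neg_phaseShift : phaseShift j α β (-r) (phaseShift j α β r f) = f := by
  funext x
  rw [phaseShift, phaseShift, ← mul_assoc, ← Complex.exp_add]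
  have h1 : x - (-r * β) • unitVec j - (r * β) • unitVec j = x := by
    rw [neg_mul, neg_smul, sub_neg_eq_add, add_sub_cancel_right]
  have h2 : Complex.I * (shiftPhase j α β (-r) x : ℝ)
      + Complex.I * (shiftPhase j α β r (x - (-r * β) • unitVec j) : ℝ) = 0 := by
    simp only [shiftPhase, PiLp.sub_apply, PiLp.smul_apply, unitVec_apply, if_true, smul_eq_mul]
    push_cast; ring
  rw [h1, h2, Complex.exp_zero, one_mul]

theorem HasWeakPartial.phaseShift (h : HasWeakPartial k f g) :
    HasWeakPartial k (phaseShift j α β r f) fun x => phaseShift j α β r g x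
      + (if k = j then Complex.I * (r * α) else 0) * phaseShift j α β r f x := by
  have h1 := h.comp_sub_right ((r * β) • unitVec j)
  have hcos : ContDiff ℝ (⊤ : ℕ∞) fun x => Real.cos (shiftPhase j α β r x) :=
    Real.contDiff_cos.comp contDiff_shiftPhase
  have hsin : ContDiff ℝ (⊤ : ℕ∞) fun x => Real.sin (shiftPhase j α β r x) :=
    Real.contDiff_sin.comp contDiff_shiftPhase
  have h2 := (h1.smooth_smul hcos).add ((h1.smooth_smul hsin).const_smul Complex.I)
  have hexp : ∀ x, Complex.exp (Complex.I * (shiftPhase j α β r x : ℝ))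
      = (Real.cos (shiftPhase j α β r x) : ℝ) + Complex.I * (Real.sin (shiftPhase j α β r x) : ℝ) :=
    fun x => by rw [mul_comm, Complex.exp_mul_I, Complex.ofReal_cos, Complex.ofReal_sin]; ring
  refine h2.congr (Eventually.of_forall fun x => ?_) (Eventually.of_forall fun x => ?_)
  · simp only [HarmonicNLS.phaseShift, hexp, Pi.add_apply, Pi.smul_apply, Complex.real_smul,
      smul_eq_mul]
    ring
  · have e1 : fderiv ℝ (fun x => Real.cos (shiftPhase j α β r x)) x = _ :=
      (hasFDerivAt_shiftPhase x).cos.fderiv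
    have e2 : fderiv ℝ (fun x => Real.sin (shiftPhase j α β r x)) x = _ :=
      (hasFDerivAt_shiftPhase x).sin.fderiv
    simp only [HarmonicNLS.phaseShift, hexp, Pi.add_apply, Pi.smul_apply, Complex.real_smul,
      smul_eq_mul, e1, e2]
    have e3 : EuclideanSpace.proj (𝕜 := ℝ) j (unitVec k) = if k = j then (1 : ℝ) else 0 := by
      have : EuclideanSpace.proj (𝕜 := ℝ) j (unitVec k) = (unitVec k : Space n) j := rfl
      rw [this, unitVec_apply]
      simp only [eq_comm]
    simp only [smul_apply, e3, smul_eq_mul]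
    split_ifs
    · push_cast
      linear_combination (-(r * α * Complex.sin (shiftPhase j α β r x : ℝ)
        * f (x - (r * β) • unitVec j))) * Complex.I_mul_I
    · push_cast; ring

theorem coordMul_phaseShift (x : Space n) : coordMul k (phaseShift j α β r f) x
    = phaseShift j α β r (coordMul k f) x
      + (if k = j then (r * β : ℂ) else 0) * phaseShift j α β r f x := by
  simp only [coordMul, phaseShift, PiLp.sub_apply, PiLp.smul_apply, unitVec_apply, smul_eq_mul]
  split_ifs <;> push_cast <;> ring

theorem memLp_norm_smul_of_coordMul (hf : AEStronglyMeasurable f volume)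
    (h : ∀ k, MemLp (coordMul k f) 2 volume) : MemLp (fun x => ‖x‖ • f x) 2 volume := by
  have h1 : MemLp (fun x => ∑ k, ‖coordMul k f x‖) 2 volume :=
    memLp_finsetSum Finset.univ fun k _ => (h k).norm
  refine h1.mono (aestronglyMeasurable_norm_smul hf) (Eventually.of_forall fun x => ?_)
  rw [norm_smul, norm_norm]
  refine le_trans (mul_le_mul_of_nonneg_right (norm_le_sum_norm_apply x) (norm_nonneg _)) ?_
  refine le_trans (le_of_eq ?_) (Real.le_norm_self _)
  simp only [Finset.sum_mul, coordMul, norm_mul, Complex.norm_real]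

theorem MemSigma.memLp_shift_partial (hf : MemSigma f) (k : Fin n) :
    MemLp (fun x => HarmonicNLS.phaseShift j α β r (weakPartial k f) x
      + (if k = j then Complex.I * (r * α) else 0) * HarmonicNLS.phaseShift j α β r f x) 2 volume :=
  (memLp_phaseShift (hf.memLp_weakPartial k)).add ((memLp_phaseShift hf.memLp).const_mul _)

theorem MemSigma.phaseShift (hf : MemSigma f) : MemSigma (phaseShift j α β r f) := by
  refine memSigma_of_hasWeakPartial (memLp_phaseShift hf.memLp)
    (fun k => (hf.2.hasWeakPartial k).phaseShift) (fun k => hf.memLp_shift_partial k)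
    (memLp_norm_smul_of_coordMul (memLp_phaseShift hf.memLp).1 fun k => ?_)
  have h1 : MemLp (fun x => HarmonicNLS.phaseShift j α β r (coordMul k f) x
      + (if k = j then (r * β : ℂ) else 0) * HarmonicNLS.phaseShift j α β r f x) 2 volume :=
    (memLp_phaseShift (hf.memLp_coordMul k)).add ((memLp_phaseShift hf.memLp).const_mul _)
  exact h1.ae_eq (Eventually.of_forall fun x => (coordMul_phaseShift x).symm)

theorem sigmaENorm_phaseShift_le (hf : MemSigma f) : sigmaENorm (phaseShift j α β r f)
    ≤ (2 + n * (1 + ‖r * α‖ₑ) + ‖r * β‖ₑ) * sigmaENorm f := by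
  have m0 := hf.1
  have m1 := aestronglyMeasurable_phaseShift (j := j) (α := α) (β := β) (r := r) m0
  have b0 : eLpNorm f 2 volume ≤ sigmaENorm f :=
    le_trans (self_le_add_right _ _) (self_le_add_right _ _)
  have bk : ∀ k, eLpNorm (weakPartial k f) 2 volume ≤ sigmaENorm f := fun k =>
    (eLpNorm_weakPartial_le f k 2).trans (le_trans (self_le_add_left _ _) (self_le_add_right _ _))
  have bx : eLpNorm (fun x => ‖x‖ • f x) 2 volume ≤ sigmaENorm f := self_le_add_left _ _
  have hshift : eLpNorm (HarmonicNLS.phaseShift j α β r f) 2 volume = eLpNorm f 2 volume :=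
    eLpNorm_phaseShift m0 2
  refine (sigmaENorm_le_of_hasWeakPartial fun k => (hf.2.hasWeakPartial k).phaseShift).trans ?_
  have s1 : ∀ k, eLpNorm (fun x => HarmonicNLS.phaseShift j α β r (weakPartial k f) x
      + (if k = j then Complex.I * (r * α) else 0) * HarmonicNLS.phaseShift j α β r f x) 2 volume
      ≤ (1 + ‖r * α‖ₑ) * sigmaENorm f := by
    intro k
    refine (eLpNorm_add_le (aestronglyMeasurable_phaseShift (hf.memLp_weakPartial k).1)
      (m1.const_mul _) (by norm_num)).trans ?_
    rw [add_mul, one_mul, eLpNorm_phaseShift (hf.memLp_weakPartial k).1]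
    refine add_le_add (bk k) ?_
    have h2 : eLpNorm (fun x => (if k = j then Complex.I * (r * α) else 0)
        * HarmonicNLS.phaseShift j α β r f x) 2 volume
        ≤ eLpNorm ((r * α : ℝ) • HarmonicNLS.phaseShift j α β r f) 2 volume := by
      refine eLpNorm_mono fun x => ?_
      simp only [Pi.smul_apply, norm_smul, norm_mul]
      gcongr
      split_ifs
      · simp
      · rw [norm_zero]; positivity
    refine h2.trans ?_
    rw [eLpNorm_const_smul, hshift]
    gcongr
  have s2 : eLpNorm (fun x => ‖x‖ • HarmonicNLS.phaseShift j α β r f x) 2 volume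
      ≤ (1 + ‖r * β‖ₑ) * sigmaENorm f := by
    have h1 : eLpNorm (fun x => ‖x‖ • HarmonicNLS.phaseShift j α β r f x) 2 volume
        ≤ eLpNorm ((fun x => ‖HarmonicNLS.phaseShift j α β r (fun x => ‖x‖ • f x) x‖)
          + fun x => ‖((r * β : ℝ) • HarmonicNLS.phaseShift j α β r f) x‖) 2 volume := by
      refine eLpNorm_mono_real fun x => ?_
      simp only [Pi.add_apply, norm_phaseShift, norm_smul, Pi.smul_apply, norm_norm]
      rw [← add_mul]
      gcongr
      calc ‖x‖ = ‖(x - (r * β) • unitVec j) + (r * β) • unitVec j‖ := by rw [sub_add_cancel]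
        _ ≤ _ := by
          refine (norm_add_le _ _).trans (add_le_add le_rfl ?_)
          rw [norm_smul, unitVec, PiLp.norm_single, norm_one, mul_one]
    have m2 := aestronglyMeasurable_phaseShift (j := j) (α := α) (β := β) (r := r)
      hf.memLp_norm_smul.1
    refine h1.trans ((eLpNorm_add_le m2.norm (m1.const_smul (r * β : ℝ)).norm (by norm_num)).trans ?_)
    rw [eLpNorm_norm, eLpNorm_norm (μ := volume), eLpNorm_phaseShift hf.memLp_norm_smul.1,
      eLpNorm_const_smul, hshift, add_mul, one_mul]
    gcongr
  calc _ ≤ sigmaENorm f + ∑ _k : Fin n, (1 + ‖r * α‖ₑ) * sigmaENorm f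
        + (1 + ‖r * β‖ₑ) * sigmaENorm f := by
        rw [hshift]
        exact add_le_add (add_le_add b0 (Finset.sum_le_sum fun k _ => s1 k)) s2
    _ = _ := by
        rw [Finset.sum_const, Finset.card_univ, Fintype.card_fin, nsmul_eq_mul]
        ring

end PhaseShift

/-! ### Generators of the groups -/

section PhaseShiftLimit

open ComplexConjugate

variable {n : ℕ} {f g : Space n → ℂ} {j : Fin n} {α β : ℝ} {p : ℝ≥0∞}

theorem HasWeakPartial.tendsto_scaled_differenceQuotient (h : HasWeakPartial j f g) (hp1 : 1 ≤ p)
    (hp : p ≠ ∞) (hg : MemLp g p volume) (β : ℝ) :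
    Tendsto (fun r : ℝ => eLpNorm (fun x => r⁻¹ • (f (x - (r * β) • unitVec j) - f x) + β • g x)
      p volume) (𝓝[≠] 0) (𝓝 0) := by
  rcases eq_or_ne β 0 with rfl | hβ
  · simp
  have h1 := h.tendsto_differenceQuotient hp1 hp hg
  have h2 : Tendsto (fun r : ℝ => r * β) (𝓝[≠] 0) (𝓝[≠] 0) := by
    refine tendsto_nhdsWithin_iff.2 ⟨?_, ?_⟩
    · have : Tendsto (fun r : ℝ => r * β) (𝓝 0) (𝓝 (0 * β)) := tendsto_id.mul_const β
      rw [zero_mul] at this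
      exact this.mono_left nhdsWithin_le_nhds
    · filter_upwards [self_mem_nhdsWithin] with r hr
      exact mul_ne_zero hr hβ
  have h3 := ENNReal.Tendsto.const_mul (a := ‖β‖ₑ) (h1.comp h2) (Or.inr (by simp))
  rw [mul_zero] at h3
  refine h3.congr' ?_
  filter_upwards [self_mem_nhdsWithin] with r hr
  rw [Function.comp_apply, ← eLpNorm_const_smul]
  congr 1; funext x
  have hr' : (r : ℝ) ≠ 0 := hr
  simp only [Pi.smul_apply, smul_add, smul_smul]
  congr 2
  field_simp

theorem abs_shiftPhase_le {r : ℝ} (hr : |r| ≤ 1) (x : Space n) :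
    |shiftPhase j α β r x| ≤ |r| * (|α| * (‖x j‖ + |β|)) := by
  rw [shiftPhase, abs_mul, abs_mul, mul_assoc]
  gcongr
  refine (abs_sub _ _).trans (add_le_add (le_of_eq (Real.norm_eq_abs _).symm) ?_)
  rw [abs_div, abs_mul, abs_two]
  have := mul_le_of_le_one_left (abs_nonneg β) hr
  linarith [abs_nonneg β]

theorem norm_phase_sub_one_mul_le {r : ℝ} (hr : |r| ≤ 1) (x : Space n) :
    ‖(Complex.exp (Complex.I * (shiftPhase j α β r x : ℝ)) - 1) * f x‖
      ≤ |r| * (|α| * (‖coordMul j f x‖ + |β| * ‖f x‖)) := by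
  rw [norm_mul]
  refine (mul_le_mul_of_nonneg_right (Real.norm_exp_I_mul_ofReal_sub_one_le.trans
    (abs_shiftPhase_le hr x)) (norm_nonneg _)).trans (le_of_eq ?_)
  rw [coordMul, norm_mul, Complex.norm_real]
  ring

theorem MemSigma.lpNorm_phaseShift_sub_le (hf : MemSigma f) {r : ℝ} (hr : |r| ≤ 1) :
    lpNorm (HarmonicNLS.phaseShift j α β r f - f) 2 volume
      ≤ |r| * (|β| + |α| * (1 + |β|)) * sigmaNorm f := by
  have m1 : MemLp (fun x => f (x - (r * β) • unitVec j) - f x) 2 volume :=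
    (hf.memLp.translate _).sub hf.memLp
  have m2 : MemLp (fun x => |r| * (|α| * (‖coordMul j f x‖ + |β| * ‖f x‖))) 2 volume :=
    (((hf.memLp_coordMul j).norm.add (hf.memLp.norm.const_mul _)).const_mul _).const_mul _
  have h1 : lpNorm (fun x => f (x - (r * β) • unitVec j) - f x) 2 volume
      ≤ |r| * |β| * sigmaNorm f := by
    refine lpNorm_le_of_eLpNorm_le m1.1 (by have := sigmaNorm_nonneg f; positivity) ?_
    refine ((hf.2.hasWeakPartial j).eLpNorm_translate_sub_le (by norm_num) (by simp) _).trans ?_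
    rw [abs_mul, ENNReal.ofReal_mul (by positivity : (0 : ℝ) ≤ |r| * |β|), hf.ofReal_sigmaNorm]
    gcongr
    exact (eLpNorm_weakPartial_le f j 2).trans
      (le_trans (self_le_add_left _ _) (self_le_add_right _ _))
  have h2 : lpNorm (fun x => |r| * (|α| * (‖coordMul j f x‖ + |β| * ‖f x‖))) 2 volume
      ≤ |r| * (|α| * (1 + |β|)) * sigmaNorm f := by
    have e : (fun x => |r| * (|α| * (‖coordMul j f x‖ + |β| * ‖f x‖)))
        = (|r| * |α|) • ((fun x => ‖coordMul j f x‖) + |β| • fun x => ‖f x‖) := by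
      funext x; simp only [Pi.smul_apply, Pi.add_apply, smul_eq_mul]; ring
    have e2 := lpNorm_add_le (μ := (volume : Measure (Space n))) (p := 2)
      (g := |β| • fun x => ‖f x‖) (hf.memLp_coordMul j).norm (by norm_num)
    rw [lpNorm_const_smul, lpNorm_norm (hf.memLp_coordMul j).1, lpNorm_norm hf.memLp.1] at e2
    rw [e, lpNorm_const_smul]
    simp only [Real.norm_eq_abs, abs_mul, abs_abs, coe_nnnorm] at e2 ⊢
    have b1 := hf.lpNorm_coordMul_le j
    have b2 := hf.lpNorm_le
    calc _ ≤ |r| * |α| * (sigmaNorm f + |β| * sigmaNorm f) := by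
          refine mul_le_mul_of_nonneg_left (e2.trans ?_) (by positivity)
          gcongr
      _ = _ := by ring
  have h3 : lpNorm (HarmonicNLS.phaseShift j α β r f - f) 2 volume
      ≤ lpNorm ((fun x => ‖f (x - (r * β) • unitVec j) - f x‖)
        + fun x => |r| * (|α| * (‖coordMul j f x‖ + |β| * ‖f x‖))) 2 volume := by
    refine lpNorm_mono_real (m1.norm.add m2) fun x => ?_
    have e : (HarmonicNLS.phaseShift j α β r f - f) x
        = Complex.exp (Complex.I * (shiftPhase j α β r x : ℝ))
            * (f (x - (r * β) • unitVec j) - f x)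
          + (Complex.exp (Complex.I * (shiftPhase j α β r x : ℝ)) - 1) * f x := by
      simp only [Pi.sub_apply, HarmonicNLS.phaseShift]; ring
    rw [e]
    refine (norm_add_le _ _).trans (add_le_add ?_ (norm_phase_sub_one_mul_le hr x))
    rw [norm_mul, mul_comm Complex.I, Complex.norm_exp_ofReal_mul_I, one_mul]
  refine h3.trans ((lpNorm_add_le m1.norm (by norm_num)).trans ?_)
  rw [lpNorm_norm m1.1]
  calc _ ≤ |r| * |β| * sigmaNorm f + |r| * (|α| * (1 + |β|)) * sigmaNorm f := add_le_add h1 h2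
    _ = _ := by ring

theorem memLp_shiftGenerator (hf : MemSigma f) : MemLp (shiftGenerator j α β f) 2 volume :=
  ((hf.memLp_coordMul j).const_mul _).sub ((hf.memLp_weakPartial j).const_mul _)

theorem tendsto_exp_shiftPhase (x : Space n) :
    Tendsto (fun r : ℝ => Complex.exp (Complex.I * (shiftPhase j α β r x : ℝ))) (𝓝 0) (𝓝 1) := by
  have : Continuous fun r : ℝ => Complex.exp (Complex.I * (shiftPhase j α β r x : ℝ)) := by
    unfold shiftPhase; fun_prop
  simpa [shiftPhase] using this.tendsto 0

theorem tendsto_exp_shiftPhase_sub_div (x : Space n) :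
    Tendsto (fun r : ℝ => (r : ℂ)⁻¹ * (Complex.exp (Complex.I * (shiftPhase j α β r x : ℝ)) - 1))
      (𝓝[≠] 0) (𝓝 (Complex.I * α * ((x j : ℝ) : ℂ))) := by
  have h1 : HasDerivAt (fun r : ℝ => shiftPhase j α β r x) (α * x j) 0 := by
    have h2 : HasDerivAt (fun r : ℝ => r * α * (x j - r * β / 2)) _ 0 :=
      ((hasDerivAt_id (0 : ℝ)).mul_const α).mul
        ((((hasDerivAt_id (0 : ℝ)).mul_const β).div_const 2).const_sub (x j))
    exact h2.congr_deriv (by simp)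
  have h3 := (((h1.ofReal_comp).const_mul Complex.I).cexp).tendsto_slope_zero
  simp only [zero_add] at h3
  have e0 : shiftPhase j α β 0 x = 0 := by simp [shiftPhase]
  simp only [e0, Complex.ofReal_zero, mul_zero, Complex.exp_zero, one_mul] at h3
  refine (h3.congr fun r => ?_).trans (le_of_eq ?_)
  · rw [Complex.real_smul, Complex.ofReal_inv]
  · push_cast; rw [mul_assoc]

/-- On `Σ`, the group `exp (i r Dⱼ)` is differentiable at `r = 0` in `L²`. -/
theorem MemSigma.tendsto_phaseShift_quotient (hf : MemSigma f) {r : ℕ → ℝ}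
    (hr1 : ∀ k, |r k| ≤ 1) (hr0 : ∀ k, r k ≠ 0) (hr : Tendsto r atTop (𝓝 0)) :
    Tendsto (fun k => eLpNorm ((fun x => (r k : ℂ)⁻¹
      * (HarmonicNLS.phaseShift j α β (r k) f x - f x)) - shiftGenerator j α β f) 2 volume)
      atTop (𝓝 0) := by
  set g := weakPartial j f with hg
  have hgm : MemLp g 2 volume := hf.memLp_weakPartial j
  have hr' : Tendsto r atTop (𝓝[≠] 0) :=
    tendsto_nhdsWithin_iff.2 ⟨hr, Eventually.of_forall hr0⟩
  have h1 := ((hf.2.hasWeakPartial j).tendsto_scaled_differenceQuotient (by norm_num) (by simp)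
    hgm β).comp hr'
  set e : ℕ → Space n → ℂ := fun k x => Complex.exp (Complex.I * (shiftPhase j α β (r k) x : ℝ))
    with he
  have hec : ∀ k, Continuous (e k) := fun k => by
    have := continuous_shiftPhase (j := j) (α := α) (β := β) (r := r k)
    simp only [he]; fun_prop
  have hen : ∀ k x, ‖e k x‖ = 1 := fun k x => by
    simp only [he]; rw [mul_comm Complex.I, Complex.norm_exp_ofReal_mul_I]
  set F : ℕ → Space n → ℂ := fun k x => (r k : ℂ)⁻¹ * ((e k x - 1) * f x)
    - Complex.I * α * coordMul j f x - (e k x - 1) * (β * g x) with hF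
  have h2 : Tendsto (fun k => eLpNorm (F k) 2 volume) atTop (𝓝 0) := by
    refine tendsto_eLpNorm_zero_of_dominated (G := fun x =>
      (|α| * (‖coordMul j f x‖ + |β| * ‖f x‖) + |α| * ‖coordMul j f x‖) + 2 * (|β| * ‖g x‖))
      (fun k => ?_) ?_ (fun k x => ?_) fun x => ?_
    · have m1 : AEStronglyMeasurable (fun x => e k x - 1) volume :=
        ((hec k).sub continuous_const).aestronglyMeasurable
      exact (((m1.mul hf.1).const_mul _).sub ((hf.memLp_coordMul j).1.const_mul _)).sub
        (m1.mul (hgm.1.const_mul _))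
    · exact ((((hf.memLp_coordMul j).norm.add (hf.memLp.norm.const_mul _)).const_mul _).add
        ((hf.memLp_coordMul j).norm.const_mul _)).add ((hgm.norm.const_mul _).const_mul _)
    · refine (norm_sub_le _ _).trans (add_le_add ((norm_sub_le _ _).trans (add_le_add ?_ ?_)) ?_)
      · rw [norm_mul, norm_inv, Complex.norm_real, Real.norm_eq_abs,
          inv_mul_le_iff₀ (abs_pos.2 (hr0 k))]
        exact norm_phase_sub_one_mul_le (hr1 k) x
      · simp
      · rw [norm_mul, norm_mul, Complex.norm_real, Real.norm_eq_abs]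
        refine mul_le_mul_of_nonneg_right ((norm_sub_le _ _).trans ?_) (by positivity)
        rw [hen, norm_one]; norm_num
    · have l1 := (tendsto_exp_shiftPhase_sub_div (j := j) (α := α) (β := β) x).comp hr'
      have l2 := (tendsto_exp_shiftPhase (j := j) (α := α) (β := β) x).comp hr
      have l3 := ((l1.mul_const (f x)).sub_const (Complex.I * α * coordMul j f x)).sub
        ((l2.sub_const 1).mul_const (β * g x))
      have e1 : Complex.I * α * ((x j : ℝ) : ℂ) * f x - Complex.I * α * coordMul j f x
          - (1 - 1) * (β * g x) = 0 := by simp only [coordMul]; ring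
      rw [e1] at l3
      refine l3.congr fun k => ?_
      simp only [Function.comp_apply, hF, he]
      ring
  have h3 := h1.add h2
  rw [add_zero] at h3
  refine tendsto_of_tendsto_of_tendsto_of_le_of_le tendsto_const_nhds h3 (fun _ => bot_le)
    fun k => ?_
  have m1 : AEStronglyMeasurable (fun x => (r k)⁻¹ • (f (x - (r k * β) • unitVec j) - f x)
      + β • g x) volume := by
    have h4 : MemLp (fun x => f (x - (r k * β) • unitVec j) - f x) 2 volume :=
      (hf.memLp.translate _).sub hf.memLp
    exact (h4.1.const_smul (r k)⁻¹).add (hgm.1.const_smul β)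
  have m2 : AEStronglyMeasurable (F k) volume := by
    have m1 : AEStronglyMeasurable (fun x => e k x - 1) volume :=
      ((hec k).sub continuous_const).aestronglyMeasurable
    exact (((m1.mul hf.1).const_mul _).sub ((hf.memLp_coordMul j).1.const_mul _)).sub
      (m1.mul (hgm.1.const_mul _))
  have hdec : (fun x => (r k : ℂ)⁻¹ * (HarmonicNLS.phaseShift j α β (r k) f x - f x))
      - shiftGenerator j α β f
      = (fun x => e k x * ((r k)⁻¹ • (f (x - (r k * β) • unitVec j) - f x) + β • g x)) + F k := by
    funext x
    simp only [Pi.sub_apply, Pi.add_apply, HarmonicNLS.phaseShift, shiftGenerator, hF, he,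
      Complex.real_smul, ← hg]
    push_cast; ring
  rw [hdec]
  refine (eLpNorm_add_le ((hec k).aestronglyMeasurable.mul m1) m2 (by norm_num)).trans
    (add_le_add (eLpNorm_mono fun x => ?_) le_rfl)
  rw [Pi.mul_apply, norm_mul, hen, one_mul]

end PhaseShiftLimit
/-! ### Evolution of `‖exp (i r Dⱼ) u - u‖²` -/

section ShiftForm

open ComplexConjugate

variable {n : ℕ} {σ lam κ C : ℝ} {f g : Space n → ℂ} {j k : Fin n} {α β r : ℝ}

theorem phaseShift_zero : phaseShift j α β 0 f = f := by
  funext x; simp [phaseShift, shiftPhase]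

/-- `∫ (|g|^{2σ} - |f|^{2σ}) Im (conj f * g)`, the contribution of the nonlinearity to the evolution
of `½ ‖g - f‖²`, for `g = exp (i r Dⱼ) f`. -/
noncomputable def shiftNL (σ : ℝ) (f g : Space n → ℂ) : ℝ :=
  ∫ x, (‖g x‖ ^ (2 * σ) - ‖f x‖ ^ (2 * σ)) * (conj (f x) * g x).im

theorem powNL_phaseShift : (fun x => powNL σ (phaseShift j α β r f x))
    = phaseShift j α β r fun x => powNL σ (f x) := by
  funext x
  rw [powNL, norm_phaseShift, phaseShift, phaseShift, powNL]
  ring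

theorem im_ip_phaseShift_add (g : Space n → ℂ) :
    (ip (phaseShift j α β r g) g).im + (ip (phaseShift j α β (-r) g) g).im = 0 := by
  have h : ip (phaseShift j α β (-r) g) g = conj (ip (phaseShift j α β r g) g) := by
    rw [ip_phaseShift_left, neg_neg, conj_ip]
  rw [h, Complex.conj_im, add_neg_cancel]

/-- The quadratic parts of the form commute with the group up to lower-order terms, because
conjugation with `exp (i r Dⱼ)` shifts `xⱼ` by `r β` and `∂ⱼ` by a multiple of `r α`; what commutes with the
group cancels between `r` and `-r`. -/
theorem im_nlsForm_phaseShift (hσ : 0 < σ) (hC : SigmaEmbeds n σ C) (hf : MemSigma f) :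
    (nlsForm σ lam κ f (phaseShift j α β r f)).im + (nlsForm σ lam κ f (phaseShift j α β (-r) f)).im
      = -(1 / 2) * (r * α) * (ip (phaseShift j α β r f - phaseShift j α β (-r) f)
          (weakPartial j f)).re
        - κ / 2 * (r * β) * (ip (phaseShift j α β r f - phaseShift j α β (-r) f) (coordMul j f)).im
        + lam * shiftNL σ f (phaseShift j α β r f) := by
  have hp : (ENNReal.ofReal (2 * σ + 2)).HolderConjugate
      (ENNReal.ofReal ((2 * σ + 2) / (2 * σ + 1))) := (holderConjugate_pow hσ).ennrealOfReal
  have hfp := (hC.2 f hf).1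
  have mW : ∀ r : ℝ, MemLp (phaseShift j α β r f) 2 volume := fun r => memLp_phaseShift hf.memLp
  have e1 : ∀ (r : ℝ) (k : Fin n), ip (weakPartial k (phaseShift j α β r f)) (weakPartial k f)
      = ip (phaseShift j α β r (weakPartial k f)) (weakPartial k f)
        + if k = j then -Complex.I * (r * α) * ip (phaseShift j α β r f) (weakPartial j f)
          else 0 := by
    intro r k
    rw [ip_congr ((hf.2.hasWeakPartial k).phaseShift).weakPartial_ae_eq EventuallyEq.rfl]
    have := ip_add_left (memLp_phaseShift (j := j) (α := α) (β := β) (r := r)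
      (hf.memLp_weakPartial k)) ((mW r).const_mul (if k = j then Complex.I * (r * α) else 0))
      (hf.memLp_weakPartial k)
    rw [ip_const_mul_left] at this
    refine this.trans ?_
    congr 1
    split_ifs with h
    · subst h; simp
    · simp
  have e2 : ∀ (r : ℝ) (k : Fin n), ip (coordMul k (phaseShift j α β r f)) (coordMul k f)
      = ip (phaseShift j α β r (coordMul k f)) (coordMul k f)
        + if k = j then (r * β) * ip (phaseShift j α β r f) (coordMul j f) else 0 := by
    intro r k
    rw [ip_congr (Eventually.of_forall fun x => coordMul_phaseShift x) EventuallyEq.rfl]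
    have := ip_add_left (memLp_phaseShift (j := j) (α := α) (β := β) (r := r)
      (hf.memLp_coordMul k)) ((mW r).const_mul (if k = j then (r * β : ℂ) else 0))
      (hf.memLp_coordMul k)
    rw [ip_const_mul_left] at this
    refine this.trans ?_
    congr 1
    split_ifs with h
    · subst h; simp
    · simp
  have e3 : (ip (phaseShift j α β r f) (fun x => powNL σ (f x))).im
      + (ip (phaseShift j α β (-r) f) (fun x => powNL σ (f x))).im
        = shiftNL σ f (phaseShift j α β r f) := by
    have mv : MemLp (phaseShift j α β r f) (ENNReal.ofReal (2 * σ + 2)) volume :=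
      memLp_phaseShift hfp
    rw [ip_phaseShift_left (r := -r), neg_neg, ← powNL_phaseShift, ← Complex.add_im, ip, ip,
      ← integral_add (integrable_conj_mul_of_holder mv (memLp_powNL hσ hfp))
        (integrable_conj_mul_of_holder hfp (memLp_powNL hσ mv)), shiftNL]
    refine (Complex.imCLM.integral_comp_comm
      ((integrable_conj_mul_of_holder mv (memLp_powNL hσ hfp)).add
        (integrable_conj_mul_of_holder hfp (memLp_powNL hσ mv)))).symm.trans ?_
    congr 1; funext x
    simp only [Complex.imCLM_apply, Pi.add_apply, powNL, Complex.add_im, Complex.mul_im, Complex.conj_re,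
      Complex.conj_im, Complex.mul_re, Complex.ofReal_re, Complex.ofReal_im]
    ring
  -- The parts that commute with the group cancel.
  have s1 : ∑ k, ((ip (phaseShift j α β r (weakPartial k f)) (weakPartial k f)).im
      + (ip (phaseShift j α β (-r) (weakPartial k f)) (weakPartial k f)).im) = 0 :=
    Finset.sum_eq_zero fun k _ => im_ip_phaseShift_add _
  have s2 : ∑ k, ((ip (phaseShift j α β r (coordMul k f)) (coordMul k f)).im
      + (ip (phaseShift j α β (-r) (coordMul k f)) (coordMul k f)).im) = 0 :=
    Finset.sum_eq_zero fun k _ => im_ip_phaseShift_add _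
  rw [Finset.sum_add_distrib] at s1 s2
  rw [← e3, ip_sub_left (mW r) (mW (-r)) (hf.memLp_weakPartial j),
    ip_sub_left (mW r) (mW (-r)) (hf.memLp_coordMul j)]
  simp only [nlsForm, e1, e2, Finset.sum_add_distrib, Finset.sum_ite_eq', Finset.mem_univ, if_true]
  simp only [Complex.add_im, Complex.sub_im, Complex.mul_im, Complex.mul_re, Complex.ofReal_re,
    Complex.ofReal_im, Complex.im_sum, Complex.sub_re, Complex.add_re, Complex.neg_re, Complex.neg_im,
    Complex.I_re, Complex.I_im, Complex.ofReal_neg, Complex.div_ofNat_re, Complex.div_ofNat_im,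
    Complex.one_re, Complex.one_im, Complex.re_sum]
  linear_combination (1 / 2) * s1 - κ / 2 * s2

end ShiftForm

section ShiftEvolution

open ComplexConjugate

variable {n : ℕ} {σ lam κ : ℝ} {I : Set ℝ} {u₀ : Space n → ℂ} {u : ℝ → Space n → ℂ} {C : ℝ}
  {j : Fin n} {α β r : ℝ}

theorem IsSolution.tendsto_sigmaNorm_phaseShift (hu : IsSolution σ lam (quadPot κ) I u₀ u)
    (hI : IsOpen I) {t : ℝ} (ht : t ∈ I) :
    Tendsto (fun s => sigmaNorm (phaseShift j α β r (u s) - phaseShift j α β r (u t)))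
      (𝓝 t) (𝓝 0) := by
  set K : ℝ≥0∞ := 2 + n * (1 + ‖r * α‖ₑ) + ‖r * β‖ₑ with hK
  have hKtop : K ≠ ∞ := by
    rw [hK]
    finiteness
  have h1 := (hu.tendsto_sigmaNorm_sub hI ht).const_mul K.toReal
  rw [mul_zero] at h1
  refine squeeze_zero' (Eventually.of_forall fun _ => sigmaNorm_nonneg _) ?_ h1
  filter_upwards [hI.mem_nhds ht] with s hs
  have hw := (hu.memSigma s hs).sub (hu.memSigma t ht)
  rw [← phaseShift_sub, sigmaNorm, sigmaNorm, ← ENNReal.toReal_mul]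
  exact ENNReal.toReal_mono (ENNReal.mul_ne_top hKtop hw.3.ne) (sigmaENorm_phaseShift_le hw)

/-- The product rule for `⟨exp (i r Dⱼ) u, u⟩`; the derivative of the first factor is moved to the
second one by the adjoint group. -/
theorem IsSolution.hasDerivAt_ip_phaseShift (hu : IsSolution σ lam (quadPot κ) I u₀ u)
    (hI : IsOpen I) (hσ : 0 < σ) (hC : SigmaEmbeds n σ C) {t : ℝ} (ht : t ∈ I) :
    HasDerivAt (fun s => ip (phaseShift j α β r (u s)) (u s))
      (-Complex.I * nlsForm σ lam κ (u t) (phaseShift j α β r (u t))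
        + conj (-Complex.I * nlsForm σ lam κ (u t) (phaseShift j α β (-r) (u t)))) t := by
  have h1 := hu.tendsto_ip_slope hI hσ hC (ψ := fun s => phaseShift j α β r (u s))
    (fun s hs => (hu.memSigma s hs).phaseShift) ht (hu.tendsto_sigmaNorm_phaseShift hI ht)
  have h2 := hasDerivAt_iff_tendsto_slope.1
    (hu.hasDerivAt_ip hI hσ hC ((hu.memSigma t ht).phaseShift (j := j) (α := α) (β := β) (r := -r))
      ht)
  have h3 := h1.add ((Complex.continuous_conj.tendsto _).comp h2)
  rw [hasDerivAt_iff_tendsto_slope]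
  refine h3.congr' ?_
  filter_upwards [nhdsWithin_le_nhds (hI.mem_nhds ht)] with s hs
  have hus := (hu.memSigma s hs).memLp
  have hut := (hu.memSigma t ht).memLp
  have e1 := ip_sub_right (memLp_phaseShift (j := j) (α := α) (β := β) (r := r) hus) hus hut
  have e2 : ip (phaseShift j α β r (u s)) (u t) - ip (phaseShift j α β r (u t)) (u t)
      = conj (ip (phaseShift j α β (-r) (u t)) (u s) - ip (phaseShift j α β (-r) (u t)) (u t)) := by
    rw [map_sub, conj_ip, conj_ip, ip_phaseShift_left, ip_phaseShift_left]
  simp only [Function.comp_apply, slope_def_module, Complex.real_smul, map_mul, ← e2, e1,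
    Complex.conj_ofReal]
  push_cast
  ring

/-- `‖U f - f‖² = 2 ‖f‖² - 2 Re ⟨U f, f⟩` for the unitary group `U`; `‖f‖²` is written with the
identity `U = exp 0`, so that one formula gives the time derivative of both terms. -/
theorem lpNorm_phaseShift_sub_sq {f : Space n → ℂ} (hf : MemLp f 2 volume) :
    lpNorm (phaseShift j α β r f - f) 2 volume ^ 2
      = 2 * (ip (phaseShift j α β 0 f) f).re - 2 * (ip (phaseShift j α β r f) f).re := by
  have m := memLp_phaseShift (j := j) (α := α) (β := β) (r := r) hf
  have h1 := congrArg Complex.re (ip_self (m.sub hf))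
  rw [Complex.ofReal_re] at h1
  have h2 : ip (phaseShift j α β r f) (phaseShift j α β r f) = ip f f := by
    rw [ip_phaseShift_left, phaseShift_neg_phaseShift]
  rw [← h1, ip_sub_left m hf (m.sub hf), ip_sub_right m m hf, ip_sub_right hf m hf, h2,
    phaseShift_zero, ← conj_ip (phaseShift j α β r f) f]
  simp only [Complex.sub_re, Complex.conj_re]
  ring

/-- For `r ≠ 0` no second derivative of `u` is involved in the evolution of `‖exp (i r Dⱼ) u - u‖²`,
which replaces that of `r² ‖Dⱼ u‖²`. -/
theorem IsSolution.hasDerivAt_lpNorm_phaseShift_sub (hu : IsSolution σ lam (quadPot κ) I u₀ u)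
    (hI : IsOpen I) (hσ : 0 < σ) (hC : SigmaEmbeds n σ C) {t : ℝ} (ht : t ∈ I) :
    HasDerivAt (fun s => 1 / 2 * lpNorm (phaseShift j α β r (u s) - u s) 2 volume ^ 2)
      (1 / 2 * (r * α) * (ip (phaseShift j α β r (u t) - phaseShift j α β (-r) (u t))
          (weakPartial j (u t))).re
        + κ / 2 * (r * β) * (ip (phaseShift j α β r (u t) - phaseShift j α β (-r) (u t))
          (coordMul j (u t))).im
        - lam * shiftNL σ (u t) (phaseShift j α β r (u t))) t := by
  have hre : ∀ r : ℝ, HasDerivAt (fun s => (ip (phaseShift j α β r (u s)) (u s)).re)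
      ((nlsForm σ lam κ (u t) (phaseShift j α β r (u t))).im
        + (nlsForm σ lam κ (u t) (phaseShift j α β (-r) (u t))).im) t := fun r => by
    have h1 := Complex.reCLM.hasFDerivAt.comp_hasDerivAt t
      (hu.hasDerivAt_ip_phaseShift (j := j) (α := α) (β := β) (r := r) hI hσ hC ht)
    refine h1.congr_deriv ?_
    simp
  have h0 := hre 0
  have hr := hre r
  rw [im_nlsForm_phaseShift hσ hC (hu.memSigma t ht)] at h0 hr
  have z : shiftNL σ (u t) (u t) = 0 := by simp [shiftNL]
  rw [neg_zero, phaseShift_zero, z] at h0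
  have h2 : HasDerivAt (fun s => 1 / 2 * (2 * (ip (phaseShift j α β 0 (u s)) (u s)).re
      - 2 * (ip (phaseShift j α β r (u s)) (u s)).re)) _ t :=
    ((h0.const_mul 2).sub (hr.const_mul 2)).const_mul (1 / 2)
  refine (h2.congr_of_eventuallyEq ?_).congr_deriv (by ring)
  filter_upwards [hI.mem_nhds ht] with s hs
  rw [lpNorm_phaseShift_sub_sq (hu.memSigma s hs).memLp]

end ShiftEvolution
/-! ### Power inequalities -/

section PowerDifferences

variable {s σ A B x y : ℝ}

theorem one_sub_rpow_le (hs : 0 < s) (h0 : 0 ≤ y) (h1 : y ≤ 1) :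
    1 - y ^ s ≤ max 1 s * (1 - y) := by
  rcases le_total s 1 with h | h
  · rw [max_eq_left h, one_mul]
    have := Real.rpow_le_rpow_of_exponent_ge' h0 h1 hs.le h
    rw [Real.rpow_one] at this
    linarith
  · rw [max_eq_right h]
    have := one_add_mul_self_le_rpow_one_add (s := y - 1) (by linarith) h
    rw [add_sub_cancel] at this
    linarith

theorem mul_rpow_sub_rpow_le (hs : 0 < s) (hB : 0 ≤ B) (hBA : B ≤ A) :
    A * (A ^ s - B ^ s) ≤ max 1 s * A ^ s * (A - B) := by
  rcases (hB.trans hBA).eq_or_lt with h | h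
  · have hA : A = 0 := h.symm
    have : B = 0 := le_antisymm (hBA.trans hA.le) hB
    subst this; simp [hA]
  · have h1 := one_sub_rpow_le hs (div_nonneg hB h.le) ((div_le_one h).2 hBA)
    rw [Real.div_rpow hB h.le] at h1
    have h2 : 0 < A ^ s := Real.rpow_pos_of_pos h s
    calc A * (A ^ s - B ^ s) = A * A ^ s * (1 - B ^ s / A ^ s) := by field_simp
      _ ≤ A * A ^ s * (max 1 s * (1 - B / A)) := by gcongr
      _ = _ := by field_simp

theorem abs_rpow_sub_rpow_mul_le (hs : 0 < s) (hA : 0 ≤ A) (hB : 0 ≤ B) :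
    |A ^ s - B ^ s| * B ≤ max 1 s * (A + B) ^ s * |A - B| := by
  have hm : 0 < max 1 s := lt_max_of_lt_left one_pos
  rcases le_total B A with h | h
  · have h1 : 0 ≤ A ^ s - B ^ s := sub_nonneg.2 (Real.rpow_le_rpow hB h hs.le)
    rw [abs_of_nonneg h1, abs_of_nonneg (sub_nonneg.2 h)]
    calc (A ^ s - B ^ s) * B ≤ A * (A ^ s - B ^ s) := by
          rw [mul_comm]; exact mul_le_mul_of_nonneg_right h h1
      _ ≤ max 1 s * A ^ s * (A - B) := mul_rpow_sub_rpow_le hs hB h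
      _ ≤ _ := by
          have := sub_nonneg.2 h
          gcongr; linarith
  · have h1 : 0 ≤ B ^ s - A ^ s := sub_nonneg.2 (Real.rpow_le_rpow hA h hs.le)
    rw [abs_sub_comm, abs_of_nonneg h1, abs_sub_comm, abs_of_nonneg (sub_nonneg.2 h), mul_comm]
    refine (mul_rpow_sub_rpow_le hs hA h).trans ?_
    have := sub_nonneg.2 h
    gcongr; linarith

/-- The error of the trapezoidal rule for the Stieltjes integral `∫ b² d(b^{2σ})` from `B` to `A`.
It is `O((A - B)²)`. -/
noncomputable def trapezoidDefect (σ A B : ℝ) : ℝ :=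
  1 / 2 * (A ^ (2 * σ) - B ^ (2 * σ)) * (A ^ 2 + B ^ 2)
    - σ / (σ + 1) * (A ^ (2 * σ + 2) - B ^ (2 * σ + 2))

/-- The mean value theorem in the larger variable: the derivative of the defect is itself
`O(A - B)`. -/
theorem abs_trapezoidDefect_le_of_le (hσ : 0 < σ) (hB : 0 ≤ B) (hBA : B ≤ A) :
    |trapezoidDefect σ A B| ≤ (2 * σ + max 1 (2 * σ)) * A ^ (2 * σ) * (A - B) ^ 2 := by
  have h2 : 0 < 2 * σ := by linarith
  rcases hBA.eq_or_lt with h | h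
  · subst h; simp [trapezoidDefect]
  have hA : 0 < A := hB.trans_lt h
  have hcont : Continuous fun x => trapezoidDefect σ x B := by
    have c1 : Continuous fun x : ℝ => x ^ (2 * σ) := Real.continuous_rpow_const h2.le
    have c2 : Continuous fun x : ℝ => x ^ (2 * σ + 2) := Real.continuous_rpow_const (by linarith)
    unfold trapezoidDefect
    fun_prop
  have hder : ∀ x ∈ Set.Ioo B A, HasDerivAt (fun x => trapezoidDefect σ x B)
      (σ * x ^ (2 * σ - 1) * (B ^ 2 - x ^ 2) + x * (x ^ (2 * σ) - B ^ (2 * σ))) x := by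
    intro x hx
    have hx0 : 0 < x := hB.trans_lt hx.1
    have d1 : HasDerivAt (fun x : ℝ => x ^ (2 * σ)) (2 * σ * x ^ (2 * σ - 1)) x :=
      Real.hasDerivAt_rpow_const (Or.inl hx0.ne')
    have d2 : HasDerivAt (fun x : ℝ => x ^ (2 * σ + 2)) ((2 * σ + 2) * x ^ (2 * σ + 2 - 1)) x :=
      Real.hasDerivAt_rpow_const (Or.inl hx0.ne')
    have d3 : HasDerivAt (fun x : ℝ => trapezoidDefect σ x B) _ x :=
      (((d1.sub_const (B ^ (2 * σ))).const_mul (1 / 2)).mul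
        ((hasDerivAt_pow 2 x).add_const (B ^ 2))).sub
        ((d2.sub_const (B ^ (2 * σ + 2))).const_mul (σ / (σ + 1)))
    refine d3.congr_deriv ?_
    have e : x ^ (2 * σ + 2 - 1) = x ^ (2 * σ - 1) * x ^ 2 := by
      rw [← Real.rpow_natCast, ← Real.rpow_add hx0]; congr 1; push_cast; ring
    rw [e]
    field_simp
    ring
  obtain ⟨c, hc, he⟩ := exists_hasDerivAt_eq_slope (fun x => trapezoidDefect σ x B) _ h
    hcont.continuousOn hder
  have hc0 : 0 < c := hB.trans_lt hc.1
  have e0 : trapezoidDefect σ B B = 0 := by simp [trapezoidDefect]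
  rw [e0, sub_zero, eq_div_iff (sub_pos.2 h).ne'] at he
  rw [← he, abs_mul, abs_of_pos (sub_pos.2 h), sq (A - B), ← mul_assoc]
  refine mul_le_mul_of_nonneg_right ?_ (sub_pos.2 h).le
  have b1 : |σ * c ^ (2 * σ - 1) * (B ^ 2 - c ^ 2)| ≤ 2 * σ * c ^ (2 * σ) * (c - B) := by
    have : B ^ 2 - c ^ 2 = -((c + B) * (c - B)) := by ring
    rw [this, abs_mul, abs_neg, abs_of_nonneg (by positivity), abs_of_nonneg
      (mul_nonneg (by linarith) (sub_nonneg.2 hc.1.le))]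
    have e : c ^ (2 * σ) = c ^ (2 * σ - 1) * c := by
      rw [← Real.rpow_add_one hc0.ne']; congr 1; ring
    rw [e]
    have h5 : 0 ≤ σ * c ^ (2 * σ - 1) * (c - B) :=
      mul_nonneg (by positivity) (sub_nonneg.2 hc.1.le)
    nlinarith [mul_nonneg h5 (sub_nonneg.2 hc.1.le)]
  have b2 : |c * (c ^ (2 * σ) - B ^ (2 * σ))| ≤ max 1 (2 * σ) * c ^ (2 * σ) * (c - B) := by
    have h3 : 0 ≤ c ^ (2 * σ) - B ^ (2 * σ) :=
      sub_nonneg.2 (Real.rpow_le_rpow hB hc.1.le h2.le)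
    rw [abs_of_nonneg (mul_nonneg hc0.le h3)]
    exact mul_rpow_sub_rpow_le h2 hB hc.1.le
  refine (abs_add_le _ _).trans ((add_le_add b1 b2).trans ?_)
  rw [← add_mul, ← add_mul]
  have hm : 0 < max 1 (2 * σ) := lt_max_of_lt_left one_pos
  have := sub_nonneg.2 hc.1.le
  have := hc.2.le
  gcongr

theorem abs_trapezoidDefect_le (hσ : 0 < σ) (hA : 0 ≤ A) (hB : 0 ≤ B) :
    |trapezoidDefect σ A B|
      ≤ (2 * σ + max 1 (2 * σ)) * (A + B) ^ (2 * σ) * (A - B) ^ 2 := by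
  have hm : 0 < max 1 (2 * σ) := lt_max_of_lt_left one_pos
  rcases le_total B A with h | h
  · refine (abs_trapezoidDefect_le_of_le hσ hB h).trans ?_
    gcongr; linarith
  · have e : trapezoidDefect σ A B = -trapezoidDefect σ B A := by unfold trapezoidDefect; ring
    rw [e, abs_neg, show (A - B) ^ 2 = (B - A) ^ 2 by ring]
    refine (abs_trapezoidDefect_le_of_le hσ hA h).trans ?_
    gcongr; linarith

theorem rpow_mul_sq_le (hσ : 0 < σ) (hx : 0 ≤ x) (hy : 0 ≤ y) :
    x ^ (2 * σ) * y ^ 2 ≤ x ^ (2 * σ + 2) + y ^ (2 * σ + 2) := by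
  have key : ∀ z : ℝ, 0 ≤ z → z ^ (2 * σ + 2) = z ^ (2 * σ) * z ^ 2 := fun z hz => by
    rw [Real.rpow_add_of_nonneg hz (by positivity) (by norm_num), Real.rpow_two]
  rw [key x hx, key y hy]
  rcases le_total x y with h | h
  · have : x ^ (2 * σ) * y ^ 2 ≤ y ^ (2 * σ) * y ^ 2 := by gcongr
    have : 0 ≤ x ^ (2 * σ) * x ^ 2 := by positivity
    linarith
  · have : x ^ (2 * σ) * y ^ 2 ≤ x ^ (2 * σ) * x ^ 2 := by gcongr
    have : 0 ≤ y ^ (2 * σ) * y ^ 2 := by positivity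
    linarith

end PowerDifferences

/-! ### Second-order differences of the nonlinearity -/

section Pointwise

open ComplexConjugate

variable {σ : ℝ}

/-- `2σ |z|^{2σ-2} Re (conj z * w) Im (conj z * w)`. For `w = ∂ⱼ z` this is
`∂ⱼ(|z|^{2σ}) Im (conj z ∂ⱼz)`, the density by which the nonlinearity feeds the kinetic energy. At `z = 0`
it is `0`, whatever the value of `0 ^ (2σ-2)`. -/
noncomputable def crossDensity (σ : ℝ) (z w : ℂ) : ℝ :=
  2 * σ * ‖z‖ ^ (2 * σ - 2) * (conj z * w).re * (conj z * w).im

/-- `r⁻²` times the integrand of `shiftNL` for `g = e^{iθ} a` and `f = z`, where `a` is the translate of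
`z`, after subtraction of `σ/(σ+1) sin θ (|a|^{2σ+2} - |z|^{2σ+2})`. The subtracted term is not of second
order pointwise, but its integral is, as a translation shows; the rest is of second order pointwise. -/
noncomputable def shiftDensity (σ θ r : ℝ) (a z : ℂ) : ℝ :=
  (r ^ 2)⁻¹ * ((‖a‖ ^ (2 * σ) - ‖z‖ ^ (2 * σ)) * (conj z * (Complex.exp (Complex.I * θ) * a)).im
    - σ / (σ + 1) * (Real.sin θ * (‖a‖ ^ (2 * σ + 2) - ‖z‖ ^ (2 * σ + 2))))

/-- Every summand is now visibly quadratic in `a - z`. -/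
theorem shiftDensity_eq (θ r : ℝ) (a z : ℂ) : shiftDensity σ θ r a z
    = (r ^ 2)⁻¹ * (Real.cos θ * ((‖a‖ ^ (2 * σ) - ‖z‖ ^ (2 * σ)) * (conj z * (a - z)).im)
      + Real.sin θ * (trapezoidDefect σ ‖a‖ ‖z‖
        - 1 / 2 * (‖a‖ ^ (2 * σ) - ‖z‖ ^ (2 * σ)) * ‖a - z‖ ^ 2)) := by
  have e1 : (conj z * (Complex.exp (Complex.I * θ) * a)).im
      = Real.cos θ * (conj z * (a - z)).im + Real.sin θ * (conj z * a).re := by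
    rw [mul_comm Complex.I, Complex.exp_mul_I, ← Complex.ofReal_cos, ← Complex.ofReal_sin]
    simp only [Complex.mul_im, Complex.mul_re, Complex.add_re, Complex.add_im, Complex.sub_re,
      Complex.sub_im, Complex.ofReal_re, Complex.ofReal_im, Complex.I_re, Complex.I_im,
      Complex.conj_re, Complex.conj_im]
    ring
  have e2 : (conj z * a).re = 1 / 2 * (‖a‖ ^ 2 + ‖z‖ ^ 2) - 1 / 2 * ‖a - z‖ ^ 2 := by
    simp only [← Complex.normSq_eq_norm_sq, Complex.normSq_apply, Complex.mul_re, Complex.sub_re,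
      Complex.sub_im, Complex.conj_re, Complex.conj_im]
    ring
  rw [shiftDensity, e1, e2, trapezoidDefect]
  ring

theorem abs_shiftDensity_le (hσ : 0 < σ) (θ : ℝ) {r : ℝ} (hr : r ≠ 0) (a z : ℂ) :
    |shiftDensity σ θ r a z| ≤ (2 * σ + 2 * max 1 (2 * σ) + 1)
      * ((‖a‖ + ‖z‖) ^ (2 * σ) * ‖r⁻¹ • (a - z)‖ ^ 2) := by
  have h2 : 0 < 2 * σ := by linarith
  have hm : 0 < max 1 (2 * σ) := lt_max_of_lt_left one_pos
  set S := (‖a‖ + ‖z‖) ^ (2 * σ) with hS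
  have hS0 : 0 ≤ S := by positivity
  have hd : |‖a‖ - ‖z‖| ≤ ‖a - z‖ := abs_norm_sub_norm_le a z
  have b1 : |(‖a‖ ^ (2 * σ) - ‖z‖ ^ (2 * σ)) * (conj z * (a - z)).im|
      ≤ max 1 (2 * σ) * S * ‖a - z‖ ^ 2 := by
    have h3 : |(conj z * (a - z)).im| ≤ ‖z‖ * ‖a - z‖ := by
      refine (Complex.abs_im_le_norm _).trans (le_of_eq ?_)
      rw [norm_mul, RCLike.norm_conj]
    rw [abs_mul]
    calc _ ≤ |‖a‖ ^ (2 * σ) - ‖z‖ ^ (2 * σ)| * (‖z‖ * ‖a - z‖) := by gcongr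
      _ = |‖a‖ ^ (2 * σ) - ‖z‖ ^ (2 * σ)| * ‖z‖ * ‖a - z‖ := by ring
      _ ≤ max 1 (2 * σ) * S * |‖a‖ - ‖z‖| * ‖a - z‖ := by
          exact mul_le_mul_of_nonneg_right
            (abs_rpow_sub_rpow_mul_le h2 (norm_nonneg a) (norm_nonneg z)) (norm_nonneg (a - z))
      _ ≤ max 1 (2 * σ) * S * ‖a - z‖ * ‖a - z‖ := by gcongr
      _ = _ := by ring
  have b2 : |trapezoidDefect σ ‖a‖ ‖z‖| ≤ (2 * σ + max 1 (2 * σ)) * S * ‖a - z‖ ^ 2 := by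
    refine (abs_trapezoidDefect_le hσ (norm_nonneg _) (norm_nonneg _)).trans ?_
    rw [← sq_abs (‖a‖ - ‖z‖)]
    gcongr
  have b3 : |1 / 2 * (‖a‖ ^ (2 * σ) - ‖z‖ ^ (2 * σ)) * ‖a - z‖ ^ 2| ≤ S * ‖a - z‖ ^ 2 := by
    rw [abs_mul, abs_mul, abs_of_nonneg (sq_nonneg ‖a - z‖)]
    gcongr
    have p1 : ‖a‖ ^ (2 * σ) ≤ S := by
      rw [hS]
      exact Real.rpow_le_rpow (norm_nonneg _) (le_add_of_nonneg_right (norm_nonneg _)) h2.le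
    have p2 : ‖z‖ ^ (2 * σ) ≤ S := by
      rw [hS]
      exact Real.rpow_le_rpow (norm_nonneg _) (le_add_of_nonneg_left (norm_nonneg _)) h2.le
    have p3 : 0 ≤ ‖a‖ ^ (2 * σ) := by positivity
    have p4 : 0 ≤ ‖z‖ ^ (2 * σ) := by positivity
    rw [abs_of_pos (by norm_num : (0 : ℝ) < 1 / 2)]
    have : |‖a‖ ^ (2 * σ) - ‖z‖ ^ (2 * σ)| ≤ S := abs_sub_le_iff.2 ⟨by linarith, by linarith⟩
    linarith
  have hnorm : ‖r⁻¹ • (a - z)‖ ^ 2 = (r ^ 2)⁻¹ * ‖a - z‖ ^ 2 := by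
    rw [norm_smul, mul_pow, norm_inv, Real.norm_eq_abs, inv_pow, sq_abs]
  rw [shiftDensity_eq, abs_mul, abs_of_pos (by positivity : 0 < (r ^ 2)⁻¹), hnorm]
  have b4 : |Real.cos θ * ((‖a‖ ^ (2 * σ) - ‖z‖ ^ (2 * σ)) * (conj z * (a - z)).im)
      + Real.sin θ * (trapezoidDefect σ ‖a‖ ‖z‖
        - 1 / 2 * (‖a‖ ^ (2 * σ) - ‖z‖ ^ (2 * σ)) * ‖a - z‖ ^ 2)|
      ≤ (2 * σ + 2 * max 1 (2 * σ) + 1) * S * ‖a - z‖ ^ 2 := by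
    refine (abs_add_le _ _).trans ?_
    rw [abs_mul (Real.cos θ), abs_mul (Real.sin θ)]
    have c1 := mul_le_of_le_one_left (abs_nonneg ((‖a‖ ^ (2 * σ) - ‖z‖ ^ (2 * σ))
      * (conj z * (a - z)).im)) (Real.abs_cos_le_one θ)
    have c2 := mul_le_of_le_one_left (abs_nonneg (trapezoidDefect σ ‖a‖ ‖z‖
        - 1 / 2 * (‖a‖ ^ (2 * σ) - ‖z‖ ^ (2 * σ)) * ‖a - z‖ ^ 2)) (Real.abs_sin_le_one θ)
    have c3 := abs_sub (trapezoidDefect σ ‖a‖ ‖z‖)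
      (1 / 2 * (‖a‖ ^ (2 * σ) - ‖z‖ ^ (2 * σ)) * ‖a - z‖ ^ 2)
    linarith
  calc _ ≤ (r ^ 2)⁻¹ * ((2 * σ + 2 * max 1 (2 * σ) + 1) * S * ‖a - z‖ ^ 2) := by gcongr
    _ = _ := by ring

theorem hasFDerivAt_norm_rpow_two_mul {z : ℂ} (hz : z ≠ 0) (σ : ℝ) :
    HasFDerivAt (fun w : ℂ => ‖w‖ ^ (2 * σ))
      ((2 * σ * ‖z‖ ^ (2 * σ - 2)) • innerSL ℝ z) z := by
  have h1 : HasFDerivAt (fun w : ℂ => ‖w‖ ^ 2) (2 • innerSL ℝ z) z :=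
    (hasStrictFDerivAt_norm_sq z).hasFDerivAt
  have hz' : 0 < ‖z‖ := norm_pos_iff.2 hz
  have h2 := h1.rpow_const (p := σ) (Or.inl (pow_pos hz' 2).ne')
  have e : ∀ w : ℂ, (‖w‖ ^ 2) ^ σ = ‖w‖ ^ (2 * σ) := fun w => by
    rw [← Real.rpow_natCast, ← Real.rpow_mul (norm_nonneg w)]; norm_num
  have e2 : (‖z‖ ^ 2) ^ (σ - 1) = ‖z‖ ^ (2 * σ - 2) := by
    rw [← Real.rpow_natCast, ← Real.rpow_mul (norm_nonneg z)]; congr 1; push_cast; ring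
  simp only [e, e2] at h2
  refine h2.congr_fderiv ?_
  rw [← Nat.cast_smul_eq_nsmul ℝ, smul_smul]
  congr 1
  push_cast
  ring

theorem tendsto_shiftDensity (hσ : 0 < σ) {r θ : ℕ → ℝ} (hr0 : ∀ k, r k ≠ 0)
    (hr : Tendsto r atTop (𝓝 0)) (hθ : Tendsto θ atTop (𝓝 0)) {a : ℕ → ℂ} {z w : ℂ}
    (ha : Tendsto (fun k => (r k)⁻¹ • (a k - z)) atTop (𝓝 w)) :
    Tendsto (fun k => shiftDensity σ (θ k) (r k) (a k) z) atTop (𝓝 (crossDensity σ z w)) := by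
  have h2 : 0 < 2 * σ := by linarith
  have ha0 : Tendsto a atTop (𝓝 z) := by
    have h1 := (hr.smul ha).add_const z
    rw [zero_smul, zero_add] at h1
    refine h1.congr fun k => ?_
    rw [smul_smul, mul_inv_cancel₀ (hr0 k), one_smul, sub_add_cancel]
  set d : ℕ → ℂ := fun k => (r k)⁻¹ • (a k - z) with hd
  have hdn : ∀ k, ‖d k‖ ^ 2 = (r k ^ 2)⁻¹ * ‖a k - z‖ ^ 2 := fun k => by
    rw [hd, norm_smul, mul_pow, norm_inv, Real.norm_eq_abs, inv_pow, sq_abs]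
  have hcos : Tendsto (fun k => Real.cos (θ k)) atTop (𝓝 1) := by
    have h1 := (Real.continuous_cos.tendsto 0).comp hθ
    rwa [Real.cos_zero] at h1
  have hsin : Tendsto (fun k => |Real.sin (θ k)|) atTop (𝓝 0) := by
    have h1 := ((Real.continuous_sin.tendsto 0).comp hθ).abs
    rwa [Real.sin_zero, abs_zero] at h1
  have hrp : Tendsto (fun k => ‖a k‖ ^ (2 * σ) - ‖z‖ ^ (2 * σ)) atTop (𝓝 0) := by
    have := (ha0.norm.rpow_const (p := 2 * σ) (Or.inr h2.le)).sub_const (‖z‖ ^ (2 * σ))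
    rwa [sub_self] at this
  have hS : Tendsto (fun k => (‖a k‖ + ‖z‖) ^ (2 * σ)) atTop (𝓝 ((‖z‖ + ‖z‖) ^ (2 * σ))) :=
    (ha0.norm.add_const _).rpow_const (Or.inr h2.le)
  -- The part with `cos θ` is the product of two difference quotients.
  have t1 : Tendsto (fun k => Real.cos (θ k) * ((r k ^ 2)⁻¹
      * ((‖a k‖ ^ (2 * σ) - ‖z‖ ^ (2 * σ)) * (conj z * (a k - z)).im))) atTop
      (𝓝 (1 * crossDensity σ z w)) := by
    refine hcos.mul ?_
    rcases eq_or_ne z 0 with rfl | hz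
    · simp [crossDensity]
    have l1 := (hasFDerivAt_norm_rpow_two_mul hz σ).hasFDerivWithinAt (s := Set.univ).lim
      (l := atTop) (c := fun k => (r k)⁻¹) (d := fun k => a k - z) (v := w) ?_ ?_ ha
    · have l2 : Tendsto (fun k => (conj z * d k).im) atTop (𝓝 (conj z * w).im) :=
        (Complex.continuous_im.tendsto _).comp (ha.const_mul _)
      have l3 := l1.mul l2
      have e : ((2 * σ * ‖z‖ ^ (2 * σ - 2)) • innerSL ℝ z) w * (conj z * w).im
          = crossDensity σ z w := by
        simp only [smul_apply, innerSL_apply_apply, Complex.inner, smul_eq_mul, crossDensity,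
          mul_comm w]
      rw [e] at l3
      refine l3.congr fun k => ?_
      simp only [hd, add_sub_cancel, smul_eq_mul, Complex.real_smul]
      rw [mul_left_comm, Complex.im_ofReal_mul]
      have := hr0 k
      field_simp
    · simpa using ha0.sub_const z
    · exact Eventually.of_forall fun _ => Set.mem_univ _
  -- The part with `sin θ` is bounded by `|sin θ|` times a bounded quantity.
  have t2 : Tendsto (fun k => (r k ^ 2)⁻¹ * (Real.sin (θ k) * (trapezoidDefect σ ‖a k‖ ‖z‖
      - 1 / 2 * (‖a k‖ ^ (2 * σ) - ‖z‖ ^ (2 * σ)) * ‖a k - z‖ ^ 2))) atTop (𝓝 0) := by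
    have l1 := hsin.mul (((hS.const_mul (2 * σ + max 1 (2 * σ))).mul (ha.norm.pow 2)).add
      ((hrp.abs.const_mul (1 / 2)).mul (ha.norm.pow 2)))
    rw [zero_mul] at l1
    refine squeeze_zero_norm (fun k => ?_) l1
    have hr2 : 0 < (r k ^ 2)⁻¹ := by have := hr0 k; positivity
    rw [Real.norm_eq_abs, abs_mul, abs_mul, abs_of_pos hr2, mul_left_comm]
    refine mul_le_mul_of_nonneg_left ?_ (abs_nonneg _)
    have b1 := abs_trapezoidDefect_le hσ (norm_nonneg (a k)) (norm_nonneg z)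
    have b2 : (‖a k‖ - ‖z‖) ^ 2 ≤ ‖a k - z‖ ^ 2 := by
      rw [← sq_abs]; gcongr; exact abs_norm_sub_norm_le _ _
    have b3 := abs_sub (trapezoidDefect σ ‖a k‖ ‖z‖)
      (1 / 2 * (‖a k‖ ^ (2 * σ) - ‖z‖ ^ (2 * σ)) * ‖a k - z‖ ^ 2)
    rw [abs_mul, abs_mul, abs_of_nonneg (sq_nonneg ‖a k - z‖),
      abs_of_pos (by norm_num : (0 : ℝ) < 1 / 2)] at b3
    have hm : 0 < max 1 (2 * σ) := lt_max_of_lt_left one_pos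
    have b4 : (2 * σ + max 1 (2 * σ)) * (‖a k‖ + ‖z‖) ^ (2 * σ) * (‖a k‖ - ‖z‖) ^ 2
        ≤ (2 * σ + max 1 (2 * σ)) * (‖a k‖ + ‖z‖) ^ (2 * σ) * ‖a k - z‖ ^ 2 := by gcongr
    have hdk := hdn k
    simp only [hd] at hdk
    rw [hdk]
    calc _ ≤ (r k ^ 2)⁻¹ * ((2 * σ + max 1 (2 * σ)) * (‖a k‖ + ‖z‖) ^ (2 * σ) * ‖a k - z‖ ^ 2
          + 1 / 2 * |‖a k‖ ^ (2 * σ) - ‖z‖ ^ (2 * σ)| * ‖a k - z‖ ^ 2) := by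
          gcongr; linarith
      _ = _ := by ring
  have t3 := t1.add t2
  rw [one_mul, add_zero] at t3
  refine t3.congr fun k => ?_
  rw [shiftDensity_eq]
  ring

end Pointwise
/-! ### The limit of the nonlinear term as `r` tends to `0` -/

section ShiftLimit

open ComplexConjugate

variable {n : ℕ} {σ : ℝ} {f g : Space n → ℂ} {j : Fin n} {α β : ℝ}

theorem integrable_rpow_mul_sq (hσ : 0 < σ) {a b : Space n → ℝ}
    (ha : MemLp a (ENNReal.ofReal (2 * σ + 2)) volume)
    (hb : MemLp b (ENNReal.ofReal (2 * σ + 2)) volume) :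
    Integrable (fun x => ‖a x‖ ^ (2 * σ) * ‖b x‖ ^ 2) volume := by
  have hp : 0 < 2 * σ + 2 := by linarith
  refine ((integrable_norm_rpow_ofReal hp ha).add (integrable_norm_rpow_ofReal hp hb)).mono' ?_
    (Eventually.of_forall fun x => ?_)
  · exact ((ha.1.norm.aemeasurable.pow_const _).mul
      (hb.1.norm.aemeasurable.pow_const 2)).aestronglyMeasurable
  · rw [Real.norm_of_nonneg (by positivity)]
    exact rpow_mul_sq_le hσ (norm_nonneg _) (norm_nonneg _)

/-- Hölder's inequality for `|a|^{2σ} |b|²`, up to a factor, obtained from Young's inequality by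
scaling. -/
theorem integral_rpow_mul_sq_le (hσ : 0 < σ) {a b : Space n → ℝ}
    (ha : MemLp a (ENNReal.ofReal (2 * σ + 2)) volume)
    (hb : MemLp b (ENNReal.ofReal (2 * σ + 2)) volume) {X Y : ℝ} (hX : 0 < X) (hY : 0 < Y)
    (haX : lpNorm a (ENNReal.ofReal (2 * σ + 2)) volume ≤ X)
    (hbY : lpNorm b (ENNReal.ofReal (2 * σ + 2)) volume ≤ Y) :
    ∫ x, ‖a x‖ ^ (2 * σ) * ‖b x‖ ^ 2 ≤ 2 * (X ^ (2 * σ) * Y ^ 2) := by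
  have hp : 0 < 2 * σ + 2 := by linarith
  set p := 2 * σ + 2 with hpdef
  have ia := integrable_norm_rpow_ofReal hp ha
  have ib := integrable_norm_rpow_ofReal hp hb
  have h1 : ∀ x, ‖a x‖ ^ (2 * σ) * ‖b x‖ ^ 2
      ≤ X ^ (2 * σ) * Y ^ 2 * (‖a x‖ ^ p / X ^ p + ‖b x‖ ^ p / Y ^ p) := fun x => by
    have h2 := rpow_mul_sq_le hσ (div_nonneg (norm_nonneg (a x)) hX.le)
      (div_nonneg (norm_nonneg (b x)) hY.le)
    rw [Real.div_rpow (norm_nonneg _) hX.le, Real.div_rpow (norm_nonneg _) hX.le,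
      Real.div_rpow (norm_nonneg _) hY.le, div_pow] at h2
    have hX2 : 0 < X ^ (2 * σ) := Real.rpow_pos_of_pos hX _
    calc _ = X ^ (2 * σ) * Y ^ 2 * (‖a x‖ ^ (2 * σ) / X ^ (2 * σ) * (‖b x‖ ^ 2 / Y ^ 2)) := by
          field_simp
      _ ≤ _ := by gcongr
  refine (integral_mono (integrable_rpow_mul_sq hσ ha hb)
    (((ia.div_const _).add (ib.div_const _)).const_mul _) h1).trans ?_
  have h3 : ∫ x, (‖a x‖ ^ p / X ^ p + ‖b x‖ ^ p / Y ^ p) ≤ 2 := by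
    rw [integral_add (ia.div_const _) (ib.div_const _), integral_div, integral_div,
      integral_norm_rpow_eq hp ha.1, integral_norm_rpow_eq hp hb.1]
    have e1 : lpNorm a (ENNReal.ofReal p) volume ^ p / X ^ p ≤ 1 :=
      (div_le_one (by positivity)).2 (Real.rpow_le_rpow lpNorm_nonneg haX hp.le)
    have e2 : lpNorm b (ENNReal.ofReal p) volume ^ p / Y ^ p ≤ 1 :=
      (div_le_one (by positivity)).2 (Real.rpow_le_rpow lpNorm_nonneg hbY hp.le)
    linarith
  rw [mul_comm 2 (X ^ (2 * σ) * Y ^ 2)]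
  refine (integral_const_mul _ _).le.trans ?_
  exact mul_le_mul_of_nonneg_left h3 (by positivity)

theorem shiftPhase_add (r : ℝ) (x : Space n) :
    shiftPhase j α β r (x + (r * β) • unitVec j) = shiftPhase j α β r x + r ^ 2 * (α * β) := by
  simp only [shiftPhase, PiLp.add_apply, PiLp.smul_apply, unitVec_apply, if_true, smul_eq_mul]
  ring

theorem tendsto_shiftPhase (x : Space n) :
    Tendsto (fun r : ℝ => shiftPhase j α β r x) (𝓝 0) (𝓝 0) := by
  have : Continuous fun r : ℝ => shiftPhase j α β r x := by
    unfold shiftPhase; fun_prop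
  simpa [shiftPhase] using this.tendsto 0

/-- The integral of the term subtracted in `shiftDensity`, without its coefficient `σ/(σ+1)`. -/
noncomputable def shiftRemainder (σ : ℝ) (j : Fin n) (α β r : ℝ) (f : Space n → ℂ) : ℝ :=
  ∫ x, (r ^ 2)⁻¹ * (Real.sin (shiftPhase j α β r x)
    * (‖f (x - (r * β) • unitVec j)‖ ^ (2 * σ + 2) - ‖f x‖ ^ (2 * σ + 2)))

theorem integrable_shiftRemainder (hσ : 0 < σ) (hf : MemLp f (ENNReal.ofReal (2 * σ + 2)) volume)
    (r : ℝ) : Integrable (fun x => (r ^ 2)⁻¹ * (Real.sin (shiftPhase j α β r x)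
    * (‖f (x - (r * β) • unitVec j)‖ ^ (2 * σ + 2) - ‖f x‖ ^ (2 * σ + 2)))) volume := by
  have hp : 0 < 2 * σ + 2 := by linarith
  refine (Integrable.bdd_mul (c := 1) ((integrable_norm_rpow_ofReal hp (hf.translate _)).sub
    (integrable_norm_rpow_ofReal hp hf)) ?_ (Eventually.of_forall fun x => ?_)).const_mul _
  · exact (Real.continuous_sin.comp continuous_shiftPhase).aestronglyMeasurable
  · rw [Real.norm_eq_abs]; exact Real.abs_sin_le_one _

/-- Moving the translation onto the phase replaces the difference of `|f|^{2σ+2}` by a difference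
of sines, which is of order `r²`. -/
theorem shiftRemainder_eq (hσ : 0 < σ) (hf : MemLp f (ENNReal.ofReal (2 * σ + 2)) volume)
    (r : ℝ) : shiftRemainder σ j α β r f
      = ∫ x, (r ^ 2)⁻¹ * (Real.sin (shiftPhase j α β r x + r ^ 2 * (α * β))
          - Real.sin (shiftPhase j α β r x)) * ‖f x‖ ^ (2 * σ + 2) := by
  have hp : 0 < 2 * σ + 2 := by linarith
  have i0 := integrable_norm_rpow_ofReal hp hf
  have is : ∀ (h : Space n → ℝ), Integrable h volume → ∀ c : ℝ,
      Integrable (fun x => Real.sin (shiftPhase j α β r x + c) * h x) volume := fun h hh c => by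
    refine Integrable.bdd_mul (c := 1) hh ?_ (Eventually.of_forall fun x => ?_)
    · exact (Real.continuous_sin.comp (continuous_shiftPhase.add continuous_const)).aestronglyMeasurable
    · rw [Real.norm_eq_abs]; exact Real.abs_sin_le_one _
  have is0 : ∀ (h : Space n → ℝ), Integrable h volume →
      Integrable (fun x => Real.sin (shiftPhase j α β r x) * h x) volume := fun h hh => by
    simpa using is h hh 0
  have i1 := integrable_norm_rpow_ofReal hp (hf.translate ((r * β) • unitVec j))
  have e1 : ∫ x, Real.sin (shiftPhase j α β r x) * ‖f (x - (r * β) • unitVec j)‖ ^ (2 * σ + 2)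
      = ∫ x, Real.sin (shiftPhase j α β r x + r ^ 2 * (α * β)) * ‖f x‖ ^ (2 * σ + 2) := by
    rw [← integral_add_right_eq_self _ ((r * β) • unitVec j)]
    simp only [add_sub_cancel_right, shiftPhase_add]
  rw [shiftRemainder, integral_const_mul]
  simp only [mul_sub, mul_assoc, sub_mul]
  rw [integral_sub (is0 _ i1) (is0 _ i0), e1, ← integral_sub (is _ i0 _) (is0 _ i0),
    ← integral_const_mul]
  congr 1; funext x; ring

theorem abs_sin_add_sub_div_le {r : ℝ} (hr : r ≠ 0) (θ c : ℝ) :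
    |(r ^ 2)⁻¹ * (Real.sin (θ + r ^ 2 * c) - Real.sin θ)| ≤ |c| := by
  have h2 : 0 < r ^ 2 := by positivity
  rw [abs_mul, abs_of_pos (inv_pos.2 h2), inv_mul_le_iff₀ h2]
  have h := Real.lipschitzWith_sin.dist_le_mul (θ + r ^ 2 * c) θ
  rw [Real.dist_eq, Real.dist_eq, add_sub_cancel_left, abs_mul, abs_of_pos h2] at h
  simpa using h

theorem tendsto_sin_add_sub_div {r θ : ℕ → ℝ} (hr0 : ∀ k, r k ≠ 0) (hr : Tendsto r atTop (𝓝 0))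
    (hθ : Tendsto θ atTop (𝓝 0)) (c : ℝ) :
    Tendsto (fun k => (r k ^ 2)⁻¹ * (Real.sin (θ k + r k ^ 2 * c) - Real.sin (θ k))) atTop
      (𝓝 c) := by
  have h0 : HasDerivAt (fun s : ℝ => 2 * Real.sin (s * c / 2)) c 0 := by
    have h1 : HasDerivAt (fun s : ℝ => s * c / 2) (1 * c / 2) 0 :=
      ((hasDerivAt_id (0 : ℝ)).mul_const c).div_const 2
    refine (h1.sin.const_mul 2).congr_deriv ?_
    simp; ring
  have hr2 : Tendsto (fun k => r k ^ 2) atTop (𝓝[≠] 0) := by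
    refine tendsto_nhdsWithin_iff.2 ⟨?_, Eventually.of_forall fun k => pow_ne_zero 2 (hr0 k)⟩
    simpa using hr.pow 2
  have h1 := h0.tendsto_slope_zero.comp hr2
  have h2 : Tendsto (fun k => Real.cos (θ k + r k ^ 2 * c / 2)) atTop (𝓝 1) := by
    have h3 : Tendsto (fun k => θ k + r k ^ 2 * c / 2) atTop (𝓝 0) := by
      simpa using hθ.add (((hr.pow 2).mul_const c).div_const 2)
    have h4 := (Real.continuous_cos.tendsto 0).comp h3
    rwa [Real.cos_zero] at h4
  have h3 := h1.mul h2
  rw [mul_one] at h3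
  refine h3.congr fun k => ?_
  rw [Real.sin_sub_sin]
  simp only [Function.comp_apply, zero_add, zero_mul, zero_div, Real.sin_zero, mul_zero, sub_zero,
    smul_eq_mul, add_sub_cancel_left]
  rw [show (θ k + r k ^ 2 * c + θ k) / 2 = θ k + r k ^ 2 * c / 2 by ring]
  ring

theorem tendsto_shiftRemainder (hσ : 0 < σ) (hf : MemLp f (ENNReal.ofReal (2 * σ + 2)) volume)
    {r : ℕ → ℝ} (hr0 : ∀ k, r k ≠ 0) (hr : Tendsto r atTop (𝓝 0)) :
    Tendsto (fun k => shiftRemainder σ j α β (r k) f) atTop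
      (𝓝 (α * β * ∫ x, ‖f x‖ ^ (2 * σ + 2))) := by
  have hp : 0 < 2 * σ + 2 := by linarith
  have i0 := integrable_norm_rpow_ofReal hp hf
  simp only [shiftRemainder_eq hσ hf]
  rw [← integral_const_mul]
  refine tendsto_integral_of_dominated_convergence (fun x => |α * β| * ‖f x‖ ^ (2 * σ + 2))
    (fun k => ?_) (i0.const_mul _) (fun k => Eventually.of_forall fun x => ?_)
    (Eventually.of_forall fun x => ?_)
  · have := continuous_shiftPhase (j := j) (α := α) (β := β) (r := r k)
    have c1 : Continuous fun x : Space n => (r k ^ 2)⁻¹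
        * (Real.sin (shiftPhase j α β (r k) x + r k ^ 2 * (α * β))
          - Real.sin (shiftPhase j α β (r k) x)) := by fun_prop
    exact c1.aestronglyMeasurable.mul i0.1
  · rw [norm_mul, Real.norm_of_nonneg (by positivity : 0 ≤ ‖f x‖ ^ (2 * σ + 2))]
    exact mul_le_mul_of_nonneg_right (abs_sin_add_sub_div_le (hr0 k) _ _) (by positivity)
  · exact (tendsto_sin_add_sub_div hr0 hr ((tendsto_shiftPhase x).comp hr) _).mul_const _

theorem abs_shiftRemainder_le (hσ : 0 < σ) (hf : MemLp f (ENNReal.ofReal (2 * σ + 2)) volume)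
    {r : ℝ} (hr0 : r ≠ 0) :
    |shiftRemainder σ j α β r f| ≤ |α * β| * ∫ x, ‖f x‖ ^ (2 * σ + 2) := by
  have hp : 0 < 2 * σ + 2 := by linarith
  have i0 := integrable_norm_rpow_ofReal hp hf
  rw [shiftRemainder_eq hσ hf, ← integral_const_mul, ← Real.norm_eq_abs]
  refine norm_integral_le_of_norm_le (i0.const_mul _) (Eventually.of_forall fun x => ?_)
  rw [norm_mul, Real.norm_of_nonneg (by positivity : 0 ≤ ‖f x‖ ^ (2 * σ + 2))]
  exact mul_le_mul_of_nonneg_right (abs_sin_add_sub_div_le hr0 _ _) (by positivity)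

/-- `∫ 2σ |f|^{2σ-2} Re (conj f * g) Im (conj f * g)`; for `g = ∂ⱼ f` it occurs both in the evolution of the
kinetic energy and in that of the potential term, and cancels in the energy. -/
noncomputable def crossTerm (σ : ℝ) (f g : Space n → ℂ) : ℝ := ∫ x, crossDensity σ (f x) (g x)

theorem aestronglyMeasurable_shiftDensity (hf : AEStronglyMeasurable f volume)
    (r : ℝ) : AEStronglyMeasurable (fun x => shiftDensity σ (shiftPhase j α β r x) r
      (f (x - (r * β) • unitVec j)) (f x)) volume := by
  have ht : AEStronglyMeasurable (fun x => f (x - (r * β) • unitVec j)) volume :=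
    hf.comp_measurePreserving (measurePreserving_sub_right volume _)
  have hpow : ∀ (h : Space n → ℂ), AEStronglyMeasurable h volume → ∀ s : ℝ,
      AEStronglyMeasurable (fun x => ‖h x‖ ^ s) volume := fun h hh s =>
    (hh.norm.aemeasurable.pow_const s).aestronglyMeasurable
  have hph := continuous_shiftPhase (j := j) (α := α) (β := β) (r := r)
  have c1 : Continuous fun x => Complex.exp (Complex.I * (shiftPhase j α β r x : ℝ)) := by fun_prop
  have h1 : AEStronglyMeasurable (fun x => (conj (f x) * (Complex.exp (Complex.I
      * (shiftPhase j α β r x : ℝ)) * f (x - (r * β) • unitVec j))).im) volume :=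
    Complex.continuous_im.comp_aestronglyMeasurable
      ((Complex.continuous_conj.comp_aestronglyMeasurable hf).mul (c1.aestronglyMeasurable.mul ht))
  have h2 : AEStronglyMeasurable (fun x => Real.sin (shiftPhase j α β r x)) volume :=
    (Real.continuous_sin.comp hph).aestronglyMeasurable
  exact ((((hpow _ ht _).sub (hpow _ hf _)).mul h1).sub
    ((h2.mul ((hpow _ ht _).sub (hpow _ hf _))).const_mul _)).const_mul _

/-- The constant of the pointwise bound `abs_shiftDensity_le`. -/
noncomputable def shiftConst (σ : ℝ) : ℝ := 2 * σ + 2 * max 1 (2 * σ) + 1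

theorem shiftConst_pos (hσ : 0 < σ) : 0 < shiftConst σ := by
  have : 0 < max 1 (2 * σ) := lt_max_of_lt_left one_pos
  unfold shiftConst; linarith

theorem integrable_shiftDensity (hσ : 0 < σ) (hf : MemLp f (ENNReal.ofReal (2 * σ + 2)) volume)
    {r : ℝ} (hr : r ≠ 0) : Integrable (fun x => shiftDensity σ (shiftPhase j α β r x) r
      (f (x - (r * β) • unitVec j)) (f x)) volume := by
  have ht := hf.translate ((r * β) • unitVec j)
  have h1 : MemLp (fun x => ‖f (x - (r * β) • unitVec j)‖ + ‖f x‖) (ENNReal.ofReal (2 * σ + 2))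
      volume := ht.norm.add hf.norm
  have h2 : MemLp (fun x => ‖r⁻¹ • (f (x - (r * β) • unitVec j) - f x)‖)
      (ENNReal.ofReal (2 * σ + 2)) volume := ((ht.sub hf).const_smul r⁻¹).norm
  refine ((integrable_rpow_mul_sq hσ h1 h2).const_mul (shiftConst σ)).mono'
    (aestronglyMeasurable_shiftDensity hf.1 r) (Eventually.of_forall fun x => ?_)
  have := abs_shiftDensity_le hσ (shiftPhase j α β r x) hr (f (x - (r * β) • unitVec j)) (f x)
  rw [norm_norm, Real.norm_of_nonneg (by positivity : 0 ≤ ‖f (x - (r * β) • unitVec j)‖ + ‖f x‖)]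
  exact this

theorem shiftNL_eq (hσ : 0 < σ) (hf : MemLp f (ENNReal.ofReal (2 * σ + 2)) volume)
    {r : ℝ} (hr : r ≠ 0) : (r ^ 2)⁻¹ * shiftNL σ f (phaseShift j α β r f)
      = (∫ x, shiftDensity σ (shiftPhase j α β r x) r (f (x - (r * β) • unitVec j)) (f x))
        + σ / (σ + 1) * shiftRemainder σ j α β r f := by
  rw [shiftNL, shiftRemainder, ← integral_const_mul, ← integral_const_mul,
    ← integral_add (integrable_shiftDensity hσ hf hr)
      ((integrable_shiftRemainder hσ hf r).const_mul _)]
  congr 1; funext x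
  rw [norm_phaseShift, shiftDensity, phaseShift]
  ring

theorem abs_shiftNL_le (hσ : 0 < σ) (hf : MemLp f (ENNReal.ofReal (2 * σ + 2)) volume)
    (h : HasWeakPartial j f g) (hg : MemLp g (ENNReal.ofReal (2 * σ + 2)) volume) {X : ℝ}
    (hX : 0 < X) (hfX : lpNorm f (ENNReal.ofReal (2 * σ + 2)) volume ≤ X) {r : ℝ} (hr : r ≠ 0) :
    |(r ^ 2)⁻¹ * shiftNL σ f (phaseShift j α β r f)|
      ≤ shiftConst σ * (2 * ((2 * X) ^ (2 * σ)
          * (|β| * lpNorm g (ENNReal.ofReal (2 * σ + 2)) volume + 1) ^ 2))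
        + σ / (σ + 1) * (|α * β| * X ^ (2 * σ + 2)) := by
  have hp : 0 < 2 * σ + 2 := by linarith
  have hp1 : 1 ≤ ENNReal.ofReal (2 * σ + 2) := by
    rw [← ENNReal.ofReal_one]; exact ENNReal.ofReal_le_ofReal (by linarith)
  have ht := hf.translate ((r * β) • unitVec j)
  have h1 : MemLp (fun x => ‖f (x - (r * β) • unitVec j)‖ + ‖f x‖) (ENNReal.ofReal (2 * σ + 2))
      volume := ht.norm.add hf.norm
  have h2 : MemLp (fun x => ‖r⁻¹ • (f (x - (r * β) • unitVec j) - f x)‖)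
      (ENNReal.ofReal (2 * σ + 2)) volume := ((ht.sub hf).const_smul r⁻¹).norm
  have hst := shiftConst_pos hσ
  have htr : lpNorm (fun x => f (x - (r * β) • unitVec j)) (ENNReal.ofReal (2 * σ + 2)) volume
      = lpNorm f (ENNReal.ofReal (2 * σ + 2)) volume := by
    rw [← toReal_eLpNorm ht.1, ← toReal_eLpNorm hf.1, eLpNorm_translate hf.1]
  have b1 : lpNorm (fun x => ‖f (x - (r * β) • unitVec j)‖ + ‖f x‖)
      (ENNReal.ofReal (2 * σ + 2)) volume ≤ 2 * X := by
    refine (lpNorm_add_le (g := fun x => ‖f x‖) ht.norm hp1).trans ?_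
    rw [lpNorm_norm ht.1, lpNorm_norm hf.1, htr]
    linarith
  have b2 : lpNorm (fun x => ‖r⁻¹ • (f (x - (r * β) • unitVec j) - f x)‖)
      (ENNReal.ofReal (2 * σ + 2)) volume
      ≤ |β| * lpNorm g (ENNReal.ofReal (2 * σ + 2)) volume + 1 := by
    have m3 : MemLp (fun x => f (x - (r * β) • unitVec j) - f x) (ENNReal.ofReal (2 * σ + 2))
      volume := ht.sub hf
    have e1 : lpNorm (fun x => ‖r⁻¹ • (f (x - (r * β) • unitVec j) - f x)‖)
        (ENNReal.ofReal (2 * σ + 2)) volume = |r|⁻¹ *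
        lpNorm (fun x => f (x - (r * β) • unitVec j) - f x) (ENNReal.ofReal (2 * σ + 2)) volume := by
      refine (lpNorm_norm (m3.1.const_smul r⁻¹) _).trans ?_
      have := lpNorm_const_smul (p := ENNReal.ofReal (2 * σ + 2)) r⁻¹
        (fun x => f (x - (r * β) • unitVec j) - f x) volume
      refine this.trans ?_
      rw [coe_nnnorm, Real.norm_eq_abs, abs_inv]
    have e2 : lpNorm (fun x => f (x - (r * β) • unitVec j) - f x) (ENNReal.ofReal (2 * σ + 2))
        volume ≤ |r * β| * lpNorm g (ENNReal.ofReal (2 * σ + 2)) volume := by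
      refine lpNorm_le_of_eLpNorm_le m3.1 (mul_nonneg (abs_nonneg _) lpNorm_nonneg) ?_
      rw [ENNReal.ofReal_mul (abs_nonneg _), ← toReal_eLpNorm hg.1, ENNReal.ofReal_toReal hg.2.ne]
      exact h.eLpNorm_translate_sub_le hp1 (by simp) _
    rw [e1]
    have hr' : 0 < |r| := abs_pos.2 hr
    calc _ ≤ |r|⁻¹ * (|r * β| * lpNorm g (ENNReal.ofReal (2 * σ + 2)) volume) := by gcongr
      _ = |β| * lpNorm g (ENNReal.ofReal (2 * σ + 2)) volume := by
          rw [abs_mul]; field_simp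
      _ ≤ _ := by linarith
  have hY : 0 < |β| * lpNorm g (ENNReal.ofReal (2 * σ + 2)) volume + 1 := by
    have := lpNorm_nonneg (f := g) (p := ENNReal.ofReal (2 * σ + 2)) (μ := volume)
    positivity
  have b3 := integral_rpow_mul_sq_le hσ h1 h2 (by positivity : 0 < 2 * X) hY b1 b2
  have b4 : |∫ x, shiftDensity σ (shiftPhase j α β r x) r (f (x - (r * β) • unitVec j)) (f x)|
      ≤ shiftConst σ * ∫ x, ‖‖f (x - (r * β) • unitVec j)‖ + ‖f x‖‖ ^ (2 * σ)
          * ‖‖r⁻¹ • (f (x - (r * β) • unitVec j) - f x)‖‖ ^ 2 := by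
    rw [← integral_const_mul, ← Real.norm_eq_abs]
    refine norm_integral_le_of_norm_le ((integrable_rpow_mul_sq hσ h1 h2).const_mul _)
      (Eventually.of_forall fun x => ?_)
    have := abs_shiftDensity_le hσ (shiftPhase j α β r x) hr (f (x - (r * β) • unitVec j)) (f x)
    rw [norm_norm, Real.norm_of_nonneg (by positivity : 0 ≤ ‖f (x - (r * β) • unitVec j)‖ + ‖f x‖)]
    exact this
  have b5 := abs_shiftRemainder_le (j := j) (α := α) (β := β) hσ hf hr
  rw [integral_norm_rpow_eq hp hf.1] at b5
  have b6 : lpNorm f (ENNReal.ofReal (2 * σ + 2)) volume ^ (2 * σ + 2) ≤ X ^ (2 * σ + 2) :=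
    Real.rpow_le_rpow lpNorm_nonneg hfX hp.le
  rw [shiftNL_eq hσ hf hr]
  refine (abs_add_le _ _).trans (add_le_add (b4.trans (by gcongr)) ?_)
  rw [abs_mul, abs_of_pos (by positivity : 0 < σ / (σ + 1))]
  gcongr
  exact b5.trans (by gcongr)

/-- Dominated convergence, with dominating functions built from the difference quotients of `f`,
which converge in `L^{2σ+2}`. -/
theorem tendsto_integral_shiftDensity (hσ : 0 < σ)
    (hf : MemLp f (ENNReal.ofReal (2 * σ + 2)) volume)
    (h : HasWeakPartial j f g) (hg : MemLp g (ENNReal.ofReal (2 * σ + 2)) volume)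
    {r : ℕ → ℝ} (hr0 : ∀ k, r k ≠ 0) (hr : Tendsto r atTop (𝓝 0)) :
    Tendsto (fun k => ∫ x, shiftDensity σ (shiftPhase j α β (r k) x) (r k)
      (f (x - (r k * β) • unitVec j)) (f x)) atTop (𝓝 (β ^ 2 * crossTerm σ f g)) := by
  have hp : 0 < 2 * σ + 2 := by linarith
  have hp1' : 1 ≤ 2 * σ + 2 := by linarith
  set p := 2 * σ + 2 with hpdef
  have hp1 : 1 ≤ ENNReal.ofReal p := by
    rw [← ENNReal.ofReal_one]; exact ENNReal.ofReal_le_ofReal hp1'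
  have hr' : Tendsto r atTop (𝓝[≠] 0) :=
    tendsto_nhdsWithin_iff.2 ⟨hr, Eventually.of_forall hr0⟩
  set a : ℕ → Space n → ℂ := fun k x => f (x - (r k * β) • unitVec j) with ha
  set d : ℕ → Space n → ℂ := fun k x => (r k)⁻¹ • (a k x - f x) with hd
  have mam : ∀ k, MemLp (a k) (ENNReal.ofReal p) volume := fun k => hf.translate _
  have mdm : ∀ k, MemLp (d k) (ENNReal.ofReal p) volume := fun k =>
    ((mam k).sub hf).const_smul (r k)⁻¹
  have mg : MemLp (fun x => (-β) • g x) (ENNReal.ofReal p) volume := hg.const_smul (-β)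
  have td : Tendsto (fun k => eLpNorm (d k - fun x => (-β) • g x) (ENNReal.ofReal p) volume) atTop
      (𝓝 0) := by
    have h1 := (h.tendsto_scaled_differenceQuotient hp1 (by simp) hg β).comp hr'
    refine h1.congr fun k => ?_
    rw [Function.comp_apply]
    congr 1; funext x
    simp only [Pi.sub_apply, hd, ha, neg_smul, sub_neg_eq_add]
  have ta : Tendsto (fun k => eLpNorm (a k - f) (ENNReal.ofReal p) volume) atTop (𝓝 0) := by
    have h1 : Tendsto (fun k => (r k * β) • (unitVec j : Space n)) atTop (𝓝 0) := by
      simpa using (hr.mul_const β).smul_const (unitVec j : Space n)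
    exact (tendsto_eLpNorm_translate_sub hp1 (by simp) hf).comp h1
  have mA : ∀ k, MemLp (fun x => ‖a k x‖ + ‖f x‖) (ENNReal.ofReal p) volume := fun k =>
    (mam k).norm.add hf.norm
  have mA0 : MemLp (fun x => ‖f x‖ + ‖f x‖) (ENNReal.ofReal p) volume := hf.norm.add hf.norm
  have tA : Tendsto (fun k => eLpNorm ((fun x => ‖a k x‖ + ‖f x‖) - fun x => ‖f x‖ + ‖f x‖)
      (ENNReal.ofReal p) volume) atTop (𝓝 0) := by
    refine tendsto_of_tendsto_of_tendsto_of_le_of_le tendsto_const_nhds ta (fun _ => bot_le)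
      fun k => eLpNorm_mono fun x => ?_
    simp only [Pi.sub_apply, add_sub_add_right_eq_sub, Real.norm_eq_abs]
    exact abs_norm_sub_norm_le _ _
  set F : ℕ → Space n → ℝ := fun k x => shiftDensity σ (shiftPhase j α β (r k) x) (r k)
    (a k x) (f x) with hF
  set G : ℕ → Space n → ℝ := fun k x =>
    shiftConst σ * (‖‖a k x‖ + ‖f x‖‖ ^ p + ‖d k x‖ ^ p) with hG
  have iG : ∀ k, Integrable (G k) volume := fun k =>
    ((integrable_norm_rpow_ofReal hp (mA k)).add
      (integrable_norm_rpow_ofReal hp (mdm k))).const_mul _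
  have iG0 : Integrable (fun x => shiftConst σ * (‖‖f x‖ + ‖f x‖‖ ^ p + ‖(-β) • g x‖ ^ p))
      volume := ((integrable_norm_rpow_ofReal hp mA0).add
        (integrable_norm_rpow_ofReal hp mg)).const_mul _
  have tG : Tendsto (fun k => ∫ x, G k x) atTop
      (𝓝 (∫ x, shiftConst σ * (‖‖f x‖ + ‖f x‖‖ ^ p + ‖(-β) • g x‖ ^ p))) := by
    have h1 := ((tendsto_integral_norm_rpow hp1' mA mA0 tA).add
      (tendsto_integral_norm_rpow hp1' mdm mg td)).const_mul (shiftConst σ)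
    rw [← integral_add (integrable_norm_rpow_ofReal hp mA0) (integrable_norm_rpow_ofReal hp mg),
      ← integral_const_mul] at h1
    refine h1.congr fun k => ?_
    rw [← integral_add (integrable_norm_rpow_ofReal hp (mA k))
      (integrable_norm_rpow_ofReal hp (mdm k)), ← integral_const_mul]
  have hlim : β ^ 2 * crossTerm σ f g = ∫ x, crossDensity σ (f x) ((-β) • g x) := by
    rw [crossTerm, ← integral_const_mul]
    congr 1; funext x
    simp only [crossDensity, Complex.real_smul, mul_left_comm (conj (f x)), Complex.re_ofReal_mul,
      Complex.im_ofReal_mul]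
    ring
  rw [hlim]
  refine tendsto_of_subseq_tendsto fun ns hns => ?_
  obtain ⟨ms, hms, hae⟩ := exists_subseq_tendsto_ae_of_tendsto_eLpNorm
    (ENNReal.ofReal_pos.2 hp).ne' (fun k => (mdm (ns k)).1) mg.1 (td.comp hns)
  refine ⟨ms, ?_⟩
  have hsub : Tendsto (fun k => ns (ms k)) atTop atTop := hns.comp hms.tendsto_atTop
  have hrs := hr.comp hsub
  refine tendsto_integral_of_tendsto_dominating (F := fun k => F (ns (ms k)))
    (G := fun k => G (ns (ms k))) (fun k => aestronglyMeasurable_shiftDensity hf.1 _)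
    (fun k => iG _) iG0 (fun k => Eventually.of_forall fun x => ?_) ?_ ?_ (tG.comp hsub)
  · have h1 := abs_shiftDensity_le hσ (shiftPhase j α β (r (ns (ms k))) x) (hr0 (ns (ms k)))
      (a (ns (ms k)) x) (f x)
    refine h1.trans (mul_le_mul_of_nonneg_left ?_ (shiftConst_pos hσ).le)
    refine (rpow_mul_sq_le hσ (by positivity) (norm_nonneg _)).trans (le_of_eq ?_)
    rw [Real.norm_of_nonneg (by positivity : 0 ≤ ‖a (ns (ms k)) x‖ + ‖f x‖)]
  · filter_upwards [hae] with x hx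
    exact tendsto_shiftDensity hσ (fun k => hr0 _) hrs ((tendsto_shiftPhase x).comp hrs) hx
  · filter_upwards [hae] with x hx
    have hax : Tendsto (fun k => a (ns (ms k)) x) atTop (𝓝 (f x)) := by
      have h1 := (hrs.smul hx).add_const (f x)
      rw [zero_smul, zero_add] at h1
      refine h1.congr fun k => ?_
      simp only [hd, Function.comp_apply]
      rw [smul_smul, mul_inv_cancel₀ (hr0 _), one_smul, sub_add_cancel]
    exact (((hax.norm.add_const _).norm.rpow_const (Or.inr hp.le)).add
      (hx.norm.rpow_const (Or.inr hp.le))).const_mul _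

/-- The second-order limit of the nonlinear part of the evolution of `‖exp (i r Dⱼ) u - u‖²`. -/
theorem tendsto_shiftNL (hσ : 0 < σ) (hf : MemLp f (ENNReal.ofReal (2 * σ + 2)) volume)
    (h : HasWeakPartial j f g) (hg : MemLp g (ENNReal.ofReal (2 * σ + 2)) volume)
    {r : ℕ → ℝ} (hr0 : ∀ k, r k ≠ 0) (hr : Tendsto r atTop (𝓝 0)) :
    Tendsto (fun k => (r k ^ 2)⁻¹ * shiftNL σ f (phaseShift j α β (r k) f)) atTop
      (𝓝 (β ^ 2 * crossTerm σ f g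
        + σ / (σ + 1) * (α * β * ∫ x, ‖f x‖ ^ (2 * σ + 2)))) := by
  have h1 := (tendsto_integral_shiftDensity (α := α) (β := β) hσ hf h hg hr0 hr).add
    ((tendsto_shiftRemainder (j := j) (α := α) (β := β) hσ hf hr0 hr).const_mul (σ / (σ + 1)))
  refine h1.congr fun k => ?_
  rw [shiftNL_eq hσ hf (hr0 k)]

end ShiftLimit
/-! ### Integrated limits of derivatives -/

section TimeLimit

/-- The fundamental theorem of calculus for a limit of differentiable functions whose derivatives
converge almost everywhere and are dominated. -/
theorem sub_eq_integral_of_tendsto_deriv {a b : ℝ} (hab : a ≤ b) {P N : ℕ → ℝ → ℝ}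
    {P₀ N₀ D : ℝ → ℝ} (hP : ∀ k, ∀ t ∈ Set.Icc a b, HasDerivAt (P k) (N k t) t)
    (hP₀ : ∀ t ∈ Set.Icc a b, Tendsto (fun k => P k t) atTop (𝓝 (P₀ t)))
    (hN₀ : ∀ᵐ t ∂volume.restrict (Set.Icc a b), Tendsto (fun k => N k t) atTop (𝓝 (N₀ t)))
    (hD : IntegrableOn D (Set.Icc a b))
    (hND : ∀ k, ∀ᵐ t ∂volume.restrict (Set.Icc a b), |N k t| ≤ D t) :
    IntegrableOn N₀ (Set.Icc a b) ∧ P₀ b - P₀ a = ∫ t in Set.Icc a b, N₀ t := by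
  have hm : ∀ k, AEStronglyMeasurable (N k) (volume.restrict (Set.Icc a b)) := fun k => by
    refine (stronglyMeasurable_deriv (P k)).aestronglyMeasurable.congr ?_
    filter_upwards [ae_restrict_mem measurableSet_Icc] with t ht
    exact (hP k t ht).deriv
  have hi : ∀ k, IntegrableOn (N k) (Set.Icc a b) := fun k => hD.mono' (hm k) (hND k)
  have hftc : ∀ k, P k b - P k a = ∫ t in Set.Icc a b, N k t := fun k => by
    rw [integral_Icc_eq_integral_Ioc, ← intervalIntegral.integral_of_le hab]
    refine (intervalIntegral.integral_eq_sub_of_hasDerivAt (fun t ht => hP k t ?_) ?_).symm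
    · rwa [Set.uIcc_of_le hab] at ht
    · exact (intervalIntegrable_iff_integrableOn_Icc_of_le hab).2 (hi k)
  have hm0 : AEStronglyMeasurable N₀ (volume.restrict (Set.Icc a b)) :=
    aestronglyMeasurable_of_tendsto_ae atTop hm hN₀
  refine ⟨hD.mono' hm0 ?_, ?_⟩
  · filter_upwards [hN₀, ae_all_iff.2 hND] with t h1 h2
    exact le_of_tendsto h1.norm (Eventually.of_forall h2)
  · have h1 := tendsto_integral_of_dominated_convergence D hm hD hND hN₀
    have h2 := (hP₀ b (Set.right_mem_Icc.2 hab)).sub (hP₀ a (Set.left_mem_Icc.2 hab))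
    exact tendsto_nhds_unique h2 (h1.congr fun k => (hftc k).symm)

end TimeLimit

/-! ### Time regularity of the norms -/

section TimeRegularity

open ComplexConjugate

variable {n : ℕ} {σ lam κ : ℝ} {I : Set ℝ} {u₀ : Space n → ℂ} {u : ℝ → Space n → ℂ} {C : ℝ}

theorem abs_lpNorm_sub_lpNorm_le {E : Type*} [NormedAddCommGroup E] {f g : Space n → E} {p : ℝ≥0∞}
    (hp : 1 ≤ p) (hf : MemLp f p volume) (hg : MemLp g p volume) :
    |lpNorm f p volume - lpNorm g p volume| ≤ lpNorm (f - g) p volume := by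
  have h1 := lpNorm_add_le (g := f - g) hg hp
  have h2 := lpNorm_add_le (g := g - f) hf hp
  rw [add_sub_cancel] at h1 h2
  rw [lpNorm_sub_comm] at h2
  exact abs_sub_le_iff.2 ⟨by linarith, by linarith⟩

theorem IsSolution.tendsto_lpNorm_weakPartial_sub (hu : IsSolution σ lam (quadPot κ) I u₀ u)
    (hI : IsOpen I) (j : Fin n) {t : ℝ} (ht : t ∈ I) :
    Tendsto (fun s => lpNorm (weakPartial j (u s) - weakPartial j (u t)) 2 volume)
      (𝓝 t) (𝓝 0) := by
  refine squeeze_zero' (Eventually.of_forall fun _ => lpNorm_nonneg) ?_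
    (hu.tendsto_sigmaNorm_sub hI ht)
  filter_upwards [hI.mem_nhds ht] with s hs
  have hw := (hu.memSigma s hs).sub (hu.memSigma t ht)
  have h1 := weakPartial_sub_ae (hu.memSigma s hs).2 (hu.memSigma t ht).2 j
  refine le_trans (le_of_eq ?_) (hw.lpNorm_weakPartial_le j)
  rw [← toReal_eLpNorm (((hu.memSigma s hs).memLp_weakPartial j).sub
    ((hu.memSigma t ht).memLp_weakPartial j)).1, ← toReal_eLpNorm (hw.memLp_weakPartial j).1,
    eLpNorm_congr_ae h1]

theorem IsSolution.tendsto_lpNorm_coordMul_sub (hu : IsSolution σ lam (quadPot κ) I u₀ u)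
    (hI : IsOpen I) (j : Fin n) {t : ℝ} (ht : t ∈ I) :
    Tendsto (fun s => lpNorm (coordMul j (u s) - coordMul j (u t)) 2 volume)
      (𝓝 t) (𝓝 0) := by
  refine squeeze_zero' (Eventually.of_forall fun _ => lpNorm_nonneg) ?_
    (hu.tendsto_sigmaNorm_sub hI ht)
  filter_upwards [hI.mem_nhds ht] with s hs
  have hw := (hu.memSigma s hs).sub (hu.memSigma t ht)
  refine le_trans (le_of_eq ?_) (hw.lpNorm_coordMul_le j)
  congr 1; funext x; simp only [coordMul, Pi.sub_apply]; ring

theorem continuousOn_ip {A B : ℝ → Space n → ℂ} (hI : IsOpen I)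
    (hA : ∀ t ∈ I, MemLp (A t) 2 volume) (hB : ∀ t ∈ I, MemLp (B t) 2 volume)
    (tA : ∀ t ∈ I, Tendsto (fun s => lpNorm (A s - A t) 2 volume) (𝓝 t) (𝓝 0))
    (tB : ∀ t ∈ I, Tendsto (fun s => lpNorm (B s - B t) 2 volume) (𝓝 t) (𝓝 0)) :
    ContinuousOn (fun t => ip (A t) (B t)) I := by
  intro t ht
  refine ContinuousAt.continuousWithinAt (tendsto_ip ?_ ?_ (hA t ht) (hB t ht) (tA t ht) (tB t ht))
  · filter_upwards [hI.mem_nhds ht] with s hs using hA s hs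
  · filter_upwards [hI.mem_nhds ht] with s hs using hB s hs

theorem IsSolution.continuousOn_sigmaNorm (hu : IsSolution σ lam (quadPot κ) I u₀ u)
    (hI : IsOpen I) : ContinuousOn (fun t => sigmaNorm (u t)) I := by
  intro t ht
  refine ContinuousAt.continuousWithinAt ?_
  rw [ContinuousAt, tendsto_iff_norm_sub_tendsto_zero]
  refine squeeze_zero' (Eventually.of_forall fun _ => norm_nonneg _) ?_
    (hu.tendsto_sigmaNorm_sub hI ht)
  filter_upwards [hI.mem_nhds ht] with s hs
  have h1 := sigmaNorm_le_add (hu.memSigma s hs) (hu.memSigma t ht)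
  have h2 := sigmaNorm_le_add (hu.memSigma t ht) (hu.memSigma s hs)
  have h3 : sigmaNorm (u t - u s) = sigmaNorm (u s - u t) := by
    rw [sigmaNorm, sigmaNorm, ← neg_sub, sigmaENorm_neg ((hu.memSigma s hs).2.sub
      (hu.memSigma t ht).2)]
  exact abs_sub_le_iff.2 ⟨by linarith, by linarith⟩

theorem IsSolution.exists_sigmaNorm_le (hu : IsSolution σ lam (quadPot κ) I u₀ u)
    (hI : IsOpen I) {a b : ℝ} (hab : Set.Icc a b ⊆ I) :
    ∃ M, 0 < M ∧ ∀ t ∈ Set.Icc a b, sigmaNorm (u t) ≤ M := by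
  obtain ⟨M, hM⟩ := isCompact_Icc.exists_bound_of_continuousOn
    ((hu.continuousOn_sigmaNorm hI).mono hab)
  refine ⟨max M 1, by positivity, fun t ht => le_trans ?_ (le_max_left _ _)⟩
  exact (Real.le_norm_self _).trans (hM t ht)

theorem IsSolution.continuousOn_potentialTerm (hu : IsSolution σ lam (quadPot κ) I u₀ u)
    (hI : IsOpen I) (hσ : 0 < σ) (hC : SigmaEmbeds n σ C) :
    ContinuousOn (fun t => potentialTerm σ (u t)) I := by
  have hp1 : 1 ≤ ENNReal.ofReal (2 * σ + 2) := by
    rw [← ENNReal.ofReal_one]; exact ENNReal.ofReal_le_ofReal (by linarith)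
  have h0 : ContinuousOn (fun t => lpNorm (u t) (ENNReal.ofReal (2 * σ + 2)) volume) I := by
    intro t ht
    refine ContinuousAt.continuousWithinAt ?_
    rw [ContinuousAt, tendsto_iff_norm_sub_tendsto_zero]
    have h1 := (hu.tendsto_sigmaNorm_sub hI ht).const_mul C
    rw [mul_zero] at h1
    refine squeeze_zero' (Eventually.of_forall fun _ => norm_nonneg _) ?_ h1
    filter_upwards [hI.mem_nhds ht] with s hs
    refine (abs_lpNorm_sub_lpNorm_le hp1 (hC.2 _ (hu.memSigma s hs)).1
      (hC.2 _ (hu.memSigma t ht)).1).trans ?_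
    exact (hC.2 _ ((hu.memSigma s hs).sub (hu.memSigma t ht))).2
  exact h0.rpow_const fun t _ => Or.inr (by linarith)

/-- The `L^p` norm of `∂ⱼ u(t)` is lower semicontinuous, hence measurable, in time. -/
theorem IsSolution.aemeasurable_eLpNorm_weakPartial (hu : IsSolution σ lam (quadPot κ) I u₀ u)
    (hI : IsOpen I) (j : Fin n) {a b : ℝ} (hab : Set.Icc a b ⊆ I) (p : ℝ≥0∞) :
    AEMeasurable (fun t => eLpNorm (weakPartial j (u t)) p volume)
      (volume.restrict (Set.Icc a b)) := by
  refine aemeasurable_restrict_of_measurable_subtype measurableSet_Icc ?_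
  refine LowerSemicontinuous.measurable (lowerSemicontinuous_iff_isClosed_preimage.2 fun y => ?_)
  refine IsSeqClosed.isClosed fun t t₀ ht hlim => ?_
  have hmem : ∀ s : Set.Icc a b, MemLp (weakPartial j (u s)) 2 volume := fun s =>
    (hu.memSigma s (hab s.2)).memLp_weakPartial j
  have h1 := (hu.tendsto_lpNorm_weakPartial_sub hI j (hab t₀.2)).comp
    ((continuous_subtype_val.tendsto t₀).comp hlim)
  have h2 : Tendsto (fun k => eLpNorm (weakPartial j (u (t k)) - weakPartial j (u t₀)) 2 volume)
      atTop (𝓝 0) := by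
    have h3 := ENNReal.tendsto_ofReal h1
    rw [ENNReal.ofReal_zero] at h3
    refine h3.congr fun k => ?_
    have hm := (hmem (t k)).sub (hmem t₀)
    rw [Function.comp_apply, Function.comp_apply, ← toReal_eLpNorm hm.1,
      ENNReal.ofReal_toReal hm.2.ne]
  obtain ⟨ns, hns, hae⟩ := exists_subseq_tendsto_ae_of_tendsto_eLpNorm (by norm_num)
    (fun k => (hmem (t k)).1) (hmem t₀).1 h2
  have h4 := Lp.eLpNorm_lim_le_liminf_eLpNorm (p := p) (fun k => (hmem (t (ns k))).1) _ hae
  refine h4.trans (liminf_le_of_le (by isBoundedDefault) fun c hc => ?_)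
  obtain ⟨k, hk⟩ := hc.exists
  exact hk.trans (ht (ns k))

/-- The only use of the Strichartz regularity: subcriticality gives `q ≥ 2`, so that `∂ⱼ u` belongs to
`L²(a, b; L^{2σ+2})`, which is what dominates the cross terms. -/
theorem IsSolution.integrableOn_lpNorm_weakPartial_sq (hu : IsSolution σ lam (quadPot κ) I u₀ u)
    (hn : 1 ≤ n) (hI : IsOpen I) (hσ : 0 < σ) (hσn : 3 ≤ n → σ < 2 / ((n : ℝ) - 2)) (j : Fin n)
    {a b : ℝ} (hab : Set.Icc a b ⊆ I) :
    (∀ᵐ t ∂volume.restrict (Set.Icc a b),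
      MemLp (weakPartial j (u t)) (ENNReal.ofReal (2 * σ + 2)) volume) ∧
    IntegrableOn (fun t => lpNorm (weakPartial j (u t)) (ENNReal.ofReal (2 * σ + 2)) volume ^ 2)
      (Set.Icc a b) := by
  set p := ENNReal.ofReal (2 * σ + 2) with hp
  set q : ℝ := (4 * σ + 4) / (n * σ) with hq
  have hn0 : (1 : ℝ) ≤ n := by exact_mod_cast hn
  have hnσ : 0 < n * σ := by positivity
  -- `q ≥ 2` amounts to `(n - 2) σ ≤ 2`.
  have hq2 : 2 ≤ q := by
    rw [hq, le_div_iff₀ hnσ]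
    rcases le_or_gt 3 n with h3 | h3
    · have h4 := hσn h3
      have h5 : (3 : ℝ) ≤ n := by exact_mod_cast h3
      rw [lt_div_iff₀ (by linarith)] at h4
      nlinarith
    · have h5 : (n : ℝ) ≤ 2 := by exact_mod_cast Nat.lt_succ_iff.1 h3
      nlinarith
  have hq0 : 0 < q := by linarith
  have hm := hu.aemeasurable_eLpNorm_weakPartial hI j hab p
  have hfin : ∫⁻ t in Set.Icc a b, eLpNorm (weakPartial j (u t)) p volume ^ q < ∞ := by
    refine lt_of_le_of_lt (lintegral_mono fun t => ?_) (hu.strichartz a b hab)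
    refine ENNReal.rpow_le_rpow ?_ hq0.le
    exact (eLpNorm_weakPartial_le _ j _).trans (self_le_add_left _ _)
  have hae : ∀ᵐ t ∂volume.restrict (Set.Icc a b),
      MemLp (weakPartial j (u t)) p volume := by
    filter_upwards [ae_lt_top' (hm.pow_const q) hfin.ne, ae_restrict_mem measurableSet_Icc]
      with t ht hti
    refine ⟨((hu.memSigma t (hab hti)).memLp_weakPartial j).1, ?_⟩
    by_contra h
    rw [not_lt, top_le_iff] at h
    rw [h, ENNReal.top_rpow_of_pos hq0] at ht
    exact lt_irrefl _ ht
  refine ⟨hae, ?_⟩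
  have hlp : (fun t => lpNorm (weakPartial j (u t)) p volume)
      =ᵐ[volume.restrict (Set.Icc a b)] fun t => (eLpNorm (weakPartial j (u t)) p volume).toReal := by
    filter_upwards [hae] with t ht
    rw [toReal_eLpNorm ht.1]
  have hml : AEStronglyMeasurable (fun t => lpNorm (weakPartial j (u t)) p volume)
      (volume.restrict (Set.Icc a b)) := hm.ennreal_toReal.aestronglyMeasurable.congr hlp.symm
  have h1 : IntegrableOn (fun t => 1 + (eLpNorm (weakPartial j (u t)) p volume ^ q).toReal)
      (Set.Icc a b) :=
    (integrableOn_const (by simp)).add (integrable_toReal_of_lintegral_ne_top (hm.pow_const q) hfin.ne)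
  refine h1.mono' (hml.pow 2) ?_
  filter_upwards [hlp] with t ht
  rw [Real.norm_of_nonneg (by positivity), ht, ← ENNReal.toReal_rpow]
  set z := (eLpNorm (weakPartial j (u t)) p volume).toReal with hz
  have hz0 : 0 ≤ z := ENNReal.toReal_nonneg
  rcases le_total z 1 with h | h
  · have h2 : z ^ 2 ≤ 1 := pow_le_one₀ hz0 h
    have : 0 ≤ z ^ q := by positivity
    linarith
  · have h2 : z ^ (2 : ℝ) ≤ z ^ q := Real.rpow_le_rpow_of_exponent_le h hq2
    rw [Real.rpow_two] at h2
    linarith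

end TimeRegularity
/-! ### Evolution of `½ ‖α xⱼ u + i β ∂ⱼ u‖²` -/

section ShiftIdentity

open ComplexConjugate

variable {n : ℕ} {σ lam κ : ℝ} {I : Set ℝ} {u₀ : Space n → ℂ} {u : ℝ → Space n → ℂ} {C : ℝ}
  {f : Space n → ℂ} {j : Fin n} {α β : ℝ}

theorem MemSigma.tendsto_lpNorm_phaseShift_quotient_sub (hf : MemSigma f) {r : ℕ → ℝ}
    (hr1 : ∀ k, |r k| ≤ 1) (hr0 : ∀ k, r k ≠ 0) (hr : Tendsto r atTop (𝓝 0)) :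
    Tendsto (fun k => lpNorm ((fun x => (r k : ℂ)⁻¹
      * (HarmonicNLS.phaseShift j α β (r k) f x - f x)) - shiftGenerator j α β f) 2 volume)
      atTop (𝓝 0) := by
  have h1 := (ENNReal.tendsto_toReal ENNReal.zero_ne_top).comp
    (hf.tendsto_phaseShift_quotient (j := j) (α := α) (β := β) hr1 hr0 hr)
  refine h1.congr fun k => ?_
  rw [Function.comp_apply, toReal_eLpNorm]
  exact ((((memLp_phaseShift hf.memLp).sub hf.memLp).const_mul _).sub (memLp_shiftGenerator hf)).1

theorem memLp_phaseShift_quotient (hf : MemLp f 2 volume) (r : ℝ) :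
    MemLp (fun x => (r : ℂ)⁻¹ * (phaseShift j α β r f x - f x)) 2 volume :=
  ((memLp_phaseShift hf).sub hf).const_mul _

theorem MemSigma.tendsto_ip_phaseShift_sub (hf : MemSigma f) {g : Space n → ℂ}
    (hg : MemLp g 2 volume) {r : ℕ → ℝ}
    (hr1 : ∀ k, |r k| ≤ 1) (hr0 : ∀ k, r k ≠ 0) (hr : Tendsto r atTop (𝓝 0)) :
    Tendsto (fun k => ((r k : ℝ) : ℂ)⁻¹ * ip (HarmonicNLS.phaseShift j α β (r k) f
      - HarmonicNLS.phaseShift j α β (-r k) f) g) atTop (𝓝 (2 * ip (shiftGenerator j α β f) g)) := by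
  have hneg : Tendsto (fun k => -r k) atTop (𝓝 0) := by simpa using hr.neg
  have key : ∀ s : ℕ → ℝ, (∀ k, |s k| ≤ 1) → (∀ k, s k ≠ 0) → Tendsto s atTop (𝓝 0) →
      Tendsto (fun k => ip (fun x => (s k : ℂ)⁻¹
        * (HarmonicNLS.phaseShift j α β (s k) f x - f x)) g) atTop
        (𝓝 (ip (shiftGenerator j α β f) g)) := fun s h1 h0 hs =>
    tendsto_ip (Eventually.of_forall fun k => memLp_phaseShift_quotient hf.memLp _)
      (Eventually.of_forall fun _ => hg) (memLp_shiftGenerator hf) hg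
      (hf.tendsto_lpNorm_phaseShift_quotient_sub h1 h0 hs) (by simp)
  have h1 := (key r hr1 hr0 hr).add (key (fun k => -r k) (by simpa using hr1) (by simpa using hr0)
    hneg)
  rw [← two_mul] at h1
  refine h1.congr fun k => ?_
  have m1 : ∀ s : ℝ, MemLp (HarmonicNLS.phaseShift j α β s f) 2 volume := fun s =>
    memLp_phaseShift hf.memLp
  have e : ∀ s : ℝ, ip (fun x => (s : ℂ)⁻¹ * (HarmonicNLS.phaseShift j α β s f x - f x)) g
      = (s : ℂ)⁻¹ * (ip (HarmonicNLS.phaseShift j α β s f) g - ip f g) := fun s => by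
    rw [← ip_sub_left (m1 s) hf.memLp hg, ip_const_mul_left, map_inv₀, Complex.conj_ofReal]
    rfl
  rw [e, e, ip_sub_left (m1 _) (m1 _) hg]
  push_cast
  rw [inv_neg]
  ring

theorem norm_ip_phaseShift_sub_le (hf : MemSigma f) {g : Space n → ℂ} (hg : MemLp g 2 volume)
    {r : ℝ} (hr : |r| ≤ 1) {M : ℝ} (hM : sigmaNorm f ≤ M) (hgM : lpNorm g 2 volume ≤ M) :
    ‖ip (phaseShift j α β r f - phaseShift j α β (-r) f) g‖
      ≤ |r| * (2 * ((|β| + |α| * (1 + |β|)) * M ^ 2)) := by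
  have m1 : ∀ s : ℝ, MemLp (phaseShift j α β s f) 2 volume := fun s => memLp_phaseShift hf.memLp
  have hM0 : 0 ≤ M := (sigmaNorm_nonneg f).trans hM
  have key : ∀ s : ℝ, |s| ≤ 1 → ‖ip (phaseShift j α β s f - f) g‖
      ≤ |s| * ((|β| + |α| * (1 + |β|)) * M ^ 2) := fun s hs => by
    refine (norm_ip_le ((m1 s).sub hf.memLp) hg).trans ?_
    have h1 : lpNorm (phaseShift j α β s f - f) 2 volume ≤ |s| * (|β| + |α| * (1 + |β|)) * M :=
      (hf.lpNorm_phaseShift_sub_le hs).trans (mul_le_mul_of_nonneg_left hM (by positivity))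
    calc _ ≤ |s| * (|β| + |α| * (1 + |β|)) * M * M :=
          mul_le_mul h1 hgM lpNorm_nonneg (by positivity)
      _ = _ := by ring
  have e : ip (phaseShift j α β r f - phaseShift j α β (-r) f) g
      = ip (phaseShift j α β r f - f) g - ip (phaseShift j α β (-r) f - f) g := by
    rw [ip_sub_left (m1 _) (m1 _) hg, ip_sub_left (m1 _) hf.memLp hg,
      ip_sub_left (m1 _) hf.memLp hg]
    ring
  rw [e]
  have k1 := key r hr
  have k2 := key (-r) (by rwa [abs_neg])
  rw [abs_neg] at k2
  refine (norm_sub_le _ _).trans ?_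
  linarith

/-- The rate of change of `½ ‖Dⱼ u‖²` along the flow, for `Dⱼ = α xⱼ + i β ∂ⱼ`. -/
noncomputable def shiftRate (σ lam κ : ℝ) (j : Fin n) (α β : ℝ) (f : Space n → ℂ) : ℝ :=
  α * (ip (shiftGenerator j α β f) (weakPartial j f)).re
    + κ * β * (ip (shiftGenerator j α β f) (coordMul j f)).im
    - lam * (β ^ 2 * crossTerm σ f (weakPartial j f)
      + σ / (σ + 1) * (α * β * potentialTerm σ f))

theorem potentialTerm_eq_integral (hσ : 0 < σ) (hf : AEStronglyMeasurable f volume) :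
    potentialTerm σ f = ∫ x, ‖f x‖ ^ (2 * σ + 2) :=
  (integral_norm_rpow_eq (by linarith) hf).symm

/-- The evolution of `½ ‖Dⱼ u‖²`, obtained from the one of `½ ‖exp (i r Dⱼ) u - u‖²` by letting
`r` tend to `0`. -/
theorem IsSolution.shiftGenerator_sub_eq_integral (hu : IsSolution σ lam (quadPot κ) I u₀ u)
    (hn : 1 ≤ n) (hI : IsOpen I) (hσ : 0 < σ) (hσn : 3 ≤ n → σ < 2 / ((n : ℝ) - 2))
    (hC : SigmaEmbeds n σ C) (j : Fin n) (α β : ℝ) {a b : ℝ} (hle : a ≤ b)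
    (hab : Set.Icc a b ⊆ I) :
    IntegrableOn (fun t => shiftRate σ lam κ j α β (u t)) (Set.Icc a b) ∧
    1 / 2 * lpNorm (shiftGenerator j α β (u b)) 2 volume ^ 2
      - 1 / 2 * lpNorm (shiftGenerator j α β (u a)) 2 volume ^ 2
      = ∫ t in Set.Icc a b, shiftRate σ lam κ j α β (u t) := by
  obtain ⟨M, hM0, hM⟩ := hu.exists_sigmaNorm_le hI hab
  obtain ⟨hLp, hsq⟩ := hu.integrableOn_lpNorm_weakPartial_sq hn hI hσ hσn j hab
  set r : ℕ → ℝ := fun k => 1 / ((k : ℝ) + 1) with hrdef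
  have hrpos : ∀ k, 0 < r k := fun k => by rw [hrdef]; positivity
  have hr0 : ∀ k, r k ≠ 0 := fun k => (hrpos k).ne'
  have hr1 : ∀ k, |r k| ≤ 1 := fun k => by
    rw [abs_of_pos (hrpos k), hrdef]
    exact (div_le_one (by positivity)).2 (by linarith [(Nat.cast_nonneg k : (0 : ℝ) ≤ k)])
  have hr : Tendsto r atTop (𝓝 0) := tendsto_one_div_add_atTop_nhds_zero_nat
  set K : ℝ := 2 * ((|β| + |α| * (1 + |β|)) * M ^ 2) with hK
  set X : ℝ := C * M with hX
  have hX0 : 0 < X := mul_pos hC.1 hM0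
  have hst := shiftConst_pos hσ
  refine sub_eq_integral_of_tendsto_deriv hle
    (P := fun k t => (r k ^ 2)⁻¹ * (1 / 2 * lpNorm (phaseShift j α β (r k) (u t) - u t) 2 volume ^ 2))
    (P₀ := fun t => 1 / 2 * lpNorm (shiftGenerator j α β (u t)) 2 volume ^ 2)
    (D := fun t => 1 / 2 * |α| * K + |κ| / 2 * |β| * K + |lam| * (shiftConst σ
      * (2 * ((2 * X) ^ (2 * σ) * (2 * (β ^ 2 * lpNorm (weakPartial j (u t))
          (ENNReal.ofReal (2 * σ + 2)) volume ^ 2) + 2)))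
      + σ / (σ + 1) * (|α * β| * X ^ (2 * σ + 2))))
    (fun k t ht => (hu.hasDerivAt_lpNorm_phaseShift_sub hI hσ hC (hab ht)).const_mul _)
    (fun t ht => ?_) ?_ ?_ fun k => ?_
  · have hf := hu.memSigma t (hab ht)
    have h1 := tendsto_lpNorm_of_tendsto_eLpNorm (by norm_num)
      (fun k => memLp_phaseShift_quotient hf.memLp (r k)) (memLp_shiftGenerator hf)
      (hf.tendsto_phaseShift_quotient (j := j) (α := α) (β := β) hr1 hr0 hr)
    refine ((h1.pow 2).const_mul (1 / 2)).congr fun k => ?_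
    have h2 := lpNorm_const_smul (p := 2) ((r k : ℂ)⁻¹) (phaseShift j α β (r k) (u t) - u t) volume
    have h3 : (fun x => (r k : ℂ)⁻¹ * (phaseShift j α β (r k) (u t) x - u t x))
        = (r k : ℂ)⁻¹ • (phaseShift j α β (r k) (u t) - u t) := rfl
    rw [h3, h2, coe_nnnorm, norm_inv, Complex.norm_real, Real.norm_eq_abs, mul_pow, inv_pow, sq_abs]
    ring
  · filter_upwards [hLp, ae_restrict_mem measurableSet_Icc] with t htp ht
    have hf := hu.memSigma t (hab ht)
    have hfp := (hC.2 _ hf).1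
    have l1 := ((Complex.continuous_re.tendsto _).comp (hf.tendsto_ip_phaseShift_sub (j := j)
      (α := α) (β := β) (hf.memLp_weakPartial j) hr1 hr0 hr)).const_mul (1 / 2 * α)
    have l2 := ((Complex.continuous_im.tendsto _).comp (hf.tendsto_ip_phaseShift_sub (j := j)
      (α := α) (β := β) (hf.memLp_coordMul j) hr1 hr0 hr)).const_mul (κ / 2 * β)
    have l3 := (tendsto_shiftNL (α := α) (β := β) hσ hfp (hf.2.hasWeakPartial j) htp hr0
      hr).const_mul lam
    have l4 := (l1.add l2).sub l3
    have e : 1 / 2 * α * (2 * ip (shiftGenerator j α β (u t)) (weakPartial j (u t))).re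
        + κ / 2 * β * (2 * ip (shiftGenerator j α β (u t)) (coordMul j (u t))).im
        - lam * (β ^ 2 * crossTerm σ (u t) (weakPartial j (u t))
          + σ / (σ + 1) * (α * β * ∫ x, ‖u t x‖ ^ (2 * σ + 2)))
        = shiftRate σ lam κ j α β (u t) := by
      rw [shiftRate, potentialTerm_eq_integral hσ hf.1]
      simp only [Complex.mul_re, Complex.mul_im, Complex.re_ofNat, Complex.im_ofNat]
      ring
    rw [e] at l4
    refine l4.congr fun k => ?_
    simp only [Function.comp_apply, ← Complex.ofReal_inv, Complex.re_ofReal_mul,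
      Complex.im_ofReal_mul]
    have := hr0 k
    field_simp
  · exact (integrableOn_const (by simp)).add ((((((hsq.const_mul _).const_mul _).add
      (integrableOn_const (by simp))).const_mul _).const_mul _).const_mul _ |>.add
        (integrableOn_const (by simp)) |>.const_mul _)
  · filter_upwards [hLp, ae_restrict_mem measurableSet_Icc] with t htp ht
    have hf := hu.memSigma t (hab ht)
    have hfp := hC.2 _ hf
    have hMt := hM t ht
    have b1 := norm_ip_phaseShift_sub_le (j := j) (α := α) (β := β) hf (hf.memLp_weakPartial j)
      (hr1 k) hMt ((hf.lpNorm_weakPartial_le j).trans hMt)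
    have b2 := norm_ip_phaseShift_sub_le (j := j) (α := α) (β := β) hf (hf.memLp_coordMul j)
      (hr1 k) hMt ((hf.lpNorm_coordMul_le j).trans hMt)
    rw [← hK, abs_of_pos (hrpos k)] at b1 b2
    have b1' := (Complex.abs_re_le_norm _).trans b1
    have b2' := (Complex.abs_im_le_norm _).trans b2
    have b3 := abs_shiftNL_le (α := α) (β := β) hσ hfp.1 (hf.2.hasWeakPartial j) htp hX0
      (hfp.2.trans (by rw [hX]; exact mul_le_mul_of_nonneg_left hMt hC.1.le)) (hr0 k)
    have b4 : (|β| * lpNorm (weakPartial j (u t)) (ENNReal.ofReal (2 * σ + 2)) volume + 1) ^ 2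
        ≤ 2 * (β ^ 2 * lpNorm (weakPartial j (u t)) (ENNReal.ofReal (2 * σ + 2)) volume ^ 2) + 2 := by
      rw [← sq_abs β]
      nlinarith [sq_nonneg (|β| * lpNorm (weakPartial j (u t)) (ENNReal.ofReal (2 * σ + 2)) volume
        - 1)]
    have b5 : shiftConst σ * (2 * ((2 * X) ^ (2 * σ) * (|β| * lpNorm (weakPartial j (u t))
          (ENNReal.ofReal (2 * σ + 2)) volume + 1) ^ 2))
        ≤ shiftConst σ * (2 * ((2 * X) ^ (2 * σ) * (2 * (β ^ 2 * lpNorm (weakPartial j (u t))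
          (ENNReal.ofReal (2 * σ + 2)) volume ^ 2) + 2))) := by gcongr
    set A := (ip (phaseShift j α β (r k) (u t) - phaseShift j α β (-r k) (u t))
      (weakPartial j (u t))).re with hA
    set B := (ip (phaseShift j α β (r k) (u t) - phaseShift j α β (-r k) (u t))
      (coordMul j (u t))).im with hB
    set N := shiftNL σ (u t) (phaseShift j α β (r k) (u t)) with hN
    have hrk := hrpos k
    have e : (r k ^ 2)⁻¹ * (1 / 2 * (r k * α) * A + κ / 2 * (r k * β) * B - lam * N)
        = 1 / 2 * α * ((r k)⁻¹ * A) + κ / 2 * β * ((r k)⁻¹ * B) - lam * ((r k ^ 2)⁻¹ * N) := by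
      field_simp
    have hinv : ∀ Z : ℝ, |Z| ≤ r k * K → |(r k)⁻¹ * Z| ≤ K := fun Z hZ => by
      rw [abs_mul, abs_inv, abs_of_pos hrk, inv_mul_le_iff₀ hrk]; exact hZ
    rw [e]
    refine (abs_sub _ _).trans (add_le_add ((abs_add_le _ _).trans (add_le_add ?_ ?_)) ?_)
    · rw [abs_mul, abs_mul, abs_of_pos (by norm_num : (0 : ℝ) < 1 / 2)]
      exact mul_le_mul_of_nonneg_left (hinv A b1') (by positivity)
    · rw [abs_mul, abs_mul, abs_div, abs_two]
      exact mul_le_mul_of_nonneg_left (hinv B b2') (by positivity)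
    · rw [abs_mul]
      exact mul_le_mul_of_nonneg_left (b3.trans (add_le_add b5 le_rfl)) (abs_nonneg _)

end ShiftIdentity
/-! ### Regularized powers -/

section Regularized

open ComplexConjugate

variable {σ ε r : ℝ}

/-- The regularization `(r / (1 + ε r)) ^ σ / (1 + ε r) ^ 2` of `r ^ σ`, bounded for `ε > 0`. The second
factor is the derivative of `r / (1 + ε r)`, which makes the primitive explicit. -/
noncomputable def regPow (σ ε r : ℝ) : ℝ := (r / (1 + ε * r)) ^ σ * ((1 + ε * r) ^ 2)⁻¹

/-- The derivative of `regPow`. -/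
noncomputable def regPowDeriv (σ ε r : ℝ) : ℝ :=
  σ * (r / (1 + ε * r)) ^ (σ - 1) * ((1 + ε * r) ^ 4)⁻¹
    - 2 * ε * (r / (1 + ε * r)) ^ σ * ((1 + ε * r) ^ 3)⁻¹

/-- The primitive of `regPow` that vanishes at `0`. -/
noncomputable def regPowPrim (σ ε r : ℝ) : ℝ := (r / (1 + ε * r)) ^ (σ + 1) / (σ + 1)

theorem hasDerivAt_regQuotient (hε : 0 ≤ ε) (hr : 0 ≤ r) :
    HasDerivAt (fun r => r / (1 + ε * r)) ((1 + ε * r) ^ 2)⁻¹ r := by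
  have h0 : 1 + ε * r ≠ 0 := by positivity
  have h1 := (hasDerivAt_id r).div (((hasDerivAt_id r).const_mul ε).const_add 1) h0
  refine h1.congr_deriv ?_
  simp only [id]
  field_simp
  ring

theorem hasDerivAt_regPowPrim (hσ : 0 < σ) (hε : 0 ≤ ε) (hr : 0 ≤ r) :
    HasDerivAt (regPowPrim σ ε) (regPow σ ε r) r := by
  have h1 := ((hasDerivAt_regQuotient hε hr).rpow_const (p := σ + 1)
    (Or.inr (by linarith))).div_const (σ + 1)
  refine h1.congr_deriv ?_
  rw [regPow, add_sub_cancel_right]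
  field_simp

theorem hasDerivAt_regPow (hε : 0 ≤ ε) (hr : 0 < r) :
    HasDerivAt (regPow σ ε) (regPowDeriv σ ε r) r := by
  have h0 : 0 < 1 + ε * r := by positivity
  have h1 := (hasDerivAt_regQuotient hε hr.le).rpow_const (p := σ)
    (Or.inl (div_pos hr h0).ne')
  have h2 : HasDerivAt (fun r => ((1 + ε * r) ^ 2)⁻¹) _ r :=
    (((((hasDerivAt_id r).const_mul ε).const_add 1).fun_pow 2)).fun_inv (by simpa using h0.ne')
  refine (h1.mul h2).congr_deriv ?_
  simp only [regPowDeriv, id]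
  field_simp
  ring

theorem regPow_nonneg (hε : 0 ≤ ε) (hr : 0 ≤ r) : 0 ≤ regPow σ ε r := by
  unfold regPow; positivity

theorem regQuotient_le (hε : 0 ≤ ε) (hr : 0 ≤ r) : r / (1 + ε * r) ≤ r :=
  div_le_self hr (by nlinarith [mul_nonneg hε hr])

theorem inv_sq_le_one (hε : 0 ≤ ε) (hr : 0 ≤ r) : ((1 + ε * r) ^ 2)⁻¹ ≤ 1 :=
  inv_le_one_of_one_le₀ (one_le_pow₀ (by nlinarith [mul_nonneg hε hr]))

theorem regPow_le_rpow (hσ : 0 < σ) (hε : 0 ≤ ε) (hr : 0 ≤ r) : regPow σ ε r ≤ r ^ σ := by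
  have h1 : (r / (1 + ε * r)) ^ σ ≤ r ^ σ :=
    Real.rpow_le_rpow (by positivity) (regQuotient_le hε hr) hσ.le
  calc regPow σ ε r ≤ r ^ σ * 1 :=
        mul_le_mul h1 (inv_sq_le_one hε hr) (by positivity) (by positivity)
    _ = r ^ σ := mul_one _

theorem regPow_le_const (hσ : 0 < σ) (hε : 0 < ε) (hr : 0 ≤ r) : regPow σ ε r ≤ ε⁻¹ ^ σ := by
  have h0 : r / (1 + ε * r) ≤ ε⁻¹ := by
    rw [div_le_iff₀ (by positivity), mul_add, inv_mul_cancel_left₀ hε.ne']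
    have := inv_pos.2 hε
    linarith
  have h1 : (r / (1 + ε * r)) ^ σ ≤ ε⁻¹ ^ σ := Real.rpow_le_rpow (by positivity) h0 hσ.le
  calc regPow σ ε r ≤ ε⁻¹ ^ σ * 1 :=
        mul_le_mul h1 (inv_sq_le_one hε.le hr) (by positivity) (by positivity)
    _ = _ := mul_one _

theorem abs_regPowDeriv_mul_le (hσ : 0 < σ) (hε : 0 ≤ ε) (hr : 0 ≤ r) :
    |regPowDeriv σ ε r| * r ≤ (σ + 2) * regPow σ ε r := by
  rcases hr.eq_or_lt with rfl | hr
  · rw [mul_zero]; exact mul_nonneg (by linarith) (regPow_nonneg hε le_rfl)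
  have h0 : 0 < 1 + ε * r := by positivity
  have hs : 0 < r / (1 + ε * r) := div_pos hr h0
  have e : regPowDeriv σ ε r * r
      = (r / (1 + ε * r)) ^ σ * ((1 + ε * r) ^ 3)⁻¹ * (σ - 2 * (ε * r)) := by
    have e1 : (r / (1 + ε * r)) ^ σ = (r / (1 + ε * r)) ^ (σ - 1) * (r / (1 + ε * r)) := by
      rw [← Real.rpow_add_one hs.ne', sub_add_cancel]
    rw [regPowDeriv, e1]
    field_simp
  have hεr : 0 ≤ ε * r := by positivity
  have h1 : |σ - 2 * (ε * r)| ≤ (σ + 2) * (1 + ε * r) := by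
    rw [abs_le]; constructor <;> nlinarith
  rw [← abs_of_pos hr, ← abs_mul, abs_of_pos hr, e, abs_mul, abs_of_nonneg (by positivity)]
  calc _ ≤ (r / (1 + ε * r)) ^ σ * ((1 + ε * r) ^ 3)⁻¹ * ((σ + 2) * (1 + ε * r)) := by gcongr
    _ = (σ + 2) * regPow σ ε r := by rw [regPow]; field_simp

theorem norm_sq_rpow (z : ℂ) (s : ℝ) : (‖z‖ ^ 2) ^ s = ‖z‖ ^ (2 * s) := by
  rw [← Real.rpow_natCast, ← Real.rpow_mul (norm_nonneg z)]; norm_num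

/-- The regularized nonlinearity `regPow σ ε (|z|²) z`. It is Lipschitz for `ε > 0`, so that it maps `Σ` to
itself and `regNL (u t)` is an admissible test function. -/
noncomputable def regNL (σ ε : ℝ) (z : ℂ) : ℂ := ((regPow σ ε (‖z‖ ^ 2) : ℝ) : ℂ) * z

/-- The real derivative of `regNL`. -/
noncomputable def regNLDeriv (σ ε : ℝ) (z : ℂ) : ℂ →L[ℝ] ℂ :=
  regPow σ ε (‖z‖ ^ 2) • ContinuousLinearMap.id ℝ ℂ
    + (2 * regPowDeriv σ ε (‖z‖ ^ 2)) • (innerSL ℝ z).smulRight z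

theorem regNLDeriv_apply (z w : ℂ) : regNLDeriv σ ε z w = (regPow σ ε (‖z‖ ^ 2) : ℂ) * w
    + ((2 * regPowDeriv σ ε (‖z‖ ^ 2) * (conj z * w).re : ℝ) : ℂ) * z := by
  simp only [regNLDeriv, add_apply, smul_apply, ContinuousLinearMap.smulRight_apply,
    innerSL_apply_apply, Complex.inner, ContinuousLinearMap.id_apply, Complex.real_smul,
    mul_comm w (conj z)]
  push_cast; ring

theorem norm_regNL_le (hσ : 0 < σ) (hε : 0 ≤ ε) (z : ℂ) : ‖regNL σ ε z‖ ≤ ‖z‖ ^ (2 * σ) * ‖z‖ := by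
  rw [regNL, norm_mul, Complex.norm_real, Real.norm_of_nonneg (regPow_nonneg hε (by positivity)),
    ← norm_sq_rpow]
  exact mul_le_mul_of_nonneg_right (regPow_le_rpow hσ hε (by positivity)) (norm_nonneg _)

theorem hasFDerivAt_regNL (hσ : 0 < σ) (hε : 0 ≤ ε) (z : ℂ) :
    HasFDerivAt (regNL σ ε) (regNLDeriv σ ε z) z := by
  rcases eq_or_ne z 0 with rfl | hz
  · have e : regNLDeriv σ ε 0 = 0 := by
      ext w
      rw [regNLDeriv_apply]
      simp [regPow, hσ.ne']
    have e0 : regNL σ ε 0 = 0 := by simp [regNL]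
    rw [e, hasFDerivAt_iff_isLittleO_nhds_zero, Asymptotics.isLittleO_iff]
    intro c hc
    have h1 : Tendsto (fun h : ℂ => ‖h‖ ^ (2 * σ)) (𝓝 0) (𝓝 0) := by
      have h2 := (continuous_norm.tendsto (0 : ℂ)).rpow_const (p := 2 * σ) (Or.inr (by positivity))
      rwa [norm_zero, Real.zero_rpow (by positivity)] at h2
    filter_upwards [h1.eventually (gt_mem_nhds hc)] with h hh
    rw [zero_add, e0, sub_zero, zero_apply, sub_zero]
    exact (norm_regNL_le hσ hε h).trans (mul_le_mul_of_nonneg_right hh.le (norm_nonneg _))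
  · have h1 : HasFDerivAt (fun w : ℂ => ‖w‖ ^ 2) (2 • innerSL ℝ z) z :=
      (hasStrictFDerivAt_norm_sq z).hasFDerivAt
    have h2 := (hasDerivAt_regPow (σ := σ) hε (pow_pos (norm_pos_iff.2 hz) 2)).comp_hasFDerivAt z h1
    have h3 : HasFDerivAt (fun w : ℂ => regPow σ ε (‖w‖ ^ 2) • w) _ z :=
      h2.smul (hasFDerivAt_id z)
    have e : (fun w : ℂ => regPow σ ε (‖w‖ ^ 2) • w) = regNL σ ε := by
      funext w; rw [regNL, Complex.real_smul]
    rw [e] at h3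
    refine h3.congr_fderiv ?_
    ext w
    rw [regNLDeriv_apply]
    simp only [add_apply, smul_apply, ContinuousLinearMap.smulRight_apply,
      innerSL_apply_apply, Complex.inner, ContinuousLinearMap.id_apply, Complex.real_smul,
      mul_comm w (conj z), Function.comp_apply, smul_eq_mul, nsmul_eq_mul]
    push_cast; ring

/-- A Lipschitz constant of the regularized nonlinearity. -/
noncomputable def regLip (σ ε : ℝ) : ℝ := (2 * σ + 5) * ε⁻¹ ^ σ

theorem regLip_nonneg (hσ : 0 < σ) (hε : 0 < ε) : 0 ≤ regLip σ ε := by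
  unfold regLip; positivity

theorem norm_regNLDeriv_le (hσ : 0 < σ) (hε : 0 < ε) (z : ℂ) : ‖regNLDeriv σ ε z‖ ≤ regLip σ ε := by
  refine ContinuousLinearMap.opNorm_le_bound _ (regLip_nonneg hσ hε) fun w => ?_
  have h1 := regPow_nonneg (σ := σ) hε.le (sq_nonneg ‖z‖)
  have h2 := abs_regPowDeriv_mul_le hσ hε.le (sq_nonneg ‖z‖)
  have h3 := regPow_le_const hσ hε (sq_nonneg ‖z‖)
  have h4 : |(conj z * w).re| ≤ ‖z‖ * ‖w‖ := by
    refine (Complex.abs_re_le_norm _).trans (le_of_eq ?_)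
    rw [norm_mul, RCLike.norm_conj]
  rw [regNLDeriv_apply]
  refine (norm_add_le _ _).trans ?_
  rw [norm_mul, norm_mul, Complex.norm_real, Complex.norm_real, Real.norm_of_nonneg h1,
    Real.norm_eq_abs, abs_mul, abs_mul, abs_two]
  calc _ ≤ regPow σ ε (‖z‖ ^ 2) * ‖w‖
        + 2 * |regPowDeriv σ ε (‖z‖ ^ 2)| * (‖z‖ * ‖w‖) * ‖z‖ := by gcongr
    _ = (regPow σ ε (‖z‖ ^ 2) + 2 * (|regPowDeriv σ ε (‖z‖ ^ 2)| * ‖z‖ ^ 2)) * ‖w‖ := by ring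
    _ ≤ (regPow σ ε (‖z‖ ^ 2) + 2 * ((σ + 2) * regPow σ ε (‖z‖ ^ 2))) * ‖w‖ := by gcongr
    _ = (2 * σ + 5) * regPow σ ε (‖z‖ ^ 2) * ‖w‖ := by ring
    _ ≤ _ := by unfold regLip; gcongr

theorem lipschitzWith_regNL (hσ : 0 < σ) (hε : 0 < ε) :
    LipschitzWith (regLip σ ε).toNNReal (regNL σ ε) := by
  refine lipschitzWith_of_nnnorm_fderiv_le (𝕜 := ℝ)
    (fun z => (hasFDerivAt_regNL hσ hε.le z).differentiableAt) fun z => ?_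
  rw [(hasFDerivAt_regNL hσ hε.le z).fderiv, ← NNReal.coe_le_coe, coe_nnnorm,
    Real.coe_toNNReal _ (regLip_nonneg hσ hε)]
  exact norm_regNLDeriv_le hσ hε z

theorem norm_regNL_sub_le (hσ : 0 < σ) (hε : 0 < ε) (z w : ℂ) :
    ‖regNL σ ε z - regNL σ ε w‖ ≤ regLip σ ε * ‖z - w‖ := by
  have := (lipschitzWith_regNL hσ hε).dist_le_mul z w
  rwa [dist_eq_norm, dist_eq_norm, Real.coe_toNNReal _ (regLip_nonneg hσ hε)] at this

/-- The regularization of `|z|^{2σ+2} / (σ+1)`. -/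
noncomputable def regPot (σ ε : ℝ) (z : ℂ) : ℝ := regPowPrim σ ε (‖z‖ ^ 2)

theorem hasFDerivAt_regPot (hσ : 0 < σ) (hε : 0 ≤ ε) (z : ℂ) :
    HasFDerivAt (regPot σ ε) ((2 : ℝ) • innerSL ℝ (regNL σ ε z)) z := by
  have h1 : HasFDerivAt (fun w : ℂ => ‖w‖ ^ 2) (2 • innerSL ℝ z) z :=
    (hasStrictFDerivAt_norm_sq z).hasFDerivAt
  have h2 : HasFDerivAt (regPot σ ε) _ z :=
    (hasDerivAt_regPowPrim hσ hε (sq_nonneg ‖z‖)).comp_hasFDerivAt z h1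
  refine h2.congr_fderiv ?_
  ext w
  simp only [smul_apply, innerSL_apply_apply, smul_eq_mul, nsmul_eq_mul, regNL]
  rw [← Complex.real_smul, real_inner_smul_left]
  push_cast; ring

/-- `regPot` is its first-order Taylor polynomial, up to a quadratic error. -/
theorem abs_regPot_sub_le (hσ : 0 < σ) (hε : 0 < ε) (z w : ℂ) :
    |regPot σ ε w - regPot σ ε z - 2 * (conj (regNL σ ε z) * (w - z)).re|
      ≤ 2 * regLip σ ε * ‖w - z‖ ^ 2 := by
  have hline : ∀ τ : ℝ, HasDerivAt (fun τ : ℝ => regPot σ ε (z + τ • (w - z)))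
      (2 * (conj (regNL σ ε (z + τ • (w - z))) * (w - z)).re) τ := fun τ => by
    have h1 : HasDerivAt (fun τ : ℝ => z + τ • (w - z)) (w - z) τ := by
      simpa using ((hasDerivAt_id τ).smul_const (w - z)).const_add z
    refine ((hasFDerivAt_regPot hσ hε.le _).comp_hasDerivAt τ h1).congr_deriv ?_
    simp only [smul_apply, innerSL_apply_apply, smul_eq_mul, Complex.inner]
    rw [mul_comm (w - z)]
  obtain ⟨c, hc, he⟩ := exists_hasDerivAt_eq_slope (fun τ : ℝ => regPot σ ε (z + τ • (w - z))) _
    one_pos (fun τ _ => (hline τ).continuousAt.continuousWithinAt) fun τ _ => hline τ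
  simp only [one_smul, zero_smul, add_zero, sub_zero, div_one, add_sub_cancel] at he
  rw [← he, ← mul_sub, ← Complex.sub_re, ← sub_mul, ← map_sub, abs_mul, abs_two, mul_assoc]
  refine mul_le_mul_of_nonneg_left ((Complex.abs_re_le_norm _).trans ?_) two_pos.le
  rw [norm_mul, RCLike.norm_conj, sq, ← mul_assoc]
  refine mul_le_mul_of_nonneg_right ((norm_regNL_sub_le hσ hε _ _).trans ?_) (norm_nonneg _)
  refine mul_le_mul_of_nonneg_left ?_ (regLip_nonneg hσ hε)
  rw [add_sub_cancel_left, norm_smul, Real.norm_of_nonneg hc.1.le]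
  exact mul_le_of_le_one_left (norm_nonneg _) hc.2.le

/-- The regularization `Im (conj (regNL' z w) w)` of `crossDensity`; see `im_conj_regNLDeriv_mul`. -/
noncomputable def regCross (σ ε : ℝ) (z w : ℂ) : ℝ :=
  2 * regPowDeriv σ ε (‖z‖ ^ 2) * (conj z * w).re * (conj z * w).im

theorem im_conj_regNLDeriv_mul (z w : ℂ) :
    (conj (regNLDeriv σ ε z w) * w).im = regCross σ ε z w := by
  rw [regNLDeriv_apply, regCross]
  simp only [map_add, map_mul, Complex.conj_ofReal, Complex.mul_im, Complex.mul_re, Complex.add_im,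
    Complex.add_re, Complex.ofReal_re, Complex.ofReal_im, Complex.conj_re, Complex.conj_im]
  ring

theorem abs_regCross_le (hσ : 0 < σ) (hε : 0 ≤ ε) (z w : ℂ) :
    |regCross σ ε z w| ≤ 2 * (σ + 2) * (‖z‖ ^ (2 * σ) * ‖w‖ ^ 2) := by
  have h2 := abs_regPowDeriv_mul_le hσ hε (sq_nonneg ‖z‖)
  have h3 := regPow_le_rpow hσ hε (sq_nonneg ‖z‖)
  rw [norm_sq_rpow] at h3
  have hn : ‖conj z * w‖ = ‖z‖ * ‖w‖ := by rw [norm_mul, RCLike.norm_conj]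
  have h4 : |(conj z * w).re| ≤ ‖z‖ * ‖w‖ := (Complex.abs_re_le_norm _).trans hn.le
  have h5 : |(conj z * w).im| ≤ ‖z‖ * ‖w‖ := (Complex.abs_im_le_norm _).trans hn.le
  rw [regCross, abs_mul, abs_mul, abs_mul, abs_two]
  calc _ ≤ 2 * |regPowDeriv σ ε (‖z‖ ^ 2)| * (‖z‖ * ‖w‖) * (‖z‖ * ‖w‖) := by gcongr
    _ = 2 * (|regPowDeriv σ ε (‖z‖ ^ 2)| * ‖z‖ ^ 2) * ‖w‖ ^ 2 := by ring
    _ ≤ 2 * ((σ + 2) * ‖z‖ ^ (2 * σ)) * ‖w‖ ^ 2 := by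
        have h6 : |regPowDeriv σ ε (‖z‖ ^ 2)| * ‖z‖ ^ 2 ≤ (σ + 2) * ‖z‖ ^ (2 * σ) :=
          h2.trans (mul_le_mul_of_nonneg_left h3 (by linarith))
        exact mul_le_mul_of_nonneg_right (mul_le_mul_of_nonneg_left h6 two_pos.le) (sq_nonneg _)
    _ = _ := by ring

theorem tendsto_regCross {ε : ℕ → ℝ} (hε : Tendsto ε atTop (𝓝 0)) (z w : ℂ) :
    Tendsto (fun k => regCross σ (ε k) z w) atTop (𝓝 (crossDensity σ z w)) := by
  rcases eq_or_ne z 0 with rfl | hz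
  · simp [regCross, crossDensity]
  have hr : 0 < ‖z‖ ^ 2 := pow_pos (norm_pos_iff.2 hz) 2
  have h1 : Tendsto (fun k => 1 + ε k * ‖z‖ ^ 2) atTop (𝓝 1) := by
    simpa using (hε.mul_const (‖z‖ ^ 2)).const_add 1
  have h2 : Tendsto (fun k => ‖z‖ ^ 2 / (1 + ε k * ‖z‖ ^ 2)) atTop (𝓝 (‖z‖ ^ 2)) := by
    have h3 := (tendsto_const_nhds (x := ‖z‖ ^ 2) (f := atTop (α := ℕ))).div h1 one_ne_zero
    rwa [div_one] at h3
  have h3 : Tendsto (fun k => regPowDeriv σ (ε k) (‖z‖ ^ 2)) atTop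
      (𝓝 (σ * (‖z‖ ^ 2) ^ (σ - 1) * (1 ^ 4)⁻¹ - 2 * 0 * (‖z‖ ^ 2) ^ σ * (1 ^ 3)⁻¹)) :=
    (((h2.rpow_const (Or.inl hr.ne')).const_mul σ).mul ((h1.pow 4).inv₀ (by norm_num))).sub
      (((hε.const_mul 2).mul (h2.rpow_const (Or.inl hr.ne'))).mul ((h1.pow 3).inv₀ (by norm_num)))
  have h4 := ((h3.const_mul 2).mul_const (conj z * w).re).mul_const (conj z * w).im
  refine h4.trans (le_of_eq ?_)
  rw [crossDensity, norm_sq_rpow, show 2 * (σ - 1) = 2 * σ - 2 by ring]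
  congr 1
  ring

theorem regPot_nonneg (hσ : 0 < σ) (hε : 0 ≤ ε) (z : ℂ) : 0 ≤ regPot σ ε z := by
  unfold regPot regPowPrim; positivity

theorem regPot_le (hσ : 0 < σ) (hε : 0 ≤ ε) (z : ℂ) :
    regPot σ ε z ≤ ‖z‖ ^ (2 * σ + 2) / (σ + 1) := by
  have e : ‖z‖ ^ (2 * σ + 2) = (‖z‖ ^ 2) ^ (σ + 1) := by
    rw [norm_sq_rpow]; congr 1; ring
  rw [regPot, regPowPrim, e]
  have h1 := regQuotient_le hε (sq_nonneg ‖z‖)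
  have h2 : 0 ≤ ‖z‖ ^ 2 / (1 + ε * ‖z‖ ^ 2) := by positivity
  gcongr

theorem tendsto_regPot (hσ : 0 < σ) {ε : ℕ → ℝ} (hε : Tendsto ε atTop (𝓝 0)) (z : ℂ) :
    Tendsto (fun k => regPot σ (ε k) z) atTop (𝓝 (‖z‖ ^ (2 * σ + 2) / (σ + 1))) := by
  have e : ‖z‖ ^ (2 * σ + 2) = (‖z‖ ^ 2) ^ (σ + 1) := by
    rw [norm_sq_rpow]; congr 1; ring
  have h1 : Tendsto (fun k => 1 + ε k * ‖z‖ ^ 2) atTop (𝓝 1) := by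
    simpa using (hε.mul_const (‖z‖ ^ 2)).const_add 1
  have h2 : Tendsto (fun k => ‖z‖ ^ 2 / (1 + ε k * ‖z‖ ^ 2)) atTop (𝓝 (‖z‖ ^ 2)) := by
    have h3 := (tendsto_const_nhds (x := ‖z‖ ^ 2) (f := atTop (α := ℕ))).div h1 one_ne_zero
    rwa [div_one] at h3
  rw [e]
  exact (h2.rpow_const (Or.inr (by linarith))).div_const _

end Regularized
/-! ### Evolution of the potential term -/

section PotentialEvolution

open ComplexConjugate

variable {n : ℕ} {σ lam κ ε : ℝ} {I : Set ℝ} {u₀ : Space n → ℂ} {u : ℝ → Space n → ℂ} {C : ℝ}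
  {f : Space n → ℂ}

theorem norm_regNL_le_mul (hσ : 0 < σ) (hε : 0 < ε) (z : ℂ) :
    ‖regNL σ ε z‖ ≤ regLip σ ε * ‖z‖ := by
  have h := norm_regNL_sub_le hσ hε z 0
  have e : regNL σ ε 0 = 0 := by simp [regNL]
  rwa [e, sub_zero, sub_zero] at h

theorem continuous_regNL (hσ : 0 < σ) (hε : 0 < ε) : Continuous (regNL σ ε) :=
  (lipschitzWith_regNL hσ hε).continuous

theorem hasWeakPartial_regNL (hσ : 0 < σ) (hε : 0 < ε) (hf : MemSigma f) (j : Fin n) :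
    HasWeakPartial j (fun x => regNL σ ε (f x))
      fun x => regNLDeriv σ ε (f x) (weakPartial j f x) :=
  (hf.2.hasWeakPartial j).comp_lipschitz hf.memLp (hf.memLp_weakPartial j)
    (hasFDerivAt_regNL hσ hε.le) (lipschitzWith_regNL hσ hε) (by simp [regNL])

theorem memLp_regNLDeriv (hσ : 0 < σ) (hε : 0 < ε) (hf : MemSigma f) (j : Fin n) :
    MemLp (fun x => regNLDeriv σ ε (f x) (weakPartial j f x)) 2 volume :=
  (hf.memLp_weakPartial j).of_le_mul
    (hasWeakPartial_regNL hσ hε hf j).locallyIntegrable_partial.aestronglyMeasurable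
    (Eventually.of_forall fun x => (regNLDeriv σ ε (f x)).le_of_opNorm_le
      (norm_regNLDeriv_le hσ hε (f x)) _)

theorem memSigma_regNL (hσ : 0 < σ) (hε : 0 < ε) (hf : MemSigma f) :
    MemSigma fun x => regNL σ ε (f x) := by
  have hm : AEStronglyMeasurable (fun x => regNL σ ε (f x)) volume :=
    (continuous_regNL hσ hε).comp_aestronglyMeasurable hf.1
  refine memSigma_of_hasWeakPartial (hf.memLp.of_le_mul hm
    (Eventually.of_forall fun x => norm_regNL_le_mul hσ hε (f x)))
    (fun j => hasWeakPartial_regNL hσ hε hf j) (fun j => memLp_regNLDeriv hσ hε hf j)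
    (hf.memLp_norm_smul.of_le_mul (c := regLip σ ε) (aestronglyMeasurable_norm_smul hm)
      (Eventually.of_forall fun x => ?_))
  rw [norm_smul, norm_smul, norm_norm, mul_left_comm]
  exact mul_le_mul_of_nonneg_left (norm_regNL_le_mul hσ hε (f x)) (norm_nonneg _)

theorem integrable_regCross (hσ : 0 < σ) (hε : 0 < ε) (hf : MemSigma f) (j : Fin n) :
    Integrable (fun x => regCross σ ε (f x) (weakPartial j f x)) volume := by
  refine (integrable_conj_mul (memLp_regNLDeriv hσ hε hf j) (hf.memLp_weakPartial j)).im.congr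
    (Eventually.of_forall fun x => ?_)
  exact im_conj_regNLDeriv_mul _ _

theorem im_ip_eq_zero {g h : Space n → ℂ} (hi : Integrable (fun x => conj (g x) * h x) volume)
    (h0 : ∀ x, (conj (g x) * h x).im = 0) : (ip g h).im = 0 := by
  have h1 := Complex.imCLM.integral_comp_comm hi
  simp only [Complex.imCLM_apply, h0, integral_zero] at h1
  exact h1.symm

/-- Only the kinetic part of the equation contributes to the evolution of a function of `|u|`: the
other terms are real multiples of `u` and do not change `|u|`. -/
theorem im_nlsForm_regNL (hσ : 0 < σ) (hε : 0 < ε) (hC : SigmaEmbeds n σ C) (hf : MemSigma f) :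
    (nlsForm σ lam κ f fun x => regNL σ ε (f x)).im
      = 1 / 2 * ∑ j, ∫ x, regCross σ ε (f x) (weakPartial j f x) := by
  have hp : (ENNReal.ofReal (2 * σ + 2)).HolderConjugate
      (ENNReal.ofReal ((2 * σ + 2) / (2 * σ + 1))) := (holderConjugate_pow hσ).ennrealOfReal
  have hfp := (hC.2 f hf).1
  have hΨ := memSigma_regNL hσ hε hf
  have hΨp := (hC.2 _ hΨ).1
  have e1 : ∀ j, (ip (weakPartial j fun x => regNL σ ε (f x)) (weakPartial j f)).im
      = ∫ x, regCross σ ε (f x) (weakPartial j f x) := fun j => by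
    rw [ip_congr (hasWeakPartial_regNL hσ hε hf j).weakPartial_ae_eq EventuallyEq.rfl, ip]
    have h1 := Complex.imCLM.integral_comp_comm
      (integrable_conj_mul (memLp_regNLDeriv hσ hε hf j) (hf.memLp_weakPartial j))
    simp only [Complex.imCLM_apply, im_conj_regNLDeriv_mul] at h1
    exact h1.symm
  have e2 : ∀ j, (ip (coordMul j fun x => regNL σ ε (f x)) (coordMul j f)).im = 0 := fun j => by
    refine im_ip_eq_zero (integrable_conj_mul (hΨ.memLp_coordMul j) (hf.memLp_coordMul j))
      fun x => ?_
    simp only [coordMul, regNL, map_mul, Complex.conj_ofReal, Complex.mul_im, Complex.mul_re,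
      Complex.ofReal_re, Complex.ofReal_im, Complex.conj_re, Complex.conj_im]
    ring
  have e3 : (ip (fun x => regNL σ ε (f x)) fun x => powNL σ (f x)).im = 0 := by
    refine im_ip_eq_zero (integrable_conj_mul_of_holder hΨp (memLp_powNL hσ hfp)) fun x => ?_
    simp only [powNL, regNL, map_mul, Complex.conj_ofReal, Complex.mul_im, Complex.mul_re,
      Complex.ofReal_re, Complex.ofReal_im, Complex.conj_re, Complex.conj_im]
    ring
  have s1 : (∑ j, ip (weakPartial j fun x => regNL σ ε (f x)) (weakPartial j f)).im
      = ∑ j, ∫ x, regCross σ ε (f x) (weakPartial j f x) := by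
    rw [Complex.im_sum]; exact Finset.sum_congr rfl fun j _ => e1 j
  have s2 : (∑ j, ip (coordMul j fun x => regNL σ ε (f x)) (coordMul j f)).im = 0 := by
    rw [Complex.im_sum]; exact Finset.sum_eq_zero fun j _ => e2 j
  rw [nlsForm, show (1 / 2 : ℂ) = ((1 / 2 : ℝ) : ℂ) by push_cast; ring,
    show (κ / 2 : ℂ) = ((κ / 2 : ℝ) : ℂ) by push_cast; ring]
  rw [Complex.add_im, Complex.sub_im, Complex.im_ofReal_mul, Complex.im_ofReal_mul,
    Complex.im_ofReal_mul, s1, s2, e3]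
  ring

theorem continuous_regPot (hσ : 0 < σ) (hε : 0 ≤ ε) : Continuous (regPot σ ε) :=
  continuous_iff_continuousAt.2 fun z => (hasFDerivAt_regPot hσ hε z).continuousAt

theorem integrable_regPot (hσ : 0 < σ) (hε : 0 ≤ ε)
    (hf : MemLp f (ENNReal.ofReal (2 * σ + 2)) volume) :
    Integrable (fun x => regPot σ ε (f x)) volume := by
  refine ((integrable_norm_rpow_ofReal (by linarith) hf).div_const (σ + 1)).mono'
    ((continuous_regPot hσ hε).comp_aestronglyMeasurable hf.1) (Eventually.of_forall fun x => ?_)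
  rw [Real.norm_of_nonneg (regPot_nonneg hσ hε _)]
  exact regPot_le hσ hε _

theorem abs_integral_regPot_sub_le (hσ : 0 < σ) (hε : 0 < ε) (hC : SigmaEmbeds n σ C)
    {g : Space n → ℂ} (hf : MemSigma f) (hg : MemSigma g) :
    |(∫ x, regPot σ ε (g x)) - (∫ x, regPot σ ε (f x))
      - 2 * (ip (fun x => regNL σ ε (f x)) (g - f)).re|
      ≤ 2 * regLip σ ε * lpNorm (g - f) 2 volume ^ 2 := by
  have hΨ := memSigma_regNL hσ hε hf
  have i1 := integrable_regPot hσ hε.le (hC.2 g hg).1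
  have i2 := integrable_regPot hσ hε.le (hC.2 f hf).1
  have i3 := integrable_conj_mul hΨ.memLp (hg.memLp.sub hf.memLp)
  have h1 := Complex.reCLM.integral_comp_comm i3
  simp only [Complex.reCLM_apply] at h1
  have i4 : Integrable (fun x => (conj (regNL σ ε (f x)) * (g - f) x).re) volume := i3.re
  have i5 : Integrable (fun x => ‖(g - f) x‖ ^ 2) volume := by
    have := integrable_norm_rpow_ofReal (p := 2) two_pos (f := g - f) (μ := volume)
      (by simpa using hg.memLp.sub hf.memLp)
    simpa using this
  have e5 : lpNorm (g - f) 2 volume ^ 2 = ∫ x, ‖(g - f) x‖ ^ 2 := by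
    have := integral_norm_rpow_eq (p := 2) two_pos (hg.memLp.sub hf.memLp).1
    simp only [Real.rpow_two, ENNReal.ofReal_ofNat] at this
    exact this.symm
  have i6 : Integrable (fun x => regPot σ ε (g x) - regPot σ ε (f x)) volume := i1.sub i2
  rw [ip, ← h1, ← integral_const_mul, ← integral_sub i1 i2,
    ← integral_sub i6 (i4.const_mul 2), e5, ← integral_const_mul, ← Real.norm_eq_abs]
  refine norm_integral_le_of_norm_le (i5.const_mul _) (Eventually.of_forall fun x => ?_)
  exact abs_regPot_sub_le hσ hε (f x) (g x)

/-- The first-order term of `regPot` is the equation tested with `regNL (u t)`; the second-order one is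
negligible because `‖u s - u t‖² = o(|s - t|)`. -/
theorem IsSolution.hasDerivAt_integral_regPot (hu : IsSolution σ lam (quadPot κ) I u₀ u)
    (hI : IsOpen I) (hσ : 0 < σ) (hε : 0 < ε) (hC : SigmaEmbeds n σ C) {t : ℝ} (ht : t ∈ I) :
    HasDerivAt (fun s => ∫ x, regPot σ ε (u s x))
      (∑ j, ∫ x, regCross σ ε (u t x) (weakPartial j (u t) x)) t := by
  have hf := hu.memSigma t ht
  have h1 := Complex.reCLM.hasFDerivAt.comp_hasDerivAt t
    (hu.hasDerivAt_ip hI hσ hC (memSigma_regNL hσ hε hf) ht)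
  have h2 : HasDerivAt (fun s => 2 * (ip (fun x => regNL σ ε (u t x)) (u s)).re)
      (∑ j, ∫ x, regCross σ ε (u t x) (weakPartial j (u t) x)) t := by
    refine (h1.const_mul 2).congr_deriv ?_
    have h3 := im_nlsForm_regNL (lam := lam) (κ := κ) hσ hε hC hf
    simp only [Complex.reCLM_apply, neg_mul, Complex.neg_re, Complex.I_mul_re, neg_neg, h3]
    ring
  have h3 : HasDerivAt (fun s => (∫ x, regPot σ ε (u s x))
      - 2 * (ip (fun x => regNL σ ε (u t x)) (u s)).re) 0 t := by
    rw [hasDerivAt_iff_tendsto_slope]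
    have h4 := (hu.tendsto_lpNorm_sq_div hI hσ hC ht).const_mul (2 * regLip σ ε)
    rw [mul_zero] at h4
    refine squeeze_zero_norm' ?_ h4
    filter_upwards [self_mem_nhdsWithin, nhdsWithin_le_nhds (hI.mem_nhds ht)] with s hs hsI
    have h5 : 0 < |s - t| := abs_pos.2 (sub_ne_zero.2 hs)
    have h6 := abs_integral_regPot_sub_le hσ hε hC hf (hu.memSigma s hsI)
    rw [ip_sub_right (memSigma_regNL hσ hε hf).memLp (hu.memSigma s hsI).memLp hf.memLp,
      Complex.sub_re] at h6
    rw [slope_def_field, norm_div, Real.norm_eq_abs, Real.norm_eq_abs, mul_div_assoc',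
      div_le_div_iff_of_pos_right h5]
    refine le_trans (le_of_eq ?_) h6
    congr 1; ring
  have h7 := h3.add h2
  rw [zero_add] at h7
  refine h7.congr_of_eventuallyEq (Eventually.of_forall fun s => ?_)
  simp

/-- The evolution of `‖u‖_{2σ+2}^{2σ+2}`, obtained from the one of its regularizations. -/
theorem IsSolution.potentialTerm_sub_eq_integral (hu : IsSolution σ lam (quadPot κ) I u₀ u)
    (hn : 1 ≤ n) (hI : IsOpen I) (hσ : 0 < σ) (hσn : 3 ≤ n → σ < 2 / ((n : ℝ) - 2))
    (hC : SigmaEmbeds n σ C) {a b : ℝ} (hle : a ≤ b) (hab : Set.Icc a b ⊆ I) :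
    IntegrableOn (fun t => ∑ j, crossTerm σ (u t) (weakPartial j (u t))) (Set.Icc a b) ∧
    potentialTerm σ (u b) / (σ + 1) - potentialTerm σ (u a) / (σ + 1)
      = ∫ t in Set.Icc a b, ∑ j, crossTerm σ (u t) (weakPartial j (u t)) := by
  obtain ⟨M, hM0, hM⟩ := hu.exists_sigmaNorm_le hI hab
  have hreg := fun j => hu.integrableOn_lpNorm_weakPartial_sq hn hI hσ hσn j hab
  set ε : ℕ → ℝ := fun k => 1 / ((k : ℝ) + 1) with hεdef
  have hεpos : ∀ k, 0 < ε k := fun k => by rw [hεdef]; positivity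
  have hε : Tendsto ε atTop (𝓝 0) := tendsto_one_div_add_atTop_nhds_zero_nat
  set X : ℝ := C * M with hX
  have hX0 : 0 < X := mul_pos hC.1 hM0
  have hLp : ∀ᵐ t ∂volume.restrict (Set.Icc a b), ∀ j,
      MemLp (weakPartial j (u t)) (ENNReal.ofReal (2 * σ + 2)) volume :=
    ae_all_iff.2 fun j => (hreg j).1
  refine sub_eq_integral_of_tendsto_deriv hle
    (P := fun k t => ∫ x, regPot σ (ε k) (u t x))
    (P₀ := fun t => potentialTerm σ (u t) / (σ + 1))
    (D := fun t => ∑ j, 2 * (σ + 2) * (2 * (X ^ (2 * σ) * (2 * lpNorm (weakPartial j (u t))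
      (ENNReal.ofReal (2 * σ + 2)) volume ^ 2 + 2))))
    (fun k t ht => hu.hasDerivAt_integral_regPot hI hσ (hεpos k) hC (hab ht))
    (fun t ht => ?_) ?_ ?_ fun k => ?_
  · have hf := hu.memSigma t (hab ht)
    have hfp := (hC.2 _ hf).1
    have hp : 0 < 2 * σ + 2 := by linarith
    rw [potentialTerm_eq_integral hσ hf.1, ← integral_div]
    refine tendsto_integral_of_dominated_convergence _
      (fun k => (integrable_regPot hσ (hεpos k).le hfp).1)
      ((integrable_norm_rpow_ofReal hp hfp).div_const (σ + 1))
      (fun k => Eventually.of_forall fun x => ?_) (Eventually.of_forall fun x => ?_)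
    · rw [Real.norm_of_nonneg (regPot_nonneg hσ (hεpos k).le _)]
      exact regPot_le hσ (hεpos k).le _
    · exact tendsto_regPot hσ hε _
  · filter_upwards [hLp, ae_restrict_mem measurableSet_Icc] with t htp ht
    have hf := hu.memSigma t (hab ht)
    have hfp := (hC.2 _ hf).1
    refine tendsto_finsetSum _ fun j _ => ?_
    refine tendsto_integral_of_dominated_convergence
      (fun x => 2 * (σ + 2) * (‖‖u t x‖‖ ^ (2 * σ) * ‖‖weakPartial j (u t) x‖‖ ^ 2))
      (fun k => (integrable_regCross hσ (hεpos k) hf j).1)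
      ((integrable_rpow_mul_sq hσ hfp.norm (htp j).norm).const_mul _)
      (fun k => Eventually.of_forall fun x => ?_) (Eventually.of_forall fun x => ?_)
    · rw [norm_norm, norm_norm]
      exact abs_regCross_le hσ (hεpos k).le _ _
    · exact tendsto_regCross hε _ _
  · refine integrable_finsetSum _ fun j _ => ?_
    exact (((((hreg j).2.const_mul 2).add (integrableOn_const (by simp))).const_mul _).const_mul
      _).const_mul _
  · filter_upwards [hLp, ae_restrict_mem measurableSet_Icc] with t htp ht
    have hf := hu.memSigma t (hab ht)
    have hfp := hC.2 _ hf
    refine (Finset.abs_sum_le_sum_abs _ _).trans (Finset.sum_le_sum fun j _ => ?_)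
    set z := lpNorm (weakPartial j (u t)) (ENNReal.ofReal (2 * σ + 2)) volume with hz
    have hz0 : 0 ≤ z := lpNorm_nonneg
    have h1 := integral_rpow_mul_sq_le hσ hfp.1.norm (htp j).norm hX0
      (by positivity : 0 < z + 1)
      (by rw [lpNorm_norm hfp.1.1]; exact hfp.2.trans (by
            rw [hX]; exact mul_le_mul_of_nonneg_left (hM t ht) hC.1.le))
      (by rw [lpNorm_norm (htp j).1]; linarith)
    have h2 : |∫ x, regCross σ (ε k) (u t x) (weakPartial j (u t) x)|
        ≤ 2 * (σ + 2) * ∫ x, ‖‖u t x‖‖ ^ (2 * σ) * ‖‖weakPartial j (u t) x‖‖ ^ 2 := by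
      rw [← integral_const_mul, ← Real.norm_eq_abs]
      refine norm_integral_le_of_norm_le
        ((integrable_rpow_mul_sq hσ hfp.1.norm (htp j).norm).const_mul _)
        (Eventually.of_forall fun x => ?_)
      rw [norm_norm, norm_norm]
      exact abs_regCross_le hσ (hεpos k).le _ _
    have h3 : (z + 1) ^ 2 ≤ 2 * z ^ 2 + 2 := by nlinarith [sq_nonneg (z - 1)]
    refine h2.trans ?_
    have h4 : 2 * (X ^ (2 * σ) * (z + 1) ^ 2) ≤ 2 * (X ^ (2 * σ) * (2 * z ^ 2 + 2)) := by gcongr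
    exact mul_le_mul_of_nonneg_left (h1.trans h4) (by positivity)

end PotentialEvolution
/-! ### Position, momentum and virial identities -/

section ConservationLaws

open ComplexConjugate

variable {n : ℕ} {σ lam κ : ℝ} {I : Set ℝ} {u₀ : Space n → ℂ} {u : ℝ → Space n → ℂ} {C : ℝ}
  {f : Space n → ℂ} {j : Fin n} {α β : ℝ}

/-- `‖x f‖²`, as a sum over the coordinates. -/
noncomputable def positionSq (f : Space n → ℂ) : ℝ := ∑ j, lpNorm (coordMul j f) 2 volume ^ 2

/-- `‖∇ f‖²`, as a sum over the coordinates. -/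
noncomputable def gradSq (f : Space n → ℂ) : ℝ := ∑ j, lpNorm (weakPartial j f) 2 volume ^ 2

/-- The virial `Im ∫ conj f (x · ∇ f)`. -/
noncomputable def virial (f : Space n → ℂ) : ℝ := ∑ j, (ip (coordMul j f) (weakPartial j f)).im

/-- Expansion of the pairing with `i Dⱼ f`, on the conjugate linear side. -/
theorem ip_shiftGenerator_left (hf : MemSigma f) {g : Space n → ℂ} (hg : MemLp g 2 volume) :
    ip (shiftGenerator j α β f) g
      = -Complex.I * α * ip (coordMul j f) g - β * ip (weakPartial j f) g := by
  have e : shiftGenerator j α β f = (fun x => Complex.I * α * coordMul j f x)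
      - fun x => (β : ℂ) * weakPartial j f x := rfl
  rw [e, ip_sub_left ((hf.memLp_coordMul j).const_mul _) ((hf.memLp_weakPartial j).const_mul _) hg,
    ip_const_mul_left, ip_const_mul_left]
  simp

theorem re_ip_shiftGenerator_weakPartial (hf : MemSigma f) :
    (ip (shiftGenerator j α β f) (weakPartial j f)).re
      = α * (ip (coordMul j f) (weakPartial j f)).im - β * lpNorm (weakPartial j f) 2 volume ^ 2 := by
  rw [ip_shiftGenerator_left hf (hf.memLp_weakPartial j), ip_self (hf.memLp_weakPartial j)]
  simp [-Complex.ofReal_pow]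

theorem im_ip_shiftGenerator_coordMul (hf : MemSigma f) :
    (ip (shiftGenerator j α β f) (coordMul j f)).im
      = β * (ip (coordMul j f) (weakPartial j f)).im - α * lpNorm (coordMul j f) 2 volume ^ 2 := by
  rw [ip_shiftGenerator_left hf (hf.memLp_coordMul j), ip_self (hf.memLp_coordMul j),
    ← conj_ip (coordMul j f)]
  simp [-Complex.ofReal_pow]
  ring

theorem lpNorm_shiftGenerator_sq (hf : MemSigma f) :
    lpNorm (shiftGenerator j α β f) 2 volume ^ 2
      = α ^ 2 * lpNorm (coordMul j f) 2 volume ^ 2 + β ^ 2 * lpNorm (weakPartial j f) 2 volume ^ 2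
        - 2 * (α * β) * (ip (coordMul j f) (weakPartial j f)).im := by
  have h1 : (ip (shiftGenerator j α β f) (shiftGenerator j α β f)).re
      = lpNorm (shiftGenerator j α β f) 2 volume ^ 2 := by
    rw [ip_self (memLp_shiftGenerator hf), Complex.ofReal_re]
  rw [← h1, ip_shiftGenerator_left hf (memLp_shiftGenerator hf), ← conj_ip _ (coordMul j f),
    ← conj_ip _ (weakPartial j f), Complex.sub_re, Complex.re_ofReal_mul, Complex.conj_re,
    re_ip_shiftGenerator_weakPartial hf, neg_mul, neg_mul, mul_assoc, Complex.neg_re,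
    Complex.I_mul_re, Complex.im_ofReal_mul, Complex.conj_im, im_ip_shiftGenerator_coordMul hf]
  ring

theorem sum_lpNorm_shiftGenerator_sq (hf : MemSigma f) (α β : ℝ) :
    ∑ j, lpNorm (shiftGenerator j α β f) 2 volume ^ 2
      = α ^ 2 * positionSq f + β ^ 2 * gradSq f - 2 * (α * β) * virial f := by
  simp only [lpNorm_shiftGenerator_sq hf, positionSq, gradSq, virial, Finset.mul_sum,
    Finset.sum_add_distrib, Finset.sum_sub_distrib]

theorem sum_shiftRate (hf : MemSigma f) (α β : ℝ) :
    ∑ j, shiftRate σ lam κ j α β f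
      = (α ^ 2 + κ * β ^ 2) * virial f - α * β * (gradSq f + κ * positionSq f)
        - lam * (β ^ 2 * ∑ j, crossTerm σ f (weakPartial j f)
          + n * σ / (σ + 1) * (α * β * potentialTerm σ f)) := by
  have h1 : ∀ j, shiftRate σ lam κ j α β f
      = (α ^ 2 + κ * β ^ 2) * (ip (coordMul j f) (weakPartial j f)).im
        - α * β * lpNorm (weakPartial j f) 2 volume ^ 2
        - α * β * κ * lpNorm (coordMul j f) 2 volume ^ 2
        - lam * β ^ 2 * crossTerm σ f (weakPartial j f)
        - lam * (σ / (σ + 1) * (α * β * potentialTerm σ f)) := fun j => by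
    rw [shiftRate, re_ip_shiftGenerator_weakPartial hf, im_ip_shiftGenerator_coordMul hf]
    ring
  simp only [h1, Finset.sum_sub_distrib, ← Finset.mul_sum, Finset.sum_const, Finset.card_univ,
    Fintype.card_fin, nsmul_eq_mul]
  simp only [virial, gradSq, positionSq]
  ring

/-- In the sum of `½ ‖α x u + i β ∇ u‖²` and `β²` times the potential energy, the cross terms cancel. The rate
which is left is a continuous function of time. -/
theorem IsSolution.sub_eq_integral (hu : IsSolution σ lam (quadPot κ) I u₀ u)
    (hn : 1 ≤ n) (hI : IsOpen I) (hσ : 0 < σ) (hσn : 3 ≤ n → σ < 2 / ((n : ℝ) - 2))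
    (hC : SigmaEmbeds n σ C) (α β : ℝ) {a b : ℝ} (hle : a ≤ b) (hab : Set.Icc a b ⊆ I) :
    (1 / 2 * (α ^ 2 * positionSq (u b) + β ^ 2 * gradSq (u b) - 2 * (α * β) * virial (u b))
        + β ^ 2 * (lam / (σ + 1)) * potentialTerm σ (u b))
      - (1 / 2 * (α ^ 2 * positionSq (u a) + β ^ 2 * gradSq (u a) - 2 * (α * β) * virial (u a))
        + β ^ 2 * (lam / (σ + 1)) * potentialTerm σ (u a))
      = ∫ t in Set.Icc a b, ((α ^ 2 + κ * β ^ 2) * virial (u t)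
          - α * β * (gradSq (u t) + κ * positionSq (u t)
            + lam * (n * σ / (σ + 1)) * potentialTerm σ (u t))) := by
  have hs := fun j => hu.shiftGenerator_sub_eq_integral hn hI hσ hσn hC j α β hle hab
  obtain ⟨ip, hp⟩ := hu.potentialTerm_sub_eq_integral hn hI hσ hσn hC hle hab
  -- `lam β²` times the evolution of the potential term removes the cross terms of the rates.
  have hsum : ∑ j, (1 / 2 * lpNorm (shiftGenerator j α β (u b)) 2 volume ^ 2
        - 1 / 2 * lpNorm (shiftGenerator j α β (u a)) 2 volume ^ 2)
      = ∫ t in Set.Icc a b, ∑ j, shiftRate σ lam κ j α β (u t) := by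
    rw [integral_finsetSum _ fun j _ => (hs j).1]
    exact Finset.sum_congr rfl fun j _ => (hs j).2
  rw [Finset.sum_sub_distrib, ← Finset.mul_sum, ← Finset.mul_sum,
    sum_lpNorm_shiftGenerator_sq (hu.memSigma b (hab ⟨hle, le_rfl⟩)),
    sum_lpNorm_shiftGenerator_sq (hu.memSigma a (hab ⟨le_rfl, hle⟩))] at hsum
  have hadd := integral_add (integrable_finsetSum (μ := volume.restrict (Set.Icc a b)) Finset.univ
    fun j _ => (hs j).1) (ip.const_mul (lam * β ^ 2))
  rw [← hsum, integral_const_mul, ← hp] at hadd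
  trans ∫ t in Set.Icc a b, (∑ j, shiftRate σ lam κ j α β (u t)
    + lam * β ^ 2 * ∑ j, crossTerm σ (u t) (weakPartial j (u t)))
  · rw [hadd]; ring
  · refine setIntegral_congr_fun measurableSet_Icc fun t ht => ?_
    rw [sum_shiftRate (hu.memSigma t (hab ht))]
    ring

theorem IsSolution.continuousOn_positionSq (hu : IsSolution σ lam (quadPot κ) I u₀ u)
    (hI : IsOpen I) : ContinuousOn (fun t => positionSq (u t)) I := by
  unfold positionSq
  refine continuousOn_finsetSum _ fun j _ => ?_
  have h := continuousOn_ip hI (fun t ht => (hu.memSigma t ht).memLp_coordMul j)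
    (fun t ht => (hu.memSigma t ht).memLp_coordMul j)
    (fun t ht => hu.tendsto_lpNorm_coordMul_sub hI j ht)
    (fun t ht => hu.tendsto_lpNorm_coordMul_sub hI j ht)
  refine (Complex.continuous_re.comp_continuousOn h).congr fun t ht => ?_
  simp only [Function.comp_apply]
  rw [ip_self ((hu.memSigma t ht).memLp_coordMul j), Complex.ofReal_re]

theorem IsSolution.continuousOn_gradSq (hu : IsSolution σ lam (quadPot κ) I u₀ u)
    (hI : IsOpen I) : ContinuousOn (fun t => gradSq (u t)) I := by
  unfold gradSq
  refine continuousOn_finsetSum _ fun j _ => ?_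
  have h := continuousOn_ip hI (fun t ht => (hu.memSigma t ht).memLp_weakPartial j)
    (fun t ht => (hu.memSigma t ht).memLp_weakPartial j)
    (fun t ht => hu.tendsto_lpNorm_weakPartial_sub hI j ht)
    (fun t ht => hu.tendsto_lpNorm_weakPartial_sub hI j ht)
  refine (Complex.continuous_re.comp_continuousOn h).congr fun t ht => ?_
  simp only [Function.comp_apply]
  rw [ip_self ((hu.memSigma t ht).memLp_weakPartial j), Complex.ofReal_re]

theorem IsSolution.continuousOn_virial (hu : IsSolution σ lam (quadPot κ) I u₀ u)
    (hI : IsOpen I) : ContinuousOn (fun t => virial (u t)) I := by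
  unfold virial
  refine continuousOn_finsetSum _ fun j _ => Complex.continuous_im.comp_continuousOn ?_
  exact continuousOn_ip hI (fun t ht => (hu.memSigma t ht).memLp_coordMul j)
    (fun t ht => (hu.memSigma t ht).memLp_weakPartial j)
    (fun t ht => hu.tendsto_lpNorm_coordMul_sub hI j ht)
    (fun t ht => hu.tendsto_lpNorm_weakPartial_sub hI j ht)

/-- A primitive of a continuous function is differentiable. -/
theorem hasDerivAt_of_sub_eq_integral {F g : ℝ → ℝ} (hI : IsOpen I) (hg : ContinuousOn g I)
    (h : ∀ a b, a ≤ b → Set.Icc a b ⊆ I → F b - F a = ∫ s in Set.Icc a b, g s)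
    {t : ℝ} (ht : t ∈ I) : HasDerivAt F (g t) t := by
  obtain ⟨δ, hδ, hball⟩ := Metric.isOpen_iff.1 hI t ht
  have hsub : Set.Icc (t - δ / 2) (t + δ / 2) ⊆ I := fun s hs => hball (by
    rw [Metric.mem_ball, Real.dist_eq, abs_lt]
    constructor <;> linarith [hs.1, hs.2])
  have hd : HasDerivAt (fun b => ∫ s in (t - δ / 2)..b, g s) (g t) t := by
    refine intervalIntegral.integral_hasDerivAt_right ?_
      (hg.stronglyMeasurableAtFilter hI t ht) (hg.continuousAt (hI.mem_nhds ht))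
    refine ContinuousOn.intervalIntegrable (hg.mono ?_)
    rw [Set.uIcc_of_le (by linarith)]
    exact (Set.Icc_subset_Icc_right (by linarith)).trans hsub
  refine (hd.add_const (F (t - δ / 2))).congr_of_eventuallyEq ?_
  filter_upwards [Icc_mem_nhds (show t - δ / 2 < t by linarith) (show t < t + δ / 2 by linarith)]
    with b hb
  have := h _ b hb.1 ((Set.Icc_subset_Icc_right hb.2).trans hsub)
  rw [intervalIntegral.integral_of_le hb.1, ← integral_Icc_eq_integral_Ioc, ← this]
  ring

/-- The preceding identity for constant `α` and `β`. Its cases `(1, 0)`, `(0, 1)` and `(1, 1)` determine the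
evolution of the three quadratic quantities. -/
theorem IsSolution.hasDerivAt_quadratic (hu : IsSolution σ lam (quadPot κ) I u₀ u)
    (hn : 1 ≤ n) (hI : IsOpen I) (hσ : 0 < σ) (hσn : 3 ≤ n → σ < 2 / ((n : ℝ) - 2))
    (α β : ℝ) {t : ℝ} (ht : t ∈ I) :
    HasDerivAt (fun t => 1 / 2 * (α ^ 2 * positionSq (u t) + β ^ 2 * gradSq (u t)
        - 2 * (α * β) * virial (u t)) + β ^ 2 * (lam / (σ + 1)) * potentialTerm σ (u t))
      ((α ^ 2 + κ * β ^ 2) * virial (u t) - α * β * (gradSq (u t) + κ * positionSq (u t)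
            + lam * (n * σ / (σ + 1)) * potentialTerm σ (u t))) t := by
  obtain ⟨C, hC⟩ := exists_sigmaEmbeds hn hσ hσn
  have c1 := hu.continuousOn_positionSq hI
  have c2 := hu.continuousOn_gradSq hI
  have c3 := hu.continuousOn_virial hI
  have c4 := hu.continuousOn_potentialTerm hI hσ hC
  exact hasDerivAt_of_sub_eq_integral hI (g := fun t => (α ^ 2 + κ * β ^ 2) * virial (u t)
      - α * β * (gradSq (u t) + κ * positionSq (u t)
            + lam * (n * σ / (σ + 1)) * potentialTerm σ (u t))) (by fun_prop)
    (fun a b hle hab => hu.sub_eq_integral hn hI hσ hσn hC α β hle hab) ht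

theorem IsSolution.hasDerivAt_positionSq (hu : IsSolution σ lam (quadPot κ) I u₀ u)
    (hn : 1 ≤ n) (hI : IsOpen I) (hσ : 0 < σ) (hσn : 3 ≤ n → σ < 2 / ((n : ℝ) - 2))
    {t : ℝ} (ht : t ∈ I) :
    HasDerivAt (fun t => positionSq (u t)) (2 * virial (u t)) t := by
  have h := (hu.hasDerivAt_quadratic hn hI hσ hσn 1 0 ht).const_mul 2
  exact (h.congr_deriv (by ring)).congr_of_eventuallyEq (Eventually.of_forall fun s => by ring)

/-- `½ ‖∇ f‖² + lam/(σ+1) ‖f‖^{2σ+2}`, the energy without the external potential. -/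
noncomputable def freeEnergy (σ lam : ℝ) (f : Space n → ℂ) : ℝ :=
  1 / 2 * gradSq f + lam / (σ + 1) * potentialTerm σ f

theorem IsSolution.hasDerivAt_freeEnergy (hu : IsSolution σ lam (quadPot κ) I u₀ u)
    (hn : 1 ≤ n) (hI : IsOpen I) (hσ : 0 < σ) (hσn : 3 ≤ n → σ < 2 / ((n : ℝ) - 2))
    {t : ℝ} (ht : t ∈ I) :
    HasDerivAt (fun t => freeEnergy σ lam (u t)) (κ * virial (u t)) t := by
  have h := hu.hasDerivAt_quadratic hn hI hσ hσn 0 1 ht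
  exact (h.congr_deriv (by ring)).congr_of_eventuallyEq
    (Eventually.of_forall fun s => by simp only [freeEnergy]; ring)

/-- The virial identity `d/dt Im ∫ conj u (x · ∇u) = ‖∇u‖² + κ ‖x u‖² + lam n σ/(σ+1) ‖u‖^{2σ+2}`. -/
theorem IsSolution.hasDerivAt_virial (hu : IsSolution σ lam (quadPot κ) I u₀ u)
    (hn : 1 ≤ n) (hI : IsOpen I) (hσ : 0 < σ) (hσn : 3 ≤ n → σ < 2 / ((n : ℝ) - 2))
    {t : ℝ} (ht : t ∈ I) :
    HasDerivAt (fun t => virial (u t)) (gradSq (u t) + κ * positionSq (u t)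
      + lam * (n * σ / (σ + 1)) * potentialTerm σ (u t)) t := by
  have h := (((hu.hasDerivAt_positionSq hn hI hσ hσn ht).const_mul (1 / 2)).add
    (hu.hasDerivAt_freeEnergy hn hI hσ hσn ht)).sub (hu.hasDerivAt_quadratic hn hI hσ hσn 1 1 ht)
  refine (h.congr_deriv (by ring)).congr_of_eventuallyEq
    (Eventually.of_forall fun s => ?_)
  simp only [freeEnergy, Pi.sub_apply, Pi.add_apply]
  ring

/-- The coefficients `(α, β)` with `β' = α` and `α' = κ β` make `α x + i β ∇` commute with the linear
equation, so that only multiples of the potential term remain in the derivative. -/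
theorem IsSolution.hasDerivAt_pseudoEnergy (hu : IsSolution σ lam (quadPot κ) I u₀ u)
    (hn : 1 ≤ n) (hI : IsOpen I) (hσ : 0 < σ) (hσn : 3 ≤ n → σ < 2 / ((n : ℝ) - 2))
    {α β : ℝ → ℝ} {t : ℝ} (ht : t ∈ I) (hα : HasDerivAt α (κ * β t) t)
    (hβ : HasDerivAt β (α t) t) :
    HasDerivAt (fun t => 1 / 2 * (α t ^ 2 * positionSq (u t) + β t ^ 2 * gradSq (u t)
        - 2 * (α t * β t) * virial (u t)) + lam / (σ + 1) * β t ^ 2 * potentialTerm σ (u t))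
      (α t * β t * (lam / (σ + 1) * (2 - n * σ)) * potentialTerm σ (u t)) t := by
  have hX := hu.hasDerivAt_positionSq hn hI hσ hσn ht
  have hY := hu.hasDerivAt_freeEnergy hn hI hσ hσn ht
  have hv := hu.hasDerivAt_virial hn hI hσ hσn ht
  have h := ((((hα.pow 2).mul hX).const_mul (1 / 2)).sub ((hα.mul hβ).mul hv)).add
    ((hβ.pow 2).mul hY)
  refine (h.congr_deriv ?_).congr_of_eventuallyEq (Eventually.of_forall fun s => ?_)
  · simp only [freeEnergy, Pi.mul_apply, Pi.pow_apply]
    push_cast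
    ring
  · simp only [freeEnergy, Pi.sub_apply, Pi.add_apply, Pi.mul_apply, Pi.pow_apply]
    ring

end ConservationLaws

/-! ### Vector-valued norms, energy and pseudo-conformal laws -/

section VectorNorms

variable {n : ℕ} {σ lam κ : ℝ} {I : Set ℝ} {u₀ : Space n → ℂ} {u : ℝ → Space n → ℂ}
  {f g : Space n → ℂ}

theorem lpNorm_two_sq_eq_integral {E : Type*} [NormedAddCommGroup E] {F : Space n → E}
    (hF : AEStronglyMeasurable F volume) : lpNorm F 2 volume ^ 2 = ∫ x, ‖F x‖ ^ 2 := by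
  have h := integral_norm_rpow_eq two_pos hF
  simp only [Real.rpow_two] at h
  rw [h]; simp

theorem lpNorm_congr_of_ae_eq {E : Type*} [NormedAddCommGroup E] {F G : Space n → E} {p : ℝ≥0∞}
    (hF : AEStronglyMeasurable F volume) (h : F =ᵐ[volume] G) :
    lpNorm F p volume = lpNorm G p volume := by
  rw [← toReal_eLpNorm hF, ← toReal_eLpNorm (hF.congr h), eLpNorm_congr_ae h]

theorem memLp_toLp {G : Fin n → Space n → ℂ} (h : ∀ j, MemLp (G j) 2 volume) :
    MemLp (fun x => WithLp.toLp 2 fun j => G j x : Space n → EuclideanSpace ℂ (Fin n)) 2 volume :=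
  MemLp.of_eval_piLp h

theorem integrable_norm_sq {G : Space n → ℂ} (h : MemLp G 2 volume) :
    Integrable (fun x => ‖G x‖ ^ 2) volume :=
  (memLp_two_iff_integrable_sq_norm h.1).1 h

theorem lpNorm_toLp_sq {G : Fin n → Space n → ℂ} (h : ∀ j, MemLp (G j) 2 volume) :
    lpNorm (fun x => WithLp.toLp 2 fun j => G j x : Space n → EuclideanSpace ℂ (Fin n)) 2 volume ^ 2
      = ∑ j, lpNorm (G j) 2 volume ^ 2 := by
  simp only [lpNorm_two_sq_eq_integral (memLp_toLp h).1, EuclideanSpace.norm_sq_eq,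
    lpNorm_two_sq_eq_integral (h _).1]
  exact integral_finsetSum _ fun j _ => integrable_norm_sq (h j)

theorem memLp_firstOrder_apply (hf : MemSigma f) (a b : ℝ) (j : Fin n) :
    MemLp (fun x => (a : ℂ) * ((x j : ℝ) : ℂ) * f x + Complex.I * (b : ℂ) * weakPartial j f x)
      2 volume := by
  refine MemLp.add ?_ ((hf.memLp_weakPartial j).const_mul _)
  simpa only [coordMul, mul_assoc] using (hf.memLp_coordMul j).const_mul (a : ℂ)

theorem memLp_firstOrder (hf : MemSigma f) (a b : ℝ) : MemLp (firstOrder a b f) 2 volume :=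
  memLp_toLp fun j => memLp_firstOrder_apply hf a b j

theorem lpNorm_firstOrder_sq (hf : MemSigma f) (a b : ℝ) :
    lpNorm (firstOrder a b f) 2 volume ^ 2
      = a ^ 2 * positionSq f + b ^ 2 * gradSq f - 2 * (a * b) * virial f := by
  rw [← sum_lpNorm_shiftGenerator_sq hf]
  refine (lpNorm_toLp_sq fun j => memLp_firstOrder_apply hf a b j).trans
    (Finset.sum_congr rfl fun j _ => ?_)
  rw [lpNorm_two_sq_eq_integral (memLp_firstOrder_apply hf a b j).1,
    lpNorm_two_sq_eq_integral (memLp_shiftGenerator hf).1]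
  refine integral_congr_ae (Eventually.of_forall fun x => ?_)
  have e : shiftGenerator j a b f x = Complex.I
      * ((a : ℂ) * ((x j : ℝ) : ℂ) * f x + Complex.I * (b : ℂ) * weakPartial j f x) := by
    rw [shiftGenerator, coordMul, mul_add, ← mul_assoc Complex.I (Complex.I * (b : ℂ)),
      ← mul_assoc Complex.I Complex.I, Complex.I_mul_I]
    ring
  simp only [e, norm_mul, Complex.norm_I, one_mul]

theorem lpNorm_weakGrad_sq (hf : MemSigma f) : lpNorm (weakGrad f) 2 volume ^ 2 = gradSq f :=
  lpNorm_toLp_sq fun j => hf.memLp_weakPartial j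

/-- `∫ V |f|²` for the quadratic potential. -/
theorem integral_quadPot_mul (hf : MemSigma f) :
    ∫ x, quadPot κ x * ‖f x‖ ^ 2 = -(κ / 2) * positionSq f := by
  simp only [positionSq, lpNorm_two_sq_eq_integral (hf.memLp_coordMul _).1]
  rw [← integral_finsetSum _ fun j _ => integrable_norm_sq (hf.memLp_coordMul j),
    ← integral_const_mul]
  refine integral_congr_ae (Eventually.of_forall fun x => ?_)
  simp only [quadPot, coordMul, norm_mul, mul_pow, Complex.norm_real, ← Finset.sum_mul,
    ← EuclideanSpace.norm_sq_eq]
  ring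

theorem energy_quadPot (hf : MemSigma f) :
    energy σ lam (quadPot κ) f = freeEnergy σ lam f - κ / 2 * positionSq f := by
  rw [energy, lpNorm_weakGrad_sq hf, integral_quadPot_mul hf, freeEnergy]
  ring

theorem energy_congr_ae {V : Space n → ℝ} (hf : MemSigma f) (h : f =ᵐ[volume] g) :
    energy σ lam V f = energy σ lam V g := by
  have h1 : weakGrad f =ᵐ[volume] weakGrad g :=
    (weakGrad_ae_eq fun j => (hf.2.hasWeakPartial j).congr h (ae_eq_refl _)).symm
  have h2 : ∫ x, V x * ‖f x‖ ^ 2 = ∫ x, V x * ‖g x‖ ^ 2 :=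
    integral_congr_ae (by filter_upwards [h] with x hx; rw [hx])
  rw [energy, energy, potentialTerm, potentialTerm, lpNorm_congr_of_ae_eq hf.1 h,
    lpNorm_congr_of_ae_eq (aestronglyMeasurable_weakGrad hf.2) h1, h2]

/-- Conservation of energy: the derivatives of `freeEnergy` and of `κ/2 ‖x u‖²` are both `κ` times
the virial. -/
theorem IsSolution.energy_eq (hu : IsSolution σ lam (quadPot κ) I u₀ u)
    (hn : 1 ≤ n) (hI : IsOpen I) (hconn : I.OrdConnected) (h0 : 0 ∈ I) (hσ : 0 < σ)
    (hσn : 3 ≤ n → σ < 2 / ((n : ℝ) - 2)) {t : ℝ} (ht : t ∈ I) :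
    energy σ lam (quadPot κ) (u t) = energy σ lam (quadPot κ) u₀ := by
  rw [← energy_congr_ae (hu.memSigma 0 h0) hu.initial, energy_quadPot (hu.memSigma t ht),
    energy_quadPot (hu.memSigma 0 h0)]
  have hd : ∀ s ∈ I, HasDerivAt
      (fun s => freeEnergy σ lam (u s) - κ / 2 * positionSq (u s)) 0 s := fun s hs =>
    ((hu.hasDerivAt_freeEnergy hn hI hσ hσn hs).sub
      ((hu.hasDerivAt_positionSq hn hI hσ hσn hs).const_mul _)).congr_deriv (by ring)
  exact hI.is_const_of_deriv_eq_zero hconn.isPreconnected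
    (fun s hs => (hd s hs).differentiableAt.differentiableWithinAt)
    (fun s hs => (hd s hs).deriv) ht h0

/-- The derivative of `½ ‖α x u + i β ∇u‖² + lam/(σ+1) β² ‖u‖^{2σ+2}`, which is `E¹` for
`(α, β) = (-ω sin ωt, cos ωt)` in the confining and `(ω sinh ωt, cosh ωt)` in the repulsive case. -/
theorem IsSolution.hasDerivAt_firstOrder (hu : IsSolution σ lam (quadPot κ) I u₀ u)
    (hn : 1 ≤ n) (hI : IsOpen I) (hσ : 0 < σ) (hσn : 3 ≤ n → σ < 2 / ((n : ℝ) - 2))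
    {α β : ℝ → ℝ} {t : ℝ} (ht : t ∈ I) (hα : HasDerivAt α (κ * β t) t)
    (hβ : HasDerivAt β (α t) t) :
    HasDerivAt (fun t => 1 / 2 * lpNorm (firstOrder (α t) (β t) (u t)) 2 volume ^ 2
        + lam / (σ + 1) * β t ^ 2 * potentialTerm σ (u t))
      (α t * β t * (lam / (σ + 1) * (2 - n * σ)) * potentialTerm σ (u t)) t := by
  refine (hu.hasDerivAt_pseudoEnergy hn hI hσ hσn ht hα hβ).congr_of_eventuallyEq ?_
  filter_upwards [hI.mem_nhds ht] with s hs
  rw [lpNorm_firstOrder_sq (hu.memSigma s hs)]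

theorem Vplus_eq_quadPot (ω : ℝ) : (Vplus ω : Space n → ℝ) = quadPot (-ω ^ 2) := by
  funext x; simp only [Vplus, quadPot]; ring

theorem Vminus_eq_quadPot (ω : ℝ) : (Vminus ω : Space n → ℝ) = quadPot (ω ^ 2) := rfl

theorem E1plus_add_E2plus {ω : ℝ} (hω : ω ≠ 0) {t : ℝ} (hf : MemSigma (u t)) :
    E1plus σ lam ω u t + E2plus σ lam ω u t = energy σ lam (Vplus ω) (u t) := by
  rw [Vplus_eq_quadPot, energy_quadPot hf, E1plus, E2plus, Jplus, Hplus, lpNorm_firstOrder_sq hf,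
    lpNorm_firstOrder_sq hf, freeEnergy, Real.sin_sq]
  field_simp
  rw [Real.sin_sq]
  ring

theorem E1minus_add_E2minus {ω : ℝ} (hω : ω ≠ 0) {t : ℝ} (hf : MemSigma (u t)) :
    E1minus σ lam ω u t + E2minus σ lam ω u t = energy σ lam (Vminus ω) (u t) := by
  rw [Vminus_eq_quadPot, energy_quadPot hf, E1minus, E2minus, Jminus, Hminus,
    lpNorm_firstOrder_sq hf, lpNorm_firstOrder_sq hf, freeEnergy]
  field_simp
  rw [Real.cosh_sq]
  ring

theorem IsSolution.hasDerivAt_E1plus {ω : ℝ} (hu : IsSolution σ lam (Vplus ω) I u₀ u)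
    (hn : 1 ≤ n) (hI : IsOpen I) (hσ : 0 < σ) (hσn : 3 ≤ n → σ < 2 / ((n : ℝ) - 2))
    {t : ℝ} (ht : t ∈ I) :
    HasDerivAt (E1plus σ lam ω u) (ω * lam / (2 * σ + 2) * (n * σ - 2) * Real.sin (2 * ω * t)
      * potentialTerm σ (u t)) t := by
  rw [Vplus_eq_quadPot] at hu
  have hlin : HasDerivAt (fun t : ℝ => ω * t) ω t := by
    simpa using (hasDerivAt_id t).const_mul ω
  have hα : HasDerivAt (fun t => -(ω * Real.sin (ω * t))) (-ω ^ 2 * Real.cos (ω * t)) t :=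
    ((hlin.sin.const_mul ω).neg).congr_deriv (by ring)
  have hβ : HasDerivAt (fun t => Real.cos (ω * t)) (-(ω * Real.sin (ω * t))) t :=
    hlin.cos.congr_deriv (by ring)
  refine (hu.hasDerivAt_firstOrder hn hI hσ hσn ht hα hβ).congr_deriv ?_
  have h1 : σ + 1 ≠ 0 := by positivity
  rw [mul_assoc 2 ω t, Real.sin_two_mul, show 2 * σ + 2 = 2 * (σ + 1) by ring]
  field_simp
  ring

theorem IsSolution.hasDerivAt_E1minus {ω : ℝ} (hu : IsSolution σ lam (Vminus ω) I u₀ u)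
    (hn : 1 ≤ n) (hI : IsOpen I) (hσ : 0 < σ) (hσn : 3 ≤ n → σ < 2 / ((n : ℝ) - 2))
    {t : ℝ} (ht : t ∈ I) :
    HasDerivAt (E1minus σ lam ω u) (ω * lam / (2 * σ + 2) * (2 - n * σ) * Real.sinh (2 * ω * t)
      * potentialTerm σ (u t)) t := by
  rw [Vminus_eq_quadPot] at hu
  have hlin : HasDerivAt (fun t : ℝ => ω * t) ω t := by
    simpa using (hasDerivAt_id t).const_mul ω
  have hα : HasDerivAt (fun t => ω * Real.sinh (ω * t)) (ω ^ 2 * Real.cosh (ω * t)) t :=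
    (hlin.sinh.const_mul ω).congr_deriv (by ring)
  have hβ : HasDerivAt (fun t => Real.cosh (ω * t)) (ω * Real.sinh (ω * t)) t :=
    hlin.cosh.congr_deriv (by ring)
  refine (hu.hasDerivAt_firstOrder hn hI hσ hσn ht hα hβ).congr_deriv ?_
  have h1 : σ + 1 ≠ 0 := by positivity
  rw [mul_assoc 2 ω t, Real.sinh_two_mul, show 2 * σ + 2 = 2 * (σ + 1) by ring]
  field_simp

end VectorNorms

end HarmonicNLS
theorem mainTheorem6 (n : ℕ) (hn : 1 ≤ n) (σ lam ω : ℝ) (hσ : 0 < σ)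
    (hσn : 3 ≤ n → σ < 2 / ((n : ℝ) - 2)) (hω : 0 < ω)
    (I : Set ℝ) (hI_open : IsOpen I) (hI_conn : I.OrdConnected) (hI_zero : (0 : ℝ) ∈ I)
    (u₀ : HarmonicNLS.Space n → ℂ) (hu₀ : HarmonicNLS.MemSigma u₀) :
    (∀ u : ℝ → HarmonicNLS.Space n → ℂ,
      HarmonicNLS.IsSolution σ lam (HarmonicNLS.Vplus ω) I u₀ u → ∀ t ∈ I,
        MeasureTheory.MemLp (u t) (ENNReal.ofReal (2 * σ + 2)) MeasureTheory.volume ∧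
        MeasureTheory.MemLp (HarmonicNLS.Jplus ω t (u t)) 2 MeasureTheory.volume ∧
        MeasureTheory.MemLp (HarmonicNLS.Hplus ω t (u t)) 2 MeasureTheory.volume ∧
        HarmonicNLS.E1plus σ lam ω u t + HarmonicNLS.E2plus σ lam ω u t
          = HarmonicNLS.energy σ lam (HarmonicNLS.Vplus ω) (u t) ∧
        HarmonicNLS.energy σ lam (HarmonicNLS.Vplus ω) (u t)
          = HarmonicNLS.energy σ lam (HarmonicNLS.Vplus ω) u₀ ∧
        HasDerivAt (HarmonicNLS.E1plus σ lam ω u)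
          (ω * lam / (2 * σ + 2) * (n * σ - 2) * Real.sin (2 * ω * t)
            * HarmonicNLS.potentialTerm σ (u t)) t) ∧
    (∀ u : ℝ → HarmonicNLS.Space n → ℂ,
      HarmonicNLS.IsSolution σ lam (HarmonicNLS.Vminus ω) I u₀ u → ∀ t ∈ I,
        MeasureTheory.MemLp (u t) (ENNReal.ofReal (2 * σ + 2)) MeasureTheory.volume ∧
        MeasureTheory.MemLp (HarmonicNLS.Jminus ω t (u t)) 2 MeasureTheory.volume ∧
        MeasureTheory.MemLp (HarmonicNLS.Hminus ω t (u t)) 2 MeasureTheory.volume ∧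
        HarmonicNLS.E1minus σ lam ω u t + HarmonicNLS.E2minus σ lam ω u t
          = HarmonicNLS.energy σ lam (HarmonicNLS.Vminus ω) (u t) ∧
        HarmonicNLS.energy σ lam (HarmonicNLS.Vminus ω) (u t)
          = HarmonicNLS.energy σ lam (HarmonicNLS.Vminus ω) u₀ ∧
        HasDerivAt (HarmonicNLS.E1minus σ lam ω u)
          (ω * lam / (2 * σ + 2) * (2 - n * σ) * Real.sinh (2 * ω * t)
            * HarmonicNLS.potentialTerm σ (u t)) t) := by
  obtain ⟨C, hC⟩ := HarmonicNLS.exists_sigmaEmbeds hn hσ hσn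
  refine ⟨fun u hu t ht => ?_, fun u hu t ht => ?_⟩
  · have hf := hu.memSigma t ht
    refine ⟨(hC.2 _ hf).1, HarmonicNLS.memLp_firstOrder hf _ _,
      HarmonicNLS.memLp_firstOrder hf _ _, HarmonicNLS.E1plus_add_E2plus hω.ne' hf, ?_,
      hu.hasDerivAt_E1plus hn hI_open hσ hσn ht⟩
    rw [HarmonicNLS.Vplus_eq_quadPot] at hu ⊢
    exact hu.energy_eq hn hI_open hI_conn hI_zero hσ hσn ht
  · have hf := hu.memSigma t ht
    refine ⟨(hC.2 _ hf).1, HarmonicNLS.memLp_firstOrder hf _ _,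
      HarmonicNLS.memLp_firstOrder hf _ _, HarmonicNLS.E1minus_add_E2minus hω.ne' hf, ?_,
      hu.hasDerivAt_E1minus hn hI_open hσ hσn ht⟩
    rw [HarmonicNLS.Vminus_eq_quadPot] at hu ⊢
    exact hu.energy_eq hn hI_open hI_conn hI_zero hσ hσn ht
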